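/- \textbf{Definitions.} Let $\mathbb R^{k,m}=[\![0,\infty)^k\times\mathbb R^{m-k}$ (as a topological space, $[0,\infty)^k\times\mathbb R^{m-k}$), and let $U\subseteq\mathbb R^{k,m}$ be open. For $f:U\to\mathbb R$ let ${}^b\partial_if=x_i\,\partial f/\partial x_i$ for $i\le k$, taken to be $0$ where $x_i=0$ (the derivative being required to exist only where $x_i>0$), and ${}^b\partial_if=\partial f/\partial x_i$ for $i>k$. A continuous $f$ is \emph{a-differentiable} if all ${}^b\partial_if$ exist and are continuous, and for each compact $S\subseteq U$ and $i\le k$ there are $C,\alpha>0$ with $|{}^b\partial_if|\le Cx_i^\alpha$ on $S$; it is \emph{a-smooth} if all its iterated b-derivatives (including $f$) are a-differentiable. A continuous map $f=(f_1,\dots,f_n):U\to V$ with $V\subseteq\mathbb R^{l,n}$ open is \emph{a-smooth} if $f_j$ is a-smooth for $j>l$, and for each $u\in U$ and $j\le l$, near $u$ either (i) $f_j=F_j\,x_1^{a_{1}}\cdots x_k^{a_{k}}$ with $F_j>0$ a-smooth, $a_{i}\in[0,\infty)$, and $a_{i}=0$ if $u_i\neq0$, or (ii) $f_j\equiv 0$.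 It is \emph{interior} if moreover (ii) never occurs. An $m$-dimensional \emph{manifold with a-corners} is a second countable Hausdorff space with a maximal atlas of charts $\phi:U\to X$ ($U\subseteq\mathbb R^{k,m}$ open, $0\le k\le m$, $\phi$ a homeomorphism onto an open subset) whose transition maps are a-smooth with a-smooth inverse; if charts of different dimensions are allowed in the atlas, $X$ is a manifold with a-corners of mixed dimension. A continuous map between such manifolds is a-smooth, or interior, if it is so in all charts; an a-diffeomorphism is a bijection which is a-smooth with a-smooth inverse. Products and disjoint unions are defined in the obvious way. Let $\mathbf{Man^{ac}}$ and $\mathbf{\check Man^{ac}}$ be the categories of manifolds with a-corners, of pure and of mixed dimension respectively, and a-smooth maps, and $\mathbf{\check Man^{ac}_{in}}\subset\mathbf{\check Man^{ac}}$ the subcategory of interior maps. Manifolds with (ordinary) corners $\mathbf{Man^c}$, $\mathbf{\check Man^c}$, $\mathbf{\check Man^c_{in}}$ are defined in the same way, with ``a-smooth'' for real functions replaced by ``all iterated partial derivatives (one-sided where $x_i=0$, $i\le k$) exist and are continuous'', and with $a_{i}\in\mathbb N$; the functor $F_{\mathbf{Man^c}}^{\mathbf{Man^{ac}}}$ replaces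 the maximal atlas by the maximal a-atlas containing it, and is the identity on maps (and similarly for mixed dimension). The \emph{depth} of $x\in X$ is the number of $x_1,\dots,x_k$ that vanish in a chart $\phi$ with $\phi(x_1,\dots,x_m)=x$, and $S^l(X)$ is the set of points of depth $l$. A \emph{local $k$-corner component} $\gamma$ of $X$ at $x$ is a choice, for each open neighbourhood $V$ of $x$, of a connected component $\gamma_V$ of $V\cap S^k(X)$ with $x\in\overline{\gamma_V}$, such that $x\in\overline{\gamma_V\cap\gamma_{V'}}$ for all $V,V'$; for $k=1$ it is called a local boundary component. Let $C_k(X)$ be the set of pairs $(x,\gamma)$ with $\gamma$ a local $k$-corner component of $X$ at $x\in X$, let $\partial X=C_1(X)$, $C(X)=\coprod_{k\ge0}C_k(X)$, and let $\Pi:C_k(X)\to X$, $\Pi:C(X)\to X$ and $i_X:\partial X\to X$ be the projections. Each chart $\phi:U\to X$, $U\subseteq\mathbb R^{l,m}$, and each set $I$ of $k$ of the first $l$ coordinates define a chart of $C_k(X)$ on $\{x\in\mathbb R^{l-k,m-k}: \hat x\in U\}$ by $x\mapsto(\phi(\hat x),\phi_*(\{x_i=0,\ i\in I\}))$, where $\hat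 x$ is $x$ with zeros inserted at the places in $I$. \textbf{Statement.} Let $X,Y$ be manifolds with a-corners, possibly of mixed dimension. (a) With these charts, and the topology they define, $\partial X$, $C_k(X)$ and $C(X)$ are manifolds with a-corners (of mixed dimension if $X$ is, and in the case of $C(X)$). If $X$ has dimension $m$, then $\partial X$ has dimension $m-1$ (and is empty if $m=0$) and $C_k(X)$ has dimension $m-k$ (and is empty if $k>m$). The maps $i_X$ and $\Pi$ are a-smooth. (b) If $f:X\to Y$ is a-smooth and $(x,\gamma)\in C_k(X)$, there are a unique $l\geq 0$ and a unique local $l$-corner component $f_*(\gamma)$ of $Y$ at $f(x)$ such that $f(\gamma_V)\cap f_*(\gamma)_{\tilde V}\neq\emptyset$ for all open neighbourhoods $V$ of $x$ and $\tilde V$ of $f(x)$. The map $C(f):C(X)\to C(Y)$, $(x,\gamma)\mapsto(f(x),f_*(\gamma))$, is interior. Identities are interior, a-smooth maps and interior maps are closed under composition, and $C(\mathrm{id})=\mathrm{id}$, $C(g\circ f)=C(g)\circ C(f)$. Thus $C$ is a functor $\mathbf{Man^{ac}}\to\mathbf{\check Man^{ac}_{in}}$ (and even $\mathbf{\check Man^{ac}}\to\mathbf{\check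 Man^{ac}_{in}}$). (c) The iterated boundary $\partial^kX$ is canonically identified with the set of $(x,\beta_1,\dots,\beta_k)$ with $\beta_1,\dots,\beta_k$ distinct local boundary components of $X$ at $x$. Permutation of $\beta_1,\dots,\beta_k$ gives a free, a-smooth action of $S_k$ on $\partial^kX$; the quotient $\partial^kX/S_k$ is a manifold with a-corners such that $\partial^kX\to\partial^kX/S_k$ is a local a-diffeomorphism; and there is an a-diffeomorphism $\partial^kX/S_k\cong C_k(X)$ taking the class of $(x,\beta_1,\dots,\beta_k)$ to the $(x,\gamma)$ for which $\beta_1,\dots,\beta_k$ are exactly the local boundary components whose closure contains $\gamma$ near $x$. (d) There is an a-diffeomorphism $\partial C(X)\cong C(\partial X)$, which identifies $\partial C_k(X)$ with $C_k(\partial X)$ and takes $((x,\gamma),\beta')$ to the unique $((x,\beta),\gamma')$ such that $\Pi_*(\beta')=(i_X)_*(\gamma')$ as local corner components of $X$ at $x$ and $\gamma$ does not lie in the closure of $\beta$ near $x$. (e) $X\times Y$ is a manifold with a-corners, of dimension $\dim X+\dim Y$ if $X,Y$ are of pure dimension, the projections $\pi_X,\pi_Y$ are a-smooth, and $(C(\pi_X),C(\pi_Y)):C(X\times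 Y)\to C(X)\times C(Y)$ is an a-diffeomorphism, which identifies $C_k(X\times Y)$ with $\coprod_{i+j=k}C_i(X)\times C_j(Y)$. It is natural: for a-smooth $f:W\to Y$, $g:X\to Y$, $h:X\to Z$, the maps $f\times h$ and $(g,h)$ are a-smooth, and under these identifications $C(f\times h)=C(f)\times C(h)$ and $C((g,h))=(C(g),C(h))$. (f) Let $F$ denote $F_{\mathbf{Man^c}}^{\mathbf{Man^{ac}}}$ and its extension to mixed dimension. If $X$ is a manifold with (ordinary) corners, then $F(X)$ is a manifold with a-corners with the same dimension (if $X$ has pure dimension) and the same depth strata, $C_k(X)$ and $C(X)$ are manifolds with corners, and the identity on pairs $(x,\gamma)$ gives a-diffeomorphisms $C_k(F(X))\cong F(C_k(X))$ (in particular $\partial F(X)\cong F(\partial X)$) and $C(F(X))\cong F(C(X))$. If $f:X\to Y$ is a smooth map of manifolds with corners, then $f:F(X)\to F(Y)$ is a-smooth, $C(f):C(X)\to C(Y)$ is well defined and interior, $F(C(f))$ is interior, and $C(F(f))=F(C(f))$ under these identifications. That is, $C\circ F\cong F\circ C$ as functors $\mathbf{Man^c}\to\mathbf{\check Man^{ac}}$.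 -/

import Mathlib

open Set TopologicalSpace

universe u

namespace ACorners

/-- The two kinds of manifold: `ordinary` (manifolds with corners, local models `[0,∞)ᵏ × ℝᵐ⁻ᵏ`) and
`analytic` (manifolds with a-corners, local models `⟦0,∞)ᵏ × ℝᵐ⁻ᵏ`). As sets and topological spaces
the local models agree; the two kinds differ in which maps count as smooth. -/
inductive Kind
  | ordinary
  | analytic

/-- The local model `[0,∞)ᵏ × ℝᵐ⁻ᵏ`. -/
def orthant (k m : ℕ) : Set (Fin m → ℝ) := {x | ∀ i : Fin m, i.val < k → 0 ≤ x i}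

/-- `U` is an open subset of the local model `[0,∞)ᵏ × ℝᵐ⁻ᵏ`. -/
def IsOpenInOrthant (k : ℕ) {m : ℕ} (U : Set (Fin m → ℝ)) : Prop :=
  ∃ O : Set (Fin m → ℝ), IsOpen O ∧ U = O ∩ orthant k m

/-- The function of one variable obtained from `f` by freezing at `x` all coordinates but the `i`-th. -/
def slice {m : ℕ} (f : (Fin m → ℝ) → ℝ) (x : Fin m → ℝ) (i : Fin m) : ℝ → ℝ :=
  fun t => f (Function.update x i t)

/-! ### Smooth real functions, ordinary corners -/

/-- The range of the `i`-th coordinate in `[0,∞)ᵏ × ℝᵐ⁻ᵏ`. -/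
def coordRange (k : ℕ) {m : ℕ} (i : Fin m) : Set ℝ := if i.val < k then Ici 0 else univ

/-- The `i`-th partial derivative, one-sided where `i < k` and `x i = 0`. -/
noncomputable def cornerPartial (k : ℕ) {m : ℕ} (i : Fin m) (f : (Fin m → ℝ) → ℝ) :
    (Fin m → ℝ) → ℝ :=
  fun x => derivWithin (slice f x i) (coordRange k i) (x i)

/-- `f` is continuous on `U` and its first partial derivatives exist and are continuous on `U`. -/
def IsCornerDiff (k : ℕ) {m : ℕ} (U : Set (Fin m → ℝ)) (f : (Fin m → ℝ) → ℝ) : Prop :=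
  ContinuousOn f U ∧
  ∀ i : Fin m,
    (∀ x ∈ U, DifferentiableWithinAt ℝ (slice f x i) (coordRange k i) (x i)) ∧
    ContinuousOn (cornerPartial k i f) U

/-- Weakly smooth: all iterated partial derivatives exist and are continuous. -/
def IsWeaklySmooth (k : ℕ) {m : ℕ} (U : Set (Fin m → ℝ)) (f : (Fin m → ℝ) → ℝ) : Prop :=
  ∀ L : List (Fin m), IsCornerDiff k U (L.foldr (cornerPartial k) f)

/-! ### A-smooth real functions -/

/-- The `i`-th b-derivative: `x_i ∂f/∂x_i` for `i < k` (which is `0` where `x_i = 0`, whatever `f` is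
there), and `∂f/∂x_i` for `i ≥ k`. -/
noncomputable def bPartial (k : ℕ) {m : ℕ} (i : Fin m) (f : (Fin m → ℝ) → ℝ) : (Fin m → ℝ) → ℝ :=
  fun x => if i.val < k then x i * deriv (slice f x i) (x i) else deriv (slice f x i) (x i)

/-- The b-derivative of `f` exists on `U`: `∂f/∂x_i` exists on `U ∩ {x_i > 0}` for `i < k` and on `U`
for `i ≥ k`. -/
def BDerivExists (k : ℕ) {m : ℕ} (U : Set (Fin m → ℝ)) (f : (Fin m → ℝ) → ℝ) : Prop :=
  ∀ i : Fin m, ∀ x ∈ U, (i.val < k → 0 < x i) → DifferentiableAt ℝ (slice f x i) (x i)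

/-- Roughly differentiable. -/
def IsRDiff (k : ℕ) {m : ℕ} (U : Set (Fin m → ℝ)) (f : (Fin m → ℝ) → ℝ) : Prop :=
  ContinuousOn f U ∧ BDerivExists k U f ∧ ∀ i : Fin m, ContinuousOn (bPartial k i f) U

/-- Analytically differentiable. -/
def IsADiff (k : ℕ) {m : ℕ} (U : Set (Fin m → ℝ)) (f : (Fin m → ℝ) → ℝ) : Prop :=
  IsRDiff k U f ∧
  ∀ S : Set (Fin m → ℝ), S ⊆ U → IsCompact S → ∀ i : Fin m, i.val < k →
    ∃ C α : ℝ, 0 < C ∧ 0 < α ∧ ∀ x ∈ S, |bPartial k i f x| ≤ C * x i ^ α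

/-- A-smooth: all iterated b-derivatives are a-differentiable. -/
def IsASmooth (k : ℕ) {m : ℕ} (U : Set (Fin m → ℝ)) (f : (Fin m → ℝ) → ℝ) : Prop :=
  ∀ L : List (Fin m), IsADiff k U (L.foldr (bPartial k) f)

/-! ### Smooth and interior maps between open subsets of local models -/

/-- The smooth real functions of either kind. -/
def IsSmoothFun (κ : Kind) (k : ℕ) {m : ℕ} (U : Set (Fin m → ℝ)) (f : (Fin m → ℝ) → ℝ) : Prop :=
  match κ with
  | .ordinary => IsWeaklySmooth k U f
  | .analytic => IsASmooth k U f

/-- Near `u` in `U`, `h = F · x_1^{a_1} ⋯ x_k^{a_k}` with `F > 0` smooth, `a_i ≥ 0` (natural numbers in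
the ordinary case) and `a_i = 0` if `u_i ≠ 0`. The exponents `a_i` with `i ≥ k` are required to be `0`,
so the product is really over `i < k`. (Such `F` and `a` are automatically unique, as `F > 0` is
continuous.) -/
def IsMonomialNear (κ : Kind) (k : ℕ) {m : ℕ} (U : Set (Fin m → ℝ)) (h : (Fin m → ℝ) → ℝ)
    (u : Fin m → ℝ) : Prop :=
  ∃ O : Set (Fin m → ℝ), IsOpen O ∧ u ∈ O ∧
  ∃ (F : (Fin m → ℝ) → ℝ) (a : Fin m → ℝ),
    IsSmoothFun κ k (U ∩ O) F ∧
    (∀ x ∈ U ∩ O, 0 < F x) ∧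
    (∀ i, 0 ≤ a i) ∧
    (κ = Kind.ordinary → ∀ i, ∃ n : ℕ, a i = n) ∧
    (∀ i : Fin m, ¬ (i.val < k ∧ u i = 0) → a i = 0) ∧
    ∀ x ∈ U ∩ O, h x = F x * ∏ i, x i ^ a i

/-- `h` vanishes identically near `u` in `U`. -/
def VanishesNear {m : ℕ} (U : Set (Fin m → ℝ)) (h : (Fin m → ℝ) → ℝ) (u : Fin m → ℝ) : Prop :=
  ∃ O : Set (Fin m → ℝ), IsOpen O ∧ u ∈ O ∧ ∀ x ∈ U ∩ O, h x = 0

/-- Smooth (resp. a-smooth) maps from an open `U ⊆ [0,∞)ᵏ × ℝᵐ⁻ᵏ` to an open subset of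
`[0,∞)ˡ × ℝⁿ⁻ˡ`. -/
def IsSmoothMap (κ : Kind) (k l : ℕ) {m n : ℕ} (U : Set (Fin m → ℝ))
    (g : (Fin m → ℝ) → (Fin n → ℝ)) : Prop :=
  ContinuousOn g U ∧
  (∀ j : Fin n, l ≤ j.val → IsSmoothFun κ k U (fun x => g x j)) ∧
  ∀ u ∈ U, ∀ j : Fin n, j.val < l →
    IsMonomialNear κ k U (fun x => g x j) u ∨ VanishesNear U (fun x => g x j) u

/-- Interior maps: smooth maps none of whose first `l` components vanishes identically near a point,
so that each of them is locally monomial. -/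
def IsInteriorMap (κ : Kind) (k l : ℕ) {m n : ℕ} (U : Set (Fin m → ℝ))
    (g : (Fin m → ℝ) → (Fin n → ℝ)) : Prop :=
  IsSmoothMap κ k l U g ∧
  ∀ u ∈ U, ∀ j : Fin n, j.val < l → IsMonomialNear κ k U (fun x => g x j) u

/-! ### Charts, atlases, manifolds -/

/-- A pair `(U, φ)` with `U` open in `[0,∞)ᵏ × ℝᵐ⁻ᵏ` and `φ : U → X` injective. That `φ` is a
homeomorphism with an open subset of `X` is required in `IsManifold`. -/
structure Chart (k m : ℕ) (X : Type u) where
  le : k ≤ m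
  dom : Set (Fin m → ℝ)
  isOpen_dom : IsOpenInOrthant k dom
  toFun : dom → X
  injective : Function.Injective toFun

/-- The points `u` of the domain of `c` with `f (c u)` in the image of `d`. -/
def overlap {k m l n : ℕ} {X Y : Type u} (c : Chart k m X) (d : Chart l n Y) (f : X → Y) :
    Set (Fin m → ℝ) :=
  {u | ∃ h : u ∈ c.dom, f (c.toFun ⟨u, h⟩) ∈ range d.toFun}

/-- `g` represents `d⁻¹ ∘ f ∘ c` on its domain `overlap c d f`. -/
def IsLocalRep {k m l n : ℕ} {X Y : Type u} (c : Chart k m X) (d : Chart l n Y) (f : X → Y)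
    (g : (Fin m → ℝ) → (Fin n → ℝ)) : Prop :=
  ∀ (u : c.dom) (v : d.dom), d.toFun v = f (c.toFun u) → g u = v

/-- `d⁻¹ ∘ f ∘ c` is smooth. -/
def SmoothInCharts (κ : Kind) {k m l n : ℕ} {X Y : Type u} (c : Chart k m X) (d : Chart l n Y)
    (f : X → Y) : Prop :=
  ∃ g, IsLocalRep c d f g ∧ IsSmoothMap κ k l (overlap c d f) g

/-- `d⁻¹ ∘ f ∘ c` is interior. -/
def InteriorInCharts (κ : Kind) {k m l n : ℕ} {X Y : Type u} (c : Chart k m X) (d : Chart l n Y)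
    (f : X → Y) : Prop :=
  ∃ g, IsLocalRep c d f g ∧ IsInteriorMap κ k l (overlap c d f) g

/-- Compatible charts: the transition map is a diffeomorphism (resp. a-diffeomorphism). -/
def Compatible (κ : Kind) {k m l n : ℕ} {X : Type u} (c : Chart k m X) (d : Chart l n X) : Prop :=
  SmoothInCharts κ c d id ∧ SmoothInCharts κ d c id

/-- A topological space with a set of charts, of any dimensions `m` and any `k ≤ m`. -/
structure AtlasSpace where
  carrier : Type u
  top : TopologicalSpace carrier
  atlas : ∀ k m : ℕ, Set (Chart k m carrier)

instance : CoeSort AtlasSpace.{u} (Type u) := ⟨AtlasSpace.carrier⟩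

instance (X : AtlasSpace.{u}) : TopologicalSpace X := X.top

/-- Manifolds of mixed dimension, with corners or with a-corners: second countable Hausdorff spaces
with a maximal atlas, the charts of which need not all have the same dimension. -/
structure IsManifold (κ : Kind) (X : AtlasSpace.{u}) : Prop where
  t2 : T2Space X
  secondCountable : SecondCountableTopology X
  isOpenEmbedding : ∀ {k m : ℕ}, ∀ c ∈ X.atlas k m, Topology.IsOpenEmbedding c.toFun
  cover : ∀ x : X, ∃ k m : ℕ, ∃ c ∈ X.atlas k m, x ∈ range c.toFun
  compatible : ∀ {k m l n : ℕ}, ∀ c ∈ X.atlas k m, ∀ d ∈ X.atlas l n, Compatible κ c d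
  maximal : ∀ {k m : ℕ} (c : Chart k m X), Topology.IsOpenEmbedding c.toFun →
    (∀ {l n : ℕ}, ∀ d ∈ X.atlas l n, Compatible κ c d) → c ∈ X.atlas k m

/-- All (non-empty) charts have dimension `n`. A manifold with (a-)corners of dimension `n` is an `X`
with `IsManifold κ X` and `HasDim X n`. The empty manifold has every dimension. -/
def HasDim (X : AtlasSpace.{u}) (n : ℕ) : Prop :=
  ∀ (k m : ℕ), ∀ c ∈ X.atlas k m, c.dom.Nonempty → m = n

/-- Smooth (resp. a-smooth) maps. -/
def IsSmooth (κ : Kind) (X Y : AtlasSpace.{u}) (f : X → Y) : Prop :=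
  Continuous f ∧
  ∀ k m l n : ℕ, ∀ c ∈ X.atlas k m, ∀ d ∈ Y.atlas l n, SmoothInCharts κ c d f

/-- Interior maps. -/
def IsInterior (κ : Kind) (X Y : AtlasSpace.{u}) (f : X → Y) : Prop :=
  Continuous f ∧
  ∀ k m l n : ℕ, ∀ c ∈ X.atlas k m, ∀ d ∈ Y.atlas l n, InteriorInCharts κ c d f

/-- Diffeomorphisms (resp. a-diffeomorphisms). -/
def IsDiffeo (κ : Kind) (X Y : AtlasSpace.{u}) (e : X ≃ Y) : Prop :=
  IsSmooth κ X Y e ∧ IsSmooth κ Y X e.symm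

/-- `d = f ∘ c` as charts. -/
def IsPushChart {k m : ℕ} {X Y : Type u} (f : X → Y) (c : Chart k m X) (d : Chart k m Y) : Prop :=
  d.dom = c.dom ∧ ∀ u (hd : u ∈ d.dom) (hc : u ∈ c.dom), d.toFun ⟨u, hd⟩ = f (c.toFun ⟨u, hc⟩)

/-- Local diffeomorphisms: maps which in suitable charts around any point are the identity. -/
def IsLocalDiffeo (X Y : AtlasSpace.{u}) (f : X → Y) : Prop :=
  ∀ x : X, ∃ k m : ℕ, ∃ c ∈ X.atlas k m, x ∈ range c.toFun ∧
    ∃ d ∈ Y.atlas k m, IsPushChart f c d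

/-- The space `Z` with all charts (open embeddings) compatible with the given set `B` of charts: the
maximal atlas containing `B`, when `B` is an atlas. -/
def generate (κ : Kind) (Z : Type u) (t : TopologicalSpace Z) (B : ∀ k m : ℕ, Set (Chart k m Z)) :
    AtlasSpace.{u} where
  carrier := Z
  top := t
  atlas := fun k m => {c | Topology.IsOpenEmbedding c.toFun ∧
    ∀ l n : ℕ, ∀ d ∈ B l n, Compatible κ c d}

/-- The topology defined by a set of charts: `A` is open iff `c⁻¹(A)` is open for all charts `c`. -/
abbrev chartTopology (Z : Type u) (B : ∀ k m : ℕ, Set (Chart k m Z)) : TopologicalSpace Z :=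
  ⨆ c : Σ k m : ℕ, B k m, TopologicalSpace.coinduced c.2.2.1.toFun inferInstance

/-! ### Products, disjoint unions, quotients, and the functor from corners to a-corners -/

/-- `e` is the chart `c × d`, its coordinates being those of `c` and of `d`, ordered in any way that
puts the coordinates with values in `[0,∞)` first. -/
def IsProdChart {k m l n K M : ℕ} {X Y : Type u} (c : Chart k m X) (d : Chart l n Y)
    (e : Chart K M (X × Y)) : Prop :=
  K = k + l ∧
  ∃ ε : Fin m ⊕ Fin n ≃ Fin M,
    (∀ i, (ε (Sum.inl i)).val < K ↔ i.val < k) ∧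
    (∀ j, (ε (Sum.inr j)).val < K ↔ j.val < l) ∧
    e.dom = {z | (fun i => z (ε (Sum.inl i))) ∈ c.dom ∧ (fun j => z (ε (Sum.inr j))) ∈ d.dom} ∧
    ∀ z (h : z ∈ e.dom) (hc : (fun i => z (ε (Sum.inl i))) ∈ c.dom)
      (hd : (fun j => z (ε (Sum.inr j))) ∈ d.dom),
      e.toFun ⟨z, h⟩ = (c.toFun ⟨_, hc⟩, d.toFun ⟨_, hd⟩)

/-- The product of two manifolds. -/
def prodMfd (κ : Kind) (X Y : AtlasSpace.{u}) : AtlasSpace.{u} :=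
  generate κ (X × Y) inferInstance fun K M =>
    {e : Chart K M (X × Y) | ∃ k m l n : ℕ, ∃ c ∈ X.atlas k m, ∃ d ∈ Y.atlas l n, IsProdChart c d e}

/-- The disjoint union of a sequence of manifolds. -/
def sumMfd (κ : Kind) (X : ℕ → AtlasSpace.{u}) : AtlasSpace.{u} :=
  generate κ (Σ p, X p) inferInstance fun k m =>
    {d | ∃ p, ∃ c ∈ (X p).atlas k m, IsPushChart (Sigma.mk p) c d}

/-- The quotient of a manifold by an equivalence relation, with the quotient topology and the charts
`π ∘ c`, where `c` is a chart with `π ∘ c` injective. -/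
def quotMfd (κ : Kind) (X : AtlasSpace.{u}) (r : Setoid X) : AtlasSpace.{u} :=
  generate κ (Quotient r) inferInstance fun k m =>
    {d | ∃ c ∈ X.atlas k m, IsPushChart (fun x => (Quotient.mk r x : Quotient r)) c d}

/-- The projection to the quotient. -/
def quotProj (κ : Kind) (X : AtlasSpace.{u}) (r : Setoid X) : X → quotMfd κ X r :=
  fun x => (Quotient.mk r x : Quotient r)

/-- The functor from manifolds with corners to manifolds with a-corners on objects: the same space, with
the maximal a-atlas containing the given atlas. On morphisms the functor is the identity. -/
def toAnalytic (X : AtlasSpace.{u}) : AtlasSpace.{u} :=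
  generate Kind.analytic X X.top X.atlas

/-! ### Depth strata and local corner components -/

/-- The number of coordinates `x_i`, `i < k`, that vanish. -/
noncomputable def depth (k : ℕ) {m : ℕ} (x : Fin m → ℝ) : ℕ := {i : Fin m | i.val < k ∧ x i = 0}.ncard

/-- The depth stratum `S^p(X)`. -/
def stratum (X : AtlasSpace.{u}) (p : ℕ) : Set X :=
  {x | ∃ k m : ℕ, ∃ c ∈ X.atlas k m, ∃ v : c.dom, c.toFun v = x ∧ depth k v.1 = p}

/-- A local `p`-corner component of `X` at `x`: a choice, for each open neighbourhood `V` of `x`, of a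
connected component of `V ∩ S^p(X)` with `x` in its closure, any two choices being compatible. (A
compatible choice for all small `V` extends uniquely to all `V`, so that it makes no difference
whether all or only small neighbourhoods are used.) -/
@[ext]
structure LocalCorner (X : AtlasSpace.{u}) (p : ℕ) (x : X) where
  comp : OpenNhdsOf x → Set X
  isComponent : ∀ V : OpenNhdsOf x, ∃ w ∈ (V : Set X) ∩ stratum X p,
    comp V = connectedComponentIn ((V : Set X) ∩ stratum X p) w
  mem_closure : ∀ V, x ∈ closure (comp V)
  compat : ∀ V V', x ∈ closure (comp V ∩ comp V')

/-- The set of pairs `(x, γ)` with `γ` a local `p`-corner component of `X` at `x`. -/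
abbrev CornerPt (X : AtlasSpace.{u}) (p : ℕ) : Type u := Σ x : X, LocalCorner X p x

/-! ### Boundary, `p`-corners and corners -/

/-- Inserts zeros into `x` at the places outside the range of `ι`. -/
noncomputable def insertZeros {m' m : ℕ} (ι : Fin m' ↪o Fin m) (x : Fin m' → ℝ) : Fin m → ℝ :=
  Function.extend ι x 0

/-- The chart `c'` of the `p`-corners of `X` induced by the chart `c` of `X` and the choice of `p` of
the coordinates `x_i`, `i < k`, namely those outside the range of `ι`. It sends `x` to
`(c(y), c_*({y_i = 0 for the chosen i}))`, where `y` is `x` with zeros inserted; the second component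
is the local corner component `γ` such that every `γ.comp V` meets, arbitrarily near `c(y)`, the
image under `c` of the set where exactly the chosen ones among `y_1, …, y_k` vanish. -/
def IsFaceChart {X : AtlasSpace.{u}} {p k m k' m' : ℕ} (c : Chart k m X)
    (c' : Chart k' m' (CornerPt X p)) : Prop :=
  m' + p = m ∧ k' + p = k ∧
  ∃ ι : Fin m' ↪o Fin m,
    (∀ i : Fin m, k ≤ i.val → i ∈ range ι) ∧
    c'.dom = {x | insertZeros ι x ∈ c.dom} ∧
    ∀ (x : Fin m' → ℝ) (h' : x ∈ c'.dom) (h : insertZeros ι x ∈ c.dom),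
      (c'.toFun ⟨x, h'⟩).1 = c.toFun ⟨insertZeros ι x, h⟩ ∧
      ∀ V, (c'.toFun ⟨x, h'⟩).1 ∈ closure ((c'.toFun ⟨x, h'⟩).2.comp V ∩
        c.toFun '' {v | ∀ i : Fin m, i.val < k → (v.1 i = 0 ↔ i ∉ range ι)})

/-- The charts of `C_p(X)` induced by the charts of `X`. -/
def faceCharts (X : AtlasSpace.{u}) (p k' m' : ℕ) : Set (Chart k' m' (CornerPt X p)) :=
  {c' | ∃ k m : ℕ, ∃ c ∈ X.atlas k m, IsFaceChart c c'}

/-- The `p`-corners `C_p(X)`. -/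
def kCorners (κ : Kind) (X : AtlasSpace.{u}) (p : ℕ) : AtlasSpace.{u} :=
  generate κ (CornerPt X p) (chartTopology _ (faceCharts X p)) (faceCharts X p)

/-- The boundary `∂X`: the pairs `(x, β)` with `β` a local boundary component, that is, a local
`1`-corner component, of `X` at `x`. -/
def boundary (κ : Kind) (X : AtlasSpace.{u}) : AtlasSpace.{u} := kCorners κ X 1

/-- The corners `C(X) = ∐ₚ C_p(X)`. -/
def corners (κ : Kind) (X : AtlasSpace.{u}) : AtlasSpace.{u} := sumMfd κ (kCorners κ X)

/-- The projection `Π : C_p(X) → X`, `(x, γ) ↦ x`; for `p = 1` it is `i_X : ∂X → X`. -/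
def kProj (κ : Kind) (X : AtlasSpace.{u}) (p : ℕ) : kCorners κ X p → X := fun z => Sigma.fst z

/-- The projection `i_X : ∂X → X`. -/
def boundaryProj (κ : Kind) (X : AtlasSpace.{u}) : boundary κ X → X := kProj κ X 1

/-- The projection `Π : C(X) → X`. -/
def proj (κ : Kind) (X : AtlasSpace.{u}) : corners κ X → X := fun z => kProj κ X z.1 z.2

/-! ### The action of maps on corners -/

/-- `b = (f(x), f_*(γ))` for `a = (x, γ)`: if `V`, `V'` are open neighbourhoods of `x`, `f(x)` and `W`,
`W'` are the connected components given by `γ`, `f_*(γ)`, then `f(W) ∩ W' ≠ ∅`. (The condition for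
small `V`, `V'` implies it for all.) -/
def IsPushCorner {X Y : AtlasSpace.{u}} (f : X → Y) {p q : ℕ} (a : CornerPt X p)
    (b : CornerPt Y q) : Prop :=
  b.1 = f a.1 ∧
  ∀ (V : OpenNhdsOf a.1) (V' : OpenNhdsOf b.1), (f '' a.2.comp V ∩ b.2.comp V').Nonempty

/-- The map `F : C(X) → C(Y)` is `C(f)`, that is, `F(x, γ) = (f(x), f_*(γ))` for all `(x, γ)`. -/
def IsCornerMap (κ : Kind) (X Y : AtlasSpace.{u}) (f : X → Y) (F : corners κ X → corners κ Y) :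
    Prop :=
  ∀ z : corners κ X, IsPushCorner f z.2 (F z).2

/-- For `a = (z, γ)` and `b = (x, β)` and a map `f : Z → X`: `f(z) = x`, and near `x` the image of `γ`
under `f` is contained in the closure of `β`. -/
def LiesOver {Z X : AtlasSpace.{u}} (f : Z → X) {p q : ℕ} (a : CornerPt Z p) (b : CornerPt X q) :
    Prop :=
  f a.1 = b.1 ∧
  ∀ V' : OpenNhdsOf b.1, ∃ V : OpenNhdsOf a.1, f '' a.2.comp V ⊆ closure (b.2.comp V')

/-! ### Iterated boundaries -/

/-- `∂ᵏX`. -/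
def iterBoundary (κ : Kind) (X : AtlasSpace.{u}) : ℕ → AtlasSpace.{u}
  | 0 => X
  | k + 1 => boundary κ (iterBoundary κ X k)

/-- The projection `∂ᵏX → X`. -/
def iterProj (κ : Kind) (X : AtlasSpace.{u}) : ∀ k : ℕ, iterBoundary κ X k → X
  | 0 => fun y => y
  | k + 1 => fun y => iterProj κ X k (boundaryProj κ (iterBoundary κ X k) y)

/-- Tuples `(x, β₁, …, β_k)` with `x ∈ X` and `β₁, …, β_k` distinct local boundary components of `X` at
`x`; here `β_j` is recorded as the point `(x, β_j)` of `∂X`. -/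
structure BoundaryTuple (X : AtlasSpace.{u}) (k : ℕ) where
  pt : X
  β : Fin k → CornerPt X 1
  pt_eq : ∀ j, (β j).1 = pt
  injective : Function.Injective β

/-- `(x, β₁, …, β_{k+1}) ↦ (x, β₁, …, β_k)`. -/
def BoundaryTuple.dropLast {X : AtlasSpace.{u}} {k : ℕ} (t : BoundaryTuple X (k + 1)) :
    BoundaryTuple X k where
  pt := t.pt
  β := fun j => t.β j.castSucc
  pt_eq := fun j => t.pt_eq j.castSucc
  injective := t.injective.comp (Fin.castSucc_injective k)

/-- `e` is the family of canonical identifications of `∂ᵏX` with the set of tuples `(x, β₁, …, β_k)`: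
`∂⁰X = X`, and the point `(y, β)` of `∂ᵏ⁺¹X = ∂(∂ᵏX)` corresponds to `(x, β₁, …, β_{k+1})`, where
`y` corresponds to `(x, β₁, …, β_k)` and `β_{k+1}` is the further local boundary component of `X` at
`x` in the closure of which the image of `β` lies. -/
def IsTupleIdentification (κ : Kind) (X : AtlasSpace.{u})
    (e : ∀ k : ℕ, iterBoundary κ X k ≃ BoundaryTuple X k) : Prop :=
  (∀ x : iterBoundary κ X 0, (e 0 x).pt = x) ∧
  ∀ (k : ℕ) (y : iterBoundary κ X (k + 1)) (t : BoundaryTuple X (k + 1)),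
    e (k + 1) y = t ↔
      t.dropLast = e k (boundaryProj κ (iterBoundary κ X k) y) ∧
      LiesOver (p := 1) (iterProj κ X k) y (t.β (Fin.last k))

/-- The natural relation between a point `z = ((x, γ), β')` of `∂C(X)` and a point `w = ((x, β), γ')`
of `C(∂X)`, which for `γ = {β₁, …, β_k}` says that `β = β_{k+1}` and `γ' = {β₁, …, β_k}`, where
`β' = β_{k+1}`: the image of `β'` under `Π : C(X) → X` and the image of `γ'` under `i_X : ∂X → X` are
the same local corner component of `X` at `x`, and `γ` does not lie in the closure of `β`. -/
def IsBoundaryCornerPair (κ : Kind) (X : AtlasSpace.{u}) (z : boundary κ (corners κ X))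
    (w : corners κ (boundary κ X)) : Prop :=
  (∃ (q : ℕ) (δ : CornerPt X q),
    IsPushCorner (p := 1) (proj κ X) z δ ∧ IsPushCorner (boundaryProj κ X) w.2 δ) ∧
  ¬ LiesOver (q := 1) (id : X → X) (boundaryProj κ (corners κ X) z).2
      (proj κ (boundary κ X) w)

/-- `Φ : C(X × Y) → C(X) × C(Y)` is the map `(C(π_X), C(π_Y))`, with `π_X`, `π_Y` the projections. -/
def IsProdIdentification (κ : Kind) (X Y : AtlasSpace.{u})
    (Φ : corners κ (prodMfd κ X Y) ≃ prodMfd κ (corners κ X) (corners κ Y)) : Prop :=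
  ∀ z : corners κ (prodMfd κ X Y),
    IsPushCorner (Prod.fst : prodMfd κ X Y → X) z.2 (Φ z).1.2 ∧
    IsPushCorner (Prod.snd : prodMfd κ X Y → Y) z.2 (Φ z).2.2

/-- A pair `(x, γ)` for `X` as a manifold with a-corners, and a pair `(x', γ')` for `X` as a manifold
with corners, are the same: `x = x'`, and `γ`, `γ'` give the same components. -/
def IsSameCorner (X : AtlasSpace.{u}) {p q : ℕ} (a : CornerPt (toAnalytic X) p)
    (b : CornerPt X q) : Prop :=
  b.1 = a.1 ∧
  ∀ (V : OpenNhdsOf a.1) (V' : OpenNhdsOf b.1), (V : Set (toAnalytic X)) = (V' : Set X) →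
    a.2.comp V = b.2.comp V'

/-- The map `J` from the corners of `X` as a manifold with a-corners to the corners of `X` as a manifold
with corners is the identity on pairs `(x, γ)`. -/
def IsCornersIdentification (X : AtlasSpace.{u})
    (J : corners .analytic (toAnalytic X) ≃ toAnalytic (corners .ordinary X)) : Prop :=
  ∀ z : corners .analytic (toAnalytic X), z.1 = (J z).1 ∧ IsSameCorner X z.2 (J z).2

end ACorners

open ACorners

open Filter Topology
open scoped ContDiff

namespace ACorners

/-! ### Calculus on orthants -/

/-! Everything is local, so the theorem reduces to germs of maps between orthants, and it rests on
one analytic and one combinatorial fact.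

The analytic fact is that a-smooth functions are stable under composition with a-smooth maps. If a
component is `g_j = F x^a`, then `x_i ∂g_j/∂x_i = g_j w_{ji}` with the weight `w_{ji} = a_i +
(b-derivative of F) / F`, which is again a-smooth. Hence the `i`-th b-derivative of `f ∘ g` is the
sum over `j` of the `j`-th b-derivative of `f` at `g`, times `w_{ji}`, and this formula can be
iterated. The decay as `x_i → 0` has two sources: if `a_i = 0` the weight decays, and if `a_i > 0`
then `g_j` is of order `x_i^{a_i}`, so that the b-derivative of `f` decays along `g`. For ordinary
corners, smoothness is shown to agree with `ContDiffOn`, which supplies the same stability. Smooth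
maps, monomials and interior maps therefore compose (`IsADiff.comp`, `MonoAt.comp`, `MapAt.comp`),
and both kinds of manifold are treated together from there on.

The combinatorial fact is that a smooth map has a zero pattern: near `u`, the set of boundary
coordinates vanishing at `g x` is `φ` of the set of those vanishing at `x`, where `φ` preserves
unions (`MapAt.exists_pattern`). For a transition map `φ` is injective and preserves cardinality, so
depth is well defined. In a small box the components of a stratum are the cells on which exactly a
given set of coordinates vanishes. So in a chart at `x = c u` the local `p`-corner components are
the `p`-element subsets `I` of the set of vanishing coordinates of `u` (`exists_hasIdx`,
`exists_cornerPt`, `HasIdx.ext`). In these terms `f_*` is `I ↦ φ I`, and lying in the closure of a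
component is an inclusion of index sets.

The charts of the corners are restrictions of charts to faces. A map sends the face of `I` to the
face of `φ I`, and once the coordinates in `φ I` are dropped it is interior, because its components
that vanish identically are among those dropped (`IsFace.push`). This gives the manifold structure
of the corners and the functor.

The remaining claims become statements about finite sets. A subset of a disjoint union is a pair of
subsets, which gives corners of products. The pairs `(I, i)` and `(i, I)` with `i ∉ I` carry the
same data, which gives the boundary of the corners. Ordered tuples of distinct elements modulo
permutation are subsets, which gives the quotients of iterated boundaries. The strata of a manifold
with corners do not change when it is regarded as a manifold with a-corners. Each bijection so
obtained is the identity in matching face charts, hence a local diffeomorphism, and a bijective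
local diffeomorphism is a diffeomorphism.

Dimension is invariant because near any point there are points of depth zero, where transition maps
have invertible Jacobian matrices. -/

theorem slice_update {m : ℕ} (f : (Fin m → ℝ) → ℝ) (x : Fin m → ℝ) (i : Fin m) (t : ℝ) :
    slice f (Function.update x i t) i = slice f x i := by
  funext s; simp [slice]

theorem slice_self {m : ℕ} (f : (Fin m → ℝ) → ℝ) (x : Fin m → ℝ) (i : Fin m) :
    slice f x i (x i) = f x := by simp [slice]

/-- A function whose partial derivatives along a product of convex sets exist near `u` and are
continuous at `u` is differentiable at `u` within the product. -/
theorem hasFDerivWithinAt_of_partials {n : ℕ} {R : Fin n → Set ℝ} (hR : ∀ i, Convex ℝ (R i))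
    {U : Set (Fin n → ℝ)} {u : Fin n → ℝ} (hu : u ∈ pi univ R) (hU : U ∈ 𝓝[pi univ R] u)
    {f : (Fin n → ℝ) → ℝ} {f' : Fin n → (Fin n → ℝ) → ℝ}
    (hf : ∀ x ∈ U ∩ pi univ R, ∀ i, HasDerivWithinAt (slice f x i) (f' i x) (R i) (x i))
    (hc : ∀ i, ContinuousWithinAt (f' i) (pi univ R) u) :
    HasFDerivWithinAt f (∑ i, f' i u • ContinuousLinearMap.proj (R := ℝ) (φ := fun _ : Fin n => ℝ) i)
      (pi univ R) u := by
  refine .of_isLittleO (Asymptotics.isLittleO_iff.2 fun c hc0 => ?_)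
  -- The error `c ‖x - u‖` is shared among the `n` coordinates; `n + 1` keeps the denominator
  -- positive when `n = 0`.
  have hε : 0 < c / (n + 1) := by positivity
  have h1 : ∀ᶠ x in 𝓝[pi univ R] u, x ∈ U ∧ ∀ i, |f' i x - f' i u| ≤ c / (n + 1) := by
    refine (eventually_mem_set.2 hU).and (eventually_all.2 fun i => ?_)
    filter_upwards [(hc i).eventually (Metric.closedBall_mem_nhds _ hε)] with x hx
    simpa [Real.dist_eq] using hx
  obtain ⟨δ, hδ, h2⟩ := Metric.mem_nhdsWithin_iff.1 h1
  filter_upwards [inter_mem_nhdsWithin _ (Metric.ball_mem_nhds u hδ)] with x ⟨hxR, hxδ⟩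
  -- The points `p s` lead from `u` to `x`, changing one coordinate at a time. Each segment stays in
  -- the product of convex sets, and the mean value inequality applies along it to the slice minus
  -- its linear part at `u`.
  let p : ℕ → Fin n → ℝ := fun s i => if i.val < s then x i else u i
  have key : ∀ i : Fin n, |f (p (i + 1)) - f (p i) - f' i u * (x i - u i)| ≤
      c / (n + 1) * |x i - u i| := by
    intro i
    have e0 : f (p i) = slice f (p i) i (u i) := by
      have : Function.update (p i) i (u i) = p i := by
        funext j; by_cases h : j = i
        · subst h; simp [p]
        · simp [h]
      simp [slice, this]
    have e1 : f (p (i + 1)) = slice f (p i) i (x i) := by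
      have : Function.update (p i) i (x i) = p (i + 1) := by
        funext j; by_cases h : j = i
        · subst h; simp [p]
        · have : j.val ≠ i.val := fun h' => h (Fin.ext h')
          simp only [p, Function.update_of_ne h]
          by_cases hj : j.val < i.val
          · simp [hj, hj.trans (Nat.lt_succ_self _)]
          · have : ¬ j.val < i.val + 1 := by omega
            simp [hj, this]
      simp [slice, this]
    have hmem : ∀ t ∈ uIcc (u i) (x i), Function.update (p i) i t ∈ U ∩ pi univ R ∧
        |f' i (Function.update (p i) i t) - f' i u| ≤ c / (n + 1) := by
      intro t ht
      have hR' : Function.update (p i) i t ∈ pi univ R := by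
        intro j _
        by_cases h : j = i
        · subst h
          simpa using (hR j).ordConnected.uIcc_subset (hu j trivial) (hxR j trivial) ht
        · simp only [Function.update_of_ne h, p]
          split_ifs
          exacts [hxR j trivial, hu j trivial]
      have hb : Function.update (p i) i t ∈ Metric.ball u δ := by
        rw [Metric.mem_ball, dist_pi_lt_iff hδ] at hxδ ⊢
        intro j
        by_cases h : j = i
        · subst h
          refine lt_of_le_of_lt ?_ (hxδ j)
          simp only [Function.update_self, Real.dist_eq]
          exact (abs_sub_left_of_mem_uIcc ht)
        · simp only [Function.update_of_ne h, p]
          split_ifs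
          exacts [hxδ j, by simpa using hδ]
      have := h2 ⟨hb, hR'⟩
      exact ⟨⟨this.1, hR'⟩, this.2 i⟩
    have := (convex_uIcc (u i) (x i)).norm_image_sub_le_of_norm_hasDerivWithin_le
      (f := fun t => slice f (p i) i t - f' i u * t)
      (f' := fun t => f' i (Function.update (p i) i t) - f' i u) (C := c / (n + 1))
      (fun t ht => by
        have h := hf _ (hmem t ht).1 i
        rw [slice_update, Function.update_self] at h
        have h' := h.mono ((hR i).ordConnected.uIcc_subset (hu i trivial) (hxR i trivial))
        have h2 := h'.sub ((hasDerivWithinAt_id t _).const_mul (f' i u))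
        rw [mul_one] at h2
        exact h2)
      (fun t ht => (hmem t ht).2) left_mem_uIcc right_mem_uIcc
    rw [e0, e1]
    simp only [Real.norm_eq_abs] at this
    convert this using 2
    ring
  have hsum : f x - f u - ∑ i, f' i u * (x i - u i) =
      ∑ i : Fin n, (f (p (i + 1)) - f (p i) - f' i u * (x i - u i)) := by
    rw [Finset.sum_sub_distrib]
    congr 1
    have := Finset.sum_range_sub (fun s => f (p s)) n
    rw [Finset.sum_range] at this
    rw [this]
    have a1 : p n = x := by funext j; simp [p]
    have a0 : p 0 = u := by funext j; simp [p]
    rw [a1, a0]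
  have hL : (∑ i, f' i u • ContinuousLinearMap.proj (R := ℝ) (φ := fun _ : Fin n => ℝ) i) (x - u) =
      ∑ i, f' i u * (x i - u i) := by simp
  rw [hL, hsum, Real.norm_eq_abs]
  calc |∑ i : Fin n, (f (p (i + 1)) - f (p i) - f' i u * (x i - u i))|
      ≤ ∑ i : Fin n, |f (p (i + 1)) - f (p i) - f' i u * (x i - u i)| :=
        Finset.abs_sum_le_sum_abs _ _
    _ ≤ ∑ i : Fin n, c / (n + 1) * ‖x - u‖ := by
        refine Finset.sum_le_sum fun i _ => (key i).trans ?_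
        gcongr
        simpa using norm_le_pi_norm (x - u) i
    _ = n * (c / (n + 1) * ‖x - u‖) := by simp
    _ ≤ c * ‖x - u‖ := by
        rw [← mul_assoc]
        gcongr
        rw [mul_div_assoc', div_le_iff₀ (by positivity)]
        nlinarith

/-! ### Open subsets of orthants -/

theorem orthant_eq_pi (k m : ℕ) : orthant k m = pi univ (fun i : Fin m => coordRange k i) := by
  ext x
  simp only [Set.mem_pi, mem_univ, true_imp_iff]
  refine forall_congr' fun i => ?_
  by_cases h : i.val < k <;> simp [coordRange, h]

theorem convex_coordRange (k : ℕ) {m : ℕ} (i : Fin m) : Convex ℝ (coordRange k i) := by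
  unfold coordRange; split_ifs
  exacts [convex_Ici 0, convex_univ]

theorem uniqueDiffOn_coordRange (k : ℕ) {m : ℕ} (i : Fin m) : UniqueDiffOn ℝ (coordRange k i) := by
  unfold coordRange; split_ifs
  exacts [uniqueDiffOn_Ici 0, uniqueDiffOn_univ]

theorem isClosed_orthant (k m : ℕ) : IsClosed (orthant k m) := by
  have : orthant k m = ⋂ i : Fin m, ⋂ _ : i.val < k, {x | 0 ≤ x i} := by ext; simp [orthant]
  rw [this]
  exact isClosed_iInter fun i => isClosed_iInter fun _ =>
    isClosed_le continuous_const (continuous_apply i)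

/-- Turns relative openness into a neighbourhood condition, so that germs can be handled with the
filter `𝓝[orthant k m]` and no choice of open sets. -/
theorem isOpenInOrthant_iff {k m : ℕ} {U : Set (Fin m → ℝ)} :
    IsOpenInOrthant k U ↔ U ⊆ orthant k m ∧ ∀ x ∈ U, U ∈ 𝓝[orthant k m] x := by
  constructor
  · rintro ⟨O, hO, rfl⟩
    exact ⟨inter_subset_right, fun x hx => inter_comm O _ ▸ inter_mem_nhdsWithin _ (hO.mem_nhds hx.1)⟩
  · rintro ⟨hU, h⟩
    choose! O hO using fun x hx => mem_nhdsWithin.1 (h x hx)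
    refine ⟨⋃ x ∈ U, O x, isOpen_biUnion fun x hx => (hO x hx).1, ?_⟩
    ext y
    simp only [mem_inter_iff, mem_iUnion]
    constructor
    · exact fun hy => ⟨⟨y, hy, (hO y hy).2.1⟩, hU hy⟩
    · rintro ⟨⟨x, hx, hy⟩, hy'⟩; exact (hO x hx).2.2 ⟨hy, hy'⟩

theorem IsOpenInOrthant.subset {k m : ℕ} {U : Set (Fin m → ℝ)} (h : IsOpenInOrthant k U) :
    U ⊆ orthant k m := (isOpenInOrthant_iff.1 h).1

theorem IsOpenInOrthant.mem_nhdsWithin {k m : ℕ} {U : Set (Fin m → ℝ)} (h : IsOpenInOrthant k U)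
    {x : Fin m → ℝ} (hx : x ∈ U) : U ∈ 𝓝[orthant k m] x := (isOpenInOrthant_iff.1 h).2 x hx

theorem IsOpenInOrthant.nhdsWithin_eq {k m : ℕ} {U : Set (Fin m → ℝ)} (h : IsOpenInOrthant k U)
    {x : Fin m → ℝ} (hx : x ∈ U) : 𝓝[U] x = 𝓝[orthant k m] x :=
  le_antisymm (nhdsWithin_mono _ h.subset)
    (nhdsWithin_le_of_mem (h.mem_nhdsWithin hx))

theorem IsOpenInOrthant.inter {k m : ℕ} {U V : Set (Fin m → ℝ)} (h : IsOpenInOrthant k U)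
    (h' : IsOpenInOrthant k V) : IsOpenInOrthant k (U ∩ V) :=
  isOpenInOrthant_iff.2 ⟨inter_subset_left.trans h.subset, fun _ hx =>
    inter_mem (h.mem_nhdsWithin hx.1) (h'.mem_nhdsWithin hx.2)⟩

theorem IsOpenInOrthant.inter_isOpen {k m : ℕ} {U O : Set (Fin m → ℝ)} (h : IsOpenInOrthant k U)
    (hO : IsOpen O) : IsOpenInOrthant k (U ∩ O) :=
  isOpenInOrthant_iff.2 ⟨inter_subset_left.trans h.subset, fun _ hx =>
    inter_mem (h.mem_nhdsWithin hx.1) (mem_nhdsWithin_of_mem_nhds (hO.mem_nhds hx.2))⟩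

theorem isOpenInOrthant_orthant (k m : ℕ) : IsOpenInOrthant k (orthant k m) :=
  ⟨univ, isOpen_univ, by simp⟩

/-- Every neighbourhood in the orthant contains one that is open in the orthant. -/
theorem exists_isOpenInOrthant_subset {k m : ℕ} {u : Fin m → ℝ} (hu : u ∈ orthant k m)
    {S : Set (Fin m → ℝ)} (hS : S ∈ 𝓝[orthant k m] u) :
    ∃ W, IsOpenInOrthant k W ∧ u ∈ W ∧ W ⊆ S := by
  obtain ⟨O, hO, huO, h⟩ := mem_nhdsWithin.1 hS
  exact ⟨O ∩ orthant k m, ⟨O, hO, rfl⟩, ⟨huO, hu⟩, h⟩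

theorem continuous_update_const {m : ℕ} (x : Fin m → ℝ) (i : Fin m) :
    Continuous fun t : ℝ => Function.update x i t := continuous_const.update i continuous_id

theorem tendsto_update {m : ℕ} (x : Fin m → ℝ) (i : Fin m) :
    Tendsto (fun t : ℝ => Function.update x i t) (𝓝 (x i)) (𝓝 x) := by
  simpa using (continuous_update_const x i).tendsto (x i)

/-- Within the coordinate range, updating a coordinate stays in `U` near a point of `U`. -/
theorem IsOpenInOrthant.eventually_update {k m : ℕ} {U : Set (Fin m → ℝ)} (h : IsOpenInOrthant k U)
    {x : Fin m → ℝ} (hx : x ∈ U) (i : Fin m) :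
    ∀ᶠ t in 𝓝[coordRange k i] (x i), Function.update x i t ∈ U := by
  have h1 : Tendsto (fun t : ℝ => Function.update x i t) (𝓝[coordRange k i] (x i))
      (𝓝[orthant k m] x) := by
    refine tendsto_nhdsWithin_iff.2 ⟨(tendsto_update x i).mono_left nhdsWithin_le_nhds, ?_⟩
    filter_upwards [self_mem_nhdsWithin] with t ht
    have hx' := h.subset hx
    rw [orthant_eq_pi] at hx' ⊢
    intro j _
    by_cases hj : j = i
    · subst hj; simpa using ht
    · simpa [hj] using hx' j trivial
  exact h1.eventually (h.mem_nhdsWithin hx)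

theorem coordRange_mem_nhds {k m : ℕ} {i : Fin m} {x : Fin m → ℝ} (hi : i.val < k → 0 < x i) :
    coordRange k i ∈ 𝓝 (x i) := by
  unfold coordRange
  split_ifs with h
  exacts [Ici_mem_nhds (hi h), univ_mem]

theorem IsOpenInOrthant.eventually_update' {k m : ℕ} {U : Set (Fin m → ℝ)}
    (h : IsOpenInOrthant k U) {x : Fin m → ℝ} (hx : x ∈ U) {i : Fin m}
    (hi : i.val < k → 0 < x i) : ∀ᶠ t in 𝓝 (x i), Function.update x i t ∈ U := by
  have := h.eventually_update hx i
  rwa [nhdsWithin_eq_nhds.2 (coordRange_mem_nhds hi)] at this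

theorem IsOpenInOrthant.eq_zero_or_pos {k m : ℕ} {U : Set (Fin m → ℝ)} (h : IsOpenInOrthant k U)
    {x : Fin m → ℝ} (hx : x ∈ U) (i : Fin m) : (i.val < k ∧ x i = 0) ∨ (i.val < k → 0 < x i) := by
  by_cases hi : i.val < k
  · rcases (h.subset hx i hi).eq_or_lt with h0 | h0
    exacts [.inl ⟨hi, h0.symm⟩, .inr fun _ => h0]
  · exact .inr fun h' => absurd h' hi

/-! ### Ordinary smooth functions -/

theorem uniqueDiffOn_of_isOpenInOrthant {k m : ℕ} {U : Set (Fin m → ℝ)}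
    (h : IsOpenInOrthant k U) : UniqueDiffOn ℝ U := by
  obtain ⟨O, hO, rfl⟩ := h
  have : UniqueDiffOn ℝ (orthant k m) := by
    rw [orthant_eq_pi]
    exact UniqueDiffOn.univ_pi fun i => uniqueDiffOn_coordRange k i
  exact inter_comm _ O ▸ this.inter hO

theorem hasDerivWithinAt_slice_of_differentiableWithinAt {k m : ℕ} {U : Set (Fin m → ℝ)}
    (hU : IsOpenInOrthant k U) {f : (Fin m → ℝ) → ℝ} {x : Fin m → ℝ} (hx : x ∈ U)
    (hf : DifferentiableWithinAt ℝ f U x) (i : Fin m) :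
    HasDerivWithinAt (slice f x i) (fderivWithin ℝ f U x (Pi.single i 1)) (coordRange k i) (x i) := by
  have h1 := hf.hasFDerivWithinAt
  have h2 : HasDerivWithinAt (fun t : ℝ => Function.update x i t) (Pi.single i 1)
      ({t | Function.update x i t ∈ U}) (x i) := (hasDerivAt_update x i (x i)).hasDerivWithinAt
  have h1' : HasFDerivWithinAt f (fderivWithin ℝ f U x) U (Function.update x i (x i)) := by simpa
  have h3 := h1'.comp_hasDerivWithinAt (x i) h2 (fun t ht => ht)
  exact (h3.mono_of_mem_nhdsWithin (hU.eventually_update hx i))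

theorem cornerPartial_eq_fderivWithin {k m : ℕ} {U : Set (Fin m → ℝ)} (hU : IsOpenInOrthant k U)
    {f : (Fin m → ℝ) → ℝ} {x : Fin m → ℝ} (hx : x ∈ U) (hf : DifferentiableWithinAt ℝ f U x)
    (i : Fin m) : cornerPartial k i f x = fderivWithin ℝ f U x (Pi.single i 1) := by
  refine (hasDerivWithinAt_slice_of_differentiableWithinAt hU hx hf i).derivWithin
    (uniqueDiffOn_coordRange k i _ ?_)
  have := hU.subset hx
  rw [orthant_eq_pi] at this
  exact this i trivial

theorem contDiffOn_cornerPartial {k m : ℕ} {U : Set (Fin m → ℝ)} (hU : IsOpenInOrthant k U)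
    {f : (Fin m → ℝ) → ℝ} (hf : ContDiffOn ℝ ∞ f U) (i : Fin m) :
    ContDiffOn ℝ ∞ (cornerPartial k i f) U := by
  have h := (contDiffOn_infty_iff_fderivWithin (uniqueDiffOn_of_isOpenInOrthant hU)).1 hf
  refine (h.2.clm_apply (contDiffOn_const (c := Pi.single i 1))).congr fun x hx => ?_
  exact cornerPartial_eq_fderivWithin hU hx (h.1 x hx) i

theorem IsCornerDiff.hasFDerivWithinAt {k m : ℕ} {U : Set (Fin m → ℝ)} (hU : IsOpenInOrthant k U)
    {f : (Fin m → ℝ) → ℝ} (hf : IsCornerDiff k U f) {x : Fin m → ℝ} (hx : x ∈ U) :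
    HasFDerivWithinAt f (∑ i, cornerPartial k i f x •
      ContinuousLinearMap.proj (R := ℝ) (φ := fun _ : Fin m => ℝ) i) U x := by
  have := hasFDerivWithinAt_of_partials (R := fun i : Fin m => coordRange k i) (U := U) (u := x)
    (f := f) (f' := fun i => cornerPartial k i f) (fun i => convex_coordRange k i)
    (by rw [← orthant_eq_pi]; exact hU.subset hx)
    (by rw [← orthant_eq_pi]; exact hU.mem_nhdsWithin hx)
    (fun y hy i => ((hf.2 i).1 y hy.1).hasDerivWithinAt)
    (fun i => by
      rw [← orthant_eq_pi, ContinuousWithinAt, ← hU.nhdsWithin_eq hx]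
      exact (hf.2 i).2 x hx)
  rw [← orthant_eq_pi] at this
  exact this.mono hU.subset

/-- Continuous partial derivatives give a Fréchet derivative that is a combination of them, and by
induction they are smooth to one order less. Products, powers and composites of ordinary smooth
functions can thus be taken from `ContDiffOn`. -/
theorem isWeaklySmooth_iff {k m : ℕ} {U : Set (Fin m → ℝ)} (hU : IsOpenInOrthant k U)
    {f : (Fin m → ℝ) → ℝ} : IsWeaklySmooth k U f ↔ ContDiffOn ℝ ∞ f U := by
  constructor
  · intro h
    refine contDiffOn_infty.2 fun n => ?_
    induction n generalizing f with
    | zero => exact contDiffOn_zero.2 (h []).1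
    | succ n ih =>
      have hd : ∀ x ∈ U, _ := fun x hx => (IsCornerDiff.hasFDerivWithinAt hU (h []) hx)
      have hu := uniqueDiffOn_of_isOpenInOrthant hU
      push_cast
      refine contDiffOn_succ_of_fderivWithin (fun x hx => (hd x hx).differentiableWithinAt)
        (by simp) ?_
      have : ContDiffOn ℝ n (fun x => ∑ i, cornerPartial k i f x •
          ContinuousLinearMap.proj (R := ℝ) (φ := fun _ : Fin m => ℝ) i) U := by
        refine ContDiffOn.sum fun i _ => ContDiffOn.smul (ih ?_) contDiffOn_const
        intro L
        -- `foldr` applies the last entry of the list first, so appending `i` yields the iterated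
        -- derivatives of the `i`-th partial derivative.
        have := h (L ++ [i])
        rwa [List.foldr_append] at this
      exact this.congr fun x hx => (hd x hx).fderivWithin (hu x hx)
  · intro h L
    have hL : ContDiffOn ℝ ∞ (L.foldr (cornerPartial k) f) U := by
      induction L with
      | nil => exact h
      | cons i L ih => exact contDiffOn_cornerPartial hU ih i
    have hd := hL.differentiableOn (by simp)
    exact ⟨hL.continuousOn, fun i =>
      ⟨fun x hx => (hasDerivWithinAt_slice_of_differentiableWithinAt hU hx
        (hd x hx) i).differentiableWithinAt, (contDiffOn_cornerPartial hU hL i).continuousOn⟩⟩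

end ACorners

namespace ACorners

/-! ### A-differentiable functions -/

/-- The function `h` is `O(x_i^α)` near `u` in `U` for some `α > 0`. -/
def DecayAt {m : ℕ} (U : Set (Fin m → ℝ)) (i : Fin m) (h : (Fin m → ℝ) → ℝ) (u : Fin m → ℝ) : Prop :=
  ∃ C α : ℝ, 0 < C ∧ 0 < α ∧ ∀ᶠ x in 𝓝[U] u, |h x| ≤ C * x i ^ α

/-- On a bounded range a higher power is dominated by a lower one; this allows several decay
exponents to be replaced by their minimum. -/
theorem rpow_le_mul_rpow {x M α β : ℝ} (hx : 0 ≤ x) (hxM : x ≤ M) (hM : 1 ≤ M) (hα : 0 < α)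
    (hαβ : α ≤ β) : x ^ β ≤ M ^ (β - α) * x ^ α := by
  rcases hx.eq_or_lt with rfl | h0
  · rw [Real.zero_rpow (hα.trans_le hαβ).ne']; positivity
  · calc x ^ β = x ^ (β - α) * x ^ α := by rw [← Real.rpow_add h0]; simp
      _ ≤ _ := by
        gcongr

theorem DecayAt.eq_zero {m : ℕ} {U : Set (Fin m → ℝ)} {i : Fin m} {h : (Fin m → ℝ) → ℝ}
    {u : Fin m → ℝ} (hd : DecayAt U i h u) (hu : u ∈ U) (hi : u i = 0) : h u = 0 := by
  obtain ⟨C, α, hC, hα, hx⟩ := hd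
  have := hx.self_of_nhdsWithin hu
  rw [hi, Real.zero_rpow hα.ne'] at this
  simpa using this

theorem DecayAt.congr {m : ℕ} {U : Set (Fin m → ℝ)} {i : Fin m} {h g : (Fin m → ℝ) → ℝ}
    {u : Fin m → ℝ} (hd : DecayAt U i h u) (hg : EqOn g h U) : DecayAt U i g u := by
  obtain ⟨C, α, hC, hα, hx⟩ := hd
  refine ⟨C, α, hC, hα, ?_⟩
  filter_upwards [hx, self_mem_nhdsWithin] with x hx hxU
  rwa [hg hxU]

theorem DecayAt.zero {m : ℕ} {U : Set (Fin m → ℝ)}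
    {k : ℕ} (hk : U ⊆ orthant k m) {i : Fin m} (hi : i.val < k) {u : Fin m → ℝ} :
    DecayAt U i (fun _ => 0) u := by
  refine ⟨1, 1, one_pos, one_pos, ?_⟩
  filter_upwards [self_mem_nhdsWithin] with x hx
  simpa using hk hx i hi

theorem eventually_le_one {m : ℕ} {U : Set (Fin m → ℝ)} {i : Fin m} {u : Fin m → ℝ} (hi : u i = 0) :
    ∀ᶠ x in 𝓝[U] u, x i ≤ 1 := by
  have : ∀ᶠ x in 𝓝 u, x i < 1 :=
    (continuous_apply i).continuousAt.eventually_lt continuousAt_const (by simp [hi])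
  exact eventually_nhdsWithin_of_eventually_nhds (this.mono fun x hx => hx.le)

/-- Since `u i = 0`, nearby points have `x i ≤ 1`, so both bounds hold with the smaller of the two
exponents. -/
theorem DecayAt.add {m k : ℕ} {U : Set (Fin m → ℝ)} (hU : U ⊆ orthant k m) {i : Fin m}
    (hi : i.val < k) {h g : (Fin m → ℝ) → ℝ} {u : Fin m → ℝ} (hu : u i = 0)
    (hh : DecayAt U i h u) (hg : DecayAt U i g u) : DecayAt U i (fun x => h x + g x) u := by
  obtain ⟨C, α, hC, hα, h1⟩ := hh
  obtain ⟨D, β, hD, hβ, h2⟩ := hg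
  refine ⟨C + D, min α β, by positivity, lt_min hα hβ, ?_⟩
  filter_upwards [h1, h2, eventually_le_one hu, self_mem_nhdsWithin] with x h1 h2 hx1 hxU
  have hx0 := hU hxU i hi
  have e1 := rpow_le_mul_rpow hx0 hx1 le_rfl (lt_min hα hβ) (min_le_left α β)
  have e2 := rpow_le_mul_rpow hx0 hx1 le_rfl (lt_min hα hβ) (min_le_right α β)
  rw [Real.one_rpow, one_mul] at e1 e2
  calc |h x + g x| ≤ |h x| + |g x| := abs_add_le _ _
    _ ≤ C * x i ^ min α β + D * x i ^ min α β := by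
      gcongr
      · exact h1.trans (by gcongr)
      · exact h2.trans (by gcongr)
    _ = _ := by ring

theorem DecayAt.mul_continuous {m k : ℕ} {U : Set (Fin m → ℝ)} (hU : U ⊆ orthant k m) {i : Fin m}
    (hi : i.val < k) {h g : (Fin m → ℝ) → ℝ} {u : Fin m → ℝ}
    (hh : DecayAt U i h u) (hg : ContinuousWithinAt g U u) : DecayAt U i (fun x => h x * g x) u := by
  obtain ⟨C, α, hC, hα, h1⟩ := hh
  refine ⟨C * (|g u| + 1), α, by positivity, hα, ?_⟩
  have h2 : ∀ᶠ x in 𝓝[U] u, |g x| < |g u| + 1 :=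
    (hg.abs).eventually_lt continuousWithinAt_const (lt_add_one _)
  filter_upwards [h1, h2, self_mem_nhdsWithin] with x h1 h2 hxU
  have hx0 : 0 ≤ x i ^ α := Real.rpow_nonneg (hU hxU i hi) _
  rw [abs_mul]
  calc |h x| * |g x| ≤ (C * x i ^ α) * (|g u| + 1) := by gcongr
    _ = _ := by ring

theorem DecayAt.sum {m k : ℕ} {U : Set (Fin m → ℝ)} (hU : U ⊆ orthant k m) {i : Fin m}
    (hi : i.val < k) {u : Fin m → ℝ} (hu : u i = 0) {ι : Type*} (s : Finset ι)
    {h : ι → (Fin m → ℝ) → ℝ} (hh : ∀ j ∈ s, DecayAt U i (h j) u) :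
    DecayAt U i (fun x => ∑ j ∈ s, h j x) u := by
  classical
  induction s using Finset.induction_on with
  | empty => simpa using DecayAt.zero hU hi
  | insert a s ha ih =>
    simp only [Finset.sum_insert ha]
    exact (hh a (by simp)).add hU hi hu (ih fun j hj => hh j (by simp [hj]))

/-- The factor by which the `i`-th b-derivative differs from the partial derivative. -/
noncomputable def bScale (k : ℕ) {m : ℕ} (i : Fin m) (x : Fin m → ℝ) : ℝ := if i.val < k then x i else 1

theorem bPartial_eq (k : ℕ) {m : ℕ} (i : Fin m) (f : (Fin m → ℝ) → ℝ) (x : Fin m → ℝ) :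
    bPartial k i f x = bScale k i x * deriv (slice f x i) (x i) := by
  unfold bPartial bScale; split_ifs <;> simp

theorem bPartial_of_eq_zero {k m : ℕ} {i : Fin m} (f : (Fin m → ℝ) → ℝ) {x : Fin m → ℝ}
    (h : i.val < k ∧ x i = 0) : bPartial k i f x = 0 := by
  simp [bPartial, h.1, h.2]

theorem bScale_ne_zero {k m : ℕ} {i : Fin m} {x : Fin m → ℝ} (h : i.val < k → 0 < x i) :
    bScale k i x ≠ 0 := by
  unfold bScale; split_ifs with h'
  exacts [(h h').ne', one_ne_zero]

theorem continuous_bScale (k : ℕ) {m : ℕ} (i : Fin m) : Continuous (bScale (m := m) k i) := by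
  unfold bScale; split_ifs
  exacts [continuous_apply i, continuous_const]

/-- The bounds on compact sets are local. A point of `U` has a compact neighbourhood in the orthant
inside `U`; conversely finitely many local bounds combine on a compact set. Decay needs to be
required only where `u i = 0`: elsewhere `x i` is bounded below near `u`, and continuity gives a
bound with exponent `1`. -/
theorem isADiff_iff {k m : ℕ} {U : Set (Fin m → ℝ)} (hU : IsOpenInOrthant k U)
    {f : (Fin m → ℝ) → ℝ} : IsADiff k U f ↔ IsRDiff k U f ∧
      ∀ u ∈ U, ∀ i : Fin m, i.val < k → u i = 0 → DecayAt U i (bPartial k i f) u := by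
  refine and_congr_right fun hr => ⟨fun h u hu i hi _ => ?_, fun h S hSU hS i hi => ?_⟩
  · obtain ⟨r, hr0, hr⟩ := Metric.mem_nhdsWithin_iff.1 (hU.mem_nhdsWithin hu)
    have hsub : Metric.closedBall u (r / 2) ∩ orthant k m ⊆ U := fun x hx =>
      hr ⟨Metric.closedBall_subset_ball (by linarith) hx.1, hx.2⟩
    obtain ⟨C, α, hC, hα, hb⟩ := h _ hsub
      ((isCompact_closedBall u (r / 2)).inter_right (isClosed_orthant k m)) i hi
    refine ⟨C, α, hC, hα, ?_⟩
    rw [hU.nhdsWithin_eq hu]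
    filter_upwards [inter_mem_nhdsWithin _ (Metric.closedBall_mem_nhds u (half_pos hr0))] with x hx
    exact hb x ⟨hx.2, hx.1⟩
  · obtain ⟨M, hM⟩ := hS.exists_bound_of_continuousOn (continuous_apply i).continuousOn
    have hM' : ∀ x ∈ S, x i ≤ max M 1 := fun x hx =>
      (le_abs_self _).trans ((hM x hx).trans (le_max_left _ _))
    -- The compactness induction works with sets in `𝓝[S] u`, which need not lie in `S`; hence the
    -- intersection with `S`.
    suffices H : ∃ C α : ℝ, 0 < C ∧ 0 < α ∧ ∀ x ∈ S ∩ S, |bPartial k i f x| ≤ C * x i ^ α by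
      simpa using H
    refine hS.induction_on (p := fun s => ∃ C α : ℝ, 0 < C ∧ 0 < α ∧
      ∀ x ∈ s ∩ S, |bPartial k i f x| ≤ C * x i ^ α) ⟨1, 1, one_pos, one_pos, by simp⟩ ?_ ?_ ?_
    · rintro s t hst ⟨C, α, hC, hα, hb⟩
      exact ⟨C, α, hC, hα, fun x hx => hb x ⟨hst hx.1, hx.2⟩⟩
    · rintro s t ⟨C, α, hC, hα, h1⟩ ⟨D, β, hD, hβ, h2⟩
      have hM0 : (0 : ℝ) < max M 1 := one_pos.trans_le (le_max_right _ _)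
      -- `max M 1` bounds `x i` on `S`, and its powers pay for lowering both exponents to the
      -- minimum.
      refine ⟨C * max M 1 ^ (α - min α β) + D * max M 1 ^ (β - min α β), min α β, by positivity,
        lt_min hα hβ, ?_⟩
      rintro x ⟨hx, hxS⟩
      have hx0 := hU.subset (hSU hxS) i hi
      have hm := lt_min hα hβ
      have e1 := rpow_le_mul_rpow hx0 (hM' x hxS) (le_max_right _ _) hm (min_le_left α β)
      have e2 := rpow_le_mul_rpow hx0 (hM' x hxS) (le_max_right _ _) hm (min_le_right α β)
      have p1 : 0 ≤ max M 1 ^ (α - min α β) * x i ^ min α β := by positivity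
      have p2 : 0 ≤ max M 1 ^ (β - min α β) * x i ^ min α β := by positivity
      rcases hx with hx | hx
      · nlinarith [h1 x ⟨hx, hxS⟩, mul_le_mul_of_nonneg_left e1 hC.le, mul_nonneg hD.le p2]
      · nlinarith [h2 x ⟨hx, hxS⟩, mul_le_mul_of_nonneg_left e2 hD.le, mul_nonneg hC.le p1]
    · intro u hu
      have main : DecayAt U i (bPartial k i f) u := by
        rcases hU.eq_zero_or_pos (hSU hu) i with h0 | h0
        · exact h u (hSU hu) i hi h0.2
        · have h0 := h0 hi
          have e1 : ∀ᶠ x in 𝓝[U] u, |bPartial k i f x| < |bPartial k i f u| + 1 :=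
            (hr.2.2 i u (hSU hu)).abs.eventually_lt continuousWithinAt_const (lt_add_one _)
          have e2 : ∀ᶠ x in 𝓝[U] u, u i / 2 < x i :=
            Tendsto.eventually_lt (continuousWithinAt_const (b := u i / 2))
              (continuous_apply i).continuousWithinAt (half_lt_self h0)
          refine ⟨(|bPartial k i f u| + 1) / (u i / 2), 1, by positivity, one_pos, ?_⟩
          filter_upwards [e1, e2] with x e1 e2
          rw [Real.rpow_one, div_mul_eq_mul_div, le_div_iff₀ (by positivity)]
          have := abs_nonneg (bPartial k i f u)
          nlinarith
      obtain ⟨C, α, hC, hα, hb⟩ := main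
      have : {x | |bPartial k i f x| ≤ C * x i ^ α} ∈ 𝓝[S] u := nhdsWithin_mono _ hSU hb
      exact ⟨_, this, C, α, hC, hα, fun x hx => hx.1⟩

theorem IsADiff.hasDerivAt {k m : ℕ} {U : Set (Fin m → ℝ)} {f : (Fin m → ℝ) → ℝ}
    (hf : IsADiff k U f) {x : Fin m → ℝ} (hx : x ∈ U) {i : Fin m} (hi : i.val < k → 0 < x i) :
    ∃ d, HasDerivAt (slice f x i) d (x i) ∧ bScale k i x * d = bPartial k i f x :=
  ⟨_, (hf.1.2.1 i x hx hi).hasDerivAt, (bPartial_eq k i f x).symm⟩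

/-- A continuous function with given b-derivatives, themselves continuous and decaying. -/
theorem isADiff_of_formula {k m : ℕ} {U : Set (Fin m → ℝ)} (hU : IsOpenInOrthant k U)
    {f : (Fin m → ℝ) → ℝ} {E : Fin m → (Fin m → ℝ) → ℝ} (hf : ContinuousOn f U)
    (hd : ∀ i : Fin m, ∀ x ∈ U, (i.val < k → 0 < x i) →
      ∃ d, HasDerivAt (slice f x i) d (x i) ∧ bScale k i x * d = E i x)
    (hE : ∀ i, ContinuousOn (E i) U)
    (hdecay : ∀ u ∈ U, ∀ i : Fin m, i.val < k → u i = 0 → DecayAt U i (E i) u) :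
    IsADiff k U f ∧ ∀ i, EqOn (bPartial k i f) (E i) U := by
  have heq : ∀ i, EqOn (bPartial k i f) (E i) U := by
    intro i x hx
    -- Where `x i = 0` with `i < k` the b-derivative is `0` by definition, and `E i` vanishes there
    -- by its decay.
    rcases hU.eq_zero_or_pos hx i with h0 | h0
    · rw [bPartial_of_eq_zero f h0, (hdecay x hx i h0.1 h0.2).eq_zero hx h0.2]
    · obtain ⟨d, h1, h2⟩ := hd i x hx h0
      rw [bPartial_eq, h1.deriv, h2]
  refine ⟨(isADiff_iff hU).2 ⟨⟨hf, fun i x hx h0 => ?_, fun i => (hE i).congr (heq i)⟩,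
    fun u hu i hi h0 => (hdecay u hu i hi h0).congr (heq i)⟩, heq⟩
  obtain ⟨d, h1, -⟩ := hd i x hx h0
  exact h1.differentiableAt

/-- The iterated b-derivatives of order at most `N` are a-differentiable. -/
def ASmoothOfOrder (k : ℕ) {m : ℕ} (U : Set (Fin m → ℝ)) : ℕ → ((Fin m → ℝ) → ℝ) → Prop
  | 0, f => IsADiff k U f
  | N + 1, f => IsADiff k U f ∧ ∀ i, ASmoothOfOrder k U N (bPartial k i f)

theorem ASmoothOfOrder.isADiff {k m N : ℕ} {U : Set (Fin m → ℝ)} {f : (Fin m → ℝ) → ℝ}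
    (h : ASmoothOfOrder k U N f) : IsADiff k U f := by
  cases N
  exacts [h, h.1]

theorem ASmoothOfOrder.continuousOn {k m N : ℕ} {U : Set (Fin m → ℝ)} {f : (Fin m → ℝ) → ℝ}
    (h : ASmoothOfOrder k U N f) : ContinuousOn f U := h.isADiff.1.1

theorem ASmoothOfOrder.of_succ {k m N : ℕ} {U : Set (Fin m → ℝ)} {f : (Fin m → ℝ) → ℝ}
    (h : ASmoothOfOrder k U (N + 1) f) : ASmoothOfOrder k U N f := by
  induction N generalizing f with
  | zero => exact h.1
  | succ N ih => exact ⟨h.1, fun i => ih (h.2 i)⟩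

/-- Counting orders in place of listing indices permits inductions in which a derivative is replaced
by an expression in several functions. -/
theorem isASmooth_iff {k m : ℕ} {U : Set (Fin m → ℝ)} {f : (Fin m → ℝ) → ℝ} :
    IsASmooth k U f ↔ ∀ N, ASmoothOfOrder k U N f := by
  constructor
  · intro h N
    induction N generalizing f with
    | zero => exact h []
    | succ N ih =>
      refine ⟨h [], fun i => ih fun L => ?_⟩
      have := h (L ++ [i])
      rwa [List.foldr_append] at this
  · intro h L
    have : ∀ N, ASmoothOfOrder k U N (L.foldr (bPartial k) f) := by
      induction L with
      | nil => exact h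
      | cons i L ih => exact fun N => (ih (N + 1)).2 i
    exact this 0

theorem IsADiff.decay {k m : ℕ} {U : Set (Fin m → ℝ)} (hU : IsOpenInOrthant k U)
    {f : (Fin m → ℝ) → ℝ} (hf : IsADiff k U f) {u : Fin m → ℝ} (hu : u ∈ U) {i : Fin m}
    (hi : i.val < k) (h0 : u i = 0) : DecayAt U i (bPartial k i f) u :=
  ((isADiff_iff hU).1 hf).2 u hu i hi h0

theorem IsADiff.congr {k m : ℕ} {U : Set (Fin m → ℝ)} (hU : IsOpenInOrthant k U)
    {f g : (Fin m → ℝ) → ℝ} (hf : IsADiff k U f) (hg : EqOn g f U) :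
    IsADiff k U g ∧ ∀ i, EqOn (bPartial k i g) (bPartial k i f) U := by
  refine isADiff_of_formula hU (hf.1.1.congr hg) (fun i x hx hi => ?_) hf.1.2.2
    (fun u hu i hi h0 => hf.decay hU hu hi h0)
  obtain ⟨d, h1, h2⟩ := hf.hasDerivAt hx hi
  refine ⟨d, h1.congr_of_eventuallyEq ?_, h2⟩
  filter_upwards [hU.eventually_update' hx hi] with t ht using hg ht

theorem ASmoothOfOrder.congr {k m N : ℕ} {U : Set (Fin m → ℝ)} (hU : IsOpenInOrthant k U)
    {f g : (Fin m → ℝ) → ℝ} (hf : ASmoothOfOrder k U N f) (hg : EqOn g f U) :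
    ASmoothOfOrder k U N g := by
  induction N generalizing f g with
  | zero => exact (IsADiff.congr hU hf hg).1
  | succ N ih =>
    have := hf.1.congr hU hg
    exact ⟨this.1, fun i => ih (hf.2 i) (this.2 i)⟩

/-- The scheme of the inductions on the order: on `U` the b-derivatives equal expressions already
known to be a-smooth to one order less. -/
theorem ASmoothOfOrder.succ_of_formula {k m N : ℕ} {U : Set (Fin m → ℝ)} (hU : IsOpenInOrthant k U)
    {f : (Fin m → ℝ) → ℝ} {E : Fin m → (Fin m → ℝ) → ℝ}
    (h : IsADiff k U f ∧ ∀ i, EqOn (ACorners.bPartial k i f) (E i) U)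
    (hE : ∀ i, ASmoothOfOrder k U N (E i)) : ASmoothOfOrder k U (N + 1) f :=
  ⟨h.1, fun i => (hE i).congr hU (h.2 i)⟩

/-! ### Sums, products and powers of a-smooth functions -/

theorem IsADiff.add {k m : ℕ} {U : Set (Fin m → ℝ)} (hU : IsOpenInOrthant k U)
    {f g : (Fin m → ℝ) → ℝ} (hf : IsADiff k U f) (hg : IsADiff k U g) :
    IsADiff k U (fun x => f x + g x) ∧ ∀ i, EqOn (bPartial k i (fun x => f x + g x))
      (fun x => bPartial k i f x + bPartial k i g x) U := by
  refine isADiff_of_formula hU (hf.1.1.add hg.1.1) (fun i x hx hi => ?_)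
    (fun i => (hf.1.2.2 i).add (hg.1.2.2 i))
    (fun u hu i hi h0 => (hf.decay hU hu hi h0).add hU.subset hi h0 (hg.decay hU hu hi h0))
  obtain ⟨d, h1, h2⟩ := hf.hasDerivAt hx hi
  obtain ⟨e, h3, h4⟩ := hg.hasDerivAt hx hi
  exact ⟨d + e, h1.add h3, by rw [mul_add, h2, h4]⟩

theorem IsADiff.mul {k m : ℕ} {U : Set (Fin m → ℝ)} (hU : IsOpenInOrthant k U)
    {f g : (Fin m → ℝ) → ℝ} (hf : IsADiff k U f) (hg : IsADiff k U g) :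
    IsADiff k U (fun x => f x * g x) ∧ ∀ i, EqOn (bPartial k i (fun x => f x * g x))
      (fun x => bPartial k i f x * g x + bPartial k i g x * f x) U := by
  refine isADiff_of_formula hU (hf.1.1.mul hg.1.1) (fun i x hx hi => ?_)
    (fun i => ((hf.1.2.2 i).mul hg.1.1).add ((hg.1.2.2 i).mul hf.1.1))
    (fun u hu i hi h0 => ((hf.decay hU hu hi h0).mul_continuous hU.subset hi (hg.1.1 u hu)).add
      hU.subset hi h0 ((hg.decay hU hu hi h0).mul_continuous hU.subset hi (hf.1.1 u hu)))
  obtain ⟨d, h1, h2⟩ := hf.hasDerivAt hx hi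
  obtain ⟨e, h3, h4⟩ := hg.hasDerivAt hx hi
  refine ⟨_, h1.mul h3, ?_⟩
  simp only [slice, Function.update_eq_self]
  rw [← h2, ← h4]; ring

theorem ASmoothOfOrder.add {k m N : ℕ} {U : Set (Fin m → ℝ)} (hU : IsOpenInOrthant k U)
    {f g : (Fin m → ℝ) → ℝ} (hf : ASmoothOfOrder k U N f) (hg : ASmoothOfOrder k U N g) :
    ASmoothOfOrder k U N (fun x => f x + g x) := by
  induction N generalizing f g with
  | zero => exact (IsADiff.add hU hf hg).1
  | succ N ih => exact .succ_of_formula hU (hf.1.add hU hg.1) fun i => ih (hf.2 i) (hg.2 i)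

theorem ASmoothOfOrder.mul {k m N : ℕ} {U : Set (Fin m → ℝ)} (hU : IsOpenInOrthant k U)
    {f g : (Fin m → ℝ) → ℝ} (hf : ASmoothOfOrder k U N f) (hg : ASmoothOfOrder k U N g) :
    ASmoothOfOrder k U N (fun x => f x * g x) := by
  induction N generalizing f g with
  | zero => exact (IsADiff.mul hU hf hg).1
  | succ N ih =>
    exact .succ_of_formula hU (hf.1.mul hU hg.1) fun i =>
      .add hU (ih (hf.2 i) hg.of_succ) (ih (hg.2 i) hf.of_succ)

theorem ASmoothOfOrder.const {k m : ℕ} (N : ℕ) {U : Set (Fin m → ℝ)} (hU : IsOpenInOrthant k U)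
    (c : ℝ) : ASmoothOfOrder k U N (fun _ => c) := by
  have h : ∀ c : ℝ, IsADiff k U (fun _ => c) ∧ ∀ i, EqOn (bPartial k i fun _ => c) (fun _ => 0) U :=
    fun c => isADiff_of_formula hU continuousOn_const
      (fun i x _ _ => ⟨0, hasDerivAt_const (x i) c, by simp⟩) (fun i => continuousOn_const)
      (fun u _ i hi _ => .zero hU.subset hi)
  induction N generalizing c with
  | zero => exact (h c).1
  | succ N ih => exact .succ_of_formula hU (h c) fun i => ih 0

theorem ASmoothOfOrder.sum {k m N : ℕ} {U : Set (Fin m → ℝ)} (hU : IsOpenInOrthant k U) {ι : Type*}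
    (s : Finset ι) {f : ι → (Fin m → ℝ) → ℝ} (hf : ∀ j ∈ s, ASmoothOfOrder k U N (f j)) :
    ASmoothOfOrder k U N (fun x => ∑ j ∈ s, f j x) := by
  classical
  induction s using Finset.induction_on with
  | empty => simpa using ASmoothOfOrder.const N hU 0
  | insert a s ha ih =>
    simp only [Finset.sum_insert ha]
    exact (hf a (by simp)).add hU (ih fun j hj => hf j (by simp [hj]))

theorem IsADiff.rpow {k m : ℕ} {U : Set (Fin m → ℝ)} (hU : IsOpenInOrthant k U)
    {f : (Fin m → ℝ) → ℝ} (hf : IsADiff k U f) (h0 : ∀ x ∈ U, 0 < f x) (b : ℝ) :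
    IsADiff k U (fun x => f x ^ b) ∧ ∀ i, EqOn (bPartial k i (fun x => f x ^ b))
      (fun x => bPartial k i f x * (b * f x ^ (b - 1))) U := by
  have hc : ∀ b : ℝ, ContinuousOn (fun x => f x ^ b) U := fun b =>
    hf.1.1.rpow_const fun x hx => .inl (h0 x hx).ne'
  have hc' := (hc (b - 1)).const_smul b
  refine isADiff_of_formula hU (hc b) (fun i x hx hi => ?_) (fun i => (hf.1.2.2 i).mul hc')
    (fun u hu i hi h0 => (hf.decay hU hu hi h0).mul_continuous hU.subset hi (hc' u hu))
  obtain ⟨d, h1, h2⟩ := hf.hasDerivAt hx hi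
  refine ⟨_, h1.rpow_const (.inl (by rw [slice_self]; exact (h0 x hx).ne')), ?_⟩
  rw [slice_self, ← h2]; ring

theorem ASmoothOfOrder.rpow {k m N : ℕ} {U : Set (Fin m → ℝ)} (hU : IsOpenInOrthant k U)
    {f : (Fin m → ℝ) → ℝ} (hf : ASmoothOfOrder k U N f) (h0 : ∀ x ∈ U, 0 < f x) (b : ℝ) :
    ASmoothOfOrder k U N (fun x => f x ^ b) := by
  induction N generalizing b with
  | zero => exact (IsADiff.rpow hU hf h0 b).1
  | succ N ih =>
    exact .succ_of_formula hU (hf.1.rpow hU h0 b) fun i => (hf.2 i).mul hU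
      ((ASmoothOfOrder.const N hU b).mul hU (ih hf.of_succ _))

/-- Ordinary smooth functions are a-smooth. -/
theorem isASmooth_of_contDiffOn {k m : ℕ} {U : Set (Fin m → ℝ)} (hU : IsOpenInOrthant k U)
    {f : (Fin m → ℝ) → ℝ} (hf : ContDiffOn ℝ ∞ f U) : IsASmooth k U f := by
  refine isASmooth_iff.2 fun N => ?_
  have main : ∀ f : (Fin m → ℝ) → ℝ, ContDiffOn ℝ ∞ f U → IsADiff k U f ∧
      ∀ i, EqOn (bPartial k i f) (fun x => bScale k i x * cornerPartial k i f x) U := by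
    intro f hf
    have hc := fun i => contDiffOn_cornerPartial hU hf i
    refine isADiff_of_formula hU hf.continuousOn (fun i x hx hi => ⟨cornerPartial k i f x, ?_, rfl⟩)
      (fun i => (continuous_bScale k i).continuousOn.mul (hc i).continuousOn)
      (fun u hu i hi h0 => ?_)
    · have hd := hf.differentiableOn (by simp) x hx
      rw [cornerPartial_eq_fderivWithin hU hx hd]
      exact (hasDerivWithinAt_slice_of_differentiableWithinAt hU hx hd i).hasDerivAt
        (coordRange_mem_nhds hi)
    -- The factor `x i` decays with exponent `1`, and the partial derivative is continuous up to the
    -- boundary.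
    · refine DecayAt.mul_continuous hU.subset hi ⟨1, 1, one_pos, one_pos, ?_⟩
        ((hc i).continuousOn u hu)
      filter_upwards [self_mem_nhdsWithin] with x hx
      simp [bScale, hi, abs_of_nonneg (hU.subset hx i hi)]
  induction N generalizing f with
  | zero => exact (main f hf).1
  | succ N ih =>
    refine .succ_of_formula hU (main f hf) fun i => ih ?_
    refine ContDiffOn.mul ?_ (contDiffOn_cornerPartial hU hf i)
    unfold bScale; split_ifs
    exacts [(contDiff_apply ℝ ℝ i).contDiffOn, contDiffOn_const]

end ACorners

namespace ACorners

/-! ### Composition of smooth functions with smooth maps -/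

theorem IsSmoothFun.mono {κ : Kind} {k m : ℕ} {U V : Set (Fin m → ℝ)} {f : (Fin m → ℝ) → ℝ}
    (h : IsSmoothFun κ k U f) (hVU : V ⊆ U) : IsSmoothFun κ k V f := by
  cases κ
  · exact fun L => ⟨(h L).1.mono hVU, fun i => ⟨fun x hx => ((h L).2 i).1 x (hVU hx),
      ((h L).2 i).2.mono hVU⟩⟩
  · exact fun L => ⟨⟨(h L).1.1.mono hVU, fun i x hx => (h L).1.2.1 i x (hVU hx),
      fun i => ((h L).1.2.2 i).mono hVU⟩, fun S hS => (h L).2 S (hS.trans hVU)⟩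

/-- The monomial `∏ x_i^{a_i}`. -/
noncomputable def monomial {m : ℕ} (a x : Fin m → ℝ) : ℝ := ∏ i, x i ^ a i

theorem monomial_eq {m : ℕ} (a x : Fin m → ℝ) (i : Fin m) :
    monomial a x = x i ^ a i * ∏ j ∈ Finset.univ.erase i, x j ^ a j :=
  (Finset.mul_prod_erase _ _ (Finset.mem_univ i)).symm

theorem continuous_prod_rpow {m : ℕ} {a : Fin m → ℝ} (ha : ∀ i, 0 ≤ a i) (s : Finset (Fin m)) :
    Continuous fun x : Fin m → ℝ => ∏ i ∈ s, x i ^ a i :=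
  continuous_finsetProd _ fun i _ => (continuous_apply i).rpow_const fun _ => .inr (ha i)

/-- If `a i = 0` the slice is constant and `a i / x i` is `0` whatever the value of `x i`, so
coordinates of any sign are allowed. -/
theorem hasDerivAt_slice_monomial {m : ℕ} (a x : Fin m → ℝ) (i : Fin m) (h : a i = 0 ∨ 0 < x i) :
    HasDerivAt (slice (monomial a) x i) (a i / x i * monomial a x) (x i) := by
  have e : slice (monomial a) x i = fun t => t ^ a i * ∏ j ∈ Finset.univ.erase i, x j ^ a j := by
    funext t
    rw [slice, monomial_eq _ _ i, Function.update_self]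
    congr 1
    refine Finset.prod_congr rfl fun j hj => ?_
    rw [Function.update_of_ne (Finset.ne_of_mem_erase hj)]
  rw [e]
  rcases h with h | h
  · simpa [h] using hasDerivAt_const (x i) _
  · have := (Real.hasDerivAt_rpow_const (p := a i) (.inl h.ne')).mul_const
      (∏ j ∈ Finset.univ.erase i, x j ^ a j)
    refine this.congr_deriv ?_
    rw [monomial_eq _ _ i, Real.rpow_sub_one h.ne']
    ring

/-- `h` is a smooth function (if `l ≤ j`), or zero or a monomial times a positive smooth function (if
`j < l`), on `U`. -/
def IsComponent (κ : Kind) (k l : ℕ) {m : ℕ} (U : Set (Fin m → ℝ)) (j : ℕ) (h : (Fin m → ℝ) → ℝ) :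
    Prop :=
  (l ≤ j → IsSmoothFun κ k U h) ∧
  (j < l → (∀ x ∈ U, h x = 0) ∨ ∃ (F : (Fin m → ℝ) → ℝ) (a : Fin m → ℝ),
    IsSmoothFun κ k U F ∧ (∀ x ∈ U, 0 < F x) ∧ (∀ i, 0 ≤ a i) ∧
    (κ = Kind.ordinary → ∀ i, ∃ n : ℕ, a i = n) ∧ (∀ i : Fin m, k ≤ i.val → a i = 0) ∧
    ∀ x ∈ U, h x = F x * monomial a x)

theorem IsComponent.mono {κ : Kind} {k l m j : ℕ} {U V : Set (Fin m → ℝ)} {h : (Fin m → ℝ) → ℝ}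
    (hh : IsComponent κ k l U j h) (hVU : V ⊆ U) : IsComponent κ k l V j h := by
  refine ⟨fun hj => (hh.1 hj).mono hVU, fun hj => ?_⟩
  rcases hh.2 hj with h0 | ⟨F, a, h1, h2, h3, h4, h5, h6⟩
  · exact .inl fun x hx => h0 x (hVU hx)
  · exact .inr ⟨F, a, h1.mono hVU, fun x hx => h2 x (hVU hx), h3, h4, h5, fun x hx => h6 x (hVU hx)⟩

/-- The logarithmic b-derivatives `w_i` of a component. -/
theorem IsComponent.exists_weight {k l m j : ℕ} {U : Set (Fin m → ℝ)} (hU : IsOpenInOrthant k U)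
    {h : (Fin m → ℝ) → ℝ} (hh : IsComponent .analytic k l U j h) :
    ContinuousOn h U ∧ ∃ w : Fin m → (Fin m → ℝ) → ℝ,
      (∀ i N, ASmoothOfOrder k U N (w i)) ∧
      (∀ x ∈ U, ∀ i : Fin m, (i.val < k → 0 < x i) → ∃ d, HasDerivAt (slice h x i) d (x i) ∧
        bScale k i x * d = (if j < l then h x else 1) * w i x) ∧
      (∀ u ∈ U, ∀ i : Fin m, i.val < k → u i = 0 → DecayAt U i (w i) u ∨ j < l ∧ DecayAt U i h u) ∧
      (∀ x ∈ U, ∀ i : Fin m, (i.val < k → 0 < x i) → j < l → h x = 0 → ∀ t,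
        Function.update x i t ∈ U → h (Function.update x i t) = 0) := by
  rcases lt_or_ge j l with hj | hj
  · rcases hh.2 hj with h0 | ⟨F, a, hF, hF0, ha, -, hak, hm⟩
    · refine ⟨continuousOn_const.congr h0, fun _ _ => 0, fun i N => .const N hU 0, fun x hx i hi => ?_,
        fun u hu i hi _ => .inl (.zero hU.subset hi), fun x hx i hi _ _ t ht => h0 _ ht⟩
      refine ⟨0, ?_, by simp⟩
      refine (hasDerivAt_const (x i) (0 : ℝ)).congr_of_eventuallyEq ?_
      filter_upwards [hU.eventually_update' hx hi] with t ht using h0 _ ht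
    · have hFN := isASmooth_iff.1 hF
      have hcont : ContinuousOn (fun x => F x * monomial a x) U :=
        (hFN 0).continuousOn.mul (continuous_prod_rpow ha _).continuousOn
      have hai : ∀ x : Fin m → ℝ, ∀ i : Fin m, (i.val < k → 0 < x i) → a i = 0 ∨ 0 < x i := by
        intro x i hi
        rcases lt_or_ge i.val k with h | h
        exacts [.inr (hi h), .inl (hak i h)]
      -- The weight is the logarithmic derivative of `F x^a`. The quotient by `F` is written as a
      -- real power so that `ASmoothOfOrder.rpow` applies.
      refine ⟨hcont.congr hm, fun i x => a i + bPartial k i F x * F x ^ (-1 : ℝ), fun i N => ?_,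
        fun x hx i hi => ?_, fun u hu i hi h0 => ?_, fun x hx i hi _ h0 t ht => ?_⟩
      · exact (ASmoothOfOrder.const N hU _).add hU
          (((hFN (N + 1)).2 i).mul hU ((hFN N).rpow hU hF0 _))
      · obtain ⟨d, h1, h2⟩ := (hFN 0).hasDerivAt hx hi
        have h3 := h1.mul (hasDerivAt_slice_monomial a x i (hai x i hi))
        refine ⟨_, h3.congr_of_eventuallyEq ?_, ?_⟩
        · filter_upwards [hU.eventually_update' hx hi] with t ht using hm _ ht
        · simp only [slice, Function.update_eq_self, hj, if_true]
          rw [hm x hx, ← h2, Real.rpow_neg_one]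
          have hne := (hF0 x hx).ne'
          have : bScale k i x * (a i / x i) = a i := by
            rcases lt_or_ge i.val k with h | h
            · have := (hi h).ne'
              simp only [bScale, h, if_true]; field_simp
            · simp [hak i h]
          field_simp
          linear_combination (F x * monomial a x) * this
      -- If `a i = 0` the weight is the b-derivative of `F` divided by `F` and decays. If `a i > 0`
      -- the weight may tend to the nonzero limit `a i`, but `h` itself is of order `x_i^{a_i}`.
      · rcases (ha i).eq_or_lt with hz | hz
        · left
          refine (((hFN 0).decay hU hu hi h0).mul_continuous hU.subset hi
            (((hFN 0).rpow hU hF0 (-1)).continuousOn u hu)).congr fun x hx => ?_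
          simp [← hz]
        · right
          refine ⟨hj, DecayAt.congr (h := fun x => x i ^ a i *
            (F x * ∏ j ∈ Finset.univ.erase i, x j ^ a j)) (.mul_continuous hU.subset hi
              ⟨1, a i, one_pos, hz, ?_⟩ (((hFN 0).continuousOn.mul
                (continuous_prod_rpow ha _).continuousOn) u hu)) fun x hx => ?_⟩
          · filter_upwards [self_mem_nhdsWithin] with x hx
            rw [one_mul, abs_of_nonneg (Real.rpow_nonneg (hU.subset hx i hi) _)]
          · rw [hm x hx, monomial_eq _ _ i]; ring
      -- A zero of `h` at `x` is caused by a vanishing coordinate `i'` with positive exponent. It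
      -- differs from `i`, so it persists when the `i`-th coordinate moves.
      · rw [hm x hx] at h0
        have h1 := (mul_eq_zero.1 h0).resolve_left (hF0 x hx).ne'
        obtain ⟨i', -, hi'⟩ := Finset.prod_eq_zero_iff.1 h1
        have ha0 : a i' ≠ 0 := by rintro e; simp [e] at hi'
        have hx0 : x i' = 0 := by
          by_contra hne
          rcases lt_or_ge i'.val k with hk | hk
          · exact (Real.rpow_pos_of_pos ((hU.subset hx i' hk).lt_of_ne' hne) _).ne' hi'
          · exact ha0 (hak i' hk)
        have hne : i' ≠ i := by
          rintro rfl
          rcases hai x i' hi with h | h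
          exacts [ha0 h, h.ne' hx0]
        rw [hm _ ht, monomial, Finset.prod_eq_zero (Finset.mem_univ i'), mul_zero]
        rw [Function.update_of_ne hne, hx0, Real.zero_rpow ha0]
  · have hs := isASmooth_iff.1 (hh.1 hj)
    refine ⟨(hs 0).continuousOn, fun i => bPartial k i h, fun i N => (hs (N + 1)).2 i,
      fun x hx i hi => ?_, fun u hu i hi h0 => .inl ((hs 0).decay hU hu hi h0),
      fun x hx i hi hj' => absurd hj' hj.not_gt⟩
    obtain ⟨d, h1, h2⟩ := (hs 0).hasDerivAt hx hi
    exact ⟨d, h1, by simp [h2, hj.not_gt]⟩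

/-- `f` need not be differentiable in a boundary coordinate that vanishes at `γ t`. Such coordinates
are assumed to stay zero along the curve, which therefore runs in a product of sets `{0}`, `(0, ∞)`
and `ℝ`. There `f` has continuous partial derivatives, and the ordinary chain rule applies. -/
theorem IsADiff.hasDerivAt_comp {l n : ℕ} {W : Set (Fin n → ℝ)} (hW : IsOpenInOrthant l W)
    {f : (Fin n → ℝ) → ℝ} (hf : IsADiff l W f) {γ : ℝ → Fin n → ℝ} {d : Fin n → ℝ} {t : ℝ}
    (hγ : HasDerivAt γ d t) (ht : γ t ∈ W)
    (h0 : ∀ j : Fin n, j.val < l → γ t j = 0 → ∀ᶠ s in 𝓝 t, γ s j = 0) :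
    HasDerivAt (fun s => f (γ s))
      (∑ j, (if j.val < l ∧ γ t j = 0 then 0 else bPartial l j f (γ t) / bScale l j (γ t)) * d j) t := by
  set y := γ t with hy
  let R : Fin n → Set ℝ := fun j => if j.val < l then (if y j = 0 then {0} else Ioi 0) else univ
  have hyR : y ∈ pi univ R := by
    intro j _
    simp only [R]
    split_ifs with h1 h2
    exacts [h2, (hW.subset ht j h1).lt_of_ne' h2, trivial]
  have hRo : pi univ R ⊆ orthant l n := by
    intro z hz j hj
    have := hz j trivial
    simp only [R, hj, if_true] at this
    split_ifs at this with h2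
    exacts [(mem_singleton_iff.1 this).ge, le_of_lt this]
  have hpos : ∀ z ∈ pi univ R, ∀ j : Fin n, ¬ (j.val < l ∧ y j = 0) → j.val < l → 0 < z j := by
    intro z hz j hj hjl
    have := hz j trivial
    have h2 : ¬ y j = 0 := fun h => hj ⟨hjl, h⟩
    simp only [R, hjl, if_true, h2, if_false] at this
    exact this
  have key := hasFDerivWithinAt_of_partials (R := R) (U := W) (u := y) (f := f)
    (f' := fun j z => if j.val < l ∧ y j = 0 then 0 else bPartial l j f z / bScale l j z)
    (fun j => by
      simp only [R]; split_ifs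
      exacts [convex_singleton 0, convex_Ioi 0, convex_univ]) hyR
    (nhdsWithin_mono _ hRo (hW.mem_nhdsWithin ht))
    (fun z hz j => by
      by_cases hj : j.val < l ∧ y j = 0
      · have hRj : R j = {0} := by simp [R, hj.1, hj.2]
        have hz0 : z j = 0 := by simpa [hRj] using hz.2 j trivial
        simp only [hj, if_true, and_self]
        rw [hRj, hz0]
        -- Within a one-point set any number is a derivative; `0` is the choice that keeps the
        -- partial derivative continuous.
        exact HasFDerivWithinAt.singleton
      · simp only [hj, if_false]
        have hzj := hpos z hz.2 j hj
        obtain ⟨e, h1, h2⟩ := hf.hasDerivAt hz.1 hzj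
        rw [← h2, mul_div_cancel_left₀ _ (bScale_ne_zero hzj)]
        exact h1.hasDerivWithinAt)
    (fun j => by
      by_cases hj : j.val < l ∧ y j = 0
      · simp only [hj, if_true, and_self]; exact continuousWithinAt_const
      · simp only [hj, if_false]
        refine ContinuousWithinAt.div ?_ (continuous_bScale l j).continuousWithinAt
          (bScale_ne_zero (hpos y hyR j hj))
        have := hf.1.2.2 j y ht
        rw [ContinuousWithinAt, hW.nhdsWithin_eq ht] at this
        exact ContinuousWithinAt.mono this hRo)
  have hmem : ∀ᶠ s in 𝓝 t, γ s ∈ pi univ R := by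
    simp only [Set.mem_pi, mem_univ, true_imp_iff]
    refine eventually_all.2 fun j => ?_
    have hcj : ContinuousAt (fun s => γ s j) t := (continuous_apply j).continuousAt.comp hγ.continuousAt
    simp only [R]
    split_ifs with h1 h2
    · exact h0 j h1 h2
    · exact hcj.eventually (lt_mem_nhds ((hW.subset ht j h1).lt_of_ne' h2))
    · simp
  have h3 := key.comp_hasDerivWithinAt t (hγ.hasDerivWithinAt (s := {s | γ s ∈ pi univ R}))
    (fun s hs => hs)
  have h4 := h3.hasDerivAt hmem
  refine h4.congr_deriv ?_
  rw [sum_apply]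
  rfl

/-- The chain rule in terms of b-derivatives, the hypotheses on `w` being those provided by
`IsComponent.exists_weight`. In each summand either the weight decays in `x i`, or `g_j` does; then
the decay of the b-derivative of `f` in its `j`-th variable is carried back along `g`, the exponents
being multiplied. -/
theorem IsADiff.comp {k l m n : ℕ} {U : Set (Fin m → ℝ)} {W : Set (Fin n → ℝ)}
    (hU : IsOpenInOrthant k U) (hW : IsOpenInOrthant l W) {g : (Fin m → ℝ) → Fin n → ℝ}
    (hgc : ContinuousOn g U) (hgW : MapsTo g U W)
    {w : Fin n → Fin m → (Fin m → ℝ) → ℝ} (hwc : ∀ j i, ContinuousOn (w j i) U)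
    (h2 : ∀ j : Fin n, ∀ x ∈ U, ∀ i : Fin m, (i.val < k → 0 < x i) →
      ∃ d, HasDerivAt (slice (fun x => g x j) x i) d (x i) ∧
        bScale k i x * d = (if j.val < l then g x j else 1) * w j i x)
    (h3 : ∀ j : Fin n, ∀ u ∈ U, ∀ i : Fin m, i.val < k → u i = 0 →
      DecayAt U i (w j i) u ∨ j.val < l ∧ DecayAt U i (fun x => g x j) u)
    (h4 : ∀ j : Fin n, ∀ x ∈ U, ∀ i : Fin m, (i.val < k → 0 < x i) → j.val < l → g x j = 0 → ∀ t,
        Function.update x i t ∈ U → g (Function.update x i t) j = 0)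
    {f : (Fin n → ℝ) → ℝ} (hf : IsADiff l W f) :
    IsADiff k U (fun x => f (g x)) ∧ ∀ i, EqOn (bPartial k i (fun x => f (g x)))
      (fun x => ∑ j, bPartial l j f (g x) * w j i x) U := by
  have hbc : ∀ j, ContinuousOn (fun x => bPartial l j f (g x)) U := fun j =>
    (hf.1.2.2 j).comp hgc hgW
  refine isADiff_of_formula hU (hf.1.1.comp hgc hgW) (fun i x hx hi => ?_)
    (fun i => continuousOn_finsetSum _ fun j _ => (hbc j).mul (hwc j i)) (fun u hu i hi h0 => ?_)
  · choose d hd hdw using fun j => h2 j x hx i hi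
    have hγ : HasDerivAt (fun t => g (Function.update x i t)) d (x i) := hasDerivAt_pi.2 hd
    have e : g (Function.update x i (x i)) = g x := by simp
    have := hf.hasDerivAt_comp hW hγ (by rw [e]; exact hgW hx) (fun j hj h0 => by
      rw [e] at h0
      filter_upwards [hU.eventually_update' hx hi] with t ht using h4 j x hx i hi hj h0 t ht)
    refine ⟨_, this, ?_⟩
    rw [e, Finset.mul_sum]
    refine Finset.sum_congr rfl fun j _ => ?_
    -- Where a boundary component `g x j` is zero, the term drops out of both sides: the coefficient
    -- is `0` on the left and the b-derivative of `f` is `0` on the right.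
    by_cases hj : j.val < l ∧ g x j = 0
    · simp [hj, bPartial_of_eq_zero f hj]
    · have hb : bScale l j (g x) ≠ 0 := by
        refine bScale_ne_zero fun hjl => (hW.subset (hgW hx) j hjl).lt_of_ne' fun h => hj ⟨hjl, h⟩
      have h5 := hdw j
      rw [show (if j.val < l then g x j else 1) = bScale l j (g x) from rfl] at h5
      simp only [hj, if_false]
      rw [mul_left_comm, h5]
      field_simp
  · refine DecayAt.sum hU.subset hi h0 _ fun j _ => ?_
    rcases h3 j u hu i hi h0 with h | ⟨hj, hd⟩
    · simpa only [mul_comm] using h.mul_continuous hU.subset hi (hbc j u hu)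
    · refine DecayAt.mul_continuous hU.subset hi ?_ (hwc j i u hu)
      have hg0 : g u j = 0 := hd.eq_zero hu h0
      obtain ⟨C, α, hC, hα, hb⟩ := hf.decay hW (hgW hu) hj hg0
      obtain ⟨D, β, hD, hβ, hx⟩ := hd
      refine ⟨C * D ^ α, β * α, by positivity, by positivity, ?_⟩
      have ht : Tendsto g (𝓝[U] u) (𝓝[W] (g u)) :=
        tendsto_nhdsWithin_iff.2 ⟨hgc u hu, eventually_mem_nhdsWithin.mono fun x hx => hgW hx⟩
      filter_upwards [hx, ht.eventually hb, self_mem_nhdsWithin] with x hx hb hxU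
      have hg := hW.subset (hgW hxU) j hj
      have hx0 := hU.subset hxU i hi
      calc |bPartial l j f (g x)| ≤ C * g x j ^ α := hb
        _ ≤ C * (D * x i ^ β) ^ α := by gcongr; exact (le_abs_self _).trans hx
        _ = C * D ^ α * x i ^ (β * α) := by
          rw [Real.mul_rpow hD.le (Real.rpow_nonneg hx0 _), Real.rpow_mul hx0, mul_assoc]

/-- The weights depend on `g` alone and are a-smooth to all orders, so the chain rule can be
iterated with `f` replaced by its b-derivatives. -/
theorem IsASmooth.comp {k l m n : ℕ} {U : Set (Fin m → ℝ)} {W : Set (Fin n → ℝ)}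
    (hU : IsOpenInOrthant k U) (hW : IsOpenInOrthant l W) {g : (Fin m → ℝ) → Fin n → ℝ}
    (hgW : MapsTo g U W) (hg : ∀ j : Fin n, IsComponent .analytic k l U j (fun x => g x j))
    {f : (Fin n → ℝ) → ℝ} (hf : IsASmooth l W f) : IsASmooth k U (fun x => f (g x)) := by
  choose hc w h1 h2 h3 h4 using fun j => (hg j).exists_weight hU
  have main : ∀ f : (Fin n → ℝ) → ℝ, IsADiff l W f → _ := fun f hf =>
    IsADiff.comp hU hW (continuousOn_pi.2 hc) hgW (fun j i => (h1 j i 0).continuousOn) h2 h3 h4 hf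
  refine isASmooth_iff.2 fun N => ?_
  have hf' := isASmooth_iff.1 hf N
  -- Only smoothness of order `N` is kept, so that the induction can pass from `f` to its
  -- b-derivatives.
  clear hf
  induction N generalizing f with
  | zero => exact (main f hf').1
  | succ N ih =>
    exact .succ_of_formula hU (main f hf'.1) fun i =>
      .sum hU _ fun j _ => (ih (hf'.2 j)).mul hU (h1 j i N)

theorem IsComponent.contDiffOn {k l m j : ℕ} {U : Set (Fin m → ℝ)} (hU : IsOpenInOrthant k U)
    {h : (Fin m → ℝ) → ℝ} (hh : IsComponent .ordinary k l U j h) : ContDiffOn ℝ ∞ h U := by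
  rcases lt_or_ge j l with hj | hj
  · rcases hh.2 hj with h0 | ⟨F, a, hF, -, -, hn, -, hm⟩
    · exact contDiffOn_const.congr h0
    · choose n hn using hn rfl
      refine (((isWeaklySmooth_iff hU).1 hF).mul (g := monomial a) ?_).congr hm
      unfold monomial
      simp only [hn, Real.rpow_natCast]
      exact contDiffOn_prod fun i _ => ((contDiff_apply ℝ ℝ i).pow _).contDiffOn
  · exact (isWeaklySmooth_iff hU).1 (hh.1 hj)

theorem IsSmoothFun.comp {κ : Kind} {k l m n : ℕ} {U : Set (Fin m → ℝ)} {W : Set (Fin n → ℝ)}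
    (hU : IsOpenInOrthant k U) (hW : IsOpenInOrthant l W) {g : (Fin m → ℝ) → Fin n → ℝ}
    (hgW : MapsTo g U W) (hg : ∀ j : Fin n, IsComponent κ k l U j (fun x => g x j))
    {f : (Fin n → ℝ) → ℝ} (hf : IsSmoothFun κ l W f) : IsSmoothFun κ k U (fun x => f (g x)) := by
  cases κ
  · exact (isWeaklySmooth_iff hU).2 (((isWeaklySmooth_iff hW).1 hf).comp
      (contDiffOn_pi.2 fun j => (hg j).contDiffOn hU) hgW)
  · exact IsASmooth.comp hU hW hgW hg hf

/-- Ordinary smooth functions are smooth of either kind. -/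
theorem isSmoothFun_of_contDiffOn (κ : Kind) {k m : ℕ} {U : Set (Fin m → ℝ)}
    (hU : IsOpenInOrthant k U) {f : (Fin m → ℝ) → ℝ} (hf : ContDiffOn ℝ ∞ f U) :
    IsSmoothFun κ k U f := by
  cases κ
  exacts [(isWeaklySmooth_iff hU).2 hf, isASmooth_of_contDiffOn hU hf]

theorem IsSmoothFun.mul {κ : Kind} {k m : ℕ} {U : Set (Fin m → ℝ)} (hU : IsOpenInOrthant k U)
    {f g : (Fin m → ℝ) → ℝ} (hf : IsSmoothFun κ k U f) (hg : IsSmoothFun κ k U g) :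
    IsSmoothFun κ k U (fun x => f x * g x) := by
  cases κ
  · exact (isWeaklySmooth_iff hU).2
      (((isWeaklySmooth_iff hU).1 hf).mul ((isWeaklySmooth_iff hU).1 hg))
  · exact isASmooth_iff.2 fun N => (isASmooth_iff.1 hf N).mul hU (isASmooth_iff.1 hg N)

theorem IsSmoothFun.rpow {κ : Kind} {k m : ℕ} {U : Set (Fin m → ℝ)} (hU : IsOpenInOrthant k U)
    {f : (Fin m → ℝ) → ℝ} (hf : IsSmoothFun κ k U f) (h0 : ∀ x ∈ U, 0 < f x) (b : ℝ) :
    IsSmoothFun κ k U (fun x => f x ^ b) := by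
  cases κ
  · exact (isWeaklySmooth_iff hU).2
      (((isWeaklySmooth_iff hU).1 hf).rpow_const_of_ne fun x hx => (h0 x hx).ne')
  · exact isASmooth_iff.2 fun N => (isASmooth_iff.1 hf N).rpow hU h0 b

theorem IsSmoothFun.congr {κ : Kind} {k m : ℕ} {U : Set (Fin m → ℝ)} (hU : IsOpenInOrthant k U)
    {f g : (Fin m → ℝ) → ℝ} (hf : IsSmoothFun κ k U f) (h : EqOn g f U) : IsSmoothFun κ k U g := by
  cases κ
  · exact (isWeaklySmooth_iff hU).2 (((isWeaklySmooth_iff hU).1 hf).congr h)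
  · exact isASmooth_iff.2 fun N => (isASmooth_iff.1 hf N).congr hU h

theorem IsSmoothFun.continuousOn {κ : Kind} {k m : ℕ} {U : Set (Fin m → ℝ)}
    {f : (Fin m → ℝ) → ℝ} (hf : IsSmoothFun κ k U f) : ContinuousOn f U := by
  cases κ
  exacts [(hf []).1, (hf []).1.1]

end ACorners

namespace ACorners

/-! ### Germs of smooth functions -/

/-- `f` is smooth near `u` in the orthant. -/
def SmAt (κ : Kind) (k : ℕ) {m : ℕ} (f : (Fin m → ℝ) → ℝ) (u : Fin m → ℝ) : Prop :=
  ∃ W, IsOpenInOrthant k W ∧ u ∈ W ∧ IsSmoothFun κ k W f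

section SmAt

variable {κ : Kind} {k m : ℕ} {f g : (Fin m → ℝ) → ℝ} {u : Fin m → ℝ}

theorem SmAt.mem_orthant (hf : SmAt κ k f u) : u ∈ orthant k m := by
  obtain ⟨W, hW, hu, -⟩ := hf
  exact hW.subset hu

theorem SmAt.congr (hf : SmAt κ k f u) (h : g =ᶠ[𝓝[orthant k m] u] f) : SmAt κ k g u := by
  have hu := hf.mem_orthant
  obtain ⟨W, hW, huW, hs⟩ := hf
  obtain ⟨V, hV, huV, h'⟩ := exists_isOpenInOrthant_subset hu (inter_mem h (hW.mem_nhdsWithin huW))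
  exact ⟨V, hV, huV, (hs.mono fun x hx => (h' hx).2).congr hV fun x hx => (h' hx).1⟩

theorem SmAt.continuousWithinAt (hf : SmAt κ k f u) : ContinuousWithinAt f (orthant k m) u := by
  obtain ⟨W, hW, huW, hs⟩ := hf
  rw [ContinuousWithinAt, ← hW.nhdsWithin_eq huW]
  exact hs.continuousOn u huW

theorem SmAt.mul (hf : SmAt κ k f u) (hg : SmAt κ k g u) : SmAt κ k (fun x => f x * g x) u := by
  obtain ⟨W, hW, huW, hs⟩ := hf
  obtain ⟨V, hV, huV, ht⟩ := hg
  exact ⟨W ∩ V, hW.inter hV, ⟨huW, huV⟩,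
    (hs.mono inter_subset_left).mul (hW.inter hV) (ht.mono inter_subset_right)⟩

theorem SmAt.eventually_pos (hf : SmAt κ k f u) (h0 : 0 < f u) :
    ∀ᶠ x in 𝓝[orthant k m] u, 0 < f x :=
  hf.continuousWithinAt.eventually (lt_mem_nhds h0)

theorem SmAt.rpow (hf : SmAt κ k f u) (h0 : 0 < f u) (b : ℝ) : SmAt κ k (fun x => f x ^ b) u := by
  have hu := hf.mem_orthant
  have hp := hf.eventually_pos h0
  obtain ⟨W, hW, huW, hs⟩ := hf
  obtain ⟨V, hV, huV, h'⟩ := exists_isOpenInOrthant_subset hu (inter_mem hp (hW.mem_nhdsWithin huW))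
  exact ⟨V, hV, huV, (hs.mono fun x hx => (h' hx).2).rpow hV (fun x hx => (h' hx).1) b⟩

theorem SmAt.of_contDiff (hu : u ∈ orthant k m) (hf : ContDiff ℝ ∞ f) : SmAt κ k f u :=
  ⟨_, isOpenInOrthant_orthant k m, hu,
    isSmoothFun_of_contDiffOn κ (isOpenInOrthant_orthant k m) hf.contDiffOn⟩

theorem SmAt.prod {ι : Type*} (s : Finset ι) {F : ι → (Fin m → ℝ) → ℝ} (hu : u ∈ orthant k m)
    (hF : ∀ j ∈ s, SmAt κ k (F j) u) : SmAt κ k (fun x => ∏ j ∈ s, F j x) u := by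
  classical
  induction s using Finset.induction_on with
  | empty => simpa using SmAt.of_contDiff hu contDiff_const
  | insert a s ha ih =>
    simp only [Finset.prod_insert ha]
    exact (hF a (by simp)).mul (ih fun j hj => hF j (by simp [hj]))

/-- Smoothness is a condition on germs. In the a-smooth case this depends on `isADiff_iff`, which
replaced the bounds on compact sets by bounds near points. -/
theorem isSmoothFun_iff {U : Set (Fin m → ℝ)} (hU : IsOpenInOrthant k U) :
    IsSmoothFun κ k U f ↔ ∀ u ∈ U, SmAt κ k f u := by
  refine ⟨fun h u hu => ⟨U, hU, hu, h⟩, fun h => ?_⟩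
  cases κ
  · refine (isWeaklySmooth_iff hU).2 fun u hu => ?_
    obtain ⟨W, hW, huW, hs⟩ := h u hu
    refine (((isWeaklySmooth_iff hW).1 hs) u huW).mono_of_mem_nhdsWithin ?_
    rw [hU.nhdsWithin_eq hu]
    exact hW.mem_nhdsWithin huW
  · intro L
    refine (isADiff_iff hU).2 ⟨⟨fun u hu => ?_, fun i u hu h0 => ?_, fun i u hu => ?_⟩,
      fun u hu i hi h0 => ?_⟩ <;> obtain ⟨W, hW, huW, hs⟩ := h u hu <;> have hL := hs L
    · rw [ContinuousWithinAt, hU.nhdsWithin_eq hu, ← hW.nhdsWithin_eq huW]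
      exact hL.1.1 u huW
    · exact hL.1.2.1 i u huW h0
    · rw [ContinuousWithinAt, hU.nhdsWithin_eq hu, ← hW.nhdsWithin_eq huW]
      exact hL.1.2.2 i u huW
    · have := hL.decay hW huW hi h0
      rw [DecayAt, hW.nhdsWithin_eq huW] at this
      rwa [DecayAt, hU.nhdsWithin_eq hu]

end SmAt

/-- Near `u` in the orthant, `h` is a positive smooth function times a monomial. -/
def MonoAt (κ : Kind) (k : ℕ) {m : ℕ} (h : (Fin m → ℝ) → ℝ) (u : Fin m → ℝ) : Prop :=
  ∃ (F : (Fin m → ℝ) → ℝ) (a : Fin m → ℝ), SmAt κ k F u ∧ 0 < F u ∧ (∀ i, 0 ≤ a i) ∧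
    (κ = Kind.ordinary → ∀ i, ∃ n : ℕ, a i = n) ∧ (∀ i : Fin m, ¬ (i.val < k ∧ u i = 0) → a i = 0) ∧
    h =ᶠ[𝓝[orthant k m] u] fun x => F x * monomial a x

theorem monoAt_iff {κ : Kind} {k m : ℕ} {U : Set (Fin m → ℝ)} (hU : IsOpenInOrthant k U)
    {h : (Fin m → ℝ) → ℝ} {u : Fin m → ℝ} (hu : u ∈ U) :
    IsMonomialNear κ k U h u ↔ MonoAt κ k h u := by
  constructor
  · rintro ⟨O, hO, huO, F, a, h1, h2, h3, h4, h5, h6⟩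
    have hUO := hU.inter_isOpen hO
    exact ⟨F, a, ⟨_, hUO, ⟨hu, huO⟩, h1⟩, h2 u ⟨hu, huO⟩, h3, h4, h5,
      mem_of_superset (hUO.mem_nhdsWithin ⟨hu, huO⟩) h6⟩
  · rintro ⟨F, a, h1, h2, h3, h4, h5, h6⟩
    have hp := h1.eventually_pos h2
    obtain ⟨W, hW, huW, hs⟩ := h1
    obtain ⟨V, ⟨O, hO, rfl⟩, huV, h'⟩ := exists_isOpenInOrthant_subset (hU.subset hu)
      (inter_mem (inter_mem hp (hW.mem_nhdsWithin huW)) h6)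
    have hUO : U ∩ O ⊆ O ∩ orthant k m := fun x hx => ⟨hx.2, hU.subset hx.1⟩
    exact ⟨O, hO, huV.1, F, a, hs.mono fun x hx => (h' (hUO hx)).1.2,
      fun x hx => (h' (hUO hx)).1.1, h3, h4, h5, fun x hx => (h' (hUO hx)).2⟩

theorem vanishesNear_iff {k m : ℕ} {U : Set (Fin m → ℝ)} (hU : IsOpenInOrthant k U)
    {h : (Fin m → ℝ) → ℝ} {u : Fin m → ℝ} (hu : u ∈ U) :
    VanishesNear U h u ↔ ∀ᶠ x in 𝓝[orthant k m] u, h x = 0 := by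
  rw [← hU.nhdsWithin_eq hu, eventually_iff, mem_nhdsWithin]
  refine exists_congr fun O => and_congr_right fun _ => and_congr_right fun _ => ?_
  rw [inter_comm]; rfl

/-- Near `u`, `g` is a smooth map between orthants, and an interior one if `b` holds. -/
def MapAt (κ : Kind) (b : Prop) (k l : ℕ) {m n : ℕ} (g : (Fin m → ℝ) → (Fin n → ℝ))
    (u : Fin m → ℝ) : Prop :=
  ∀ j : Fin n, (l ≤ j.val → SmAt κ k (fun x => g x j) u) ∧
    (j.val < l → MonoAt κ k (fun x => g x j) u ∨ (¬ b ∧ ∀ᶠ x in 𝓝[orthant k m] u, g x j = 0))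

/-- The set of those of the first `k` coordinates that vanish at `x`. -/
noncomputable def zeroSet (k : ℕ) {m : ℕ} (x : Fin m → ℝ) : Finset (Fin m) := by
  classical exact Finset.univ.filter fun i => i.val < k ∧ x i = 0

theorem mem_zeroSet {k m : ℕ} {x : Fin m → ℝ} {i : Fin m} :
    i ∈ zeroSet k x ↔ i.val < k ∧ x i = 0 := by
  simp [zeroSet]

/-! ### Germs of smooth maps and their composition -/

section MapAt

variable {κ : Kind} {b : Prop} {k l m n : ℕ} {g : (Fin m → ℝ) → (Fin n → ℝ)} {u : Fin m → ℝ}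

theorem MonoAt.congr {h h' : (Fin m → ℝ) → ℝ} (hh : MonoAt κ k h u)
    (he : h' =ᶠ[𝓝[orthant k m] u] h) : MonoAt κ k h' u := by
  obtain ⟨F, a, h1, h2, h3, h4, h5, h6⟩ := hh
  exact ⟨F, a, h1, h2, h3, h4, h5, he.trans h6⟩

theorem MapAt.congr {g' : (Fin m → ℝ) → (Fin n → ℝ)} (h : MapAt κ b k l g u)
    (he : g' =ᶠ[𝓝[orthant k m] u] g) : MapAt κ b k l g' u := by
  have he' : ∀ j, (fun x => g' x j) =ᶠ[𝓝[orthant k m] u] fun x => g x j :=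
    fun j => he.mono fun x hx => congrFun hx j
  refine fun j => ⟨fun hj => ((h j).1 hj).congr (he' j), fun hj => ?_⟩
  rcases (h j).2 hj with h1 | ⟨h0, h1⟩
  · exact .inl (h1.congr (he' j))
  · refine .inr ⟨h0, ?_⟩
    filter_upwards [h1, he] with x hx hx'
    rw [hx', hx]

theorem MapAt.of_interior (h : MapAt κ True k l g u) : MapAt κ b k l g u := fun j =>
  ⟨(h j).1, fun hj => .inl (((h j).2 hj).resolve_right (by simp))⟩

theorem MapAt.to_smooth (h : MapAt κ b k l g u) : MapAt κ False k l g u := fun j =>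
  ⟨(h j).1, fun hj => ((h j).2 hj).imp_right fun h' => ⟨id, h'.2⟩⟩

theorem MonoAt.continuousWithinAt {h : (Fin m → ℝ) → ℝ} (hu : u ∈ orthant k m)
    (hh : MonoAt κ k h u) : ContinuousWithinAt h (orthant k m) u := by
  obtain ⟨F, a, h1, -, h3, -, -, h6⟩ := hh
  exact (h1.continuousWithinAt.mul (continuous_prod_rpow h3 _).continuousWithinAt).congr_of_eventuallyEq
    h6 (h6.self_of_nhdsWithin hu)

theorem MapAt.continuousWithinAt (hu : u ∈ orthant k m) (h : MapAt κ b k l g u) :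
    ContinuousWithinAt g (orthant k m) u := by
  refine continuousWithinAt_pi.2 fun j => ?_
  rcases lt_or_ge j.val l with hj | hj
  · rcases (h j).2 hj with h1 | ⟨-, h1⟩
    · exact h1.continuousWithinAt hu
    · exact continuousWithinAt_const.congr_of_eventuallyEq h1 (h1.self_of_nhdsWithin hu)
  · exact ((h j).1 hj).continuousWithinAt

theorem isSmoothMap_iff {U : Set (Fin m → ℝ)} (hU : IsOpenInOrthant k U) :
    IsSmoothMap κ k l U g ↔ ∀ u ∈ U, MapAt κ False k l g u := by
  constructor
  · rintro ⟨-, h2, h3⟩ u hu j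
    refine ⟨fun hj => (isSmoothFun_iff hU).1 (h2 j hj) u hu, fun hj => ?_⟩
    rcases h3 u hu j hj with h | h
    exacts [.inl ((monoAt_iff hU hu).1 h), .inr ⟨id, (vanishesNear_iff hU hu).1 h⟩]
  · intro h
    refine ⟨fun u hu => ?_, fun j hj => (isSmoothFun_iff hU).2 fun u hu => (h u hu j).1 hj,
      fun u hu j hj => ?_⟩
    · exact ((h u hu).continuousWithinAt (hU.subset hu)).mono hU.subset
    · rcases (h u hu j).2 hj with h1 | ⟨-, h1⟩
      exacts [.inl ((monoAt_iff hU hu).2 h1), .inr ((vanishesNear_iff hU hu).2 h1)]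

theorem isInteriorMap_iff {U : Set (Fin m → ℝ)} (hU : IsOpenInOrthant k U) :
    IsInteriorMap κ k l U g ↔ ∀ u ∈ U, MapAt κ True k l g u := by
  rw [IsInteriorMap, isSmoothMap_iff hU]
  constructor
  · rintro ⟨h1, h2⟩ u hu j
    exact ⟨(h1 u hu j).1, fun hj => .inl ((monoAt_iff hU hu).1 (h2 u hu j hj))⟩
  · exact fun h => ⟨fun u hu => (h u hu).of_interior, fun u hu j hj =>
      (monoAt_iff hU hu).2 (((h u hu j).2 hj).resolve_right (by simp))⟩

theorem MapAt.exists_isComponent (h : MapAt κ b k l g u) (j : Fin n) :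
    ∃ S ∈ 𝓝[orthant k m] u, IsComponent κ k l S j (fun x => g x j) := by
  rcases lt_or_ge j.val l with hj | hj
  · rcases (h j).2 hj with ⟨F, a, h1, h2, h3, h4, h5, h6⟩ | ⟨-, h1⟩
    · have hp := h1.eventually_pos h2
      obtain ⟨W, hW, huW, hs⟩ := h1
      refine ⟨_, inter_mem (inter_mem hp h6) (hW.mem_nhdsWithin huW), fun hj' => absurd hj hj'.not_gt,
        fun _ => .inr ⟨F, a, hs.mono fun x hx => hx.2, fun x hx => hx.1.1, h3, h4,
          fun i hi => h5 i fun hi' => hi.not_gt hi'.1, fun x hx => hx.1.2⟩⟩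
    · exact ⟨_, h1, fun hj' => absurd hj hj'.not_gt, fun _ => .inl fun x hx => hx⟩
  · obtain ⟨W, hW, huW, hs⟩ := (h j).1 hj
    exact ⟨W, hW.mem_nhdsWithin huW, fun _ => hs, fun hj' => absurd hj' hj.not_gt⟩

theorem SmAt.comp {f : (Fin n → ℝ) → ℝ} (hf : SmAt κ l f (g u)) (hu : u ∈ orthant k m)
    (hg : MapAt κ b k l g u) (hm : ∀ᶠ x in 𝓝[orthant k m] u, g x ∈ orthant l n) :
    SmAt κ k (fun x => f (g x)) u := by
  obtain ⟨W, hW, huW, hs⟩ := hf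
  choose S hS hc using hg.exists_isComponent
  have ht : Tendsto g (𝓝[orthant k m] u) (𝓝[orthant l n] (g u)) :=
    tendsto_nhdsWithin_iff.2 ⟨hg.continuousWithinAt hu, hm⟩
  obtain ⟨V, hV, huV, h'⟩ := exists_isOpenInOrthant_subset hu
    (inter_mem (ht (hW.mem_nhdsWithin huW)) (iInter_mem.2 hS))
  exact ⟨V, hV, huV, hs.comp hV hW (fun x hx => (h' hx).1)
    fun j => (hc j).mono fun x hx => mem_iInter.1 (h' hx).2 j⟩

/-- Substituting `g_j = F_j x^{a_j}` in `H y^c` gives the positive factor `H(g) ∏ F_j^{c_j}` times a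
monomial with exponents `∑_j a_{ji} c_j`. The composite vanishes instead if some `g_j` with `c_j ≠
0` vanishes near `u`. -/
theorem MonoAt.comp {h : (Fin n → ℝ) → ℝ} (hh : MonoAt κ l h (g u)) (hu : u ∈ orthant k m)
    (hg : MapAt κ b k l g u) (hm : ∀ᶠ x in 𝓝[orthant k m] u, g x ∈ orthant l n) :
    MonoAt κ k (fun x => h (g x)) u ∨ (¬ b ∧ ∀ᶠ x in 𝓝[orthant k m] u, h (g x) = 0) := by
  obtain ⟨H, c, h1, h2, h3, h4, h5, h6⟩ := hh
  have ht : Tendsto g (𝓝[orthant k m] u) (𝓝[orthant l n] (g u)) :=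
    tendsto_nhdsWithin_iff.2 ⟨hg.continuousWithinAt hu, hm⟩
  have h6' := ht.eventually h6
  have hjl : ∀ j : Fin n, c j ≠ 0 → j.val < l := fun j hj => by
    by_contra h'
    exact hj (h5 j fun h => h' h.1)
  by_cases hv : ∃ j, c j ≠ 0 ∧ ¬ b ∧ ∀ᶠ x in 𝓝[orthant k m] u, g x j = 0
  · obtain ⟨j, hj, hb, hv⟩ := hv
    refine .inr ⟨hb, ?_⟩
    filter_upwards [h6', hv] with x hx hx'
    rw [hx, monomial_eq _ _ j, hx', Real.zero_rpow hj]
    ring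
  · left
    have : ∀ j, ∃ (F : (Fin m → ℝ) → ℝ) (a : Fin m → ℝ), SmAt κ k F u ∧ 0 < F u ∧ (∀ i, 0 ≤ a i) ∧
        (κ = Kind.ordinary → ∀ i, ∃ n : ℕ, a i = n) ∧
        (∀ i : Fin m, ¬ (i.val < k ∧ u i = 0) → a i = 0) ∧
        (c j ≠ 0 → (fun x => g x j) =ᶠ[𝓝[orthant k m] u] fun x => F x * monomial a x) := by
      intro j
      by_cases hj : c j = 0
      -- Components with `c j = 0` do not enter, and need not be monomial at all; they receive dummy
      -- data.
      · exact ⟨fun _ => 1, fun _ => 0, .of_contDiff hu contDiff_const, one_pos, fun _ => le_rfl,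
          fun _ _ => ⟨0, by simp⟩, fun _ _ => rfl, fun h => absurd hj h⟩
      · rcases (hg j).2 (hjl j hj) with ⟨F, a, e1, e2, e3, e4, e5, e6⟩ | h'
        · exact ⟨F, a, e1, e2, e3, e4, e5, fun _ => e6⟩
        · exact absurd ⟨j, hj, h'⟩ hv
    choose F a e1 e2 e3 e4 e5 e6 using this
    refine ⟨fun x => H (g x) * ∏ j, F j x ^ c j, fun i => ∑ j, a j i * c j,
      (h1.comp hu hg hm).mul (.prod _ hu fun j _ => (e1 j).rpow (e2 j) _),
      mul_pos h2 (Finset.prod_pos fun j _ => Real.rpow_pos_of_pos (e2 j) _),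
      fun i => Finset.sum_nonneg fun j _ => mul_nonneg (e3 j i) (h3 j), fun hκ i => ?_,
      fun i hi => Finset.sum_eq_zero fun j _ => by rw [e5 j i hi, zero_mul], ?_⟩
    · choose p hp using fun j => e4 j hκ i
      choose q hq using h4 hκ
      exact ⟨∑ j, p j * q j, by push_cast; simp only [hp, hq]⟩
    · have h7 : ∀ᶠ x in 𝓝[orthant k m] u, ∀ j, 0 < F j x ∧
          (c j ≠ 0 → g x j = F j x * monomial (a j) x) := by
        refine eventually_all.2 fun j => ((e1 j).eventually_pos (e2 j)).and ?_
        by_cases hj : c j = 0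
        · exact .of_forall fun x h => absurd hj h
        · exact (e6 j hj).mono fun x hx _ => hx
      filter_upwards [h6', h7, self_mem_nhdsWithin] with x hx h7 hxo
      -- The power laws for real exponents need nonnegative bases. A coordinate with `i ≥ k` may be
      -- negative, but all its exponents are `0`.
      have hxi : ∀ i, (∀ j, a j i = 0) ∨ 0 ≤ x i := fun i => by
        by_cases hi : i.val < k
        exacts [.inr (hxo i hi), .inl fun j => e5 j i fun h => hi h.1]
      have hp0 : ∀ j i, 0 ≤ x i ^ a j i := fun j i => by
        rcases hxi i with h | h
        exacts [by simp [h j], Real.rpow_nonneg h _]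
      rw [hx, mul_assoc]
      congr 1
      have : ∀ j, g x j ^ c j = F j x ^ c j * ∏ i, x i ^ (a j i * c j) := by
        intro j
        by_cases hj : c j = 0
        · simp [hj]
        · rw [(h7 j).2 hj, monomial, Real.mul_rpow (h7 j).1.le (Finset.prod_nonneg fun i _ => hp0 j i),
            ← Real.finsetProd_rpow _ _ fun i _ => hp0 j i]
          congr 1
          refine Finset.prod_congr rfl fun i _ => ?_
          rcases hxi i with h | h
          exacts [by simp [h j], (Real.rpow_mul h _ _).symm]
      rw [monomial, Finset.prod_congr rfl fun j _ => this j, Finset.prod_mul_distrib, Finset.prod_comm]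
      congr 1
      refine Finset.prod_congr rfl fun i _ => ?_
      rcases hxi i with h | h
      · simp [h]
      · exact (Real.rpow_sum_of_nonneg h fun j _ => mul_nonneg (e3 j i) (h3 j)).symm

theorem MapAt.comp {l' n' : ℕ} {h : (Fin n → ℝ) → (Fin n' → ℝ)} (hh : MapAt κ b l l' h (g u))
    (hu : u ∈ orthant k m) (hg : MapAt κ b k l g u)
    (hm : ∀ᶠ x in 𝓝[orthant k m] u, g x ∈ orthant l n) : MapAt κ b k l' (fun x => h (g x)) u := by
  intro j
  refine ⟨fun hj => ((hh j).1 hj).comp hu hg hm, fun hj => ?_⟩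
  rcases (hh j).2 hj with h1 | ⟨h0, h1⟩
  · exact h1.comp hu hg hm
  · have ht : Tendsto g (𝓝[orthant k m] u) (𝓝[orthant l n] (g u)) :=
      tendsto_nhdsWithin_iff.2 ⟨hg.continuousWithinAt hu, hm⟩
    exact .inr ⟨h0, ht.eventually h1⟩

/-- A coordinate among the first `k` is a monomial at any point. -/
theorem monoAt_coord (κ : Kind) (hu : u ∈ orthant k m) {i : Fin m} (hi : i.val < k) :
    MonoAt κ k (fun x => x i) u := by
  rcases (hu i hi).eq_or_lt with h0 | h0
  · refine ⟨fun _ => 1, Pi.single i 1, .of_contDiff hu contDiff_const, one_pos, fun j => ?_,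
      fun _ j => ?_, fun j hj => ?_, .of_forall fun x => ?_⟩
    · by_cases h : j = i
      · subst h; simp
      · simp [h]
    · by_cases h : j = i
      · subst h; exact ⟨1, by simp⟩
      · exact ⟨0, by simp [h]⟩
    · have : j ≠ i := by rintro rfl; exact hj ⟨hi, h0.symm⟩
      simp [this]
    · dsimp only
      rw [monomial_eq _ _ i, Finset.prod_eq_one]
      · simp
      · intro j hj
        simp [Finset.ne_of_mem_erase hj]
  · exact ⟨fun x => x i, 0, .of_contDiff hu (contDiff_apply ℝ ℝ i), h0, fun _ => le_rfl,
      fun _ _ => ⟨0, by simp⟩, fun _ _ => rfl, .of_forall fun x => by simp [monomial]⟩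

/-- Maps each component of which is a coordinate or zero are smooth. -/
theorem mapAt_of_coord (κ : Kind) (hu : u ∈ orthant k m)
    (h : ∀ j : Fin n, (∃ i : Fin m, (j.val < l → i.val < k) ∧ ∀ x, g x j = x i) ∨
      (¬ b ∧ ∀ x, g x j = 0)) : MapAt κ b k l g u := by
  intro j
  rcases h j with ⟨i, hi, hg⟩ | ⟨h0, hg⟩
  · simp only [hg]
    exact ⟨fun _ => .of_contDiff hu (contDiff_apply ℝ ℝ i), fun hj => .inl (monoAt_coord κ hu (hi hj))⟩
  · simp only [hg]
    exact ⟨fun _ => .of_contDiff hu contDiff_const, fun hj => .inr ⟨h0, by simp⟩⟩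

/-! ### Zero patterns -/

/-- Near `u`, the zero set of `g x` is the union-preserving function `φ` of the zero set of `x`. -/
def HasPattern (k l : ℕ) {m n : ℕ} (g : (Fin m → ℝ) → (Fin n → ℝ)) (u : Fin m → ℝ)
    (φ : Finset (Fin m) → Finset (Fin n)) : Prop :=
  (∀ I J, φ (I ∪ J) = φ I ∪ φ J) ∧ ∀ᶠ x in 𝓝[orthant k m] u, zeroSet l (g x) = φ (zeroSet k x)

/-- A monomial component vanishes at `x` exactly when one of the coordinates in the support `A j` of
its exponents does; an identically zero component vanishes always, which is recorded by `v j`. So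
`j` lies in `φ I` iff `v j` holds or `A j` meets `I`, a condition compatible with unions. For
interior maps no `v j` holds, and `φ ∅ = ∅`. -/
theorem MapAt.exists_pattern (h : MapAt κ b k l g u) : 
    ∃ φ, HasPattern k l g u φ ∧ (b → φ ∅ = ∅) := by
  classical
  have : ∀ j : Fin n, ∃ (A : Finset (Fin m)) (v : Prop), (b → ¬ v) ∧ (j.val < l →
      ∀ᶠ x in 𝓝[orthant k m] u, g x j = 0 ↔ v ∨ ∃ i ∈ A, i ∈ zeroSet k x) := by
    intro j
    by_cases hj : j.val < l
    · rcases (h j).2 hj with ⟨F, a, h1, h2, h3, -, h5, h6⟩ | ⟨hb, h1⟩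
      · refine ⟨Finset.univ.filter fun i => a i ≠ 0, False, fun _ => id, fun _ => ?_⟩
        filter_upwards [h6, h1.eventually_pos h2, self_mem_nhdsWithin] with x hx hF hxo
        have hk : ∀ i, a i ≠ 0 → i.val < k := fun i hi => by
          by_contra h'; exact hi (h5 i fun h => h' h.1)
        rw [hx, mul_eq_zero, or_iff_right hF.ne', monomial, Finset.prod_eq_zero_iff, false_or]
        refine exists_congr fun i => ?_
        simp only [Finset.mem_univ, Finset.mem_filter, true_and, mem_zeroSet]
        constructor
        · intro h0
          have ha : a i ≠ 0 := by rintro e; simp [e] at h0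
          exact ⟨ha, hk i ha, ((Real.rpow_eq_zero (hxo i (hk i ha)) ha).1 h0)⟩
        · rintro ⟨ha, -, h0⟩
          rw [h0, Real.zero_rpow ha]
      · exact ⟨∅, True, fun hb' => absurd hb' hb, fun _ => h1.mono fun x hx => by simp [hx]⟩
    · exact ⟨∅, False, fun _ => id, fun h => absurd h hj⟩
  choose A v hv hA using this
  refine ⟨fun I => Finset.univ.filter fun j => j.val < l ∧ (v j ∨ ∃ i ∈ A j, i ∈ I),
    ⟨fun I J => ?_, ?_⟩, fun hb => ?_⟩
  · ext j
    simp only [Finset.mem_filter, Finset.mem_univ, true_and, Finset.mem_union]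
    constructor
    · rintro ⟨h1, h2 | ⟨i, hi, h2 | h2⟩⟩
      exacts [.inl ⟨h1, .inl h2⟩, .inl ⟨h1, .inr ⟨i, hi, h2⟩⟩, .inr ⟨h1, .inr ⟨i, hi, h2⟩⟩]
    · rintro (⟨h1, h2 | ⟨i, hi, h2⟩⟩ | ⟨h1, h2 | ⟨i, hi, h2⟩⟩)
      exacts [⟨h1, .inl h2⟩, ⟨h1, .inr ⟨i, hi, .inl h2⟩⟩, ⟨h1, .inl h2⟩, ⟨h1, .inr ⟨i, hi, .inr h2⟩⟩]
  · have : ∀ᶠ x in 𝓝[orthant k m] u, ∀ j : Fin n, j.val < l →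
        (g x j = 0 ↔ v j ∨ ∃ i ∈ A j, i ∈ zeroSet k x) :=
      eventually_all.2 fun j => by
        by_cases hj : j.val < l
        · exact (hA j hj).mono fun x hx _ => hx
        · exact .of_forall fun x h => absurd h hj
    filter_upwards [this] with x hx
    ext j
    simp only [Finset.mem_filter, Finset.mem_univ, true_and]
    rw [mem_zeroSet]
    exact and_congr_right fun hj => hx j hj
  · ext j
    simp [hv j hb]

theorem HasPattern.mono {φ : Finset (Fin m) → Finset (Fin n)} (h : HasPattern k l g u φ)
    {I J : Finset (Fin m)} (hIJ : I ⊆ J) : φ I ⊆ φ J := by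
  rw [← Finset.union_eq_right.2 hIJ, h.1]
  exact Finset.subset_union_left

theorem HasPattern.eventually {φ : Finset (Fin m) → Finset (Fin n)} (h : HasPattern k l g u φ) :
    ∀ᶠ v in 𝓝[orthant k m] u, HasPattern k l g v φ := by
  filter_upwards [eventually_eventually_nhdsWithin.2 h.2] with v hv using ⟨h.1, hv⟩

theorem eventually_zeroSet_subset (k : ℕ) (u : Fin m → ℝ) :
    ∀ᶠ x in 𝓝 u, zeroSet k x ⊆ zeroSet k u := by
  have : ∀ᶠ x in 𝓝 u, ∀ i, u i ≠ 0 → x i ≠ 0 := eventually_all.2 fun i => by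
    by_cases hi : u i = 0
    · simp [hi]
    · exact ((continuous_apply i).continuousAt.eventually_ne hi).mono fun x hx _ => hx
  filter_upwards [this] with x hx i hi
  rw [mem_zeroSet] at hi ⊢
  exact ⟨hi.1, by_contra fun h => hx i h hi.2⟩

/-- The point `u` with the coordinates in `zeroSet k u \ I` increased by `t`. -/
noncomputable def liftZeros (k : ℕ) (u : Fin m → ℝ) (I : Finset (Fin m)) (t : ℝ) : Fin m → ℝ := by
  classical exact fun i => if i ∈ zeroSet k u ∧ i ∉ I then t else u i

theorem tendsto_liftZeros (k : ℕ) (u : Fin m → ℝ) (I : Finset (Fin m)) :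
    Tendsto (liftZeros k u I) (𝓝[>] 0) (𝓝 u) := by
  refine tendsto_pi_nhds.2 fun i => ?_
  unfold liftZeros
  split_ifs with h
  · rw [(mem_zeroSet.1 h.1).2]
    exact tendsto_nhdsWithin_of_tendsto_nhds tendsto_id
  · exact tendsto_const_nhds

theorem liftZeros_spec (hu : u ∈ orthant k m) {I : Finset (Fin m)} (hI : I ⊆ zeroSet k u) {t : ℝ}
    (ht : 0 < t) : liftZeros k u I t ∈ orthant k m ∧ zeroSet k (liftZeros k u I t) = I := by
  constructor
  · intro i hi
    unfold liftZeros; split_ifs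
    exacts [ht.le, hu i hi]
  · ext i
    rw [mem_zeroSet]
    unfold liftZeros
    split_ifs with h
    · simp [h.2, ht.ne']
    · rw [← mem_zeroSet]
      exact ⟨fun h' => by_contra fun h2 => h ⟨h', h2⟩, fun h' => hI h'⟩

/-- Raising the vanishing coordinates outside `I` to a small `t > 0` gives points with zero set `I`
tending to `u`. Identities between patterns that hold near `u` are read off at such points. -/
theorem frequently_zeroSet_eq (hu : u ∈ orthant k m) {I : Finset (Fin m)} (hI : I ⊆ zeroSet k u) :
    ∃ᶠ x in 𝓝[orthant k m] u, zeroSet k x = I := by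
  have h1 : Tendsto (liftZeros k u I) (𝓝[>] 0) (𝓝[orthant k m] u) :=
    tendsto_nhdsWithin_iff.2 ⟨tendsto_liftZeros k u I,
      eventually_mem_nhdsWithin.mono fun t ht => (liftZeros_spec hu hI ht).1⟩
  refine h1.frequently (Eventually.frequently ?_)
  exact eventually_mem_nhdsWithin.mono fun t ht => (liftZeros_spec hu hI ht).2

theorem depth_eq_card (k : ℕ) (x : Fin m → ℝ) : depth k x = (zeroSet k x).card := by
  rw [depth, ← Set.ncard_coe_finset]
  congr 1
  ext i
  simp [mem_zeroSet]

end MapAt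

end ACorners

namespace ACorners

/-! ### Charts -/

/-- The chart `c` sends `u` to `x`. -/
def At {k m : ℕ} {X : Type u} (c : Chart k m X) (u : Fin m → ℝ) (x : X) : Prop :=
  ∃ h : u ∈ c.dom, c.toFun ⟨u, h⟩ = x

section At

variable {k m l n : ℕ} {X Y : Type u} {c : Chart k m X} {d : Chart l n Y} {u : Fin m → ℝ} {x : X}

theorem At.mem_orthant (h : At c u x) : u ∈ orthant k m := c.isOpen_dom.subset h.1

theorem At.eq {y : X} (h : At c u x) (h' : At c u y) : x = y := h.2.symm.trans h'.2

theorem At.inj {v : Fin m → ℝ} (h : At c u x) (h' : At c v x) : u = v := by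
  obtain ⟨h1, h2⟩ := h
  obtain ⟨h3, h4⟩ := h'
  exact congrArg Subtype.val (c.injective (h2.trans h4.symm))

theorem mem_range_iff : x ∈ range c.toFun ↔ ∃ u, At c u x :=
  ⟨fun ⟨u, hu⟩ => ⟨u.1, u.2, hu⟩, fun ⟨u, h, hu⟩ => ⟨⟨u, h⟩, hu⟩⟩

theorem mem_overlap_iff {f : X → Y} : u ∈ overlap c d f ↔ ∃ x v, At c u x ∧ At d v (f x) := by
  constructor
  · rintro ⟨h, h'⟩
    obtain ⟨v, hv⟩ := mem_range_iff.1 h'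
    exact ⟨_, v, ⟨h, rfl⟩, hv⟩
  · rintro ⟨x, v, ⟨h, rfl⟩, hv⟩
    exact ⟨h, mem_range_iff.2 ⟨v, hv⟩⟩

theorem At.eventually_exists (h : At c u x) : ∀ᶠ v in 𝓝[orthant k m] u, ∃ y, At c v y := by
  filter_upwards [c.isOpen_dom.mem_nhdsWithin h.1] with v hv using ⟨_, hv, rfl⟩

/-- Carries neighbourhood statements from the manifold to the orthant, where all germs are taken. -/
theorem At.eventually_iff [TopologicalSpace X] (hc : IsOpenEmbedding c.toFun) (h : At c u x)
    {p : X → Prop} : (∀ᶠ y in 𝓝 x, p y) ↔ ∀ᶠ v in 𝓝[orthant k m] u, ∃ y, At c v y ∧ p y := by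
  obtain ⟨hu, rfl⟩ := h
  rw [← hc.map_nhds_eq, eventually_map, ← c.isOpen_dom.nhdsWithin_eq hu,
    nhdsWithin_eq_map_subtype_coe hu, eventually_map]
  refine eventually_congr (.of_forall fun v => ⟨fun h => ⟨_, ⟨v.2, rfl⟩, h⟩, ?_⟩)
  rintro ⟨y, ⟨_, rfl⟩, h⟩
  exact h

/-- Near `u`, the map `f` is represented by `g` in the charts `c` and `d`. -/
def RepAt (c : Chart k m X) (d : Chart l n Y) (f : X → Y) (g : (Fin m → ℝ) → Fin n → ℝ)
    (u : Fin m → ℝ) : Prop :=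
  ∀ᶠ v in 𝓝[orthant k m] u, ∃ x, At c v x ∧ At d (g v) (f x)

variable {f : X → Y} {g : (Fin m → ℝ) → Fin n → ℝ}

theorem RepAt.self (h : RepAt c d f g u) (hu : At c u x) : At d (g u) (f x) := by
  obtain ⟨y, h1, h2⟩ := h.self_of_nhdsWithin hu.mem_orthant
  rwa [hu.eq h1]

theorem RepAt.maps (h : RepAt c d f g u) : ∀ᶠ v in 𝓝[orthant k m] u, g v ∈ orthant l n :=
  h.mono fun _ ⟨_, _, h⟩ => h.mem_orthant

theorem RepAt.eventually (h : RepAt c d f g u) : ∀ᶠ v in 𝓝[orthant k m] u, RepAt c d f g v :=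
  eventually_eventually_nhdsWithin.2 h

theorem RepAt.tendsto (h : RepAt c d f g u) (hg : ContinuousWithinAt g (orthant k m) u) :
    Tendsto g (𝓝[orthant k m] u) (𝓝[orthant l n] (g u)) :=
  tendsto_nhdsWithin_iff.2 ⟨hg, h.maps⟩

theorem RepAt.unique {g' : (Fin m → ℝ) → Fin n → ℝ} (h : RepAt c d f g u) (h' : RepAt c d f g' u) :
    g' =ᶠ[𝓝[orthant k m] u] g := by
  filter_upwards [h, h'] with v ⟨x, hx, hgx⟩ ⟨y, hy, hgy⟩
  obtain rfl := hx.eq hy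
  exact hgy.inj hgx

theorem RepAt.comp {l' n' : ℕ} {Z : Type u} {e : Chart l' n' Z} {f' : Y → Z}
    {h : (Fin n → ℝ) → Fin n' → ℝ} (hg : RepAt c d f g u)
    (hc : ContinuousWithinAt g (orthant k m) u) (hh : RepAt d e f' h (g u)) :
    RepAt c e (f' ∘ f) (fun v => h (g v)) u := by
  filter_upwards [hg, (hg.tendsto hc).eventually hh] with v ⟨x, hx, hgx⟩ ⟨y, hy, hhy⟩
  obtain rfl := hgx.eq hy
  exact ⟨x, hx, hhy⟩

theorem RepAt.continuousAt [TopologicalSpace X] [TopologicalSpace Y] (hc : IsOpenEmbedding c.toFun)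
    (hd : IsOpenEmbedding d.toFun) (hu : At c u x) (hr : RepAt c d f g u)
    (hg : ContinuousWithinAt g (orthant k m) u) : ContinuousAt f x := by
  intro N hN
  refine (hu.eventually_iff hc).2 ?_
  filter_upwards [hr, (hr.tendsto hg).eventually (((hr.self hu).eventually_iff hd).1 hN)]
    with v ⟨x, hx, hgx⟩ ⟨y, hy, hyN⟩
  obtain rfl := hgx.eq hy
  exact ⟨x, hx, hyN⟩

/-- In the charts `c` and `d`, the map `f` is smooth, and interior if `b` holds. -/
def MapIn (κ : Kind) (b : Prop) (c : Chart k m X) (d : Chart l n Y) (f : X → Y) : Prop :=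
  ∀ u v x, At c u x → At d v (f x) → ∃ g, RepAt c d f g u ∧ MapAt κ b k l g u

theorem isOpenInOrthant_overlap [TopologicalSpace X] [TopologicalSpace Y]
    (hc : IsOpenEmbedding c.toFun) (hd : IsOpenEmbedding d.toFun) (hf : Continuous f) :
    IsOpenInOrthant k (overlap c d f) := by
  refine isOpenInOrthant_iff.2 ⟨fun u hu => ?_, fun u hu => ?_⟩
  · obtain ⟨x, v, hx, -⟩ := mem_overlap_iff.1 hu
    exact hx.mem_orthant
  · obtain ⟨x, v, hx, hv⟩ := mem_overlap_iff.1 hu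
    have := hf.continuousAt.eventually (hd.isOpen_range.mem_nhds (mem_range_iff.2 ⟨v, hv⟩))
    filter_upwards [(hx.eventually_iff hc).1 this] with w ⟨y, hy, hy'⟩
    obtain ⟨v, hv⟩ := mem_range_iff.1 hy'
    exact mem_overlap_iff.2 ⟨y, v, hy, hv⟩

/-- Charts are injective, so the representatives near different points agree where both are defined
and assemble to a single `g` on the overlap. Outside it the value of `g` is irrelevant and set to
`0`. -/
theorem mapIn_iff [TopologicalSpace X] [TopologicalSpace Y] {κ : Kind} {b : Prop}
    (hc : IsOpenEmbedding c.toFun) (hd : IsOpenEmbedding d.toFun) (hf : Continuous f) :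
    MapIn κ b c d f ↔ ∃ g, IsLocalRep c d f g ∧ ∀ u ∈ overlap c d f, MapAt κ b k l g u := by
  classical
  have ho := isOpenInOrthant_overlap hc hd hf
  have hrep : ∀ g, IsLocalRep c d f g → ∀ u ∈ overlap c d f, RepAt c d f g u := by
    intro g hg u hu
    filter_upwards [ho.mem_nhdsWithin hu] with v hv
    obtain ⟨x, w, hx, hw⟩ := mem_overlap_iff.1 hv
    obtain ⟨hv, rfl⟩ := hx
    have := hg ⟨v, hv⟩ ⟨w, hw.1⟩ hw.2
    exact ⟨_, ⟨hv, rfl⟩, by rwa [this]⟩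
  constructor
  · intro h
    let g : (Fin m → ℝ) → Fin n → ℝ := fun u =>
      if h : ∃ v x, At c u x ∧ At d v (f x) then h.choose else 0
    have hg : IsLocalRep c d f g := by
      rintro ⟨u, hu⟩ ⟨v, hv⟩ huv
      have h : ∃ v x, At c u x ∧ At d v (f x) := ⟨v, _, ⟨hu, rfl⟩, hv, huv⟩
      have e : g u = h.choose := dif_pos h
      obtain ⟨x, h1, h2⟩ := h.choose_spec
      change g u = v
      rw [e]
      obtain ⟨_, rfl⟩ := h1
      exact h2.inj ⟨hv, huv⟩
    refine ⟨g, hg, fun u hu => ?_⟩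
    obtain ⟨x, v, hx, hv⟩ := mem_overlap_iff.1 hu
    obtain ⟨g', h1, h2⟩ := h u v x hx hv
    exact h2.congr (h1.unique (hrep g hg u hu))
  · rintro ⟨g, hg, hm⟩ u v x hx hv
    have hu := mem_overlap_iff.2 ⟨x, v, hx, hv⟩
    exact ⟨g, hrep g hg u hu, hm u hu⟩

theorem smoothInCharts_iff [TopologicalSpace X] [TopologicalSpace Y] {κ : Kind}
    (hc : IsOpenEmbedding c.toFun) (hd : IsOpenEmbedding d.toFun) (hf : Continuous f) :
    SmoothInCharts κ c d f ↔ MapIn κ False c d f := by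
  rw [mapIn_iff hc hd hf, SmoothInCharts]
  simp only [isSmoothMap_iff (isOpenInOrthant_overlap hc hd hf)]

theorem interiorInCharts_iff [TopologicalSpace X] [TopologicalSpace Y] {κ : Kind}
    (hc : IsOpenEmbedding c.toFun) (hd : IsOpenEmbedding d.toFun) (hf : Continuous f) :
    InteriorInCharts κ c d f ↔ MapIn κ True c d f := by
  rw [mapIn_iff hc hd hf, InteriorInCharts]
  simp only [isInteriorMap_iff (isOpenInOrthant_overlap hc hd hf)]

end At

/-! ### Transition maps -/

/-- When the elements of `I` are added one by one, each addition strictly enlarges the image. -/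
theorem card_le_card_of_strictMono {α β : Type*} {S : Finset α} {φ : Finset α → Finset β}
    (hmono : ∀ I J, I ⊆ J → φ I ⊆ φ J) (hinj : ∀ I J, I ⊆ S → J ⊆ S → φ I = φ J → I = J)
    {I : Finset α} (hI : I ⊆ S) : I.card ≤ (φ I).card := by
  classical
  induction I using Finset.induction_on with
  | empty => simp
  | insert a I ha ih =>
    have hIS := (Finset.subset_insert a I).trans hI
    have : φ I ⊂ φ (insert a I) := (hmono _ _ (Finset.subset_insert a I)).ssubset_of_ne fun h =>
      ha (hinj _ _ hIS hI h ▸ Finset.mem_insert_self a I)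
    rw [Finset.card_insert_of_notMem ha]
    exact Nat.succ_le_of_lt ((ih hIS).trans_lt (Finset.card_lt_card this))

section Transition

variable {κ : Kind} {k m l n : ℕ} {X : Type u} {c : Chart k m X} {d : Chart l n X}
  {u : Fin m → ℝ} {v : Fin n → ℝ} {x : X}

/-- If the `j`-th component of `g` vanished near `u`, then points `y = g (h y)` near `g u` would all
have `y j = 0`; but points with empty zero set occur arbitrarily near `g u`. -/
theorem mapAt_true_of_inverse {g : (Fin m → ℝ) → Fin n → ℝ} {h : (Fin n → ℝ) → Fin m → ℝ}
    (hu : At c u x) (hg : RepAt c d id g u) (hgm : MapAt κ False k l g u)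
    (hh : RepAt d c id h (g u)) (hhm : MapAt κ False l k h (g u)) : MapAt κ True k l g u := by
  refine fun j => ⟨(hgm j).1, fun hj => .inl (((hgm j).2 hj).resolve_right ?_)⟩
  rintro ⟨-, h0⟩
  have hv : At d (g u) x := hg.self hu
  have e : h (g u) = u := (hh.self hv).inj hu
  have ht := hh.tendsto (hhm.continuousWithinAt hv.mem_orthant)
  rw [e] at ht
  obtain ⟨y, hy, ⟨h1, h2⟩, x1, h3, h4⟩ := ((frequently_zeroSet_eq hv.mem_orthant
    (Finset.empty_subset _)).and_eventually ((ht.eventually (h0.and hg)).and hh)).exists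
  obtain ⟨x2, h5, h6⟩ := h2
  obtain rfl := h4.eq h5
  have : g (h y) = y := h6.inj h3
  have hj' : j ∈ zeroSet l y := mem_zeroSet.2 ⟨hj, by rw [← this]; exact h1⟩
  simp [hy] at hj'

/-- The transition map from `c` to `d` at a common point `x`: it is interior, and near `x` the
vanishing coordinates of `c` correspond bijectively to those of `d`. -/
theorem exists_transition (hcd : MapIn κ False c d id) (hdc : MapIn κ False d c id)
    (hu : At c u x) (hv : At d v x) :
    ∃ g φ, RepAt c d id g u ∧ MapAt κ True k l g u ∧ g u = v ∧ HasPattern k l g u φ ∧ φ ∅ = ∅ ∧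
      φ (zeroSet k u) = zeroSet l v ∧ (∀ I, I ⊆ zeroSet k u → (φ I).card = I.card) ∧
      (∀ I J, I ⊆ zeroSet k u → J ⊆ zeroSet k u → φ I = φ J → I = J) := by
  obtain ⟨g, hg, hgm⟩ := hcd u v x hu hv
  have e : g u = v := (hg.self hu).inj hv
  obtain ⟨h, hh, hhm⟩ := hdc v u x hv hu
  have e' : h v = u := (hh.self hv).inj hu
  have hgm' := mapAt_true_of_inverse hu hg hgm (e ▸ hh) (e ▸ hhm)
  obtain ⟨φ, hφ, h0⟩ := hgm'.exists_pattern
  obtain ⟨ψ, hψ, -⟩ := hhm.exists_pattern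
  -- Near `u` there is a point `y` with zero set exactly `I` and `h (g y) = y`; comparing zero sets
  -- gives `ψ (φ I) = I`.
  have inv : ∀ I, I ⊆ zeroSet k u → ψ (φ I) = I := by
    intro I hI
    have ht := hg.tendsto (hgm.continuousWithinAt hu.mem_orthant)
    rw [e] at ht
    obtain ⟨y, hy, ⟨h1, x1, h3, h4⟩, h2, x2, h5, h6⟩ := ((frequently_zeroSet_eq hu.mem_orthant
      hI).and_eventually ((ht.eventually (hψ.2.and hh)).and (hφ.2.and hg))).exists
    obtain rfl := h6.eq h3
    have : h (g y) = y := h4.inj h5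
    rw [this, hy, h2, hy] at h1
    exact h1.symm
  have inv' : ∀ J, J ⊆ zeroSet l v → φ (ψ J) = J := by
    intro J hJ
    have ht := hh.tendsto (hhm.continuousWithinAt hv.mem_orthant)
    rw [e'] at ht
    obtain ⟨y, hy, ⟨h1, x1, h3, h4⟩, h2, x2, h5, h6⟩ := ((frequently_zeroSet_eq hv.mem_orthant
      hJ).and_eventually ((ht.eventually (hφ.2.and hg)).and (hψ.2.and hh))).exists
    obtain rfl := h6.eq h3
    have : g (h y) = y := h4.inj h5
    rw [this, hy, h2, hy] at h1
    exact h1.symm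
  have hz : φ (zeroSet k u) = zeroSet l v := by
    rw [← e]; exact (hφ.2.self_of_nhdsWithin hu.mem_orthant).symm
  have hinj : ∀ I J, I ⊆ zeroSet k u → J ⊆ zeroSet k u → φ I = φ J → I = J := fun I J hI hJ h => by
    rw [← inv I hI, h, inv J hJ]
  -- Cardinality is preserved because both `φ` and its inverse `ψ` are monotone and injective, so
  -- neither lowers it.
  refine ⟨g, φ, hg, hgm', e, hφ, h0 trivial, hz, fun I hI => le_antisymm ?_ ?_, hinj⟩
  · have hJ : φ I ⊆ zeroSet l v := hz ▸ hφ.mono hI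
    have := card_le_card_of_strictMono (S := zeroSet l v) (fun _ _ => hψ.mono)
      (fun I J hI hJ h => by rw [← inv' I hI, h, inv' J hJ]) hJ
    rwa [inv I hI] at this
  · exact card_le_card_of_strictMono (fun _ _ => hφ.mono) hinj hI

theorem card_zeroSet_eq (hcd : MapIn κ False c d id) (hdc : MapIn κ False d c id)
    (hu : At c u x) (hv : At d v x) : (zeroSet k u).card = (zeroSet l v).card := by
  obtain ⟨g, φ, -, -, -, -, -, h, h', -⟩ := exists_transition hcd hdc hu hv
  rw [← h, h' _ subset_rfl]

/-! ### Dimension -/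

theorem MapAt.smAt_of_zeroSet_eq_empty {g : (Fin m → ℝ) → Fin n → ℝ} (hg : MapAt κ True k l g u)
    (hu : zeroSet k u = ∅) (j : Fin n) : SmAt κ k (fun x => g x j) u := by
  rcases lt_or_ge j.val l with hj | hj
  · obtain ⟨F, a, h1, -, -, -, h5, h6⟩ := ((hg j).2 hj).resolve_right (by simp)
    have ha : a = 0 := funext fun i => h5 i fun h => by
      have := mem_zeroSet.2 h
      simp [hu] at this
    exact h1.congr (by simpa [ha, monomial] using h6)
  · exact (hg j).1 hj

/-- Where no boundary coordinate vanishes, both maps are differentiable in the usual sense.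
Differentiating `h ∘ g = id` factors the identity matrix of size `m` through `n` dimensions, and the
rank gives `m ≤ n`. -/
theorem dim_le_of_inverse {g : (Fin m → ℝ) → Fin n → ℝ} {h : (Fin n → ℝ) → Fin m → ℝ}
    (huo : u ∈ orthant k m) (hu : zeroSet k u = ∅) (hv : zeroSet l (g u) = ∅) (hg : MapAt .analytic True k l g u)
    (hh : MapAt .analytic True l k h (g u))
    (hinv : ∀ᶠ x in 𝓝[orthant k m] u, h (g x) = x) : m ≤ n := by
  have hpos : ∀ i : Fin m, i.val < k → u i ≠ 0 := fun i hi h0 => by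
    have := mem_zeroSet.2 ⟨hi, h0⟩
    simp [hu] at this
  have hSg := fun j => hg.smAt_of_zeroSet_eq_empty hu j
  have hSh := fun i => hh.smAt_of_zeroSet_eq_empty hv i
  have hder : ∀ i j, ∃ d, HasDerivAt (slice (fun x => g x j) u i) d (u i) := by
    intro i j
    obtain ⟨W, hW, huW, hs⟩ := hSg j
    obtain ⟨d, hd, -⟩ := (hs []).hasDerivAt huW (i := i)
      fun hi => (hW.subset huW i hi).lt_of_ne' (hpos i hi)
    exact ⟨d, hd⟩
  choose B hB using hder
  have hcoef : ∀ i', ∃ A : Fin n → ℝ, ∀ i, ∑ j, A j * B i j = (1 : Matrix (Fin m) (Fin m) ℝ) i' i := by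
    intro i'
    obtain ⟨W, hW, huW, hs⟩ := hSh i'
    refine ⟨fun j => if j.val < l ∧ g u j = 0 then 0 else
      bPartial l j (fun x => h x i') (g u) / bScale l j (g u), fun i => ?_⟩
    have hγ : HasDerivAt (fun t => g (Function.update u i t)) (B i) (u i) := hasDerivAt_pi.2 (hB i)
    have e : g (Function.update u i (u i)) = g u := by simp
    have := (hs []).hasDerivAt_comp hW hγ (by rwa [e]) (fun j hj h0 => by
      rw [e] at h0
      have := mem_zeroSet.2 ⟨hj, h0⟩
      simp [hv] at this)
    rw [e] at this
    refine this.unique ?_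
    obtain ⟨V, hV, huV, hVs⟩ := exists_isOpenInOrthant_subset huo hinv
    have h1 : HasDerivAt (fun s => Function.update u i s i') (Pi.single (M := fun _ => ℝ) i 1 i')
      (u i) := hasDerivAt_pi.1 (hasDerivAt_update u i (u i)) i'
    refine (h1.congr_of_eventuallyEq ?_).congr_deriv ?_
    · filter_upwards [hV.eventually_update' huV
        fun hi => (huo i hi).lt_of_ne' (hpos i hi)] with s hs
      exact congrFun (hVs hs) i'
    · rw [Matrix.one_apply, Pi.single_apply]
  choose A hA using hcoef
  have hAB : (Matrix.of A : Matrix (Fin m) (Fin n) ℝ) * (Matrix.of B).transpose = 1 := by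
    ext i' i
    exact hA i' i
  have h1 := Matrix.rank_mul_le_left (Matrix.of A) (Matrix.of B).transpose
  rw [hAB, Matrix.rank_one, Fintype.card_fin] at h1
  exact h1.trans (Matrix.rank_le_width _)

/-- The common point may be moved to a nearby `x'` of depth zero in both charts, and the rank
inequality is applied in both directions there. -/
theorem dim_eq_of_transition {c : Chart k m X} {d : Chart l n X} {x : X}
    (hcd : MapIn .analytic False c d id) (hdc : MapIn .analytic False d c id)
    {u : Fin m → ℝ} {v : Fin n → ℝ} (hu : At c u x) (hv : At d v x) : m = n := by
  obtain ⟨g, φ, hg, hgm, e, hφ, h0, -⟩ := exists_transition hcd hdc hu hv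
  obtain ⟨y, hy, hgy, x', h1, h2⟩ := ((frequently_zeroSet_eq hu.mem_orthant
    (Finset.empty_subset _)).and_eventually (hφ.2.and hg)).exists
  rw [hy, h0] at hgy
  have main : ∀ {k m l n : ℕ} {c : Chart k m X} {d : Chart l n X} {u : Fin m → ℝ} {v : Fin n → ℝ},
      MapIn .analytic False c d id → MapIn .analytic False d c id → At c u x' → At d v x' →
      zeroSet k u = ∅ → zeroSet l v = ∅ → m ≤ n := by
    intro k m l n c d u v hcd hdc hu hv hu0 hv0
    obtain ⟨g, φ, hg, hgm, rfl, -⟩ := exists_transition hcd hdc hu hv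
    obtain ⟨h, ψ, hh, hhm, -⟩ := exists_transition hdc hcd hv hu
    refine dim_le_of_inverse hu.mem_orthant hu0 hv0 hgm hhm ?_
    filter_upwards [hg.comp (hgm.continuousWithinAt hu.mem_orthant) hh] with v ⟨x, h1, h2⟩
    exact h2.inj h1
  exact le_antisymm (main hcd hdc h1 h2 hy hgy) (main hdc hcd h2 h1 hgy hy)

end Transition

end ACorners

namespace ACorners

/-! ### Manifolds and maps -/

section Manifold

variable {κ : Kind} {X Y Z : AtlasSpace.{u}}

theorem IsManifold.mapIn (hX : IsManifold κ X) {k m l n : ℕ} {c : Chart k m X} {d : Chart l n X}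
    (hc : c ∈ X.atlas k m) (hd : d ∈ X.atlas l n) : MapIn κ False c d id :=
  (smoothInCharts_iff (hX.isOpenEmbedding c hc) (hX.isOpenEmbedding d hd) continuous_id).1
    (hX.compatible c hc d hd).1

theorem IsManifold.exists_at (hX : IsManifold κ X) (x : X) :
    ∃ k m : ℕ, ∃ c ∈ X.atlas k m, ∃ u, At c u x := by
  obtain ⟨k, m, c, hc, h⟩ := hX.cover x
  exact ⟨k, m, c, hc, mem_range_iff.1 h⟩

theorem IsManifold.exists_rep (hX : IsManifold κ X) (b : Prop) {k m l n : ℕ} {c : Chart k m X}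
    {d : Chart l n X} (hc : c ∈ X.atlas k m) (hd : d ∈ X.atlas l n) {u : Fin m → ℝ}
    {v : Fin n → ℝ} {x : X} (hu : At c u x) (hv : At d v x) :
    ∃ g, RepAt c d id g u ∧ MapAt κ b k l g u := by
  obtain ⟨g, φ, h1, h2, -⟩ := exists_transition (hX.mapIn hc hd) (hX.mapIn hd hc) hu hv
  exact ⟨g, h1, h2.of_interior⟩

/-- Smooth maps, and interior ones if `b` holds. -/
def IsMap (κ : Kind) (b : Prop) (X Y : AtlasSpace.{u}) (f : X → Y) : Prop :=
  Continuous f ∧ ∀ k m l n : ℕ, ∀ c ∈ X.atlas k m, ∀ d ∈ Y.atlas l n, MapIn κ b c d f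

theorem isSmooth_iff (hX : IsManifold κ X) (hY : IsManifold κ Y) {f : X → Y} :
    IsSmooth κ X Y f ↔ IsMap κ False X Y f := by
  refine and_congr_right fun hf => ?_
  refine forall₄_congr fun k m l n => forall₂_congr fun c hc => forall₂_congr fun d hd => ?_
  exact smoothInCharts_iff (hX.isOpenEmbedding c hc) (hY.isOpenEmbedding d hd) hf

theorem isInterior_iff (hX : IsManifold κ X) (hY : IsManifold κ Y) {f : X → Y} :
    IsInterior κ X Y f ↔ IsMap κ True X Y f := by
  refine and_congr_right fun hf => ?_
  refine forall₄_congr fun k m l n => forall₂_congr fun c hc => forall₂_congr fun d hd => ?_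
  exact interiorInCharts_iff (hX.isOpenEmbedding c hc) (hY.isOpenEmbedding d hd) hf

/-- One pair of charts at each point suffices: any other pair differs by transition maps, and these
are interior, so the criterion covers interior maps as well. -/
theorem isMap_of_local {b : Prop} (hX : IsManifold κ X) (hY : IsManifold κ Y) {f : X → Y}
    (h : ∀ x, ∃ k m : ℕ, ∃ c ∈ X.atlas k m, ∃ l n : ℕ, ∃ d ∈ Y.atlas l n, ∃ u g,
      At c u x ∧ RepAt c d f g u ∧ MapAt κ b k l g u) : IsMap κ b X Y f := by
  constructor
  · refine continuous_iff_continuousAt.2 fun x => ?_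
    obtain ⟨k, m, c, hc, l, n, d, hd, u, g, hu, hg, hgm⟩ := h x
    exact hg.continuousAt (hX.isOpenEmbedding c hc) (hY.isOpenEmbedding d hd) hu
      (hgm.continuousWithinAt hu.mem_orthant)
  · intro k' m' l' n' c' hc' d' hd' u' v' x hu' hv'
    obtain ⟨k, m, c, hc, l, n, d, hd, u, g, hu, hg, hgm⟩ := h x
    obtain ⟨p, hp, hpm⟩ := hX.exists_rep b hc' hc hu' hu
    obtain ⟨q, hq, hqm⟩ := hY.exists_rep b hd hd' (hg.self hu) hv'
    obtain rfl : p u' = u := (hp.self hu').inj hu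
    have hpc := hpm.continuousWithinAt hu'.mem_orthant
    have h1 := hp.comp hpc hg
    have h1m := hgm.comp hu'.mem_orthant hpm hp.maps
    exact ⟨_, h1.comp (h1m.continuousWithinAt hu'.mem_orthant) hq,
      MapAt.comp (g := fun v => g (p v)) hqm hu'.mem_orthant h1m h1.maps⟩

theorem IsMap.comp {b : Prop} (hX : IsManifold κ X) (hY : IsManifold κ Y) (hZ : IsManifold κ Z)
    {f : X → Y} {g : Y → Z} (hf : IsMap κ b X Y f) (hg : IsMap κ b Y Z g) :
    IsMap κ b X Z (g ∘ f) := by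
  refine isMap_of_local hX hZ fun x => ?_
  obtain ⟨k, m, c, hc, u, hu⟩ := hX.exists_at x
  obtain ⟨l, n, d, hd, v, hv⟩ := hY.exists_at (f x)
  obtain ⟨p, q, e, he, w, hw⟩ := hZ.exists_at (g (f x))
  obtain ⟨F, hF, hFm⟩ := hf.2 _ _ _ _ c hc d hd u v x hu hv
  obtain ⟨G, hG, hGm⟩ := hg.2 _ _ _ _ d hd e he v w (f x) hv hw
  obtain rfl : F u = v := (hF.self hu).inj hv
  exact ⟨k, m, c, hc, p, q, e, he, u, _, hu, hF.comp (hFm.continuousWithinAt hu.mem_orthant) hG,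
    hGm.comp hu.mem_orthant hFm hF.maps⟩

theorem mapAt_id (κ : Kind) (b : Prop) {k m : ℕ} {u : Fin m → ℝ} (hu : u ∈ orthant k m) :
    MapAt κ b k k (fun x => x) u :=
  mapAt_of_coord κ hu fun j => .inl ⟨j, id, fun _ => rfl⟩

theorem isMap_id (b : Prop) (hX : IsManifold κ X) : IsMap κ b X X id := by
  refine isMap_of_local hX hX fun x => ?_
  obtain ⟨k, m, c, hc, u, hu⟩ := hX.exists_at x
  exact ⟨k, m, c, hc, k, m, c, hc, u, fun x => x, hu,
    hu.eventually_exists.mono fun v ⟨y, hy⟩ => ⟨y, hy, hy⟩, mapAt_id κ b hu.mem_orthant⟩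

theorem IsMap.exists_rep {b : Prop} {f : X → Y} (hf : IsMap κ b X Y f) {k m l n : ℕ}
    {c : Chart k m X} {d : Chart l n Y} (hc : c ∈ X.atlas k m) (hd : d ∈ Y.atlas l n)
    {u : Fin m → ℝ} {v : Fin n → ℝ} {x : X} (hu : At c u x) (hv : At d v (f x)) :
    ∃ g, RepAt c d f g u ∧ MapAt κ b k l g u ∧ g u = v := by
  obtain ⟨g, h1, h2⟩ := hf.2 _ _ _ _ c hc d hd u v x hu hv
  exact ⟨g, h1, h2, (h1.self hu).inj hv⟩

/-! ### The manifold generated by an atlas -/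

/-- Two charts compatible with `B` are compatible with each other, since near a common point their
transition map factors through a chart of `B`. Maximality is then immediate from the definition of
`generate`. -/
theorem isManifold_generate (Z : Type u) [t : TopologicalSpace Z] (h2 : T2Space Z)
    (hs : SecondCountableTopology Z) (B : ∀ k m : ℕ, Set (Chart k m Z))
    (hB : ∀ k m : ℕ, ∀ c ∈ B k m, IsOpenEmbedding c.toFun)
    (hcov : ∀ z, ∃ k m : ℕ, ∃ c ∈ B k m, ∃ u, At c u z)
    (hcomp : ∀ k m l n : ℕ, ∀ c ∈ B k m, ∀ d ∈ B l n, MapIn κ False c d id) :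
    IsManifold κ (generate κ Z t B) ∧ ∀ k m : ℕ, B k m ⊆ (generate κ Z t B).atlas k m := by
  have hcompat : ∀ {k m l n : ℕ} {c : Chart k m Z} {d : Chart l n Z}, IsOpenEmbedding c.toFun →
      IsOpenEmbedding d.toFun →
      (Compatible κ c d ↔ MapIn κ False c d id ∧ MapIn κ False d c id) := fun hc hd =>
    and_congr (smoothInCharts_iff hc hd continuous_id) (smoothInCharts_iff hd hc continuous_id)
  have hsub : ∀ k m : ℕ, B k m ⊆ (generate κ Z t B).atlas k m := fun k m c hc =>
    ⟨hB k m c hc, fun l n d hd => (hcompat (hB k m c hc) (hB l n d hd)).2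
      ⟨hcomp _ _ _ _ c hc d hd, hcomp _ _ _ _ d hd c hc⟩⟩
  have htr : ∀ {k m l n : ℕ} {c : Chart k m Z} {d : Chart l n Z},
      c ∈ (generate κ Z t B).atlas k m → d ∈ (generate κ Z t B).atlas l n →
      MapIn κ False c d id := by
    rintro k m l n c d ⟨hc, hc'⟩ ⟨hd, hd'⟩ u v z hu hv
    obtain ⟨p, q, e, he, w, hw⟩ := hcov z
    have hce := (hcompat hc (hB _ _ e he)).1 (hc' _ _ e he)
    have hde := (hcompat hd (hB _ _ e he)).1 (hd' _ _ e he)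
    obtain ⟨F, hF, hFm⟩ := hce.1 u w z hu hw
    obtain ⟨G, hG, hGm⟩ := hde.2 w v z hw hv
    obtain rfl : F u = w := (hF.self hu).inj hw
    exact ⟨_, hF.comp (hFm.continuousWithinAt hu.mem_orthant) hG,
      hGm.comp hu.mem_orthant hFm hF.maps⟩
  refine ⟨⟨h2, hs, fun c hc => hc.1, fun z => ?_, fun c hc d hd =>
    (hcompat hc.1 hd.1).2 ⟨htr hc hd, htr hd hc⟩, fun c hc h =>
      ⟨hc, fun l n d hd => h d (hsub l n hd)⟩⟩, hsub⟩
  obtain ⟨k, m, c, hc, u, hu⟩ := hcov z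
  exact ⟨k, m, c, hsub k m hc, mem_range_iff.2 ⟨u, hu⟩⟩

/-- A manifold all points of which lie in some chart of dimension `n` has dimension `n`. -/
theorem hasDim_of_cover (hX : IsManifold .analytic X) {n : ℕ}
    (h : ∀ x : X, ∃ k : ℕ, ∃ c ∈ X.atlas k n, ∃ u, At c u x) : HasDim X n := by
  rintro k m c hc ⟨u, hu⟩
  obtain ⟨l, d, hd, v, hv⟩ := h (c.toFun ⟨u, hu⟩)
  exact dim_eq_of_transition (hX.mapIn hc hd) (hX.mapIn hd hc) ⟨hu, rfl⟩ hv

theorem HasDim.eq {n k m : ℕ} (h : HasDim X n) {c : Chart k m X} (hc : c ∈ X.atlas k m)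
    {u : Fin m → ℝ} {x : X} (hu : At c u x) : m = n := h k m c hc ⟨u, hu.1⟩

/-! ### Local diffeomorphisms -/

theorem IsPushChart.at {X Y : Type u} {k m : ℕ} {f : X → Y} {c : Chart k m X} {d : Chart k m Y}
    (h : IsPushChart f c d) {u : Fin m → ℝ} {x : X} (hu : At c u x) : At d u (f x) := by
  obtain ⟨hu, rfl⟩ := hu
  exact ⟨h.1 ▸ hu, h.2 u _ hu⟩

theorem IsPushChart.exists_at {X Y : Type u} {k m : ℕ} {f : X → Y} {c : Chart k m X}
    {d : Chart k m Y} (h : IsPushChart f c d) {u : Fin m → ℝ} {y : Y} (hu : At d u y) :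
    ∃ x, At c u x ∧ f x = y := by
  obtain ⟨hu, rfl⟩ := hu
  exact ⟨_, ⟨h.1 ▸ hu, rfl⟩, (h.2 u hu _).symm⟩

theorem isPushChart_of_at {X Y : Type u} {k m : ℕ} {f : X → Y} {c : Chart k m X} {d : Chart k m Y}
    (hd : d.dom = c.dom) (h : ∀ u x, At c u x → At d u (f x)) : IsPushChart f c d := by
  refine ⟨hd, fun u hu hc => ?_⟩
  obtain ⟨_, h'⟩ := h u _ ⟨hc, rfl⟩
  exact h'

theorem IsPushChart.repAt {X Y : Type u} {k m : ℕ} {f : X → Y} {c : Chart k m X} {d : Chart k m Y}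
    (h : IsPushChart f c d) {u : Fin m → ℝ} {x : X} (hu : At c u x) :
    RepAt c d f (fun v => v) u :=
  hu.eventually_exists.mono fun _ ⟨y, hy⟩ => ⟨y, hy, h.at hy⟩

/-- In the charts provided, `f` is represented by the identity of an orthant, which is smooth and
interior. For a bijection the same charts serve for the inverse. -/
theorem IsLocalDiffeo.isMap (b : Prop) (hX : IsManifold κ X) (hY : IsManifold κ Y) {f : X → Y}
    (h : IsLocalDiffeo X Y f) : IsMap κ b X Y f := by
  refine isMap_of_local hX hY fun x => ?_
  obtain ⟨k, m, c, hc, hx, d, hd, hp⟩ := h x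
  obtain ⟨u, hu⟩ := mem_range_iff.1 hx
  exact ⟨k, m, c, hc, k, m, d, hd, u, _, hu, hp.repAt hu, mapAt_id κ b hu.mem_orthant⟩

theorem IsLocalDiffeo.isMap_symm (b : Prop) (hX : IsManifold κ X) (hY : IsManifold κ Y) {e : X ≃ Y}
    (h : IsLocalDiffeo X Y e) : IsMap κ b Y X e.symm := by
  refine isMap_of_local hY hX fun y => ?_
  obtain ⟨k, m, c, hc, hx, d, hd, hp⟩ := h (e.symm y)
  obtain ⟨u, hu⟩ := mem_range_iff.1 hx
  have hu' : At d u y := by simpa using hp.at hu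
  refine ⟨k, m, d, hd, k, m, c, hc, u, _, hu', ?_, mapAt_id κ b hu.mem_orthant⟩
  filter_upwards [hu.eventually_exists] with v ⟨x, hx⟩
  exact ⟨e x, hp.at hx, by simpa using hx⟩

theorem IsLocalDiffeo.isDiffeo (hX : IsManifold κ X) (hY : IsManifold κ Y) {e : X ≃ Y}
    (h : IsLocalDiffeo X Y e) : IsDiffeo κ X Y e :=
  ⟨(isSmooth_iff hX hY).2 (h.isMap False hX hY), (isSmooth_iff hY hX).2 (h.isMap_symm False hX hY)⟩

theorem IsLocalDiffeo.isOpenMap (hX : IsManifold κ X) (hY : IsManifold κ Y) {f : X → Y}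
    (h : IsLocalDiffeo X Y f) : IsOpenMap f := by
  refine isOpenMap_iff_nhds_le.2 fun x => ?_
  obtain ⟨k, m, c, hc, hx, d, hd, hp⟩ := h x
  obtain ⟨u, hu⟩ := mem_range_iff.1 hx
  intro N hN
  refine ((hp.at hu).eventually_iff (hY.isOpenEmbedding d hd)).2 ?_
  have := (hu.eventually_iff (p := fun y => f y ∈ N) (hX.isOpenEmbedding c hc)).1 hN
  filter_upwards [this] with v ⟨y, hy, hyN⟩
  exact ⟨f y, hp.at hy, hyN⟩

/-- The image of a chart under a local diffeomorphism, when it is a chart, belongs to the atlas. -/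
theorem IsLocalDiffeo.mem_atlas (hX : IsManifold κ X) (hY : IsManifold κ Y) {f : X → Y}
    (h : IsLocalDiffeo X Y f) {k m : ℕ} {c : Chart k m X} (hc : c ∈ X.atlas k m) {d : Chart k m Y}
    (hd : IsPushChart f c d) : d ∈ Y.atlas k m := by
  have hdo : IsOpenEmbedding d.toFun := by
    obtain ⟨le, dom, hdom, F, hF⟩ := d
    obtain ⟨h1, h2⟩ := hd
    dsimp only at h1
    subst h1
    have e : F = f ∘ c.toFun := by
      funext u
      exact h2 u.1 u.2 u.2
    have hco := hX.isOpenEmbedding c hc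
    refine .of_continuous_injective_isOpenMap ?_ hF ?_ <;> simp only [e]
    · exact (h.isMap False hX hY).1.comp hco.continuous
    · exact (h.isOpenMap hX hY).comp hco.isOpenMap
  refine hY.maximal d hdo fun {l n} e he => ?_
  have heo := hY.isOpenEmbedding e he
  refine ⟨(smoothInCharts_iff hdo heo continuous_id).2 fun u v y hu hv => ?_,
    (smoothInCharts_iff heo hdo continuous_id).2 fun v u y hv hu => ?_⟩ <;>
  obtain ⟨x, hux, rfl⟩ := hd.exists_at hu <;>
  obtain ⟨k0, m0, c0, hc0, hx0, d0, hd0, hp0⟩ := h x <;>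
  obtain ⟨w, hw⟩ := mem_range_iff.1 hx0
  · obtain ⟨F, hF, hFm⟩ := hX.exists_rep False hc hc0 hux hw
    obtain ⟨G, hG, hGm⟩ := hY.exists_rep False hd0 he (hp0.at hw) hv
    obtain rfl : F u = w := (hF.self hux).inj hw
    -- The transition from `c` to `c0` also represents the transition between their images `d` and
    -- `d0` under `f`.
    have hF' : RepAt d d0 id F u := hF.mono fun v ⟨y, h1, h2⟩ => ⟨f y, hd.at h1, hp0.at h2⟩
    exact ⟨_, hF'.comp (hFm.continuousWithinAt hu.mem_orthant) hG,
      hGm.comp hu.mem_orthant hFm hF.maps⟩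
  · obtain ⟨F, hF, hFm⟩ := hX.exists_rep False hc0 hc hw hux
    obtain ⟨G, hG, hGm⟩ := hY.exists_rep False he hd0 hv (hp0.at hw)
    obtain rfl : G v = w := (hG.self hv).inj (hp0.at hw)
    have hF' : RepAt d0 d id F (G v) := hF.mono fun v ⟨y, h1, h2⟩ => ⟨f y, hp0.at h1, hd.at h2⟩
    exact ⟨_, hG.comp (hGm.continuousWithinAt hv.mem_orthant) hF',
      hFm.comp hv.mem_orthant hGm hG.maps⟩

end Manifold

end ACorners

namespace ACorners

/-! ### Local corner components in charts -/

section Corner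

variable {κ : Kind} {X Y : AtlasSpace.{u}} {k m l n p q : ℕ} {c : Chart k m X} {d : Chart l n Y}
  {u : Fin m → ℝ} {x : X} {I : Finset (Fin m)} {J : Finset (Fin n)}

/-- Depth can be computed in any chart, because transition maps preserve the number of vanishing
boundary coordinates. -/
theorem IsManifold.mem_stratum_iff (hX : IsManifold κ X) (hc : c ∈ X.atlas k m) (hu : At c u x) :
    x ∈ stratum X p ↔ (zeroSet k u).card = p := by
  constructor
  · rintro ⟨l, n, d, hd, v, hv, rfl⟩
    rw [depth_eq_card]
    exact card_zeroSet_eq (hX.mapIn hc hd) (hX.mapIn hd hc) hu ⟨v.2, hv⟩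
  · rintro rfl
    exact ⟨k, m, c, hc, ⟨u, hu.1⟩, hu.2, depth_eq_card k u⟩

/-- In the chart `c`, the image of the points of the `ε`-ball about `u` with zero set `I`. -/
def cell (c : Chart k m X) (u : Fin m → ℝ) (ε : ℝ) (I : Finset (Fin m)) : Set X :=
  {y | ∃ v ∈ Metric.ball u ε, At c v y ∧ zeroSet k v = I}

/-- Fixing the zero set makes each of the first `k` coordinates either zero or positive and leaves
the others free; these are convex conditions. -/
theorem convex_zeroSet_eq (k : ℕ) (I : Finset (Fin m)) (hI : ∀ i ∈ I, i.val < k) :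
    Convex ℝ {v | v ∈ orthant k m ∧ zeroSet k v = I} := by
  have : {v | v ∈ orthant k m ∧ zeroSet k v = I} =
      ⋂ i : Fin m, {v | (i ∈ I → v i = 0) ∧ (i ∉ I → i.val < k → 0 < v i)} := by
    ext v
    simp only [mem_iInter]
    constructor
    · rintro ⟨hv, rfl⟩ i
      refine ⟨fun hi => (mem_zeroSet.1 hi).2, fun hi hk => (hv i hk).lt_of_ne' fun h0 => ?_⟩
      exact hi (mem_zeroSet.2 ⟨hk, h0⟩)
    · intro h
      refine ⟨fun i hi => ?_, ?_⟩
      · by_cases hI : i ∈ I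
        exacts [((h i).1 hI).ge, ((h i).2 hI hi).le]
      · ext i
        rw [mem_zeroSet]
        exact ⟨fun h' => by_contra fun hI => ((h i).2 hI h'.1).ne' h'.2,
          fun hi => ⟨hI i hi, (h i).1 hi⟩⟩
  rw [this]
  refine convex_iInter fun i => ?_
  intro v hv w hw s t hs ht hst
  refine ⟨fun hi => by simp [hv.1 hi, hw.1 hi], fun hi hk => ?_⟩
  have h1 := hv.2 hi hk
  have h2 := hw.2 hi hk
  rcases hs.eq_or_lt with rfl | hs
  · have : t = 1 := by linarith
    simpa [this] using h2
  · simp only [Pi.add_apply, Pi.smul_apply, smul_eq_mul]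
    have := mul_pos hs h1
    have := mul_nonneg ht h2.le
    linarith

theorem isPreconnected_cell (hc : IsOpenEmbedding c.toFun) {ε : ℝ}
    (hε : Metric.ball u ε ∩ orthant k m ⊆ c.dom) (hI : ∀ i ∈ I, i.val < k) :
    IsPreconnected (cell c u ε I) := by
  set P := Metric.ball u ε ∩ {v | v ∈ orthant k m ∧ zeroSet k v = I} with hP
  have hPd : P ⊆ c.dom := fun v hv => hε ⟨hv.1, hv.2.1⟩
  have h1 : IsPreconnected P := ((convex_ball u ε).inter (convex_zeroSet_eq k I hI)).isPreconnected
  have h2 : IsPreconnected (Subtype.val ⁻¹' P : Set c.dom) := by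
    rw [← Topology.IsInducing.subtypeVal.isPreconnected_image, Subtype.image_preimage_coe,
      inter_eq_right.2 hPd]
    exact h1
  have h3 : cell c u ε I = c.toFun '' (Subtype.val ⁻¹' P) := by
    ext y
    constructor
    · rintro ⟨v, hv, ⟨hd, rfl⟩, h⟩
      exact ⟨⟨v, hd⟩, ⟨hv, c.isOpen_dom.subset hd, h⟩, rfl⟩
    · rintro ⟨v, ⟨h1, -, h2⟩, rfl⟩
      exact ⟨v, h1, ⟨v.2, rfl⟩, h2⟩
  rw [h3]
  exact h2.image _ hc.continuous.continuousOn

/-- The image of the `ε`-ball about `u` under the chart `c`. -/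
def boxNhd (hc : IsOpenEmbedding c.toFun) (hu : At c u x) {ε : ℝ} (hε : 0 < ε) : OpenNhdsOf x where
  carrier := {y | ∃ v ∈ Metric.ball u ε, At c v y}
  is_open' := by
    have : {y | ∃ v ∈ Metric.ball u ε, At c v y} = c.toFun '' (Subtype.val ⁻¹' Metric.ball u ε) := by
      ext y
      constructor
      · rintro ⟨v, hv, hd, rfl⟩
        exact ⟨⟨v, hd⟩, hv, rfl⟩
      · rintro ⟨v, hv, rfl⟩
        exact ⟨v, hv, v.2, rfl⟩
    rw [this]
    exact hc.isOpenMap _ (Metric.isOpen_ball.preimage continuous_subtype_val)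
  mem' := ⟨u, Metric.mem_ball_self hε, hu⟩

/-- In a small box, the connected components of the strata are the cells. -/
theorem connectedComponentIn_boxNhd (hX : IsManifold κ X) (hc : c ∈ X.atlas k m) (hu : At c u x)
    {ε : ℝ} (hε : 0 < ε) (hd : Metric.ball u ε ∩ orthant k m ⊆ c.dom) {w : X}
    (hw : w ∈ stratum X p) {v : Fin m → ℝ} (hv : v ∈ Metric.ball u ε) (hvw : At c v w) :
    connectedComponentIn ((boxNhd (hX.isOpenEmbedding c hc) hu hε : Set X) ∩ stratum X p) w =
      cell c u ε (zeroSet k v) := by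
  classical
  set F := (boxNhd (hX.isOpenEmbedding c hc) hu hε : Set X) ∩ stratum X p with hF
  have hwF : w ∈ F := ⟨⟨v, hv, hvw⟩, hw⟩
  have hcard := (hX.mem_stratum_iff hc hvw).1 hw
  refine subset_antisymm ?_ ?_
  -- `z` is the zero set read in the chart `c`. Zero sets can only shrink at nearby points and have
  -- fixed size on a stratum, so `z` is locally constant on `F`, hence constant on connected
  -- subsets. Its value off the range of `c` does not matter.
  · let z : X → Finset (Fin m) := fun y => if h : ∃ v, At c v y then zeroSet k h.choose else ∅
    have hz : ∀ {v y}, At c v y → z y = zeroSet k v := by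
      intro v y h
      have h' : ∃ v, At c v y := ⟨v, h⟩
      simp only [z, h', dif_pos]
      rw [h'.choose_spec.inj h]
    let _ : TopologicalSpace (Finset (Fin m)) := ⊥
    have : DiscreteTopology (Finset (Fin m)) := ⟨rfl⟩
    have hcont : ContinuousOn z F := by
      intro y hy
      obtain ⟨v', hv', hvy⟩ := hy.1
      rw [ContinuousWithinAt, nhds_discrete, tendsto_pure]
      have h1 : ∀ᶠ y' in 𝓝 y, ∃ v'', At c v'' y' ∧ zeroSet k v'' ⊆ zeroSet k v' := by
        refine (hvy.eventually_iff (hX.isOpenEmbedding c hc)).2 ?_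
        filter_upwards [hvy.eventually_exists,
          eventually_nhdsWithin_of_eventually_nhds (eventually_zeroSet_subset k v')] with v'' ⟨y', h⟩ h'
        exact ⟨y', h, v'', h, h'⟩
      filter_upwards [eventually_nhdsWithin_of_eventually_nhds h1, self_mem_nhdsWithin]
        with y' ⟨v'', h2, h3⟩ hy'
      rw [hz h2, hz hvy]
      refine Finset.eq_of_subset_of_card_le h3 ?_
      rw [(hX.mem_stratum_iff hc h2).1 hy'.2, (hX.mem_stratum_iff hc hvy).1 hy.2]
    intro y hy
    have hyF := connectedComponentIn_subset F w hy
    obtain ⟨v', hv', hvy⟩ := hyF.1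
    refine ⟨v', hv', hvy, ?_⟩
    rw [← hz hvy, ← hz hvw]
    exact isPreconnected_connectedComponentIn.constant
      (hcont.mono (connectedComponentIn_subset F w)) hy (mem_connectedComponentIn hwF)
  · refine (isPreconnected_cell (hX.isOpenEmbedding c hc) hd
      fun i hi => (mem_zeroSet.1 hi).1).subset_connectedComponentIn ⟨v, hv, hvw, rfl⟩ ?_
    rintro y ⟨v', hv', hy, h⟩
    exact ⟨⟨v', hv', hy⟩, (hX.mem_stratum_iff hc hy).2 (h ▸ hcard)⟩

/-- In the chart `c`, the corner point `a` is `(c u, c_*{v_i = 0, i ∈ I})`. -/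
structure HasIdx (c : Chart k m X) (u : Fin m → ℝ) (I : Finset (Fin m)) (a : CornerPt X p) :
    Prop where
  at_fst : At c u a.1
  subset : I ⊆ zeroSet k u
  card : I.card = p
  eventually : ∀ V, ∀ᶠ v in 𝓝[orthant k m] u, zeroSet k v = I → ∃ y, At c v y ∧ y ∈ a.2.comp V

/-- Balls in the orthant about a point of the domain inside a given neighbourhood. -/
theorem exists_ball (hu : At c u x) {S : Set (Fin m → ℝ)} (hS : S ∈ 𝓝[orthant k m] u) :
    ∃ ε > 0, ∀ v ∈ Metric.ball u ε ∩ orthant k m, v ∈ c.dom ∧ v ∈ S ∧ zeroSet k v ⊆ zeroSet k u := by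
  obtain ⟨ε, hε, h⟩ := Metric.mem_nhdsWithin_iff.1 (inter_mem (c.isOpen_dom.mem_nhdsWithin hu.1)
    (inter_mem hS (eventually_nhdsWithin_of_eventually_nhds (eventually_zeroSet_subset k u))))
  exact ⟨ε, hε, fun v hv => h hv⟩

theorem mem_closure_of_frequently (hc : IsOpenEmbedding c.toFun) (hu : At c u x) {S : Set X}
    (h : ∃ᶠ v in 𝓝[orthant k m] u, ∃ y, At c v y ∧ y ∈ S) : x ∈ closure S := by
  rw [mem_closure_iff_frequently]
  intro h'
  refine h (((hu.eventually_iff hc).1 h').mono ?_)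
  rintro v ⟨y, hy, hyS⟩ ⟨y', hy', hy'S⟩
  exact hyS (hy.eq hy' ▸ hy'S)

theorem LocalCorner.nonempty_inter (γ : LocalCorner X p x) (V V' : OpenNhdsOf x) :
    (γ.comp V ∩ γ.comp V').Nonempty := closure_nonempty_iff.1 ⟨x, γ.compat V V'⟩

theorem LocalCorner.comp_eq (γ : LocalCorner X p x) (V : OpenNhdsOf x) {w : X} (hw : w ∈ γ.comp V) :
    γ.comp V = connectedComponentIn ((V : Set X) ∩ stratum X p) w := by
  obtain ⟨w', -, h⟩ := γ.isComponent V
  rw [h] at hw ⊢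
  exact connectedComponentIn_eq hw

/-- In a small box, a local corner component is a cell. -/
theorem LocalCorner.comp_boxNhd (hX : IsManifold κ X) (hc : c ∈ X.atlas k m) (hu : At c u x)
    (γ : LocalCorner X p x) {ε : ℝ} (hε : 0 < ε)
    (hd : ∀ v ∈ Metric.ball u ε ∩ orthant k m, v ∈ c.dom ∧ zeroSet k v ⊆ zeroSet k u) :
    ∃ I, I ⊆ zeroSet k u ∧ I.card = p ∧
      γ.comp (boxNhd (hX.isOpenEmbedding c hc) hu hε) = cell c u ε I := by
  obtain ⟨w, ⟨hw1, hw2⟩, h⟩ := γ.isComponent (boxNhd (hX.isOpenEmbedding c hc) hu hε)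
  obtain ⟨v, hv, hvw⟩ := hw1
  refine ⟨zeroSet k v, (hd v ⟨hv, hvw.mem_orthant⟩).2, (hX.mem_stratum_iff hc hvw).1 hw2, ?_⟩
  rw [h]
  exact connectedComponentIn_boxNhd hX hc hu hε (fun v hv => (hd v hv).1) hw2 hv hvw

/-- In a small box the component is the cell of some `I`, and compatibility of the choices forces
the same `I` in all small boxes. For an arbitrary `V`, the cell of a box inside `V` is connected and
meets the component chosen for `V`, so it is contained in it. -/
theorem exists_hasIdx (hX : IsManifold κ X) (hc : c ∈ X.atlas k m) (a : CornerPt X p)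
    (hu : At c u a.1) : ∃ I, HasIdx c u I a := by
  obtain ⟨ε, hε, hb⟩ := exists_ball hu univ_mem
  obtain ⟨I, hI, hIp, hcomp⟩ := a.2.comp_boxNhd hX hc hu hε fun v hv => ⟨(hb v hv).1, (hb v hv).2.2⟩
  refine ⟨I, hu, hI, hIp, fun V => ?_⟩
  have hV := (hu.eventually_iff (hX.isOpenEmbedding c hc)).1 (V.1.2.mem_nhds V.2)
  obtain ⟨δ, hδ, hb'⟩ := exists_ball hu hV
  obtain ⟨I', hI', hIp', hcomp'⟩ :=
    a.2.comp_boxNhd hX hc hu hδ fun v hv => ⟨(hb' v hv).1, (hb' v hv).2.2⟩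
  have hII : I' = I := by
    obtain ⟨y, h1, h2⟩ := a.2.nonempty_inter (boxNhd (hX.isOpenEmbedding c hc) hu hε)
      (boxNhd (hX.isOpenEmbedding c hc) hu hδ)
    rw [hcomp] at h1
    rw [hcomp'] at h2
    obtain ⟨v, -, hv, rfl⟩ := h1
    obtain ⟨v', -, hv', rfl⟩ := h2
    rw [hv.inj hv']
  subst hII
  have hsub : cell c u δ I' ⊆ a.2.comp V := by
    obtain ⟨y, h1, h2⟩ := a.2.nonempty_inter V (boxNhd (hX.isOpenEmbedding c hc) hu hδ)
    rw [a.2.comp_eq V h1]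
    rw [hcomp'] at h2
    refine (isPreconnected_cell (hX.isOpenEmbedding c hc) (fun v hv => (hb' v hv).1)
      fun i hi => (mem_zeroSet.1 (hI hi)).1).subset_connectedComponentIn h2 ?_
    rintro y ⟨v, hv, hy, hz⟩
    obtain ⟨y', hy', hyV⟩ := (hb' v ⟨hv, hy.mem_orthant⟩).2.1
    exact ⟨hy.eq hy' ▸ hyV, (hX.mem_stratum_iff hc hy).2 (hz ▸ hIp)⟩
  filter_upwards [inter_mem_nhdsWithin _ (Metric.ball_mem_nhds u hδ)] with v hv hz
  have hvd := (hb' v ⟨hv.2, hv.1⟩).1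
  exact ⟨_, ⟨hvd, rfl⟩, hsub ⟨v, hv.2, ⟨hvd, rfl⟩, hz⟩⟩

/-- A counterpart to the field `eventually`: for a suitable `V` the whole component, not only its
part near the point, consists of points with zero set `I` in the prescribed set `S`. -/
theorem HasIdx.small (hX : IsManifold κ X) (hc : c ∈ X.atlas k m) {a : CornerPt X p}
    (h : HasIdx c u I a) {S : Set (Fin m → ℝ)} (hS : S ∈ 𝓝[orthant k m] u) :
    ∃ V, ∀ y ∈ a.2.comp V, ∃ v ∈ S, At c v y ∧ zeroSet k v = I := by
  obtain ⟨ε, hε, hb⟩ := exists_ball h.at_fst hS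
  obtain ⟨I', hI', hIp', hcomp⟩ :=
    a.2.comp_boxNhd hX hc h.at_fst hε fun v hv => ⟨(hb v hv).1, (hb v hv).2.2⟩
  have : I = I' := by
    obtain ⟨v, hv, hv'⟩ := ((frequently_zeroSet_eq h.at_fst.mem_orthant h.subset).and_eventually
      (h.eventually (boxNhd (hX.isOpenEmbedding c hc) h.at_fst hε))).exists
    obtain ⟨y, hy, hyc⟩ := hv' hv
    rw [hcomp] at hyc
    obtain ⟨v', -, hv', rfl⟩ := hyc
    rw [← hv, hy.inj hv']
  subst this
  refine ⟨boxNhd (hX.isOpenEmbedding c hc) h.at_fst hε, fun y hy => ?_⟩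
  rw [hcomp] at hy
  obtain ⟨v, hv, hvy, hz⟩ := hy
  exact ⟨v, (hb v ⟨hv, hvy.mem_orthant⟩).2.1, hvy, hz⟩

theorem HasIdx.frequently (h : HasIdx c u I (⟨x, γ⟩ : Σ x : X, LocalCorner X p x)) (V : OpenNhdsOf x) :
    ∃ᶠ v in 𝓝[orthant k m] u, zeroSet k v = I ∧ ∃ y, At c v y ∧ y ∈ γ.comp V :=
  ((frequently_zeroSet_eq h.at_fst.mem_orthant h.subset).and_eventually (h.eventually V)).mono
    fun _ hv => ⟨hv.1, hv.2 hv.1⟩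

theorem HasIdx.unique (hX : IsManifold κ X) (hc : c ∈ X.atlas k m) {a : CornerPt X p}
    {I' : Finset (Fin m)} (h : HasIdx c u I a) (h' : HasIdx c u I' a) : I = I' := by
  obtain ⟨V, hV⟩ := h.small hX hc univ_mem
  obtain ⟨v, hv, y, hy, hyV⟩ := (h'.frequently V).exists
  obtain ⟨v', -, hv', rfl⟩ := hV y hyV
  rw [← hv, hv'.inj hy]

/-- For every `V` both chosen components contain the points with zero set `I` close to `u`. They are
components of the same set with a common point, hence equal. -/
theorem HasIdx.ext {a b : CornerPt X p} (ha : HasIdx c u I a) (hb : HasIdx c u I b) : a = b := by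
  obtain ⟨x, γ⟩ := a
  obtain ⟨y, δ⟩ := b
  obtain rfl : x = y := ha.at_fst.eq hb.at_fst
  congr 1
  refine LocalCorner.ext (funext fun V => ?_)
  obtain ⟨v, ⟨hv, z, hz, hzV⟩, hδ⟩ := ((ha.frequently V).and_eventually (hb.eventually V)).exists
  obtain ⟨z', hz', hzV'⟩ := hδ hv
  obtain rfl := hz.eq hz'
  rw [γ.comp_eq V hzV, δ.comp_eq V hzV']

/-- Every admissible index occurs: to `V` is assigned the component that contains the cell of `I` in
a box inside `V`. Any two of these components share points with zero set `I` arbitrarily near `x`,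
which makes them compatible. -/
theorem exists_cornerPt (hX : IsManifold κ X) (hc : c ∈ X.atlas k m) (hu : At c u x)
    (hI : I ⊆ zeroSet k u) (hIp : I.card = p) :
    ∃ a : CornerPt X p, HasIdx c u I a := by
  have hV : ∀ V : OpenNhdsOf x, ∃ ε > 0, ∀ v ∈ Metric.ball u ε ∩ orthant k m, v ∈ c.dom ∧
      (∃ y, At c v y ∧ y ∈ (V : Set X)) ∧ zeroSet k v ⊆ zeroSet k u := fun V =>
    exists_ball hu ((hu.eventually_iff (hX.isOpenEmbedding c hc)).1 (V.1.2.mem_nhds V.2))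
  choose ε hε hb using hV
  have hv : ∀ V, ∃ v ∈ Metric.ball u (ε V) ∩ orthant k m, zeroSet k v = I := fun V => by
    obtain ⟨v, hv, hv'⟩ := ((frequently_zeroSet_eq hu.mem_orthant hI).and_eventually
      (inter_mem_nhdsWithin _ (Metric.ball_mem_nhds u (hε V)))).exists
    exact ⟨v, ⟨hv'.2, hv'.1⟩, hv⟩
  choose v hv hvI using hv
  have hcell : ∀ V, cell c u (ε V) I ⊆ (V : Set X) ∩ stratum X p := by
    rintro V y ⟨v, hv, hy, hz⟩
    obtain ⟨y', hy', hyV⟩ := (hb V v ⟨hv, hy.mem_orthant⟩).2.1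
    exact ⟨hy.eq hy' ▸ hyV, (hX.mem_stratum_iff hc hy).2 (hz ▸ hIp)⟩
  let w : OpenNhdsOf x → X := fun V => c.toFun ⟨v V, (hb V _ (hv V)).1⟩
  have hw : ∀ V, w V ∈ cell c u (ε V) I := fun V => ⟨v V, (hv V).1, ⟨_, rfl⟩, hvI V⟩
  let C : OpenNhdsOf x → Set X := fun V => connectedComponentIn ((V : Set X) ∩ stratum X p) (w V)
  have hC : ∀ V, cell c u (ε V) I ⊆ C V := fun V =>
    (isPreconnected_cell (hX.isOpenEmbedding c hc) (fun v hv => (hb V v hv).1)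
      fun i hi => (mem_zeroSet.1 (hI hi)).1).subset_connectedComponentIn (hw V) (hcell V)
  have hev : ∀ V, ∀ᶠ v in 𝓝[orthant k m] u, zeroSet k v = I → ∃ y, At c v y ∧ y ∈ C V := by
    intro V
    filter_upwards [inter_mem_nhdsWithin _ (Metric.ball_mem_nhds u (hε V))] with v hv hz
    have hvd := (hb V v ⟨hv.2, hv.1⟩).1
    exact ⟨_, ⟨hvd, rfl⟩, hC V ⟨v, hv.2, ⟨hvd, rfl⟩, hz⟩⟩
  have hfr := frequently_zeroSet_eq hu.mem_orthant hI
  refine ⟨⟨x, C, fun V => ⟨w V, hcell V (hw V), rfl⟩, fun V => ?_, fun V V' => ?_⟩, hu, hI, hIp, hev⟩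
  · exact mem_closure_of_frequently (hX.isOpenEmbedding c hc) hu
      ((hfr.and_eventually (hev V)).mono fun v hv => hv.2 hv.1)
  · refine mem_closure_of_frequently (hX.isOpenEmbedding c hc) hu
      ((hfr.and_eventually ((hev V).and (hev V'))).mono fun v hv => ?_)
    obtain ⟨y, hy, h1⟩ := hv.2.1 hv.1
    obtain ⟨y', hy', h2⟩ := hv.2.2 hv.1
    obtain rfl := hy.eq hy'
    exact ⟨y, hy, h1, h2⟩

/-! ### The action of maps on local corner components, in charts -/

variable {f : X → Y} {g : (Fin m → ℝ) → Fin n → ℝ} {φ : Finset (Fin m) → Finset (Fin n)}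
  {a : CornerPt X p} {b : CornerPt Y q}

/-- The combinatorial form of `f_*`. Points of the given component near `x` have zero set `I`, so
their images have zero set `φ I`, while points of the target component near `f x` have zero set `J`.
-/
theorem isPushCorner_iff_of_hasIdx (hX : IsManifold κ X) (hY : IsManifold κ Y)
    (hc : c ∈ X.atlas k m) (hd : d ∈ Y.atlas l n) (ha : HasIdx c u I a) (hb : HasIdx d (g u) J b)
    (hg : RepAt c d f g u) (hgc : ContinuousWithinAt g (orthant k m) u) (hφ : HasPattern k l g u φ) :
    IsPushCorner f a b ↔ J = φ I := by
  constructor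
  · rintro ⟨-, h⟩
    obtain ⟨V, hV⟩ := ha.small hX hc (inter_mem hg hφ.2)
    obtain ⟨V', hV'⟩ := hb.small hY hd univ_mem
    obtain ⟨_, ⟨y, hy, rfl⟩, hy'⟩ := h V V'
    obtain ⟨v, ⟨⟨y1, h1, h2⟩, h3⟩, h4, rfl⟩ := hV y hy
    obtain ⟨w, -, h5, rfl⟩ := hV' _ hy'
    obtain rfl := h1.eq h4
    rw [← h3.out, h5.inj h2]
  · rintro rfl
    refine ⟨hb.at_fst.eq (hg.self ha.at_fst), fun V V' => ?_⟩
    obtain ⟨v, ⟨h1, y, hy, hyV⟩, ⟨y1, h2, h3⟩, h4, h5⟩ := ((ha.frequently V).and_eventually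
      (hg.and (hφ.2.and ((hg.tendsto hgc).eventually (hb.eventually V'))))).exists
    obtain rfl := hy.eq h2
    obtain ⟨z, hz, hzV⟩ := h5 (by rw [h4, h1])
    obtain rfl := hz.eq h3
    exact ⟨_, ⟨y, hyV, rfl⟩, hzV⟩

/-- Points with zero set `J` accumulate at a point with zero set `φ I` exactly when `J ⊆ φ I`: zero
sets can only shrink at nearby points, and every smaller set does occur there. -/
theorem liesOver_iff_of_hasIdx (hX : IsManifold κ X) (hY : IsManifold κ Y)
    (hc : c ∈ X.atlas k m) (hd : d ∈ Y.atlas l n) (ha : HasIdx c u I a) (hb : HasIdx d (g u) J b)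
    (hg : RepAt c d f g u) (hgc : ContinuousWithinAt g (orthant k m) u) (hφ : HasPattern k l g u φ) :
    LiesOver f a b ↔ J ⊆ φ I := by
  constructor
  · rintro ⟨-, h⟩
    obtain ⟨V', hV'⟩ := hb.small hY hd univ_mem
    obtain ⟨V, hV⟩ := h V'
    obtain ⟨v, ⟨h1, y, hy, hyV⟩, ⟨y1, h2, h3⟩, h4⟩ :=
      ((ha.frequently V).and_eventually (hg.and hφ.2)).exists
    obtain rfl := hy.eq h2
    have hcl := hV ⟨y, hyV, rfl⟩
    rw [mem_closure_iff_frequently] at hcl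
    have hev : ∀ᶠ z in 𝓝 (f y), ∃ w, At d w z ∧ zeroSet l w ⊆ zeroSet l (g v) := by
      refine (h3.eventually_iff (hY.isOpenEmbedding d hd)).2 ?_
      filter_upwards [h3.eventually_exists, eventually_nhdsWithin_of_eventually_nhds
        (eventually_zeroSet_subset l (g v))] with w ⟨z, hz⟩ hw
      exact ⟨z, hz, w, hz, hw⟩
    obtain ⟨z, hz, w, hw, hsub⟩ := (hcl.and_eventually hev).exists
    obtain ⟨w', -, hw', rfl⟩ := hV' z hz
    obtain rfl := hw.inj hw'
    rwa [h4, h1] at hsub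
  · intro hJ
    refine ⟨(hb.at_fst.eq (hg.self ha.at_fst)).symm, fun V' => ?_⟩
    obtain ⟨V, hV⟩ := ha.small hX hc (inter_mem (inter_mem hg hφ.2)
      ((hg.tendsto hgc).eventually (eventually_eventually_nhdsWithin.2 (hb.eventually V'))))
    refine ⟨V, ?_⟩
    rintro _ ⟨y, hy, rfl⟩
    obtain ⟨v, ⟨⟨⟨y1, h1, h2⟩, h3⟩, h4⟩, h5, rfl⟩ := hV y hy
    obtain rfl := h1.eq h5
    refine mem_closure_of_frequently (hY.isOpenEmbedding d hd) h2
      (((frequently_zeroSet_eq h2.mem_orthant (I := J) ?_).and_eventually h4).mono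
        fun w hw => hw.2 hw.1)
    rw [h3.out]
    exact hJ

theorem HasPattern.subset_zeroSet (hφ : HasPattern k l g u φ) (hu : u ∈ orthant k m)
    (hI : I ⊆ zeroSet k u) : φ I ⊆ zeroSet l (g u) := by
  rw [hφ.2.self_of_nhdsWithin hu]
  exact hφ.mono hI

theorem HasIdx.of_isPushCorner (hX : IsManifold κ X) (hY : IsManifold κ Y)
    (hc : c ∈ X.atlas k m) (hd : d ∈ Y.atlas l n) (ha : HasIdx c u I a) (hab : IsPushCorner f a b)
    (hg : RepAt c d f g u) (hgc : ContinuousWithinAt g (orthant k m) u) (hφ : HasPattern k l g u φ) :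
    HasIdx d (g u) (φ I) b := by
  have hu : At d (g u) b.1 := hab.1 ▸ hg.self ha.at_fst
  obtain ⟨J, hJ⟩ := exists_hasIdx hY hd b hu
  rwa [(isPushCorner_iff_of_hasIdx hX hY hc hd ha hJ hg hgc hφ).1 hab] at hJ

theorem isPushCorner_id (a : CornerPt X p) : IsPushCorner id a a :=
  ⟨rfl, fun V V' => by simpa using a.2.nonempty_inter V V'⟩

/-- Change of charts for indices of corner points. -/
theorem HasIdx.change (hX : IsManifold κ X) {d : Chart l n X} (hc : c ∈ X.atlas k m)
    (hd : d ∈ X.atlas l n) (ha : HasIdx c u I a)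
    (hg : RepAt c d id g u) (hgc : ContinuousWithinAt g (orthant k m) u)
    (hφ : HasPattern k l g u φ) : HasIdx d (g u) (φ I) a :=
  ha.of_isPushCorner hX hX hc hd (isPushCorner_id a) hg hgc hφ

/-- A smooth map acts on corner points. -/
theorem existsUnique_isPushCorner (hX : IsManifold κ X) (hY : IsManifold κ Y) {b : Prop}
    (hf : IsMap κ b X Y f) (a : CornerPt X p) :
    ∃! w : Σ q, CornerPt Y q, IsPushCorner f a w.2 := by
  obtain ⟨k, m, c, hc, u, hu⟩ := hX.exists_at a.1
  obtain ⟨l, n, d, hd, v, hv⟩ := hY.exists_at (f a.1)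
  obtain ⟨g, hg, hgm, rfl⟩ := hf.exists_rep hc hd hu hv
  obtain ⟨I, ha⟩ := exists_hasIdx hX hc a hu
  obtain ⟨φ, hφ, -⟩ := hgm.exists_pattern
  have hgc := hgm.continuousWithinAt hu.mem_orthant
  obtain ⟨w, hw⟩ := exists_cornerPt hY hd hv (hφ.subset_zeroSet hu.mem_orthant ha.subset) rfl
  refine ⟨⟨_, w⟩, (isPushCorner_iff_of_hasIdx hX hY hc hd ha hw hg hgc hφ).2 rfl, ?_⟩
  rintro ⟨q, w'⟩ hw'
  have h' := ha.of_isPushCorner hX hY hc hd hw' hg hgc hφ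
  obtain rfl : (φ I).card = q := h'.card
  rw [hw.ext h']

theorem IsPushCorner.unique (hX : IsManifold κ X) (hY : IsManifold κ Y) {b : Prop}
    (hf : IsMap κ b X Y f) {a : CornerPt X p} {w w' : Σ q, CornerPt Y q}
    (h : IsPushCorner f a w.2) (h' : IsPushCorner f a w'.2) : w = w' :=
  (existsUnique_isPushCorner hX hY hf a).unique h h'

/-- The pattern of a composite map is the composite of the patterns. -/
theorem IsPushCorner.comp {Z : AtlasSpace.{u}} {r : ℕ} (hX : IsManifold κ X) (hY : IsManifold κ Y)
    (hZ : IsManifold κ Z) {s : Prop} (hf : IsMap κ s X Y f) {f' : Y → Z} (hf' : IsMap κ s Y Z f')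
    {e : CornerPt Z r} (hab : IsPushCorner f a b) (hbe : IsPushCorner f' b e) :
    IsPushCorner (f' ∘ f) a e := by
  obtain ⟨k, m, c, hc, u, hu⟩ := hX.exists_at a.1
  obtain ⟨l, n, d, hd, v, hv⟩ := hY.exists_at (f a.1)
  obtain ⟨k', m', c', hc', w, hw⟩ := hZ.exists_at (f' (f a.1))
  obtain ⟨g, hg, hgm, rfl⟩ := hf.exists_rep hc hd hu hv
  obtain ⟨h, hh, hhm, rfl⟩ := hf'.exists_rep hd hc' hv hw
  obtain ⟨I, ha⟩ := exists_hasIdx hX hc a hu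
  obtain ⟨φ, hφ, -⟩ := hgm.exists_pattern
  obtain ⟨ψ, hψ, -⟩ := hhm.exists_pattern
  have hgc := hgm.continuousWithinAt hu.mem_orthant
  have hhc := hhm.continuousWithinAt hv.mem_orthant
  have h1 := ha.of_isPushCorner hX hY hc hd hab hg hgc hφ
  have h2 := h1.of_isPushCorner hY hZ hd hc' hbe hh hhc hψ
  have hcomp : ContinuousWithinAt (fun v => h (g v)) (orthant k m) u :=
    (hhm.comp hu.mem_orthant hgm hg.maps).continuousWithinAt hu.mem_orthant
  refine (isPushCorner_iff_of_hasIdx (g := fun v => h (g v)) (φ := fun I => ψ (φ I)) hX hZ hc hc'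
    ha h2 (hg.comp hgc hh) hcomp ⟨fun I J => by simp only [hφ.1, hψ.1], ?_⟩).2 rfl
  filter_upwards [hφ.2, (hg.tendsto hgc).eventually hψ.2] with v h1 h2
  rw [h2, h1]

end Corner

end ACorners

namespace ACorners

/-! ### Faces of orthants -/

/-- A face of `[0,∞)ᵏ × ℝᵐ⁻ᵏ` of codimension `p`, with its coordinates. -/
structure Face (k m k' m' p : ℕ) where
  dim_add : m' + p = m
  bound_add : k' + p = k
  ι : Fin m' ↪o Fin m
  mem_range : ∀ i : Fin m, k ≤ i.val → i ∈ range ι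

namespace Face

variable {k m k' m' p : ℕ} (F : Face k m k' m' p)

/-- The inclusion of the face. -/
noncomputable def ins (y : Fin m' → ℝ) : Fin m → ℝ := insertZeros F.ι y

/-- The projection to the face. -/
def restr (x : Fin m → ℝ) : Fin m' → ℝ := fun i => x (F.ι i)

/-- The coordinates that vanish on the face. -/
noncomputable def missing : Finset (Fin m) := by classical exact Finset.univ.filter fun i => i ∉ range F.ι

theorem mem_missing {i : Fin m} : i ∈ F.missing ↔ i ∉ range F.ι := by simp [missing]

theorem ι_notMem_missing (i : Fin m') : F.ι i ∉ F.missing := fun h => F.mem_missing.1 h ⟨i, rfl⟩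

theorem ins_ι (y : Fin m' → ℝ) (i : Fin m') : F.ins y (F.ι i) = y i :=
  F.ι.injective.extend_apply _ _ _

theorem ins_missing (y : Fin m' → ℝ) {i : Fin m} (hi : i ∈ F.missing) : F.ins y i = 0 :=
  Function.extend_apply' _ _ _ fun ⟨a, ha⟩ => F.mem_missing.1 hi ⟨a, ha⟩

theorem lt_of_mem_missing {i : Fin m} (hi : i ∈ F.missing) : i.val < k := by
  by_contra h
  exact F.mem_missing.1 hi (F.mem_range i (not_lt.1 h))

theorem card_missing : F.missing.card = p := by
  classical
  have h : F.missing = (Finset.univ.map F.ι.toEmbedding)ᶜ := by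
    ext i; simp [mem_missing]
  have := F.dim_add
  rw [h, Finset.card_compl, Finset.card_map]
  simp
  omega

/-- As `ι` is increasing, the indices sent below `k` form an initial segment. Its length is `k - p =
k'`, because all `p` missing coordinates lie below `k`. -/
theorem ι_lt_iff (hkm : k ≤ m) (i : Fin m') : (F.ι i).val < k ↔ i.val < k' := by
  classical
  let S : Finset (Fin m') := Finset.univ.filter fun j => (F.ι j).val < k
  have hcard : S.card = k' := by
    have h1 : (S.map F.ι.toEmbedding) ∪ F.missing = Finset.univ.filter fun i : Fin m => i.val < k := by
      ext i
      simp only [Finset.mem_union, Finset.mem_map, Finset.mem_filter, Finset.mem_univ, true_and, S]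
      constructor
      · rintro (⟨j, hj, rfl⟩ | h)
        exacts [hj, F.lt_of_mem_missing h]
      · intro hi
        by_cases h : i ∈ range F.ι
        · obtain ⟨j, rfl⟩ := h
          exact .inl ⟨j, hi, rfl⟩
        · exact .inr (F.mem_missing.2 h)
    have h2 : Disjoint (S.map F.ι.toEmbedding) F.missing := by
      rw [Finset.disjoint_left]
      rintro i hi h
      obtain ⟨j, -, rfl⟩ := Finset.mem_map.1 hi
      exact F.ι_notMem_missing j h
    have h3 := congrArg Finset.card h1
    rw [Finset.card_union_of_disjoint h2, Finset.card_map, F.card_missing,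
      Fin.card_filter_val_lt] at h3
    have := F.bound_add
    omega
  have hlow : ∀ a b : Fin m', a ≤ b → b ∈ S → a ∈ S := by
    intro a b hab hb
    have : F.ι a ≤ F.ι b := F.ι.monotone hab
    simp only [S, Finset.mem_filter, Finset.mem_univ, true_and] at hb ⊢
    exact lt_of_le_of_lt this hb
  have hmem : i ∈ S ↔ (F.ι i).val < k := by simp [S]
  rw [← hmem]
  constructor
  · intro hi
    have : Finset.Iic i ⊆ S := fun a ha => hlow a i (Finset.mem_Iic.1 ha) hi
    have := Finset.card_le_card this
    rw [Fin.card_Iic, hcard] at this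
    omega
  · intro hi
    by_contra h
    have : S ⊆ Finset.Iio i := fun a ha => Finset.mem_Iio.2 (lt_of_not_ge fun h' => h (hlow _ _ h' ha))
    have := Finset.card_le_card this
    rw [Fin.card_Iio, hcard] at this
    omega

theorem restr_ins (y : Fin m' → ℝ) : F.restr (F.ins y) = y := funext fun i => F.ins_ι y i

theorem ins_injective : Function.Injective F.ins :=
  Function.LeftInverse.injective F.restr_ins

theorem ins_restr {x : Fin m → ℝ} (hx : ∀ i ∈ F.missing, x i = 0) : F.ins (F.restr x) = x := by
  funext i
  by_cases h : i ∈ range F.ι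
  · obtain ⟨j, rfl⟩ := h
    rw [ins_ι, restr]
  · rw [F.ins_missing _ (F.mem_missing.2 h), hx i (F.mem_missing.2 h)]

theorem continuous_ins : Continuous F.ins := by
  refine continuous_pi fun i => ?_
  by_cases h : i ∈ range F.ι
  · obtain ⟨j, rfl⟩ := h
    simpa only [ins_ι] using continuous_apply j
  · simpa only [F.ins_missing _ (F.mem_missing.2 h)] using continuous_const

theorem ins_mem_orthant_iff (hkm : k ≤ m) {y : Fin m' → ℝ} : F.ins y ∈ orthant k m ↔ y ∈ orthant k' m' := by
  constructor
  · intro h i hi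
    have := h (F.ι i) ((F.ι_lt_iff hkm i).2 hi)
    rwa [ins_ι] at this
  · intro h i hi
    by_cases h' : i ∈ range F.ι
    · obtain ⟨j, rfl⟩ := h'
      rw [ins_ι]
      exact h j ((F.ι_lt_iff hkm j).1 hi)
    · rw [F.ins_missing _ (F.mem_missing.2 h')]

theorem tendsto_ins (hkm : k ≤ m) (y : Fin m' → ℝ) :
    Tendsto F.ins (𝓝[orthant k' m'] y) (𝓝[orthant k m] (F.ins y)) :=
  tendsto_nhdsWithin_iff.2 ⟨F.continuous_ins.continuousWithinAt,
    eventually_mem_nhdsWithin.mono fun _ h => (F.ins_mem_orthant_iff hkm).2 h⟩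

theorem mem_zeroSet_ins_ι (hkm : k ≤ m) {y : Fin m' → ℝ} {i : Fin m'} :
    F.ι i ∈ zeroSet k (F.ins y) ↔ i ∈ zeroSet k' y := by
  rw [mem_zeroSet, mem_zeroSet, F.ι_lt_iff hkm, ins_ι]

theorem missing_subset_zeroSet (y : Fin m' → ℝ) : F.missing ⊆ zeroSet k (F.ins y) := fun _ hi =>
  mem_zeroSet.2 ⟨F.lt_of_mem_missing hi, F.ins_missing y hi⟩

theorem zeroSet_ins (hkm : k ≤ m) (y : Fin m' → ℝ) :
    zeroSet k (F.ins y) = F.missing ∪ (zeroSet k' y).map F.ι.toEmbedding := by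
  ext i
  rw [Finset.mem_union, Finset.mem_map]
  constructor
  · intro h
    by_cases h' : i ∈ range F.ι
    · obtain ⟨j, rfl⟩ := h'
      exact .inr ⟨j, (F.mem_zeroSet_ins_ι hkm).1 h, rfl⟩
    · exact .inl (F.mem_missing.2 h')
  · rintro (h | ⟨j, hj, rfl⟩)
    exacts [F.missing_subset_zeroSet y h, (F.mem_zeroSet_ins_ι hkm).2 hj]

theorem hasPattern_ins (hkm : k ≤ m) (y : Fin m' → ℝ) :
    HasPattern k' k F.ins y fun I => F.missing ∪ I.map F.ι.toEmbedding := by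
  refine ⟨fun I J => ?_, .of_forall fun y => F.zeroSet_ins hkm y⟩
  ext i
  simp only [Finset.map_union, Finset.mem_union]
  tauto

theorem mapAt_ins (κ : Kind) (hkm : k ≤ m) {y : Fin m' → ℝ} (hy : y ∈ orthant k' m') :
    MapAt κ False k' k F.ins y := by
  refine mapAt_of_coord κ hy fun j => ?_
  by_cases h : j ∈ range F.ι
  · obtain ⟨i, rfl⟩ := h
    exact .inl ⟨i, (F.ι_lt_iff hkm i).1, fun x => F.ins_ι x i⟩
  · exact .inr ⟨id, fun x => F.ins_missing x (F.mem_missing.2 h)⟩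

theorem mapAt_restr (κ : Kind) (b : Prop) (hkm : k ≤ m) {x : Fin m → ℝ} (hx : x ∈ orthant k m) :
    MapAt κ b k k' F.restr x :=
  mapAt_of_coord κ hx fun j => .inl ⟨F.ι j, (F.ι_lt_iff hkm j).2, fun _ => rfl⟩

end Face

theorem exists_face {k m p : ℕ} (hkm : k ≤ m) {I : Finset (Fin m)} (hI : ∀ i ∈ I, i.val < k)
    (hp : I.card = p) : ∃ k' m' : ℕ, ∃ F : Face k m k' m' p, F.missing = I := by
  classical
  have h1 : p ≤ k := by
    have : I ⊆ Finset.univ.filter fun i : Fin m => i.val < k := fun i hi => by simp [hI i hi]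
    have := Finset.card_le_card this
    rw [Fin.card_filter_val_lt] at this
    omega
  have hcard : (Iᶜ).card = m - p := by rw [Finset.card_compl, Fintype.card_fin, hp]
  have hr : range (Iᶜ.orderEmbOfFin hcard) = {i | i ∉ I} := by
    rw [Finset.range_orderEmbOfFin]; ext; simp
  refine ⟨k - p, m - p, ⟨by omega, by omega, Iᶜ.orderEmbOfFin hcard, fun i hi => ?_⟩, ?_⟩
  · rw [hr]
    exact fun h => (hI i h).not_ge hi
  · ext i
    rw [Face.mem_missing]
    dsimp only
    rw [hr]
    simp

/-! ### Face charts -/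

/-- In `IsFace.push` the representative is assumed smooth at one point only, while its continuity is
needed at nearby points; there it is deduced from the continuity of `f`. -/
theorem RepAt.continuousWithinAt {k m l n : ℕ} {X Y : Type u} [TopologicalSpace X]
    [TopologicalSpace Y] {c : Chart k m X} {d : Chart l n Y} {f : X → Y}
    {g : (Fin m → ℝ) → Fin n → ℝ} {u : Fin m → ℝ} {x : X} (hc : IsOpenEmbedding c.toFun)
    (hd : IsOpenEmbedding d.toFun) (hu : At c u x) (hg : RepAt c d f g u) (hf : ContinuousAt f x) :
    ContinuousWithinAt g (orthant k m) u := by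
  intro N hN
  have h1 : ∀ᶠ z in 𝓝 (f x), ∃ w ∈ N, At d w z := by
    refine ((hg.self hu).eventually_iff hd).2 ?_
    filter_upwards [(hg.self hu).eventually_exists, mem_nhdsWithin_of_mem_nhds hN] with w ⟨z, hz⟩ hw
    exact ⟨z, hz, w, hw, hz⟩
  change ∀ᶠ v in 𝓝[orthant k m] u, g v ∈ N
  filter_upwards [(hu.eventually_iff hc).1 (hf.eventually h1), hg]
    with v ⟨y, hy, w, hw, hwz⟩ ⟨y', hy', hgy⟩
  obtain rfl := hy.eq hy'
  rw [← hwz.inj hgy]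
  exact hw

section FaceChart

variable {κ : Kind} {X Y : AtlasSpace.{u}} {k m l n p q k' m' l' n' : ℕ} {c : Chart k m X}
  {c' : Chart k' m' (CornerPt X p)} {d : Chart l n Y} {d' : Chart l' n' (CornerPt Y q)}
  {F : Face k m k' m' p} {G : Face l n l' n' q}

/-- `c'` is the chart of the corners of `X` given by the chart `c` and the face `F`. -/
def IsFace (F : Face k m k' m' p) (c : Chart k m X) (c' : Chart k' m' (CornerPt X p)) : Prop :=
  c'.dom = {y | F.ins y ∈ c.dom} ∧ ∀ y a, At c' y a → HasIdx c (F.ins y) F.missing a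

theorem IsFace.at_iff (h : IsFace F c c') {y : Fin m' → ℝ} {a : CornerPt X p} :
    At c' y a ↔ HasIdx c (F.ins y) F.missing a := by
  refine ⟨h.2 y a, fun ha => ?_⟩
  have hy : y ∈ c'.dom := by rw [h.1]; exact ha.at_fst.1
  have h1 : At c' y (c'.toFun ⟨y, hy⟩) := ⟨hy, rfl⟩
  rwa [(h.2 _ _ h1).ext ha] at h1

/-- The closure condition says that the component meets the cell of `F.missing` near the point.
Tested on a neighbourhood from `HasIdx.small`, where all points have zero set `I`, it forces `I =
F.missing`. -/
theorem isFaceChart_iff (hX : IsManifold κ X) (hc : c ∈ X.atlas k m) :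
    IsFaceChart c c' ↔ ∃ F : Face k m k' m' p, IsFace F c c' := by
  have key : ∀ (F : Face k m k' m' p) (y : Fin m' → ℝ),
      {v : c.dom | ∀ i : Fin m, i.val < k → (v.1 i = 0 ↔ i ∉ range F.ι)} =
      {v : c.dom | zeroSet k v.1 = F.missing} := by
    intro F y
    ext v
    change (∀ i : Fin m, i.val < k → (v.1 i = 0 ↔ i ∉ range F.ι)) ↔ zeroSet k v.1 = F.missing
    rw [Finset.ext_iff]
    refine forall_congr' fun i => ?_
    rw [mem_zeroSet, F.mem_missing]
    constructor
    · intro h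
      exact ⟨fun h' => (h h'.1).1 h'.2, fun h' => ⟨F.lt_of_mem_missing (F.mem_missing.2 h'),
        (h (F.lt_of_mem_missing (F.mem_missing.2 h'))).2 h'⟩⟩
    · exact fun h hi => ⟨fun h0 => h.1 ⟨hi, h0⟩, fun h' => (h.2 h').2⟩
  constructor
  · rintro ⟨hm, hk, ι, hι, hdom, h⟩
    refine ⟨⟨hm, hk, ι, hι⟩, hdom, ?_⟩
    set F : Face k m k' m' p := ⟨hm, hk, ι, hι⟩ with hF
    rintro y _ ⟨hy, rfl⟩
    have hy' : F.ins y ∈ c.dom := by rw [hdom] at hy; exact hy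
    obtain ⟨h1, h2⟩ := h y hy hy'
    have hu : At c (F.ins y) (c'.toFun ⟨y, hy⟩).1 := ⟨hy', h1.symm⟩
    obtain ⟨I, hI⟩ := exists_hasIdx hX hc _ hu
    obtain ⟨V, hV⟩ := hI.small hX hc univ_mem
    have h3 := h2 V
    rw [key F y] at h3
    obtain ⟨z, hz, w, hw, rfl⟩ := closure_nonempty_iff.1 ⟨_, h3⟩
    obtain ⟨v, -, hv, rfl⟩ := hV _ hz
    have : v = w := hv.inj ⟨w.2, rfl⟩
    have hw' : zeroSet k w.1 = F.missing := hw
    rwa [this, hw'] at hI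
  · rintro ⟨F, hdom, h⟩
    refine ⟨F.dim_add, F.bound_add, F.ι, F.mem_range, hdom, fun y hy hy' => ?_⟩
    have hI := h y _ ⟨hy, rfl⟩
    refine ⟨hI.at_fst.eq ⟨hy', rfl⟩, fun V => ?_⟩
    rw [key F y]
    refine mem_closure_of_frequently (hX.isOpenEmbedding c hc) hI.at_fst
      ((hI.frequently V).mono ?_)
    rintro v ⟨hv, z, hz, hzV⟩
    exact ⟨z, hz, hzV, ⟨v, hz.1⟩, hv, hz.2⟩

theorem exists_isFace (hX : IsManifold κ X) (hc : c ∈ X.atlas k m) (F : Face k m k' m' p) :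
    ∃ c', IsFace F c c' := by
  choose a ha using fun y : {y | F.ins y ∈ c.dom} => exists_cornerPt hX hc
    (⟨y.2, rfl⟩ : At c (F.ins y) _) (F.missing_subset_zeroSet y.1) F.card_missing
  have h1 := F.dim_add
  have h2 := F.bound_add
  have h3 := c.le
  refine ⟨⟨by omega, _, isOpenInOrthant_iff.2 ⟨fun y hy => ?_, fun y hy => ?_⟩, a, fun y y' h => ?_⟩,
    rfl, ?_⟩
  · exact (F.ins_mem_orthant_iff c.le).1 (c.isOpen_dom.subset hy)
  · exact F.tendsto_ins c.le y (c.isOpen_dom.mem_nhdsWithin hy)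
  · have h4 := (ha y).at_fst
    rw [h] at h4
    exact Subtype.ext (F.ins_injective (h4.inj (ha y').at_fst))
  · rintro y _ ⟨hy, rfl⟩
    exact ha ⟨y, hy⟩

theorem mem_faceCharts_iff (hX : IsManifold κ X) : c' ∈ faceCharts X p k' m' ↔
    ∃ k m : ℕ, ∃ c ∈ X.atlas k m, ∃ F : Face k m k' m' p, IsFace F c c' := by
  refine exists₂_congr fun k m => exists_congr fun c => and_congr_right fun hc => ?_
  exact isFaceChart_iff hX hc

theorem HasIdx.exists_face (hX : IsManifold κ X) (hc : c ∈ X.atlas k m) {u : Fin m → ℝ}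
    {I : Finset (Fin m)} {a : CornerPt X p} (h : HasIdx c u I a) :
    ∃ (k' m' : ℕ) (F : Face k m k' m' p) (c' : Chart k' m' (CornerPt X p)) (y : Fin m' → ℝ),
      F.missing = I ∧ IsFace F c c' ∧ F.ins y = u ∧ At c' y a := by
  obtain ⟨k', m', F, rfl⟩ := ACorners.exists_face c.le
    (fun i hi => (mem_zeroSet.1 (h.subset hi)).1) h.card
  obtain ⟨c', hc'⟩ := exists_isFace hX hc F
  have hu : F.ins (F.restr u) = u := F.ins_restr fun i hi => (mem_zeroSet.1 (h.subset hi)).2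
  exact ⟨k', m', F, c', F.restr u, rfl, hc', hu, hc'.at_iff.2 (hu.symm ▸ h)⟩

/-- A component vanishing near `u` would vanish at points with empty zero set, and such points
accumulate at `u`. -/
theorem MapAt.to_interior {κ : Kind} {b : Prop} {g : (Fin m → ℝ) → Fin n → ℝ} {u : Fin m → ℝ}
    (hg : MapAt κ b k l g u) (hu : u ∈ orthant k m)
    (h : ∀ᶠ x in 𝓝[orthant k m] u, zeroSet k x = ∅ → zeroSet l (g x) = ∅) : MapAt κ True k l g u := by
  refine fun j => ⟨(hg j).1, fun hj => .inl (((hg j).2 hj).resolve_right ?_)⟩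
  rintro ⟨-, h0⟩
  obtain ⟨x, hx, h1, h2⟩ := ((frequently_zeroSet_eq hu (Finset.empty_subset _)).and_eventually
    (h.and h0)).exists
  have := mem_zeroSet.2 ⟨hj, h2⟩
  simp [h1 hx] at this

/-- The local form of the action of a smooth map on corners. -/
theorem IsFace.push (hX : IsManifold κ X) (hY : IsManifold κ Y) (hc : c ∈ X.atlas k m)
    (hd : d ∈ Y.atlas l n) (hF : IsFace F c c') (hG : IsFace G d d') {f : X → Y} (hf : Continuous f)
    {y : Fin m' → ℝ} {a : CornerPt X p} (ha : At c' y a) {g : (Fin m → ℝ) → Fin n → ℝ} {b : Prop}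
    {φ : Finset (Fin m) → Finset (Fin n)}
    (hg : RepAt c d f g (F.ins y)) (hgm : MapAt κ b k l g (F.ins y))
    (hφ : HasPattern k l g (F.ins y) φ) (hFG : φ F.missing = G.missing) :
    (∀ᶠ y' in 𝓝[orthant k' m'] y, ∃ a b, At c' y' a ∧ At d' (G.restr (g (F.ins y'))) b ∧
      IsPushCorner f a b) ∧ MapAt κ True k' l' (fun y' => G.restr (g (F.ins y'))) y := by
  have ht := F.tendsto_ins c.le y
  have hy := ha.mem_orthant
  have hiy := (F.ins_mem_orthant_iff c.le).2 hy
  constructor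
  · filter_upwards [ha.eventually_exists, ht.eventually hg.eventually, ht.eventually hφ.eventually]
      with y' ⟨a', ha'⟩ hg' hφ'
    have hI := hF.at_iff.1 ha'
    have hv := hg'.self hI.at_fst
    have hsub := hφ'.subset_zeroSet hI.at_fst.mem_orthant hI.subset
    rw [hFG] at hsub
    obtain ⟨b', hb'⟩ := exists_cornerPt hY hd hv hsub G.card_missing
    refine ⟨a', b', ha', hG.at_iff.2 ?_, (isPushCorner_iff_of_hasIdx hX hY hc hd hI hb' hg'
      (hg'.continuousWithinAt (hX.isOpenEmbedding c hc) (hY.isOpenEmbedding d hd) hI.at_fst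
        hf.continuousAt) hφ').2 hFG.symm⟩
    rwa [G.ins_restr fun i hi => (mem_zeroSet.1 (hsub hi)).2]
  · have h1 : MapAt κ False k' l (fun y' => g (F.ins y')) y := hgm.to_smooth.comp hy
      (F.mapAt_ins κ c.le hy) (ht.eventually self_mem_nhdsWithin)
    have hm := ht.eventually hg.maps
    have h2 : MapAt κ False k' l' (fun y' => G.restr (g (F.ins y'))) y :=
      MapAt.comp (g := fun y' => g (F.ins y')) (G.mapAt_restr κ False d.le
        (hm.self_of_nhdsWithin hy)) hy h1 hm
    -- At an interior point of the face the zero set upstairs is `F.missing`, so the zero set of the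
    -- image is `G.missing`; these are the coordinates that `G.restr` discards.
    refine h2.to_interior hy ?_
    filter_upwards [ht.eventually hφ.2] with y' hφ' h0
    rw [F.zeroSet_ins c.le, h0, Finset.map_empty, Finset.union_empty, hFG] at hφ'
    rw [Finset.eq_empty_iff_forall_notMem]
    intro j hj
    rw [mem_zeroSet, ← G.ι_lt_iff d.le] at hj
    exact G.ι_notMem_missing j (hφ' ▸ mem_zeroSet.2 hj)

/-- At a common corner point the pattern of the transition map sends `F.missing` to `G.missing`, so
`IsFace.push` for the identity yields the transition map between the faces. It represents the
identity because `id` pushes a corner point only to itself. -/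
theorem IsFace.mapIn (hX : IsManifold κ X) {d : Chart l n X} {d' : Chart l' n' (CornerPt X p)}
    {G : Face l n l' n' p} (hc : c ∈ X.atlas k m) (hd : d ∈ X.atlas l n) (hF : IsFace F c c')
    (hG : IsFace G d d') : MapIn κ False c' d' id := by
  intro y z a ha ha'
  have h1 := hF.at_iff.1 ha
  have h2 := hG.at_iff.1 ha'
  obtain ⟨g, φ, hg, hgm, hgz, hφ, -⟩ :=
    exists_transition (hX.mapIn hc hd) (hX.mapIn hd hc) h1.at_fst h2.at_fst
  have h3 := h1.change hX hc hd hg (hgm.continuousWithinAt h1.at_fst.mem_orthant) hφ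
  rw [hgz] at h3
  obtain ⟨h4, h5⟩ := hF.push hX hX hc hd hG continuous_id ha hg hgm hφ (h3.unique hX hd h2)
  refine ⟨_, h4.mono ?_, h5.of_interior⟩
  rintro y' ⟨a, b, h6, h7, h8⟩
  have : (⟨p, a⟩ : Σ q, CornerPt X q) = ⟨p, b⟩ :=
    IsPushCorner.unique hX hX (isMap_id True hX) (isPushCorner_id a) h8
  cases this
  exact ⟨a, h6, h7⟩

end FaceChart

/-! ### The topology defined by charts -/

/-- The image of an open set under `c` is open because its preimage under another chart `d` is, near
each point, a preimage under a continuous transition map. -/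
theorem isOpenEmbedding_of_chartTopology (Z : Type u) (B : ∀ k m : ℕ, Set (Chart k m Z))
    (h : ∀ {k m l n : ℕ}, ∀ c ∈ B k m, ∀ d ∈ B l n, ∀ u v z, At c u z → At d v z →
      ∃ g, RepAt c d id g u ∧ ContinuousWithinAt g (orthant k m) u)
    {k m : ℕ} {c : Chart k m Z} (hc : c ∈ B k m) :
    @IsOpenEmbedding _ _ _ (chartTopology Z B) c.toFun := by
  let _ : TopologicalSpace Z := chartTopology Z B
  have hopen : ∀ A : Set Z, IsOpen A ↔ ∀ (k m : ℕ), ∀ c ∈ B k m, IsOpen (c.toFun ⁻¹' A) := by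
    intro A
    rw [isOpen_iSup_iff]
    simp only [isOpen_coinduced]
    exact ⟨fun h k m c hc => h ⟨k, m, c, hc⟩, fun h c => h _ _ _ c.2.2.2⟩
  refine .of_continuous_injective_isOpenMap (continuous_def.2 fun A hA => (hopen A).1 hA _ _ c hc)
    c.injective fun A hA => (hopen _).2 fun l n d hd => ?_
  rw [isOpen_iff_mem_nhds]
  rintro ⟨v, hv⟩ ⟨⟨u, hu⟩, huA, huv⟩
  obtain ⟨O, hO, rfl⟩ := isOpen_induced_iff.1 hA
  obtain ⟨g, hg, hgc⟩ := h d hd c hc v u _ ⟨hv, rfl⟩ ⟨hu, huv⟩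
  have e : g v = u := (hg.self ⟨hv, rfl⟩).inj ⟨hu, huv⟩
  have h1 : ∀ᶠ w in 𝓝[d.dom] v, ∃ h : w ∈ d.dom, d.toFun ⟨w, h⟩ ∈ c.toFun '' (Subtype.val ⁻¹' O) := by
    rw [d.isOpen_dom.nhdsWithin_eq hv]
    filter_upwards [hg, hgc.eventually (hO.mem_nhds (by rw [e]; exact huA))]
      with w ⟨z, ⟨hw, hwz⟩, hgw, hgz⟩ hwO
    exact ⟨hw, ⟨g w, hgw⟩, hwO, hgz.trans hwz.symm⟩
  rw [nhdsWithin_eq_map_subtype_coe hv] at h1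
  exact mem_of_superset h1 fun w ⟨_, hw⟩ => hw

theorem secondCountableTopology_range {Z : Type u} [TopologicalSpace Z] {k m : ℕ} {c : Chart k m Z}
    (hc : IsOpenEmbedding c.toFun) : SecondCountableTopology (range c.toFun) :=
  hc.isEmbedding.toHomeomorph.symm.secondCountableTopology

end ACorners

namespace ACorners

/-! ### The corners of a manifold -/

section KCorners

variable {κ : Kind} {X Y : AtlasSpace.{u}} {k m l n p q k' m' l' n' : ℕ}

theorem mapIn_of_mem_faceCharts (hX : IsManifold κ X) {c' : Chart k m (CornerPt X p)}
    {d' : Chart l n (CornerPt X p)} (hc : c' ∈ faceCharts X p k m) (hd : d' ∈ faceCharts X p l n) :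
    MapIn κ False c' d' id := by
  obtain ⟨_, _, c, hc, F, hF⟩ := (mem_faceCharts_iff hX).1 hc
  obtain ⟨_, _, d, hd, G, hG⟩ := (mem_faceCharts_iff hX).1 hd
  exact hF.mapIn hX hc hd hG

theorem isOpenEmbedding_of_mem_faceCharts (hX : IsManifold κ X) {c' : Chart k m (CornerPt X p)}
    (hc : c' ∈ faceCharts X p k m) :
    @IsOpenEmbedding _ _ _ (chartTopology _ (faceCharts X p)) c'.toFun := by
  refine isOpenEmbedding_of_chartTopology _ _ (fun c hc d hd u v z hu hv => ?_) hc
  obtain ⟨g, h1, h2⟩ := mapIn_of_mem_faceCharts hX hc hd u v z hu hv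
  exact ⟨g, h1, h2.continuousWithinAt hu.mem_orthant⟩

theorem IsFace.repAt_fst {c : Chart k m X} {c' : Chart k' m' (CornerPt X p)}
    {F : Face k m k' m' p} (hF : IsFace F c c') {y : Fin m' → ℝ} {a : CornerPt X p}
    (ha : At c' y a) : RepAt c' c (fun a => a.1) F.ins y :=
  ha.eventually_exists.mono fun _ ⟨b, hb⟩ => ⟨b, hb, (hF.at_iff.1 hb).at_fst⟩

theorem exists_faceChart (hX : IsManifold κ X) (a : CornerPt X p) : ∃ k m k' m' : ℕ,
    ∃ c ∈ X.atlas k m, ∃ (F : Face k m k' m' p) (c' : Chart k' m' (CornerPt X p)) (y : Fin m' → ℝ),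
      IsFace F c c' ∧ c' ∈ faceCharts X p k' m' ∧ At c' y a := by
  obtain ⟨k, m, c, hc, u, hu⟩ := hX.exists_at a.1
  obtain ⟨I, hI⟩ := exists_hasIdx hX hc a hu
  obtain ⟨k', m', F, c', y, -, hF, -, hy⟩ := hI.exists_face hX hc
  exact ⟨k, m, k', m', c, hc, F, c', y, hF, (mem_faceCharts_iff hX).2 ⟨k, m, c, hc, F, hF⟩, hy⟩

/-- Corner points over different points of `X` are separated by the projection. Over the same point
they have different indices in a chart `c`, and the corresponding face charts have disjoint ranges
because the index of a corner point in `c` is unique. For second countability, countably many charts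
cover `X`, and each has finitely many faces. -/
theorem isManifold_kCorners (hX : IsManifold κ X) (p : ℕ) : IsManifold κ (kCorners κ X p) ∧
    ∀ k m : ℕ, faceCharts X p k m ⊆ (kCorners κ X p).atlas k m := by
  let _ : TopologicalSpace (CornerPt X p) := chartTopology _ (faceCharts X p)
  have hopen : ∀ (k m : ℕ), ∀ c ∈ faceCharts X p k m, IsOpenEmbedding c.toFun :=
    fun k m c hc => isOpenEmbedding_of_mem_faceCharts hX hc
  have hfst : Continuous (fun a : CornerPt X p => a.1) := by
    refine continuous_iff_continuousAt.2 fun a => ?_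
    obtain ⟨k, m, k', m', c, hc, F, c', y, hF, hc', hy⟩ := exists_faceChart hX a
    exact (hF.repAt_fst hy).continuousAt (hopen _ _ c' hc') (hX.isOpenEmbedding c hc) hy
      F.continuous_ins.continuousWithinAt
  refine isManifold_generate (CornerPt X p) ⟨fun a b hab => ?_⟩ ?_ _ hopen (fun a => ?_)
    fun k m l n c hc d hd => mapIn_of_mem_faceCharts hX hc hd
  · by_cases h : a.1 = b.1
    · obtain ⟨k, m, c, hc, u, hu⟩ := hX.exists_at a.1
      obtain ⟨I, hI⟩ := exists_hasIdx hX hc a hu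
      obtain ⟨J, hJ⟩ := exists_hasIdx hX hc b (h ▸ hu)
      obtain ⟨k1, m1, F, c1, y1, rfl, hF, -, hy1⟩ := hI.exists_face hX hc
      obtain ⟨k2, m2, G, c2, y2, rfl, hG, -, hy2⟩ := hJ.exists_face hX hc
      refine ⟨range c1.toFun, range c2.toFun,
        (hopen _ _ c1 ((mem_faceCharts_iff hX).2 ⟨k, m, c, hc, F, hF⟩)).isOpen_range,
        (hopen _ _ c2 ((mem_faceCharts_iff hX).2 ⟨k, m, c, hc, G, hG⟩)).isOpen_range,
        mem_range_iff.2 ⟨y1, hy1⟩, mem_range_iff.2 ⟨y2, hy2⟩, ?_⟩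
      rw [Set.disjoint_left]
      intro e he1 he2
      obtain ⟨z1, hz1⟩ := mem_range_iff.1 he1
      obtain ⟨z2, hz2⟩ := mem_range_iff.1 he2
      have h1 := hF.at_iff.1 hz1
      have h2 := hG.at_iff.1 hz2
      rw [h1.at_fst.inj h2.at_fst] at h1
      rw [h1.unique hX hc h2] at hI
      exact hab (hI.ext hJ)
    · have := hX.t2
      obtain ⟨V, W, hV, hW, ha, hb, hVW⟩ := t2_separation h
      exact ⟨_, _, hV.preimage hfst, hW.preimage hfst, ha, hb, hVW.preimage _⟩
  · have := hX.secondCountable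
    choose K M c hc hcov using hX.cover
    obtain ⟨T, hT, hTU⟩ := isOpen_iUnion_countable (fun x : X => range (c x).toFun)
      fun x => (hX.isOpenEmbedding (c x) (hc x)).isOpen_range
    have : Countable T := hT.to_subtype
    let U : (Σ x : T, Finset (Fin (M x.1))) → Set (CornerPt X p) := fun s =>
      {a | ∃ u, HasIdx (c s.1.1) u s.2 a}
    have hU : ∀ s, U s = ∅ ∨ ∃ (k' m' : ℕ) (c' : Chart k' m' (CornerPt X p)),
        c' ∈ faceCharts X p k' m' ∧ U s = range c'.toFun := by
      rintro ⟨x, I⟩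
      rcases (U ⟨x, I⟩).eq_empty_or_nonempty with h | ⟨a, u, ha⟩
      · exact .inl h
      · right
        obtain ⟨k', m', F, c', y, rfl, hF, -, -⟩ := ha.exists_face hX (hc x.1)
        refine ⟨k', m', c', (mem_faceCharts_iff hX).2 ⟨_, _, _, hc x.1, F, hF⟩, ?_⟩
        ext b
        rw [mem_range_iff]
        constructor
        · rintro ⟨v, hv⟩
          have : F.ins (F.restr v) = v :=
            F.ins_restr fun i hi => (mem_zeroSet.1 (hv.subset hi)).2
          exact ⟨F.restr v, hF.at_iff.2 (this.symm ▸ hv)⟩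
        · rintro ⟨y, hy⟩
          exact ⟨F.ins y, hF.at_iff.1 hy⟩
    have : ∀ s, SecondCountableTopology (U s) := fun s => by
      rcases hU s with h | ⟨k', m', c', hc', h⟩
      · rw [h]; infer_instance
      · rw [h]; exact secondCountableTopology_range (hopen _ _ c' hc')
    refine secondCountableTopology_of_countable_cover (U := U) (fun s => ?_) ?_
    · rcases hU s with h | ⟨k', m', c', hc', h⟩
      · rw [h]; exact isOpen_empty
      · rw [h]; exact (hopen _ _ c' hc').isOpen_range
    · rw [eq_univ_iff_forall]
      intro a
      have : a.1 ∈ ⋃ x ∈ T, range (c x).toFun := by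
        rw [hTU]; exact mem_iUnion.2 ⟨a.1, hcov a.1⟩
      obtain ⟨x, hx, h⟩ := mem_iUnion₂.1 this
      obtain ⟨u, hu⟩ := mem_range_iff.1 h
      obtain ⟨I, hI⟩ := exists_hasIdx hX (hc x) a hu
      exact mem_iUnion.2 ⟨⟨⟨x, hx⟩, I⟩, u, hI⟩
  · obtain ⟨k, m, k', m', c, hc, F, c', y, hF, hc', hy⟩ := exists_faceChart hX a
    exact ⟨k', m', c', hc', y, hy⟩

theorem IsFace.mem_atlas (hX : IsManifold κ X) {c : Chart k m X} {c' : Chart k' m' (CornerPt X p)}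
    {F : Face k m k' m' p} (hc : c ∈ X.atlas k m) (hF : IsFace F c c') :
    c' ∈ (kCorners κ X p).atlas k' m' :=
  (isManifold_kCorners hX p).2 _ _ ((mem_faceCharts_iff hX).2 ⟨k, m, c, hc, F, hF⟩)

theorem isMap_kProj (hX : IsManifold κ X) (p : ℕ) :
    IsMap κ False (kCorners κ X p) X (kProj κ X p) := by
  refine isMap_of_local (isManifold_kCorners hX p).1 hX fun a => ?_
  obtain ⟨k, m, k', m', c, hc, F, c', y, hF, -, hy⟩ := exists_faceChart hX a
  exact ⟨k', m', c', hF.mem_atlas hX hc, k, m, c, hc, y, F.ins, hy, hF.repAt_fst hy,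
    F.mapAt_ins κ c.le hy.mem_orthant⟩

theorem hasDim_kCorners (hX : IsManifold .analytic X) {n : ℕ} (h : HasDim X (n + p)) :
    HasDim (kCorners .analytic X p) n := by
  refine hasDim_of_cover (isManifold_kCorners hX p).1 fun a => ?_
  obtain ⟨k, m, k', m', c, hc, F, c', y, hF, -, hy⟩ := exists_faceChart hX a
  have h1 := h.eq hc (hF.at_iff.1 hy).at_fst
  have h2 := F.dim_add
  obtain rfl : m' = n := by omega
  exact ⟨k', c', hF.mem_atlas hX hc, y, hy⟩

theorem isEmpty_kCorners (hX : IsManifold κ X) {n : ℕ} (h : HasDim X n) (hp : n < p) :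
    IsEmpty (kCorners κ X p) := by
  refine ⟨fun a => ?_⟩
  obtain ⟨k, m, k', m', c, hc, F, c', y, hF, -, hy⟩ := exists_faceChart hX a
  have h1 := h.eq hc (hF.at_iff.1 hy).at_fst
  have h2 := F.dim_add
  omega

end KCorners

/-! ### Disjoint unions -/

section Sum

variable {κ : Kind} {X : ℕ → AtlasSpace.{u}} {k m l n : ℕ}

theorem exists_isPushChart {X Y : Type u} (c : Chart k m X) {f : X → Y}
    (hf : Function.Injective (f ∘ c.toFun)) : ∃ d : Chart k m Y, IsPushChart f c d :=
  ⟨⟨c.le, c.dom, c.isOpen_dom, f ∘ c.toFun, hf⟩, rfl, fun _ _ _ => rfl⟩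

theorem IsPushChart.isOpenEmbedding {X Y : Type u} [TopologicalSpace X] [TopologicalSpace Y]
    {f : X → Y} (hf : IsOpenEmbedding f) {c : Chart k m X} {d : Chart k m Y}
    (hc : IsOpenEmbedding c.toFun) (h : IsPushChart f c d) : IsOpenEmbedding d.toFun := by
  obtain ⟨le, dom, hdom, F, hF⟩ := d
  obtain ⟨h1, h2⟩ := h
  dsimp only at h1
  subst h1
  have e : F = f ∘ c.toFun := funext fun u => h2 u.1 u.2 u.2
  simp only [e]
  exact hf.comp hc

theorem isManifold_sumMfd (hX : ∀ p, IsManifold κ (X p)) : IsManifold κ (sumMfd κ X) ∧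
    ∀ (p k m : ℕ), ∀ c ∈ (X p).atlas k m, ∀ d : Chart k m (Σ p, X p),
      IsPushChart (Sigma.mk p) c d → d ∈ (sumMfd κ X).atlas k m := by
  have := fun p => (hX p).t2
  have := fun p => (hX p).secondCountable
  have main := isManifold_generate (κ := κ) (Σ p, X p) inferInstance inferInstance
    (fun k m => {d | ∃ p, ∃ c ∈ (X p).atlas k m, IsPushChart (Sigma.mk p) c d})
    (fun k m d ⟨p, c, hc, h⟩ => h.isOpenEmbedding .sigmaMk ((hX p).isOpenEmbedding c hc))
    (fun ⟨p, x⟩ => by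
      obtain ⟨k, m, c, hc, u, hu⟩ := (hX p).exists_at x
      obtain ⟨d, hd⟩ := exists_isPushChart c (f := Sigma.mk (β := fun p => (X p).carrier) p)
        (sigma_mk_injective.comp c.injective)
      exact ⟨k, m, d, ⟨p, c, hc, hd⟩, u, hd.at hu⟩)
    (by
      rintro k m l n d ⟨p, c, hc, hd⟩ d' ⟨p', c', hc', hd'⟩ u v z hu hv
      obtain ⟨x, hux, rfl⟩ := hd.exists_at hu
      obtain ⟨x', hvx, h⟩ := hd'.exists_at hv
      cases h
      obtain ⟨g, hg, hgm⟩ := (hX p).exists_rep False hc hc' hux hvx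
      exact ⟨g, hg.mono fun w ⟨y, h1, h2⟩ => ⟨_, hd.at h1, hd'.at h2⟩, hgm⟩)
  exact ⟨main.1, fun p k m c hc d hd => main.2 k m ⟨p, c, hc, hd⟩⟩

theorem exists_sumChart (hX : ∀ p, IsManifold κ (X p)) {p : ℕ} {c : Chart k m (X p)}
    (hc : c ∈ (X p).atlas k m) :
    ∃ d ∈ (sumMfd κ X).atlas k m, IsPushChart (Y := sumMfd κ X) (Sigma.mk p) c d := by
  obtain ⟨d, hd⟩ := exists_isPushChart c (f := Sigma.mk (β := fun p => (X p).carrier) p)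
        (sigma_mk_injective.comp c.injective)
  exact ⟨d, (isManifold_sumMfd hX).2 p k m c hc d hd, hd⟩

end Sum

/-! ### The manifold `C(X)` and the action of smooth maps on it -/

section Corners

variable {κ : Kind} {X Y : AtlasSpace.{u}} {k m l n p q k' m' l' n' : ℕ}

theorem isManifold_corners (hX : IsManifold κ X) : IsManifold κ (corners κ X) :=
  (isManifold_sumMfd fun p => (isManifold_kCorners hX p).1).1

theorem exists_cornersChart (hX : IsManifold κ X) {c' : Chart k m (kCorners κ X p)}
    (hc : c' ∈ (kCorners κ X p).atlas k m) :
    ∃ e ∈ (corners κ X).atlas k m, IsPushChart (Y := corners κ X) (Sigma.mk p) c' e :=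
  exists_sumChart (fun p => (isManifold_kCorners hX p).1) hc

theorem isMap_proj (hX : IsManifold κ X) : IsMap κ False (corners κ X) X (proj κ X) := by
  refine isMap_of_local (isManifold_corners hX) hX fun z => ?_
  obtain ⟨p, a⟩ := z
  obtain ⟨k, m, k', m', c, hc, F, c', y, hF, -, hy⟩ := exists_faceChart hX a
  obtain ⟨e, he, hpe⟩ := exists_cornersChart hX (hF.mem_atlas hX hc)
  refine ⟨k', m', e, he, k, m, c, hc, y, F.ins, hpe.at hy, ?_,
    F.mapAt_ins κ c.le hy.mem_orthant⟩
  exact (hF.repAt_fst hy).mono fun v ⟨b, h1, h2⟩ => ⟨_, hpe.at h1, h2⟩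

theorem exists_isCornerMap (hX : IsManifold κ X) (hY : IsManifold κ Y) {b : Prop} {f : X → Y}
    (hf : IsMap κ b X Y f) : ∃ F, IsCornerMap κ X Y f F := by
  choose F hF _ using fun z : corners κ X => existsUnique_isPushCorner hX hY hf z.2
  exact ⟨F, hF⟩

theorem IsCornerMap.eq_of_isPushCorner (hX : IsManifold κ X) (hY : IsManifold κ Y) {s : Prop}
    {f : X → Y} (hf : IsMap κ s X Y f) {F : corners κ X → corners κ Y}
    (hF : IsCornerMap κ X Y f F) {z : corners κ X} {w : corners κ Y} (h : IsPushCorner f z.2 w.2) :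
    F z = w :=
  IsPushCorner.unique hX hY hf (w := F z) (w' := w) (hF z) h

theorem IsCornerMap.unique (hX : IsManifold κ X) (hY : IsManifold κ Y) {s : Prop}
    {f : X → Y} (hf : IsMap κ s X Y f) {F G : corners κ X → corners κ Y}
    (hF : IsCornerMap κ X Y f F) (hG : IsCornerMap κ X Y f G) : F = G :=
  funext fun z => hF.eq_of_isPushCorner hX hY hf (hG z)

/-- The action of a smooth map on corners is interior. -/
theorem IsCornerMap.isMap (hX : IsManifold κ X) (hY : IsManifold κ Y) {s : Prop} {f : X → Y}
    (hf : IsMap κ s X Y f) {F : corners κ X → corners κ Y} (hF : IsCornerMap κ X Y f F) :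
    IsMap κ True (corners κ X) (corners κ Y) F := by
  refine isMap_of_local (isManifold_corners hX) (isManifold_corners hY) fun z => ?_
  obtain ⟨p, a⟩ := z
  obtain ⟨k, m, c, hc, u, hu⟩ := hX.exists_at a.1
  obtain ⟨l, n, d, hd, v, hv⟩ := hY.exists_at (f a.1)
  obtain ⟨g, hg, hgm, rfl⟩ := hf.exists_rep hc hd hu hv
  obtain ⟨I, ha⟩ := exists_hasIdx hX hc a hu
  obtain ⟨φ, hφ, -⟩ := hgm.exists_pattern
  have hgc := hgm.continuousWithinAt hu.mem_orthant
  -- The corner point with index `φ I` serves to produce the face chart of the target matching the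
  -- face of `I` in the source.
  obtain ⟨w, hw⟩ := exists_cornerPt hY hd hv (hφ.subset_zeroSet hu.mem_orthant ha.subset) rfl
  obtain ⟨k', m', G, c', y, rfl, hGc, rfl, hy⟩ := ha.exists_face hX hc
  obtain ⟨l', n', H, d', y', hH, hHd, -, -⟩ := hw.exists_face hY hd
  obtain ⟨h1, h2⟩ := hGc.push hX hY hc hd hHd hf.1 hy hg hgm hφ hH.symm
  obtain ⟨e, he, hpe⟩ := exists_cornersChart hX (hGc.mem_atlas hX hc)
  obtain ⟨e', he', hpe'⟩ := exists_cornersChart hY (hHd.mem_atlas hY hd)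
  refine ⟨k', m', e, he, l', n', e', he', y, _, hpe.at hy, h1.mono ?_, h2⟩
  rintro y' ⟨a', b', h3, h4, h5⟩
  refine ⟨⟨p, a'⟩, hpe.at h3, ?_⟩
  rw [hF.eq_of_isPushCorner hX hY hf (z := ⟨p, a'⟩) (w := ⟨_, b'⟩) h5]
  exact hpe'.at h4

end Corners

end ACorners

namespace ACorners

/-! ### Products -/

/-- An identification of the coordinates of `[0,∞)ᴷ × ℝᴹ⁻ᴷ` with those of
`([0,∞)ᵏ × ℝᵐ⁻ᵏ) × ([0,∞)ˡ × ℝⁿ⁻ˡ)`. -/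
structure Splitting (k m l n K M : ℕ) where
  bound_add : K = k + l
  ε : Fin m ⊕ Fin n ≃ Fin M
  inl_lt_iff : ∀ i, (ε (Sum.inl i)).val < K ↔ i.val < k
  inr_lt_iff : ∀ j, (ε (Sum.inr j)).val < K ↔ j.val < l

/-- The coordinates with values in `[0,∞)` must come first, so these and the remaining ones are
matched separately, each by counting. -/
theorem exists_splitting {k m l n : ℕ} (hk : k ≤ m) (hl : l ≤ n) :
    Nonempty (Splitting k m l n (k + l) (m + n)) := by
  classical
  let P : Fin m ⊕ Fin n → Prop := Sum.elim (fun i => i.val < k) fun j => j.val < l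
  let Q : Fin (m + n) → Prop := fun i => i.val < k + l
  have h1 : Fintype.card {t // P t} = Fintype.card {t // Q t} := by
    rw [Fintype.card_congr (Equiv.subtypeSum (p := P)), Fintype.card_sum]
    have e1 : Fintype.card {i : Fin m // P (Sum.inl i)} = k := by
      convert Fintype.card_fin_lt_of_le hk
      exact Iff.rfl
    have e2 : Fintype.card {j : Fin n // P (Sum.inr j)} = l := by
      convert Fintype.card_fin_lt_of_le hl
      exact Iff.rfl
    have e3 : Fintype.card {i : Fin (m + n) // Q i} = k + l := by
      convert Fintype.card_fin_lt_of_le (add_le_add hk hl)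
    rw [e1, e2, e3]
  have h2 : Fintype.card {t // ¬ P t} = Fintype.card {t // ¬ Q t} := by
    rw [Fintype.card_subtype_compl, Fintype.card_subtype_compl, h1]
    simp
  let e1 := Fintype.equivOfCardEq h1
  let e2 := Fintype.equivOfCardEq h2
  let E := (Equiv.sumCompl P).symm.trans ((Equiv.sumCongr e1 e2).trans (Equiv.sumCompl Q))
  have hE : ∀ t, Q (E t) ↔ P t := by
    intro t
    by_cases h : P t
    · simp only [E, Equiv.trans_apply,
        Equiv.sumCompl_symm_apply_of_pos h, Equiv.sumCongr_apply, Sum.map_inl,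
        Equiv.sumCompl_apply_inl, h, iff_true]
      exact (e1 ⟨t, h⟩).2
    · simp only [E, Equiv.trans_apply,
        Equiv.sumCompl_symm_apply_of_neg h, Equiv.sumCongr_apply, Sum.map_inr,
        Equiv.sumCompl_apply_inr, h, iff_false]
      exact (e2 ⟨t, h⟩).2
  exact ⟨⟨rfl, E, fun i => hE (Sum.inl i), fun j => hE (Sum.inr j)⟩⟩

namespace Splitting

variable {κ : Kind} {b : Prop} {k m l n K M : ℕ} (P : Splitting k m l n K M)

/-- The first projection. -/
def fst (z : Fin M → ℝ) : Fin m → ℝ := fun i => z (P.ε (Sum.inl i))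

/-- The second projection. -/
def snd (z : Fin M → ℝ) : Fin n → ℝ := fun j => z (P.ε (Sum.inr j))

/-- The point with given projections. -/
def pair (x : Fin m → ℝ) (y : Fin n → ℝ) : Fin M → ℝ := fun t => Sum.elim x y (P.ε.symm t)

theorem fst_pair (x : Fin m → ℝ) (y : Fin n → ℝ) : P.fst (P.pair x y) = x := by
  ext; simp [fst, pair]

theorem snd_pair (x : Fin m → ℝ) (y : Fin n → ℝ) : P.snd (P.pair x y) = y := by
  ext; simp [snd, pair]

theorem forall_fin {p : Fin M → Prop} :
    (∀ t, p t) ↔ (∀ i, p (P.ε (Sum.inl i))) ∧ ∀ j, p (P.ε (Sum.inr j)) := by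
  rw [← P.ε.forall_congr_right, Sum.forall]

theorem ext_iff {z w : Fin M → ℝ} : z = w ↔ P.fst z = P.fst w ∧ P.snd z = P.snd w := by
  simp only [funext_iff, P.forall_fin, fst, snd]

theorem continuous_fst : Continuous P.fst := continuous_pi fun _ => continuous_apply _

theorem continuous_snd : Continuous P.snd := continuous_pi fun _ => continuous_apply _

theorem mem_orthant_iff {z : Fin M → ℝ} :
    z ∈ orthant K M ↔ P.fst z ∈ orthant k m ∧ P.snd z ∈ orthant l n := by
  change (∀ t, _) ↔ _
  rw [P.forall_fin]
  exact and_congr (forall_congr' fun i => by rw [P.inl_lt_iff]; rfl)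
    (forall_congr' fun j => by rw [P.inr_lt_iff]; rfl)

theorem mapAt_fst (κ : Kind) (b : Prop) {z : Fin M → ℝ} (hz : z ∈ orthant K M) :
    MapAt κ b K k P.fst z :=
  mapAt_of_coord κ hz fun i => .inl ⟨_, (P.inl_lt_iff i).2, fun _ => rfl⟩

theorem mapAt_snd (κ : Kind) (b : Prop) {z : Fin M → ℝ} (hz : z ∈ orthant K M) :
    MapAt κ b K l P.snd z :=
  mapAt_of_coord κ hz fun i => .inl ⟨_, (P.inr_lt_iff i).2, fun _ => rfl⟩

theorem mapAt_pair {k₀ m₀ : ℕ} {u : Fin m₀ → ℝ} {g : (Fin m₀ → ℝ) → Fin m → ℝ}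
    {h : (Fin m₀ → ℝ) → Fin n → ℝ} (hg : MapAt κ b k₀ k g u) (hh : MapAt κ b k₀ l h u) :
    MapAt κ b k₀ K (fun v => P.pair (g v) (h v)) u := by
  refine P.forall_fin.2 ⟨fun i => ?_, fun j => ?_⟩
  · have := hg i
    simp only [pair, Equiv.symm_apply_apply, Sum.elim_inl]
    rwa [← not_lt, P.inl_lt_iff, not_lt]
  · have := hh j
    simp only [pair, Equiv.symm_apply_apply, Sum.elim_inr]
    rwa [← not_lt, P.inr_lt_iff, not_lt]

/-- The coordinates of the first factor in a set of coordinates. -/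
noncomputable def left (S : Finset (Fin M)) : Finset (Fin m) := by
  classical exact Finset.univ.filter fun i => P.ε (Sum.inl i) ∈ S

/-- The coordinates of the second factor in a set of coordinates. -/
noncomputable def right (S : Finset (Fin M)) : Finset (Fin n) := by
  classical exact Finset.univ.filter fun j => P.ε (Sum.inr j) ∈ S

theorem mem_left {S : Finset (Fin M)} {i : Fin m} : i ∈ P.left S ↔ P.ε (Sum.inl i) ∈ S := by
  simp [left]

theorem mem_right {S : Finset (Fin M)} {j : Fin n} : j ∈ P.right S ↔ P.ε (Sum.inr j) ∈ S := by
  simp [right]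

theorem finset_ext {S T : Finset (Fin M)} (h1 : P.left S = P.left T) (h2 : P.right S = P.right T) :
    S = T := by
  simp only [Finset.ext_iff, mem_left, mem_right] at h1 h2
  rw [Finset.ext_iff, P.forall_fin]
  exact ⟨h1, h2⟩

theorem card_left_add_card_right (S : Finset (Fin M)) :
    (P.left S).card + (P.right S).card = S.card := by
  classical
  rw [← Finset.card_disjSum, ← Finset.card_map P.ε.toEmbedding]
  congr 1
  rw [Finset.ext_iff, P.forall_fin]
  constructor <;> intro i <;> simp [mem_left, mem_right]

theorem exists_finset (I : Finset (Fin m)) (J : Finset (Fin n)) :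
    ∃ S, P.left S = I ∧ P.right S = J := by
  refine ⟨(I.disjSum J).map P.ε.toEmbedding, ?_, ?_⟩ <;> ext i <;> simp [mem_left, mem_right]

theorem left_zeroSet (z : Fin M → ℝ) : P.left (zeroSet K z) = zeroSet k (P.fst z) := by
  ext i
  rw [mem_left, mem_zeroSet, mem_zeroSet, P.inl_lt_iff]; rfl

theorem right_zeroSet (z : Fin M → ℝ) : P.right (zeroSet K z) = zeroSet l (P.snd z) := by
  ext i
  rw [mem_right, mem_zeroSet, mem_zeroSet, P.inr_lt_iff]; rfl

theorem hasPattern_fst (z : Fin M → ℝ) : HasPattern K k P.fst z P.left :=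
  ⟨fun I J => by ext; simp only [mem_left, Finset.mem_union],
    .of_forall fun z => (P.left_zeroSet z).symm⟩

theorem hasPattern_snd (z : Fin M → ℝ) : HasPattern K l P.snd z P.right :=
  ⟨fun I J => by ext; simp only [mem_right, Finset.mem_union],
    .of_forall fun z => (P.right_zeroSet z).symm⟩

end Splitting

section Prod

variable {κ : Kind} {b : Prop} {X Y Z : AtlasSpace.{u}} {k m l n K M p q : ℕ}

/-- `e` is the product chart of `c` and `d` with respect to `P`. -/
def IsProd {X Y : Type u} (P : Splitting k m l n K M) (c : Chart k m X) (d : Chart l n Y)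
    (e : Chart K M (X × Y)) : Prop :=
  ∀ z x y, At e z (x, y) ↔ At c (P.fst z) x ∧ At d (P.snd z) y

theorem IsProd.dom_eq {X Y : Type u} {P : Splitting k m l n K M} {c : Chart k m X}
    {d : Chart l n Y} {e : Chart K M (X × Y)} (h : IsProd P c d e) :
    e.dom = {z | P.fst z ∈ c.dom ∧ P.snd z ∈ d.dom} := by
  ext z
  constructor
  · intro hz
    obtain ⟨h1, h2⟩ := (h z _ _).1 ⟨hz, rfl⟩
    exact ⟨h1.1, h2.1⟩
  · rintro ⟨h1, h2⟩
    exact ((h z _ _).2 ⟨⟨h1, rfl⟩, ⟨h2, rfl⟩⟩).1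

theorem isProdChart_iff {X Y : Type u} {c : Chart k m X} {d : Chart l n Y}
    {e : Chart K M (X × Y)} : IsProdChart c d e ↔ ∃ P, IsProd P c d e := by
  constructor
  · rintro ⟨hK, ε, h1, h2, h3, h4⟩
    refine ⟨⟨hK, ε, h1, h2⟩, fun z x y => ⟨?_, ?_⟩⟩
    · rintro ⟨hz, h⟩
      have hz' := hz
      rw [h3] at hz'
      rw [h4 z hz hz'.1 hz'.2] at h
      cases h
      exact ⟨⟨hz'.1, rfl⟩, ⟨hz'.2, rfl⟩⟩
    · rintro ⟨⟨hx, rfl⟩, ⟨hy, rfl⟩⟩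
      have hz : z ∈ e.dom := by rw [h3]; exact ⟨hx, hy⟩
      exact ⟨hz, h4 z hz hx hy⟩
  · rintro ⟨P, h⟩
    refine ⟨P.bound_add, P.ε, P.inl_lt_iff, P.inr_lt_iff, h.dom_eq, fun z hz hc hd => ?_⟩
    obtain ⟨_, h'⟩ := (h z _ _).2 ⟨⟨hc, rfl⟩, ⟨hd, rfl⟩⟩
    exact h'

theorem exists_isProd {X Y : Type u} (P : Splitting k m l n K M) (c : Chart k m X)
    (d : Chart l n Y) : ∃ e, IsProd P c d e := by
  have hM : m + n = M := by simpa using Fintype.card_congr P.ε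
  refine ⟨⟨?_, {z | P.fst z ∈ c.dom ∧ P.snd z ∈ d.dom}, ?_,
    fun z => (c.toFun ⟨_, z.2.1⟩, d.toFun ⟨_, z.2.2⟩), ?_⟩, ?_⟩
  · rw [P.bound_add, ← hM]
    exact add_le_add c.le d.le
  · obtain ⟨O, hO, h1⟩ := c.isOpen_dom
    obtain ⟨O', hO', h2⟩ := d.isOpen_dom
    refine ⟨P.fst ⁻¹' O ∩ P.snd ⁻¹' O',
      (hO.preimage P.continuous_fst).inter (hO'.preimage P.continuous_snd), ?_⟩
    ext z
    rw [h1, h2]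
    simp only [mem_inter_iff, P.mem_orthant_iff, mem_preimage]
    change (_ ∧ _) ∧ (_ ∧ _) ↔ _
    tauto
  · intro z w h
    obtain ⟨h1, h2⟩ := Prod.mk.inj h
    exact Subtype.ext (P.ext_iff.2
      ⟨congrArg Subtype.val (c.injective h1), congrArg Subtype.val (d.injective h2)⟩)
  · refine fun z x y => ⟨?_, ?_⟩
    · rintro ⟨h, h'⟩
      cases h'
      exact ⟨⟨h.1, rfl⟩, ⟨h.2, rfl⟩⟩
    · rintro ⟨⟨hx, rfl⟩, ⟨hy, rfl⟩⟩
      exact ⟨⟨hx, hy⟩, rfl⟩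

theorem IsProd.isOpenEmbedding {X Y : Type u} [TopologicalSpace X] [TopologicalSpace Y]
    {P : Splitting k m l n K M} {c : Chart k m X} {d : Chart l n Y} {e : Chart K M (X × Y)}
    (h : IsProd P c d e) (hc : IsOpenEmbedding c.toFun) (hd : IsOpenEmbedding d.toFun) :
    IsOpenEmbedding e.toFun := by
  have hz : ∀ z : e.dom, P.fst z.1 ∈ c.dom ∧ P.snd z.1 ∈ d.dom := fun z => h.dom_eq.subset z.2
  let H : e.dom ≃ₜ c.dom × d.dom :=
    { toFun := fun z => (⟨P.fst z, (hz z).1⟩, ⟨P.snd z, (hz z).2⟩)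
      invFun := fun w => ⟨P.pair w.1 w.2, by
        rw [h.dom_eq]
        exact ⟨by rw [P.fst_pair]; exact w.1.2, by rw [P.snd_pair]; exact w.2.2⟩⟩
      left_inv := fun z => Subtype.ext (P.ext_iff.2 ⟨P.fst_pair _ _, P.snd_pair _ _⟩)
      right_inv := fun w => Prod.ext (Subtype.ext (P.fst_pair _ _)) (Subtype.ext (P.snd_pair _ _))
      continuous_toFun := by
        refine .prodMk (.subtype_mk (P.continuous_fst.comp continuous_subtype_val) _)
          (.subtype_mk (P.continuous_snd.comp continuous_subtype_val) _)
      continuous_invFun := by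
        refine .subtype_mk (continuous_pi fun t => ?_) _
        unfold Splitting.pair
        rcases P.ε.symm t with i | j
        · exact (continuous_apply i).comp (continuous_subtype_val.comp continuous_fst)
        · exact (continuous_apply j).comp (continuous_subtype_val.comp continuous_snd) }
  have he : e.toFun = Prod.map c.toFun d.toFun ∘ H := by
    funext z
    obtain ⟨_, h'⟩ := (h z.1 _ _).2 ⟨⟨(hz z).1, rfl⟩, ⟨(hz z).2, rfl⟩⟩
    exact h'
  rw [he]
  exact (hc.prodMap hd).comp H.isOpenEmbedding

section Rep

variable {X Y Z : Type u} {P : Splitting k m l n K M} {c : Chart k m X} {d : Chart l n Y}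
  {e : Chart K M (X × Y)} {k₀ m₀ : ℕ} {a : Chart k₀ m₀ Z} {u : Fin m₀ → ℝ}

theorem IsProd.repAt_fst (h : IsProd P c d e) {z : Fin M → ℝ} {w : X × Y} (hz : At e z w) :
    RepAt e c Prod.fst P.fst z :=
  hz.eventually_exists.mono fun z' ⟨w', hw'⟩ => ⟨w', hw', ((h z' w'.1 w'.2).1 hw').1⟩

theorem IsProd.repAt_snd (h : IsProd P c d e) {z : Fin M → ℝ} {w : X × Y} (hz : At e z w) :
    RepAt e d Prod.snd P.snd z :=
  hz.eventually_exists.mono fun z' ⟨w', hw'⟩ => ⟨w', hw', ((h z' w'.1 w'.2).1 hw').2⟩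

theorem IsProd.repAt_pair (h : IsProd P c d e) {f : Z → X} {f' : Z → Y}
    {g : (Fin m₀ → ℝ) → Fin m → ℝ} {g' : (Fin m₀ → ℝ) → Fin n → ℝ}
    (hf : RepAt a c f g u) (hf' : RepAt a d f' g' u) :
    RepAt a e (fun w => (f w, f' w)) (fun v => P.pair (g v) (g' v)) u := by
  filter_upwards [hf, hf'] with v ⟨x, h1, h2⟩ ⟨y, h3, h4⟩
  obtain rfl := h1.eq h3
  refine ⟨x, h1, (h _ _ _).2 ?_⟩
  rw [P.fst_pair, P.snd_pair]
  exact ⟨h2, h4⟩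

end Rep

/-- The transition between two product charts is the pair of the transitions of the factors,
composed with the projections. -/
theorem isManifold_prodMfd (hX : IsManifold κ X) (hY : IsManifold κ Y) :
    IsManifold κ (prodMfd κ X Y) ∧ ∀ {k m l n K M : ℕ} {P : Splitting k m l n K M} {c d e},
      c ∈ X.atlas k m → d ∈ Y.atlas l n → IsProd P c d e → e ∈ (prodMfd κ X Y).atlas K M := by
  have := hX.t2
  have := hY.t2
  have := hX.secondCountable
  have := hY.secondCountable
  have main := isManifold_generate (κ := κ) (X × Y) inferInstance inferInstance
    (fun K M => {e : Chart K M (X × Y) | ∃ k m l n : ℕ, ∃ c ∈ X.atlas k m, ∃ d ∈ Y.atlas l n,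
      IsProdChart c d e}) ?_ ?_ ?_
  · exact ⟨main.1, fun {k m l n K M P c d e} hc hd he =>
      main.2 K M ⟨k, m, l, n, c, hc, d, hd, isProdChart_iff.2 ⟨P, he⟩⟩⟩
  · rintro K M e ⟨k, m, l, n, c, hc, d, hd, h⟩
    obtain ⟨P, h⟩ := isProdChart_iff.1 h
    exact h.isOpenEmbedding (hX.isOpenEmbedding c hc) (hY.isOpenEmbedding d hd)
  · rintro ⟨x, y⟩
    obtain ⟨k, m, c, hc, u, hu⟩ := hX.exists_at x
    obtain ⟨l, n, d, hd, v, hv⟩ := hY.exists_at y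
    obtain ⟨P⟩ := exists_splitting c.le d.le
    obtain ⟨e, he⟩ := exists_isProd P c d
    refine ⟨_, _, e, ⟨k, m, l, n, c, hc, d, hd, isProdChart_iff.2 ⟨P, he⟩⟩, P.pair u v,
      (he _ _ _).2 ?_⟩
    rw [P.fst_pair, P.snd_pair]
    exact ⟨hu, hv⟩
  · rintro K M K' M' e ⟨k, m, l, n, c, hc, d, hd, h⟩ e' ⟨k', m', l', n', c', hc', d', hd', h'⟩
    obtain ⟨P, h⟩ := isProdChart_iff.1 h
    obtain ⟨P', h'⟩ := isProdChart_iff.1 h'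
    rintro z z' ⟨x, y⟩ hz hz'
    have h1 := (h _ _ _).1 hz
    have h2 := (h' _ _ _).1 hz'
    obtain ⟨g1, hg1, hm1⟩ := hX.exists_rep False hc hc' h1.1 h2.1
    obtain ⟨g2, hg2, hm2⟩ := hY.exists_rep False hd hd' h1.2 h2.2
    have r1 := (h.repAt_fst hz).comp P.continuous_fst.continuousWithinAt hg1
    have r2 := (h.repAt_snd hz).comp P.continuous_snd.continuousWithinAt hg2
    refine ⟨_, h'.repAt_pair r1 r2, P'.mapAt_pair
      (hm1.comp hz.mem_orthant (P.mapAt_fst κ _ hz.mem_orthant) (h.repAt_fst hz).maps)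
      (hm2.comp hz.mem_orthant (P.mapAt_snd κ _ hz.mem_orthant) (h.repAt_snd hz).maps)⟩

theorem exists_prodChart (hX : IsManifold κ X) (hY : IsManifold κ Y) {c : Chart k m X}
    {d : Chart l n Y} (hc : c ∈ X.atlas k m) (hd : d ∈ Y.atlas l n) {u : Fin m → ℝ}
    {v : Fin n → ℝ} {x : X} {y : Y} (hu : At c u x) (hv : At d v y) :
    ∃ (P : Splitting k m l n (k + l) (m + n)), ∃ e ∈ (prodMfd κ X Y).atlas (k + l) (m + n), ∃ z,
      IsProd P c d e ∧ P.fst z = u ∧ P.snd z = v ∧ At e z (x, y) := by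
  obtain ⟨P⟩ := exists_splitting c.le d.le
  obtain ⟨e, he⟩ := exists_isProd P c d
  refine ⟨P, e, (isManifold_prodMfd hX hY).2 hc hd he, P.pair u v, he, P.fst_pair u v,
    P.snd_pair u v, (he _ _ _).2 ?_⟩
  rw [P.fst_pair, P.snd_pair]
  exact ⟨hu, hv⟩

theorem hasDim_prodMfd (hX : IsManifold .analytic X) (hY : IsManifold .analytic Y)
    (h1 : HasDim X m) (h2 : HasDim Y n) : HasDim (prodMfd .analytic X Y) (m + n) := by
  refine hasDim_of_cover (isManifold_prodMfd hX hY).1 fun ⟨x, y⟩ => ?_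
  obtain ⟨k, m', c, hc, u, hu⟩ := hX.exists_at x
  obtain ⟨l, n', d, hd, v, hv⟩ := hY.exists_at y
  obtain rfl := h1.eq hc hu
  obtain rfl := h2.eq hd hv
  obtain ⟨P, e, he, z, -, -, -, hz⟩ := exists_prodChart hX hY hc hd hu hv
  exact ⟨_, e, he, z, hz⟩

theorem isMap_fst (b : Prop) (hX : IsManifold κ X) (hY : IsManifold κ Y) :
    IsMap κ b (prodMfd κ X Y) X Prod.fst := by
  refine isMap_of_local (isManifold_prodMfd hX hY).1 hX fun ⟨x, y⟩ => ?_
  obtain ⟨k, m, c, hc, u, hu⟩ := hX.exists_at x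
  obtain ⟨l, n, d, hd, v, hv⟩ := hY.exists_at y
  obtain ⟨P, e, he, z, hp, -, -, hz⟩ := exists_prodChart hX hY hc hd hu hv
  exact ⟨_, _, e, he, k, m, c, hc, z, P.fst, hz, hp.repAt_fst hz, P.mapAt_fst κ b hz.mem_orthant⟩

theorem isMap_snd (b : Prop) (hX : IsManifold κ X) (hY : IsManifold κ Y) :
    IsMap κ b (prodMfd κ X Y) Y Prod.snd := by
  refine isMap_of_local (isManifold_prodMfd hX hY).1 hY fun ⟨x, y⟩ => ?_
  obtain ⟨k, m, c, hc, u, hu⟩ := hX.exists_at x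
  obtain ⟨l, n, d, hd, v, hv⟩ := hY.exists_at y
  obtain ⟨P, e, he, z, hp, -, -, hz⟩ := exists_prodChart hX hY hc hd hu hv
  exact ⟨_, _, e, he, l, n, d, hd, z, P.snd, hz, hp.repAt_snd hz, P.mapAt_snd κ b hz.mem_orthant⟩

theorem IsMap.pair (hX : IsManifold κ X) (hY : IsManifold κ Y) (hZ : IsManifold κ Z)
    {f : Z → X} {f' : Z → Y} (hf : IsMap κ b Z X f) (hf' : IsMap κ b Z Y f') :
    IsMap κ b Z (prodMfd κ X Y) fun w => (f w, f' w) := by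
  refine isMap_of_local hZ (isManifold_prodMfd hX hY).1 fun w => ?_
  obtain ⟨k₀, m₀, a, ha, t, ht⟩ := hZ.exists_at w
  obtain ⟨k, m, c, hc, u, hu⟩ := hX.exists_at (f w)
  obtain ⟨l, n, d, hd, v, hv⟩ := hY.exists_at (f' w)
  obtain ⟨P, e, he, z, hp, -, -, hz⟩ := exists_prodChart hX hY hc hd hu hv
  obtain ⟨g, hg, hgm, -⟩ := hf.exists_rep ha hc ht hu
  obtain ⟨g', hg', hgm', -⟩ := hf'.exists_rep ha hd ht hv
  exact ⟨k₀, m₀, a, ha, _, _, e, he, t, _, ht, hp.repAt_pair hg hg', P.mapAt_pair hgm hgm'⟩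

theorem IsMap.prodMap {W : AtlasSpace.{u}} (hW : IsManifold κ W) (hX : IsManifold κ X)
    (hY : IsManifold κ Y) (hZ : IsManifold κ Z) {f : W → Y} {h : X → Z} (hf : IsMap κ b W Y f)
    (hh : IsMap κ b X Z h) : IsMap κ b (prodMfd κ W X) (prodMfd κ Y Z) (Prod.map f h) :=
  have hP := (isManifold_prodMfd hW hX).1
  IsMap.pair hY hZ hP (IsMap.comp hP hW hY (isMap_fst b hW hX) hf)
    (IsMap.comp hP hX hZ (isMap_snd b hW hX) hh)

end Prod

end ACorners

namespace ACorners

/-! ### Corners of products -/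

theorem isPushChart_of_at_iff {X Y : Type u} {k m : ℕ} {f : X → Y} {c : Chart k m X}
    {d : Chart k m Y} (h : ∀ u x, At c u x → At d u (f x)) (h' : ∀ u y, At d u y → ∃ x, At c u x) :
    IsPushChart f c d :=
  isPushChart_of_at (Set.ext fun u => ⟨fun hu => (h' u _ ⟨hu, rfl⟩).choose_spec.1,
    fun hu => (h u _ ⟨hu, rfl⟩).1⟩) h

/-- A splitting restricts to faces. -/
theorem Splitting.exists_face {k m l n K M k' m' l' n' K' M' p q r : ℕ} (P : Splitting k m l n K M)
    (hk : k ≤ m) (hl : l ≤ n) (hK : K ≤ M) (F : Face k m k' m' p) (G : Face l n l' n' q)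
    (H : Face K M K' M' r) (h1 : P.left H.missing = F.missing)
    (h2 : P.right H.missing = G.missing) :
    ∃ P' : Splitting k' m' l' n' K' M', ∀ z, P.fst (H.ins z) = F.ins (P'.fst z) ∧
      P.snd (H.ins z) = G.ins (P'.snd z) := by
  have hl' : ∀ i, P.ε (Sum.inl i) ∈ range H.ι ↔ i ∈ range F.ι := fun i => by
    rw [← not_iff_not, ← H.mem_missing, ← F.mem_missing, ← h1, P.mem_left]
  have hr' : ∀ j, P.ε (Sum.inr j) ∈ range H.ι ↔ j ∈ range G.ι := fun j => by
    rw [← not_iff_not, ← H.mem_missing, ← G.mem_missing, ← h2, P.mem_right]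
  -- The missing coordinates of `H` are those of `F` and `G` together, so the remaining ones
  -- correspond as well; `ε'` is the bijection between them induced by `P.ε`.
  have hex : ∀ t : Fin m' ⊕ Fin n', ∃ s, H.ι s = P.ε (Sum.map F.ι G.ι t) := by
    rintro (i | j)
    · exact (hl' _).2 ⟨i, rfl⟩
    · exact (hr' _).2 ⟨j, rfl⟩
  choose ε' hε' using hex
  have hinj : Function.Injective ε' := fun s t h => by
    have : P.ε (Sum.map F.ι G.ι s) = P.ε (Sum.map F.ι G.ι t) := by rw [← hε', ← hε', h]
    exact Sum.map_injective.2 ⟨F.ι.injective, G.ι.injective⟩ (P.ε.injective this)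
  have hsurj : Function.Surjective ε' := fun s => by
    obtain ⟨t, ht⟩ := P.ε.surjective (H.ι s)
    rcases t with i | j
    · obtain ⟨i', rfl⟩ := (hl' i).1 ⟨s, ht.symm⟩
      exact ⟨Sum.inl i', H.ι.injective ((hε' _).trans ht)⟩
    · obtain ⟨j', rfl⟩ := (hr' j).1 ⟨s, ht.symm⟩
      exact ⟨Sum.inr j', H.ι.injective ((hε' _).trans ht)⟩
  have hbij : Function.Bijective ε' := ⟨hinj, hsurj⟩
  have hcard := P.card_left_add_card_right H.missing
  rw [h1, h2, F.card_missing, G.card_missing, H.card_missing] at hcard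
  have b1 := F.bound_add
  have b2 := G.bound_add
  have b3 := H.bound_add
  have b4 := P.bound_add
  refine ⟨⟨by omega, Equiv.ofBijective ε' hbij, fun i => ?_, fun j => ?_⟩,
    fun z => ⟨?_, ?_⟩⟩
  · rw [Equiv.ofBijective_apply, ← H.ι_lt_iff hK, hε', Sum.map_inl, P.inl_lt_iff, F.ι_lt_iff hk]
  · rw [Equiv.ofBijective_apply, ← H.ι_lt_iff hK, hε', Sum.map_inr, P.inr_lt_iff, G.ι_lt_iff hl]
  · funext i
    by_cases h : i ∈ F.missing
    · rw [F.ins_missing _ h]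
      exact H.ins_missing _ (P.mem_left.1 (h1 ▸ h))
    · obtain ⟨i', rfl⟩ := not_not.1 (fun h' => h (F.mem_missing.2 h'))
      rw [F.ins_ι]
      change H.ins z (P.ε (Sum.inl _)) = z (ε' (Sum.inl i'))
      rw [← H.ins_ι z, hε', Sum.map_inl]
  · funext j
    by_cases h : j ∈ G.missing
    · rw [G.ins_missing _ h]
      exact H.ins_missing _ (P.mem_right.1 (h2 ▸ h))
    · obtain ⟨j', rfl⟩ := not_not.1 (fun h' => h (G.mem_missing.2 h'))
      rw [G.ins_ι]
      change H.ins z (P.ε (Sum.inr _)) = z (ε' (Sum.inr j'))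
      rw [← H.ins_ι z, hε', Sum.map_inr]

section ProdCorners

variable {κ : Kind} {b : Prop} {X Y Z : AtlasSpace.{u}} {k m l n K M p q r : ℕ}
  {P : Splitting k m l n K M} {c : Chart k m X} {d : Chart l n Y}
  {e : Chart K M (prodMfd κ X Y)} {z : Fin M → ℝ} {S : Finset (Fin M)}

theorem IsProd.hasIdx_fst (hX : IsManifold κ X) (hY : IsManifold κ Y) (hc : c ∈ X.atlas k m)
    (hd : d ∈ Y.atlas l n) (h : IsProd P c d e) {a : CornerPt (prodMfd κ X Y) r}
    (ha : HasIdx e z S a) {a' : CornerPt X p} (hp : IsPushCorner (Prod.fst : X × Y → X) a a') :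
    HasIdx c (P.fst z) (P.left S) a' :=
  ha.of_isPushCorner (isManifold_prodMfd hX hY).1 hX ((isManifold_prodMfd hX hY).2 hc hd h) hc hp
    (h.repAt_fst ha.at_fst) P.continuous_fst.continuousWithinAt (P.hasPattern_fst z)

theorem IsProd.hasIdx_snd (hX : IsManifold κ X) (hY : IsManifold κ Y) (hc : c ∈ X.atlas k m)
    (hd : d ∈ Y.atlas l n) (h : IsProd P c d e) {a : CornerPt (prodMfd κ X Y) r}
    (ha : HasIdx e z S a) {a' : CornerPt Y p} (hp : IsPushCorner (Prod.snd : X × Y → Y) a a') :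
    HasIdx d (P.snd z) (P.right S) a' :=
  ha.of_isPushCorner (isManifold_prodMfd hX hY).1 hY ((isManifold_prodMfd hX hY).2 hc hd h) hd hp
    (h.repAt_snd ha.at_fst) P.continuous_snd.continuousWithinAt (P.hasPattern_snd z)

theorem IsProd.isPushCorner_iff (hX : IsManifold κ X) (hY : IsManifold κ Y) (hc : c ∈ X.atlas k m)
    (hd : d ∈ Y.atlas l n) (h : IsProd P c d e) {a : CornerPt (prodMfd κ X Y) r}
    (ha : HasIdx e z S a) {I : Finset (Fin m)} {J : Finset (Fin n)} {a₁ : CornerPt X p}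
    {a₂ : CornerPt Y q} (h1 : HasIdx c (P.fst z) I a₁) (h2 : HasIdx d (P.snd z) J a₂) :
    (IsPushCorner (Prod.fst : X × Y → X) a a₁ ∧ IsPushCorner (Prod.snd : X × Y → Y) a a₂) ↔
      I = P.left S ∧ J = P.right S := by
  have hP := isManifold_prodMfd hX hY
  exact and_congr
    (isPushCorner_iff_of_hasIdx hP.1 hX (hP.2 hc hd h) hc ha h1 (h.repAt_fst ha.at_fst)
      P.continuous_fst.continuousWithinAt (P.hasPattern_fst z))
    (isPushCorner_iff_of_hasIdx hP.1 hY (hP.2 hc hd h) hd ha h2 (h.repAt_snd ha.at_fst)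
      P.continuous_snd.continuousWithinAt (P.hasPattern_snd z))

/-- The codimension is the size of the index, so corner points with equal index need not be assumed
to have equal codimension. -/
theorem HasIdx.sigma_ext {c : Chart k m X} {u : Fin m → ℝ} {I : Finset (Fin m)}
    {a : CornerPt X p} {b : CornerPt X q} (ha : HasIdx c u I a) (hb : HasIdx c u I b) :
    (⟨p, a⟩ : Σ p, CornerPt X p) = ⟨q, b⟩ := by
  obtain rfl : p = q := ha.card.symm.trans hb.card
  rw [ha.ext hb]

/-- A point of the corners of a product, seen in a product chart. -/
theorem exists_prod_hasIdx (hX : IsManifold κ X) (hY : IsManifold κ Y)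
    (a : CornerPt (prodMfd κ X Y) r) {a₁ : CornerPt X p} {a₂ : CornerPt Y q}
    (h1 : IsPushCorner (Prod.fst : X × Y → X) a a₁)
    (h2 : IsPushCorner (Prod.snd : X × Y → Y) a a₂) :
    ∃ (k m l n K M : ℕ) (P : Splitting k m l n K M), ∃ c ∈ X.atlas k m, ∃ d ∈ Y.atlas l n,
      ∃ e ∈ (prodMfd κ X Y).atlas K M, IsProd P c d e ∧ ∃ z S, HasIdx e z S a ∧
        HasIdx c (P.fst z) (P.left S) a₁ ∧ HasIdx d (P.snd z) (P.right S) a₂ := by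
  obtain ⟨k, m, c, hc, u, hu⟩ := hX.exists_at a.1.1
  obtain ⟨l, n, d, hd, v, hv⟩ := hY.exists_at a.1.2
  obtain ⟨P, e, he, z, hp, rfl, rfl, hz⟩ := exists_prodChart hX hY hc hd hu hv
  obtain ⟨S, hS⟩ := exists_hasIdx (isManifold_prodMfd hX hY).1 he a hz
  exact ⟨k, m, l, n, _, _, P, c, hc, d, hd, e, he, hp, z, S, hS, hp.hasIdx_fst hX hY hc hd hS h1,
    hp.hasIdx_snd hX hY hc hd hS h2⟩

theorem IsFace.corners_at_iff {k' m' : ℕ} {c : Chart k m X} {F : Face k m k' m' p}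
    {c' : Chart k' m' (kCorners κ X p)} (hF : IsFace F c c') {c'' : Chart k' m' (corners κ X)}
    (hc : IsPushChart (Y := corners κ X) (Sigma.mk p) c' c'') {y : Fin m' → ℝ} {w : corners κ X} :
    At c'' y w ↔ HasIdx c (F.ins y) F.missing w.2 := by
  constructor
  · intro h
    obtain ⟨a, ha, rfl⟩ := hc.exists_at h
    exact hF.at_iff.1 ha
  · intro h
    obtain ⟨q, a⟩ := w
    obtain rfl : p = q := F.card_missing.symm.trans h.card
    exact hc.at (hF.at_iff.2 h)

/-- In a product chart an index is a subset `S` of a disjoint union of coordinates, and pushing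
along the two projections gives its halves `P.left S` and `P.right S`. Such an `S` is the same as a
pair of subsets, and the codimensions add up. In the face charts belonging to `S` and its halves the
map is the identity. -/
theorem exists_isProdIdentification (hX : IsManifold κ X) (hY : IsManifold κ Y) :
    ∃ Φ : corners κ (prodMfd κ X Y) ≃ prodMfd κ (corners κ X) (corners κ Y),
      IsDiffeo κ (corners κ (prodMfd κ X Y)) (prodMfd κ (corners κ X) (corners κ Y)) Φ ∧
      (∀ z : corners κ (prodMfd κ X Y),
        IsPushCorner (Prod.fst : prodMfd κ X Y → X) z.2 (Φ z).1.2 ∧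
        IsPushCorner (Prod.snd : prodMfd κ X Y → Y) z.2 (Φ z).2.2) ∧
      ∀ z, (Φ z).1.1 + (Φ z).2.1 = z.1 := by
  have hP := isManifold_prodMfd hX hY
  have hCX := isManifold_corners hX
  have hCY := isManifold_corners hY
  obtain ⟨F, hF⟩ := exists_isCornerMap hP.1 hX (isMap_fst False hX hY)
  obtain ⟨G, hG⟩ := exists_isCornerMap hP.1 hY (isMap_snd False hX hY)
  have hinj : Function.Injective fun w => (F w, G w) := by
    intro w w' h
    obtain ⟨h1, h2⟩ := Prod.mk.inj h
    obtain ⟨r, a⟩ := w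
    obtain ⟨r', a'⟩ := w'
    have hpt : a.1 = a'.1 := by
      refine Prod.ext ?_ ?_
      · rw [← (hF ⟨r, a⟩).1, ← (hF ⟨r', a'⟩).1, h1]
      · rw [← (hG ⟨r, a⟩).1, ← (hG ⟨r', a'⟩).1, h2]
    obtain ⟨k, m, l, n, K, M, P, c, hc, d, hd, e, he, hp, z, S, hS, hl, hr⟩ :=
      exists_prod_hasIdx hX hY a (hF ⟨r, a⟩) (hG ⟨r, a⟩)
    obtain ⟨S', hS'⟩ := exists_hasIdx hP.1 he a' (hpt ▸ hS.at_fst)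
    have hl' := hp.hasIdx_fst hX hY hc hd hS' (hF ⟨r', a'⟩)
    have hr' := hp.hasIdx_snd hX hY hc hd hS' (hG ⟨r', a'⟩)
    rw [← h1] at hl'
    rw [← h2] at hr'
    obtain rfl := P.finset_ext (hl.unique hX hc hl') (hr.unique hY hd hr')
    exact hS.sigma_ext hS'
  have hsurj : Function.Surjective fun w => (F w, G w) := by
    rintro ⟨⟨p, a₁⟩, ⟨q, a₂⟩⟩
    obtain ⟨k, m, c, hc, u, hu⟩ := hX.exists_at a₁.1
    obtain ⟨l, n, d, hd, v, hv⟩ := hY.exists_at a₂.1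
    obtain ⟨P, e, he, z, hp, rfl, rfl, hz⟩ := exists_prodChart hX hY hc hd hu hv
    obtain ⟨I, hI⟩ := exists_hasIdx hX hc a₁ hu
    obtain ⟨J, hJ⟩ := exists_hasIdx hY hd a₂ hv
    obtain ⟨S, rfl, rfl⟩ := P.exists_finset I J
    have hS : S ⊆ zeroSet (k + l) z := by
      intro t
      revert t
      refine P.forall_fin.2 ⟨fun i hi => ?_, fun j hj => ?_⟩
      · rw [← P.mem_left, P.left_zeroSet]
        exact hI.subset (P.mem_left.2 hi)
      · rw [← P.mem_right, P.right_zeroSet]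
        exact hJ.subset (P.mem_right.2 hj)
    obtain ⟨a, ha⟩ := exists_cornerPt hP.1 he hz hS rfl
    obtain ⟨h1, h2⟩ := (hp.isPushCorner_iff hX hY hc hd ha hI hJ).2 ⟨rfl, rfl⟩
    exact ⟨⟨_, a⟩, Prod.ext
      (hF.eq_of_isPushCorner hP.1 hX (isMap_fst False hX hY) (z := ⟨_, a⟩) (w := ⟨p, a₁⟩) h1)
      (hG.eq_of_isPushCorner hP.1 hY (isMap_snd False hX hY) (z := ⟨_, a⟩) (w := ⟨q, a₂⟩) h2)⟩
  have hloc : IsLocalDiffeo (corners κ (prodMfd κ X Y)) (prodMfd κ (corners κ X) (corners κ Y))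
      fun w => (F w, G w) := by
    rintro ⟨r, a⟩
    obtain ⟨k, m, l, n, K, M, P, c, hc, d, hd, e, he, hp, z, S, hS, hl, hr⟩ :=
      exists_prod_hasIdx hX hY a (hF ⟨r, a⟩) (hG ⟨r, a⟩)
    obtain ⟨K', M', H, e', y, rfl, hHe, rfl, hy⟩ := hS.exists_face hP.1 he
    obtain ⟨k', m', F₁, c', -, hm1, hFc, -, -⟩ := hl.exists_face hX hc
    obtain ⟨l', n', G₁, d', -, hm2, hGd, -, -⟩ := hr.exists_face hY hd
    obtain ⟨P', hP'⟩ := P.exists_face c.le d.le e.le F₁ G₁ H hm1.symm hm2.symm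
    obtain ⟨e'', he'', hpe⟩ := exists_cornersChart hP.1 (hHe.mem_atlas hP.1 he)
    obtain ⟨c'', hc'', hpc⟩ := exists_cornersChart hX (hFc.mem_atlas hX hc)
    obtain ⟨d'', hd'', hpd⟩ := exists_cornersChart hY (hGd.mem_atlas hY hd)
    obtain ⟨f, hf⟩ := exists_isProd P' c'' d''
    refine ⟨K', M', e'', he'', mem_range_iff.2 ⟨y, hpe.at hy⟩, f,
      (isManifold_prodMfd hCX hCY).2 hc'' hd'' hf, isPushChart_of_at_iff ?_ ?_⟩
    · intro y' w hw
      obtain ⟨w, hw₀, rfl⟩ := hpe.exists_at hw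
      have hw' := hHe.at_iff.1 hw₀
      have h1 := hp.hasIdx_fst hX hY hc hd hw' (hF ⟨r, w⟩)
      have h2 := hp.hasIdx_snd hX hY hc hd hw' (hG ⟨r, w⟩)
      rw [(hP' y').1, ← hm1] at h1
      rw [(hP' y').2, ← hm2] at h2
      exact (hf _ _ _).2 ⟨(hFc.corners_at_iff hpc).2 h1, (hGd.corners_at_iff hpd).2 h2⟩
    · rintro y' ⟨w₁, w₂⟩ hw
      obtain ⟨h1, h2⟩ := (hf _ _ _).1 hw
      have h5 := ((hFc.corners_at_iff hpc).1 h1).at_fst.1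
      have h6 := ((hGd.corners_at_iff hpd).1 h2).at_fst.1
      rw [← (hP' y').1] at h5
      rw [← (hP' y').2] at h6
      have hy' : y' ∈ e'.dom := by
        rw [hHe.1]
        exact hp.dom_eq.symm.subset ⟨h5, h6⟩
      exact ⟨_, hpe.at ⟨hy', rfl⟩⟩
  let Φ : corners κ (prodMfd κ X Y) ≃ prodMfd κ (corners κ X) (corners κ Y) :=
    Equiv.ofBijective (fun w => (F w, G w)) ⟨hinj, hsurj⟩
  refine ⟨Φ, IsLocalDiffeo.isDiffeo (isManifold_corners hP.1) (isManifold_prodMfd hCX hCY).1 hloc,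
    fun w => ⟨hF w, hG w⟩, fun w => ?_⟩
  obtain ⟨k, m, l, n, K, M, P, c, hc, d, hd, e, he, hp, z, S, hS, hl, hr⟩ :=
    exists_prod_hasIdx hX hY w.2 (hF w) (hG w)
  rw [← hS.card, ← P.card_left_add_card_right, hl.card, hr.card]
  rfl

/-- Uniqueness in the identification of the corners of a product. -/
theorem eq_of_isPushCorner_prod (hX : IsManifold κ X) (hY : IsManifold κ Y) (hZ : IsManifold κ Z)
    {g : X → Y} {h : X → Z} (hg : IsMap κ False X Y g) (hh : IsMap κ False X Z h)
    {G : corners κ X → corners κ Y} {H : corners κ X → corners κ Z}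
    {Q : corners κ X → corners κ (prodMfd κ Y Z)}
    {Ψ : corners κ (prodMfd κ Y Z) ≃ prodMfd κ (corners κ Y) (corners κ Z)}
    (hG : IsCornerMap κ X Y g G) (hH : IsCornerMap κ X Z h H)
    (hQ : IsCornerMap κ X (prodMfd κ Y Z) (fun x => (g x, h x)) Q)
    (hΨ : IsProdIdentification κ Y Z Ψ) (z : corners κ X) : Ψ (Q z) = (G z, H z) := by
  have hP := (isManifold_prodMfd hY hZ).1
  have hgh : IsMap κ False X (prodMfd κ Y Z) fun x => (g x, h x) := hg.pair hY hZ hX hh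
  refine Prod.ext ?_ ?_
  · exact (hG.eq_of_isPushCorner hX hY hg (z := z) (w := (Ψ (Q z)).1)
      (IsPushCorner.comp hX hP hY hgh (isMap_fst False hY hZ) (hQ z) (hΨ (Q z)).1)).symm
  · exact (hH.eq_of_isPushCorner hX hZ hh (z := z) (w := (Ψ (Q z)).2)
      (IsPushCorner.comp hX hP hZ hgh (isMap_snd False hY hZ) (hQ z) (hΨ (Q z)).2)).symm

/-- The case of a pair of maps, applied to the composites of `f` and `h` with the projections of the
source. -/
theorem eq_of_isPushCorner_prodMap {W : AtlasSpace.{u}} (hW : IsManifold κ W) (hX : IsManifold κ X)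
    (hY : IsManifold κ Y) (hZ : IsManifold κ Z) {f : W → Y} {h : X → Z} (hf : IsMap κ False W Y f)
    (hh : IsMap κ False X Z h) {F : corners κ W → corners κ Y} {H : corners κ X → corners κ Z}
    {Q : corners κ (prodMfd κ W X) → corners κ (prodMfd κ Y Z)}
    {Φ : corners κ (prodMfd κ W X) ≃ prodMfd κ (corners κ W) (corners κ X)}
    {Ψ : corners κ (prodMfd κ Y Z) ≃ prodMfd κ (corners κ Y) (corners κ Z)}
    (hF : IsCornerMap κ W Y f F) (hH : IsCornerMap κ X Z h H)
    (hQ : IsCornerMap κ (prodMfd κ W X) (prodMfd κ Y Z) (Prod.map f h) Q)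
    (hΦ : IsProdIdentification κ W X Φ) (hΨ : IsProdIdentification κ Y Z Ψ)
    (z : corners κ (prodMfd κ W X)) : Ψ (Q z) = (F (Φ z).1, H (Φ z).2) := by
  have hP := (isManifold_prodMfd hW hX).1
  have h1 := isMap_fst False hW hX
  have h2 := isMap_snd False hW hX
  exact eq_of_isPushCorner_prod hP hY hZ (IsMap.comp hP hW hY h1 hf) (IsMap.comp hP hX hZ h2 hh)
    (G := fun z => F (Φ z).1) (H := fun z => H (Φ z).2)
    (fun z => IsPushCorner.comp hP hW hY h1 hf (hΦ z).1 (hF (Φ z).1))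
    (fun z => IsPushCorner.comp hP hX hZ h2 hh (hΦ z).2 (hH (Φ z).2)) hQ hΨ z

end ProdCorners

end ACorners

namespace ACorners

/-! ### From corners to a-corners -/

section Germ

variable {b : Prop} {k l m n : ℕ} {u : Fin m → ℝ}

theorem SmAt.toAnalytic {f : (Fin m → ℝ) → ℝ} (h : SmAt .ordinary k f u) : SmAt .analytic k f u := by
  obtain ⟨W, hW, hu, hf⟩ := h
  exact ⟨W, hW, hu, isASmooth_of_contDiffOn hW ((isWeaklySmooth_iff hW).1 hf)⟩

theorem MonoAt.toAnalytic {h : (Fin m → ℝ) → ℝ} (hh : MonoAt .ordinary k h u) :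
    MonoAt .analytic k h u := by
  obtain ⟨F, a, h1, h2, h3, -, h4⟩ := hh
  exact ⟨F, a, h1.toAnalytic, h2, h3, fun h => (nomatch h), h4⟩

theorem MapAt.toAnalytic {g : (Fin m → ℝ) → Fin n → ℝ} (h : MapAt .ordinary b k l g u) :
    MapAt .analytic b k l g u := fun j =>
  ⟨fun hj => ((h j).1 hj).toAnalytic, fun hj => ((h j).2 hj).imp_left MonoAt.toAnalytic⟩

end Germ

section ToAnalytic

variable {b : Prop} {X Y : AtlasSpace.{u}} {k l m n p q : ℕ}

theorem isManifold_toAnalytic (hX : IsManifold .ordinary X) : IsManifold .analytic (toAnalytic X) ∧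
    ∀ k m : ℕ, X.atlas k m ⊆ (toAnalytic X).atlas k m := by
  refine isManifold_generate X hX.t2 hX.secondCountable X.atlas
    (fun k m c hc => hX.isOpenEmbedding c hc) hX.exists_at fun k m l n c hc d hd u v x hu hv => ?_
  obtain ⟨g, h1, h2⟩ := hX.mapIn hc hd u v x hu hv
  exact ⟨g, h1, h2.toAnalytic⟩

theorem hasDim_toAnalytic (hX : IsManifold .ordinary X) (h : HasDim X n) :
    HasDim (toAnalytic X) n := by
  refine hasDim_of_cover (isManifold_toAnalytic hX).1 fun x => ?_
  obtain ⟨k, m, c, hc, u, hu⟩ := hX.exists_at x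
  obtain rfl := h.eq hc hu
  exact ⟨k, c, (isManifold_toAnalytic hX).2 _ _ hc, u, hu⟩

/-- Both depths are computed in a chart that belongs to both atlases. As the spaces and their strata
agree, so do the local corner components. -/
theorem stratum_toAnalytic (hX : IsManifold .ordinary X) (p : ℕ) :
    stratum (toAnalytic X) p = stratum X p := by
  ext x
  obtain ⟨k, m, c, hc, u, hu⟩ := hX.exists_at x
  exact ((isManifold_toAnalytic hX).1.mem_stratum_iff ((isManifold_toAnalytic hX).2 _ _ hc) hu).trans
    (hX.mem_stratum_iff hc hu).symm

theorem IsMap.toAnalytic (hX : IsManifold .ordinary X) (hY : IsManifold .ordinary Y) {f : X → Y}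
    (hf : IsMap .ordinary b X Y f) :
    IsMap .analytic b (ACorners.toAnalytic X) (ACorners.toAnalytic Y) f := by
  have hX' := isManifold_toAnalytic hX
  have hY' := isManifold_toAnalytic hY
  refine isMap_of_local hX'.1 hY'.1 fun x => ?_
  obtain ⟨k, m, c, hc, u, hu⟩ := hX.exists_at x
  obtain ⟨l, n, d, hd, v, hv⟩ := hY.exists_at (f x)
  obtain ⟨g, hg, hgm, -⟩ := hf.exists_rep hc hd hu hv
  exact ⟨k, m, c, hX'.2 _ _ hc, l, n, d, hY'.2 _ _ hd, u, g, hu, hg, hgm.toAnalytic⟩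

/-- The identification of the local corner components for the two structures. -/
def cornerPtEquiv (hX : IsManifold .ordinary X) (p : ℕ) :
    CornerPt (toAnalytic X) p ≃ CornerPt X p where
  toFun a := ⟨a.1, ⟨a.2.comp, fun V => by
    have := a.2.isComponent V
    rw [stratum_toAnalytic hX] at this
    exact this, a.2.mem_closure, a.2.compat⟩⟩
  invFun a := ⟨a.1, ⟨a.2.comp, fun V => by
    have := a.2.isComponent V
    rw [← stratum_toAnalytic hX] at this
    exact this, a.2.mem_closure, a.2.compat⟩⟩
  left_inv _ := rfl
  right_inv _ := rfl

theorem isSameCorner_cornerPtEquiv (hX : IsManifold .ordinary X) (a : CornerPt (toAnalytic X) p) :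
    IsSameCorner X a (cornerPtEquiv hX p a) := by
  refine ⟨rfl, fun V V' h => ?_⟩
  have : V = V' := SetLike.coe_injective h
  rw [this]
  rfl

theorem hasIdx_cornerPtEquiv (hX : IsManifold .ordinary X) {a : CornerPt (toAnalytic X) p}
    {c : Chart k m X} {u : Fin m → ℝ} {I : Finset (Fin m)} :
    HasIdx (X := X) c u I (cornerPtEquiv hX p a) ↔ HasIdx (X := toAnalytic X) c u I a :=
  ⟨fun h => ⟨h.1, h.2, h.3, h.4⟩, fun h => ⟨h.1, h.2, h.3, h.4⟩⟩

/-- The same face of the same chart of `X` gives a chart on either side, and in these charts the map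
is the identity. -/
theorem isLocalDiffeo_cornerPtEquiv (hX : IsManifold .ordinary X) (p : ℕ) :
    IsLocalDiffeo (kCorners .analytic (toAnalytic X) p) (toAnalytic (kCorners .ordinary X p))
      (cornerPtEquiv hX p) := by
  intro a
  have hX' := isManifold_toAnalytic hX
  have hC := isManifold_toAnalytic (isManifold_kCorners hX p).1
  obtain ⟨k, m, c, hc, u, hu⟩ := hX.exists_at a.1
  obtain ⟨I, hI⟩ := exists_hasIdx hX'.1 (hX'.2 _ _ hc) a hu
  obtain ⟨k', m', F, c', y, rfl, hF, rfl, hy⟩ := hI.exists_face hX'.1 (hX'.2 _ _ hc)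
  obtain ⟨d', hd'⟩ := exists_isFace hX hc F
  refine ⟨k', m', c', hF.mem_atlas hX'.1 (hX'.2 _ _ hc), mem_range_iff.2 ⟨y, hy⟩, d',
    hC.2 _ _ (hd'.mem_atlas hX hc), isPushChart_of_at (hd'.1.trans hF.1.symm) fun v b hb => ?_⟩
  exact hd'.at_iff.2 ((hasIdx_cornerPtEquiv hX).2 (hF.at_iff.1 hb))

/-- The identification of the corners for the two structures. -/
def cornersEquiv (hX : IsManifold .ordinary X) :
    corners .analytic (toAnalytic X) ≃ toAnalytic (corners .ordinary X) :=
  Equiv.sigmaCongrRight (cornerPtEquiv hX)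

theorem isCornersIdentification_cornersEquiv (hX : IsManifold .ordinary X) :
    IsCornersIdentification X (cornersEquiv hX) := fun z =>
  ⟨rfl, isSameCorner_cornerPtEquiv hX z.2⟩

theorem isLocalDiffeo_cornersEquiv (hX : IsManifold .ordinary X) :
    IsLocalDiffeo (corners .analytic (toAnalytic X)) (toAnalytic (corners .ordinary X))
      (cornersEquiv hX) := by
  rintro ⟨p, a⟩
  have hX' := isManifold_toAnalytic hX
  have hC := isManifold_toAnalytic (isManifold_corners hX)
  obtain ⟨k, m, c, hc, u, hu⟩ := hX.exists_at a.1
  obtain ⟨I, hI⟩ := exists_hasIdx hX'.1 (hX'.2 _ _ hc) a hu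
  obtain ⟨k', m', F, c', y, rfl, hF, rfl, hy⟩ := hI.exists_face hX'.1 (hX'.2 _ _ hc)
  obtain ⟨d', hd'⟩ := exists_isFace hX hc F
  obtain ⟨c'', hc'', hpc⟩ := exists_cornersChart hX'.1 (hF.mem_atlas hX'.1 (hX'.2 _ _ hc))
  obtain ⟨d'', hd'', hpd⟩ := exists_cornersChart hX (hd'.mem_atlas hX hc)
  refine ⟨k', m', c'', hc'', mem_range_iff.2 ⟨y, hpc.at hy⟩, d'', hC.2 _ _ hd'',
    isPushChart_of_at ((hpd.1.trans (hd'.1.trans hF.1.symm)).trans hpc.1.symm) fun v b hb => ?_⟩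
  exact (hd'.corners_at_iff hpd).2
    ((hasIdx_cornerPtEquiv hX).2 ((hF.corners_at_iff hpc).1 hb))

theorem IsSameCorner.isPushCorner {f : X → Y} {p' q' : ℕ} {a : CornerPt (toAnalytic X) p}
    {a' : CornerPt X p'} {b : CornerPt (toAnalytic Y) q} {b' : CornerPt Y q'}
    (ha : IsSameCorner X a a') (hb : IsSameCorner Y b b')
    (h : IsPushCorner (X := toAnalytic X) (Y := toAnalytic Y) f a b) : IsPushCorner f a' b' := by
  refine ⟨(hb.1.trans h.1).trans (congrArg f ha.1.symm), fun V V' => ?_⟩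
  let W : OpenNhdsOf a.1 := ⟨⟨V.carrier, V.is_open'⟩, ha.1 ▸ V.mem'⟩
  let W' : OpenNhdsOf b.1 := ⟨⟨V'.carrier, V'.is_open'⟩, hb.1 ▸ V'.mem'⟩
  rw [← ha.2 W V rfl, ← hb.2 W' V' rfl]
  exact h.2 W W'

theorem existsUnique_isCornerMap {κ : Kind} (hX : IsManifold κ X) (hY : IsManifold κ Y)
    {f : X → Y} (hf : IsMap κ False X Y f) :
    ∃! F, IsCornerMap κ X Y f F ∧ IsInterior κ (corners κ X) (corners κ Y) F := by
  obtain ⟨F, hF⟩ := exists_isCornerMap hX hY hf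
  exact ⟨F, ⟨hF, (isInterior_iff (isManifold_corners hX) (isManifold_corners hY)).2
    (hF.isMap hX hY hf)⟩, fun G hG => hG.1.unique hX hY hf hF⟩

/-- The condition characterising `f_*(γ)` involves only the chosen components, which are the same
sets for both structures; uniqueness of `f_*(γ)` does the rest. -/
theorem cornersIdentification_comm (hX : IsManifold .ordinary X) (hY : IsManifold .ordinary Y)
    {f : X → Y} (hf : IsMap .ordinary False X Y f) {F F' J J'}
    (hF : IsCornerMap .ordinary X Y f F)
    (hF' : IsCornerMap .analytic (toAnalytic X) (toAnalytic Y) f F')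
    (hJ : IsCornersIdentification X J) (hJ' : IsCornersIdentification Y J')
    (z : corners .analytic (toAnalytic X)) : J' (F' z) = F (J z) :=
  (hF.eq_of_isPushCorner hX hY hf (z := J z) (w := J' (F' z))
    ((hJ z).2.isPushCorner (hJ' (F' z)).2 (hF' z))).symm

end ToAnalytic

end ACorners

namespace ACorners

/-! ### Boundaries of corners and corners of boundaries -/

namespace Face

variable {k m k₁ m₁ k₂ m₂ p q r : ℕ}

/-- A face of a face. -/
def comp (hkm : k ≤ m) (F : Face k m k₁ m₁ p) (G : Face k₁ m₁ k₂ m₂ q) :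
    Face k m k₂ m₂ (p + q) where
  dim_add := by have := F.dim_add; have := G.dim_add; omega
  bound_add := by have := F.bound_add; have := G.bound_add; omega
  ι := G.ι.trans F.ι
  mem_range i hi := by
    obtain ⟨j, rfl⟩ := F.mem_range i hi
    obtain ⟨j', rfl⟩ := G.mem_range j (not_lt.1 fun h => hi.not_gt ((F.ι_lt_iff hkm j).2 h))
    exact ⟨j', rfl⟩

theorem missing_comp (hkm : k ≤ m) (F : Face k m k₁ m₁ p) (G : Face k₁ m₁ k₂ m₂ q) :
    (F.comp hkm G).missing = F.missing ∪ G.missing.map F.ι.toEmbedding := by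
  ext i
  rw [mem_missing, Finset.mem_union]
  by_cases hi : i ∈ F.missing
  · refine iff_of_true ?_ (.inl hi)
    rintro ⟨j, rfl⟩
    exact F.ι_notMem_missing _ hi
  · obtain ⟨j, rfl⟩ := not_not.1 fun h => hi (F.mem_missing.2 h)
    have h1 : F.ι j ∈ range (F.comp hkm G).ι ↔ j ∈ range G.ι :=
      ⟨fun ⟨t, ht⟩ => ⟨t, F.ι.injective ht⟩, fun ⟨t, ht⟩ => ⟨t, congrArg F.ι ht⟩⟩
    have h2 : F.ι j ∈ G.missing.map F.ι.toEmbedding ↔ j ∈ G.missing :=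
      Finset.mem_map' F.ι.toEmbedding
    rw [h1, h2, G.mem_missing]
    tauto

theorem ins_comp (hkm : k ≤ m) (F : Face k m k₁ m₁ p) (G : Face k₁ m₁ k₂ m₂ q) (y : Fin m₂ → ℝ) :
    (F.comp hkm G).ins y = F.ins (G.ins y) := by
  funext i
  by_cases h : i ∈ (F.comp hkm G).missing
  · rw [ins_missing _ _ h]
    rw [missing_comp, Finset.mem_union, Finset.mem_map] at h
    rcases h with h | ⟨j, hj, rfl⟩
    · rw [ins_missing _ _ h]
    · exact ((F.ins_ι _ j).trans (G.ins_missing y hj)).symm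
  · obtain ⟨j, rfl⟩ := not_not.1 fun h' => h ((F.comp hkm G).mem_missing.2 h')
    exact ((F.comp hkm G).ins_ι y j).trans (((F.ins_ι _ _).trans (G.ins_ι y j)).symm)

/-- An increasing map between finite ordinals is determined by its range. This compares two ways of
reaching the same face in several steps. -/
theorem ins_eq_of_missing_eq {k₃ : ℕ} (F : Face k m k₂ m₂ p) (G : Face k m k₃ m₂ q)
    (h : F.missing = G.missing) (y : Fin m₂ → ℝ) : F.ins y = G.ins y := by
  have h1 : range F.ι = range G.ι := by
    ext i
    rw [← not_iff_not, ← F.mem_missing, ← G.mem_missing, h]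
  unfold ins
  rw [OrderEmbedding.range_inj.1 h1]

end Face

section BoundaryCorners

variable {κ : Kind} {X : AtlasSpace.{u}} {k m k₁ m₁ k₂ m₂ p q : ℕ} {c : Chart k m X}
  {F : Face k m k₁ m₁ p} {c' : Chart k₁ m₁ (kCorners κ X p)} {c'' : Chart k₁ m₁ (corners κ X)}
  {G : Face k m k₂ m₂ 1} {d' : Chart k₂ m₂ (boundary κ X)} {u : Fin m → ℝ}

/-- In a chart of `X`, a point of the boundary of `C(X)` is an index set, the missing coordinates of
`F`, with one further vanishing coordinate `s` of the face. -/
theorem exists_hasIdx_boundary_corners (hX : IsManifold κ X) (hc : c ∈ X.atlas k m)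
    (z : boundary κ (corners κ X)) (hu : At c u z.1.2.1) :
    ∃ (k₁ m₁ p : ℕ) (F : Face k m k₁ m₁ p) (c' : Chart k₁ m₁ (kCorners κ X p))
      (c'' : Chart k₁ m₁ (corners κ X)) (y : Fin m₁ → ℝ) (s : Fin m₁),
      IsFace F c c' ∧ c'' ∈ (corners κ X).atlas k₁ m₁ ∧
      IsPushChart (Y := corners κ X) (Sigma.mk p) c' c'' ∧ F.ins y = u ∧
      HasIdx (p := 1) c'' y {s} z := by
  obtain ⟨I, hI⟩ := exists_hasIdx hX hc z.1.2 hu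
  obtain ⟨k₁, m₁, F, c', y, rfl, hF, hy, hya⟩ := hI.exists_face hX hc
  obtain ⟨c'', hc'', h⟩ := exists_cornersChart hX (hF.mem_atlas hX hc)
  obtain ⟨S, hS⟩ := exists_hasIdx (p := 1) (isManifold_corners hX) hc'' z (h.at hya)
  obtain ⟨s, rfl⟩ := Finset.card_eq_one.1 hS.card
  exact ⟨k₁, m₁, _, F, c', c'', y, s, hF, hc'', h, hy, hS⟩

/-- In a chart of `X`, a point of the corners of the boundary is a single coordinate, the one
missing from `G`, with a set `S` of further vanishing coordinates. -/
theorem exists_hasIdx_corners_boundary (hX : IsManifold κ X) (hc : c ∈ X.atlas k m)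
    (w : corners κ (boundary κ X)) (hu : At c u w.2.1.1) :
    ∃ (k₂ m₂ : ℕ) (G : Face k m k₂ m₂ 1) (d' : Chart k₂ m₂ (boundary κ X)) (y : Fin m₂ → ℝ)
      (S : Finset (Fin m₂)), IsFace G c d' ∧ G.ins y = u ∧ HasIdx d' y S w.2 := by
  obtain ⟨J, hJ⟩ := exists_hasIdx (p := 1) hX hc w.2.1 hu
  obtain ⟨k₂, m₂, G, d', y, -, hG, hy, hyb⟩ := hJ.exists_face hX hc
  obtain ⟨S, hS⟩ := exists_hasIdx (X := boundary κ X) (isManifold_kCorners hX 1).1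
    (hG.mem_atlas hX hc) w.2 hyb
  exact ⟨k₂, m₂, G, d', y, S, hG, hy, hS⟩

/-- The relation between the boundary of the corners and the corners of the boundary in terms of
indices. -/
theorem isBoundaryCornerPair_iff (hX : IsManifold κ X) (hc : c ∈ X.atlas k m) (hF : IsFace F c c')
    (hc'' : c'' ∈ (corners κ X).atlas k₁ m₁)
    (hpc : IsPushChart (Y := corners κ X) (Sigma.mk p) c' c'') {y : Fin m₁ → ℝ} {s : Fin m₁}
    {z : boundary κ (corners κ X)} (hz : HasIdx (p := 1) c'' y {s} z) (hG : IsFace G c d')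
    {y' : Fin m₂ → ℝ} {S : Finset (Fin m₂)} {w : corners κ (boundary κ X)}
    (hw : HasIdx d' y' S w.2) (hy : F.ins y = G.ins y') :
    IsBoundaryCornerPair κ X z w ↔
      G.missing = {F.ι s} ∧ S.map G.ι.toEmbedding = F.missing := by
  have hza := (hF.corners_at_iff hpc).1 hz.at_fst
  have hwa := hG.at_iff.1 hw.at_fst
  have hBX := isManifold_kCorners hX 1
  have hr1 : RepAt c'' c (proj κ X) F.ins y := hz.at_fst.eventually_exists.mono fun v ⟨a, ha⟩ =>
    ⟨a, ha, ((hF.corners_at_iff hpc).1 ha).at_fst⟩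
  have hr2 := hG.repAt_fst hw.at_fst
  -- Each of the two corner components pushed forward to `X` has as index all the coordinates
  -- involved, so equality of the components is equality of two unions.
  have key : (∃ (q : ℕ) (δ : CornerPt X q), IsPushCorner (p := 1) (proj κ X) z δ ∧
      IsPushCorner (boundaryProj κ X) w.2 δ) ↔
      F.missing ∪ {F.ι s} = G.missing ∪ S.map G.ι.toEmbedding := by
    have h1 : ∀ (q : ℕ) (δ : CornerPt X q) I, HasIdx c (F.ins y) I δ →
        (IsPushCorner (p := 1) (proj κ X) z δ ↔ I = F.missing ∪ {F.ι s}) := fun q δ I hI => by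
      have := isPushCorner_iff_of_hasIdx (isManifold_corners hX) hX hc'' hc hz hI hr1
        F.continuous_ins.continuousWithinAt (F.hasPattern_ins c.le y)
      rwa [Finset.map_singleton] at this
    have h2 : ∀ (q : ℕ) (δ : CornerPt X q) I, HasIdx c (G.ins y') I δ →
        (IsPushCorner (boundaryProj κ X) w.2 δ ↔ I = G.missing ∪ S.map G.ι.toEmbedding) :=
      fun q δ I hI => isPushCorner_iff_of_hasIdx (X := boundary κ X) (g := G.ins) hBX.1 hX
        (hG.mem_atlas hX hc) hc hw hI hr2 G.continuous_ins.continuousWithinAt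
        (G.hasPattern_ins c.le y')
    constructor
    · rintro ⟨q, δ, h3, h4⟩
      obtain ⟨I, hI⟩ := exists_hasIdx hX hc δ (by rw [h3.1]; exact hza.at_fst)
      rw [← (h1 q δ I hI).1 h3, ← (h2 q δ I (hy ▸ hI)).1 h4]
    · intro h
      have hsub := (F.hasPattern_ins c.le y).subset_zeroSet hz.at_fst.mem_orthant hz.subset
      simp only [Finset.map_singleton] at hsub
      obtain ⟨δ, hδ⟩ := exists_cornerPt hX hc hza.at_fst
        (I := F.missing ∪ {F.ι s}) hsub rfl
      exact ⟨_, δ, (h1 _ δ _ hδ).2 rfl, (h2 _ δ _ (hy ▸ hδ)).2 h⟩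
  have hlies : LiesOver (q := 1) (id : X → X) z.1.2 w.2.1 ↔ G.missing ⊆ F.missing :=
    liesOver_iff_of_hasIdx hX hX hc hc hza (hy ▸ hwa) (g := fun v => v) (φ := fun I => I)
      (hza.at_fst.eventually_exists.mono fun v ⟨x, hx⟩ => ⟨x, hx, hx⟩) continuousWithinAt_id
      ⟨fun _ _ => rfl, .of_forall fun _ => rfl⟩
  obtain ⟨j, hj⟩ := Finset.card_eq_one.1 G.card_missing
  have hs : F.ι s ∉ F.missing := F.ι_notMem_missing s
  have hjS : j ∉ S.map G.ι.toEmbedding := fun h => by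
    obtain ⟨t, -, rfl⟩ := Finset.mem_map.1 h
    exact G.ι_notMem_missing t (hj ▸ Finset.mem_singleton_self _)
  -- With `I = F.missing` and `i = F.ι s` the condition reads `I ∪ {i} = {j} ∪ S` and `j ∉ I`. The
  -- first forces `j = i`, and as both unions are disjoint, `S = I`.
  refine (and_congr key (not_congr hlies)).trans ?_
  rw [hj, Finset.singleton_subset_iff, Finset.singleton_inj]
  simp only [Finset.ext_iff, Finset.mem_union, Finset.mem_singleton]
  constructor
  · rintro ⟨h1, h2⟩
    obtain rfl : j = F.ι s := ((h1 j).2 (.inl rfl)).resolve_left h2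
    refine ⟨rfl, fun i => ?_⟩
    have := h1 i
    by_cases hi : i = F.ι s
    · subst hi; tauto
    · tauto
  · rintro ⟨rfl, h⟩
    exact ⟨fun i => by rw [h i]; tauto, hs⟩

/-- In terms of indices `w` exchanges the roles of the two parts: the coordinate `s` is used first
and the set `F.missing` afterwards. -/
theorem existsUnique_corners_boundary (hX : IsManifold κ X) (z : boundary κ (corners κ X)) :
    ∃! w, IsBoundaryCornerPair κ X z w := by
  have hBX := (isManifold_kCorners hX 1).1
  obtain ⟨k, m, c, hc, u, hu⟩ := hX.exists_at z.1.2.1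
  obtain ⟨k₁, m₁, p, F, c', c'', y, s, hF, hc'', hpc, rfl, hz⟩ :=
    exists_hasIdx_boundary_corners hX hc z hu
  have hs : F.ι s ∈ zeroSet k (F.ins y) :=
    (F.mem_zeroSet_ins_ι c.le).2 (hz.subset (Finset.mem_singleton_self _))
  obtain ⟨β, hβ⟩ := exists_cornerPt hX hc hu (Finset.singleton_subset_iff.2 hs)
    (Finset.card_singleton _)
  obtain ⟨k₂, m₂, G, d', y', hGm, hG, hy, hyβ⟩ := hβ.exists_face hX hc
  obtain ⟨S, hS⟩ : ∃ S : Finset (Fin m₂), S.map G.ι.toEmbedding = F.missing := by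
    classical
    refine ⟨Finset.univ.filter fun t => G.ι t ∈ F.missing, ?_⟩
    ext i
    simp only [Finset.mem_map, Finset.mem_filter, Finset.mem_univ, true_and]
    constructor
    · rintro ⟨t, ht, rfl⟩; exact ht
    · intro hi
      have : i ∉ G.missing := by
        rw [hGm, Finset.mem_singleton]
        rintro rfl
        exact F.ι_notMem_missing s hi
      obtain ⟨t, rfl⟩ := not_not.1 fun h => this (G.mem_missing.2 h)
      exact ⟨t, hi, rfl⟩
  have hSz : S ⊆ zeroSet k₂ y' := fun t ht => by
    rw [← G.mem_zeroSet_ins_ι c.le, hy]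
    exact F.missing_subset_zeroSet y (hS ▸ Finset.mem_map_of_mem _ ht)
  obtain ⟨b, hb⟩ := exists_cornerPt (X := boundary κ X) hBX (hG.mem_atlas hX hc) hyβ hSz rfl
  refine ⟨⟨_, b⟩, (isBoundaryCornerPair_iff hX hc hF hc'' hpc hz hG (w := ⟨_, b⟩) hb hy.symm).2
    ⟨hGm, hS⟩, fun w hw => ?_⟩
  have hw1 : At c (F.ins y) w.2.1.1 := by
    obtain ⟨q, δ, h1, h2⟩ := hw.1
    exact (h1.1.symm.trans h2.1 : z.1.2.1 = w.2.1.1) ▸ hu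
  -- In a chart of its own, a second solution `w` is seen to have boundary component with index
  -- `{F.ι s}`. It therefore lies in the range of `d'` as well, where its index set is determined.
  obtain ⟨k₃, m₃, G', d₃, y₃, S₃, hG', hy₃, hw'⟩ := exists_hasIdx_corners_boundary hX hc w hw1
  have h1 := ((isBoundaryCornerPair_iff hX hc hF hc'' hpc hz hG' hw' hy₃.symm).1 hw).1
  have h2 := hG'.at_iff.1 hw'.at_fst
  rw [hy₃, h1, ← hGm, ← hy] at h2
  obtain ⟨S', hS'⟩ := exists_hasIdx (X := boundary κ X) hBX (hG.mem_atlas hX hc) w.2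
    (hG.at_iff.2 h2)
  have h3 := ((isBoundaryCornerPair_iff hX hc hF hc'' hpc hz hG hS' hy.symm).1 hw).2
  obtain rfl := Finset.map_injective _ (h3.trans hS.symm)
  exact HasIdx.sigma_ext hS' hb

theorem existsUnique_boundary_corners (hX : IsManifold κ X) (w : corners κ (boundary κ X)) :
    ∃! z, IsBoundaryCornerPair κ X z w := by
  have hCX := isManifold_corners hX
  obtain ⟨k, m, c, hc, u, hu⟩ := hX.exists_at w.2.1.1
  obtain ⟨k₂, m₂, G, d', y', S, hG, rfl, hw⟩ := exists_hasIdx_corners_boundary hX hc w hu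
  have hSz : S.map G.ι.toEmbedding ⊆ zeroSet k (G.ins y') := fun i hi => by
    obtain ⟨t, ht, rfl⟩ := Finset.mem_map.1 hi
    exact (G.mem_zeroSet_ins_ι c.le).2 (hw.subset ht)
  obtain ⟨a, ha⟩ := exists_cornerPt hX hc hu hSz rfl
  obtain ⟨k₁, m₁, F, c', y, hFm, hF, hy, hya⟩ := ha.exists_face hX hc
  obtain ⟨c'', hc'', hpc⟩ := exists_cornersChart hX (hF.mem_atlas hX hc)
  obtain ⟨j, hj⟩ := Finset.card_eq_one.1 G.card_missing
  have hjm : j ∈ G.missing := hj ▸ Finset.mem_singleton_self _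
  have hjF : j ∉ F.missing := fun h => by
    rw [hFm] at h
    obtain ⟨t, -, rfl⟩ := Finset.mem_map.1 h
    exact G.ι_notMem_missing t hjm
  obtain ⟨s, rfl⟩ := not_not.1 fun h => hjF (F.mem_missing.2 h)
  have hsz : {s} ⊆ zeroSet k₁ y := Finset.singleton_subset_iff.2 <| by
    rw [← F.mem_zeroSet_ins_ι c.le, hy]
    exact G.missing_subset_zeroSet y' hjm
  obtain ⟨z, hz⟩ := exists_cornerPt hCX hc'' (hpc.at hya) hsz (Finset.card_singleton _)
  refine ⟨z, (isBoundaryCornerPair_iff hX hc hF hc'' hpc hz hG hw hy).2 ⟨hj, hFm.symm⟩,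
    fun z' hz' => ?_⟩
  have hz1 : At c (G.ins y') z'.1.2.1 := by
    obtain ⟨q, δ, h1, h2⟩ := hz'.1
    exact (h2.1.symm.trans h1.1 : w.2.1.1 = z'.1.2.1) ▸ hu
  obtain ⟨k₃, m₃, p₃, F₃, c₃, c₃', y₃, s₃, hF₃, hc₃', hpc₃, hy₃, hz₃⟩ :=
    exists_hasIdx_boundary_corners hX hc z' hz1
  have h1 := ((isBoundaryCornerPair_iff hX hc hF₃ hc₃' hpc₃ hz₃ hG hw hy₃).1 hz').2
  have h2 := (hF₃.corners_at_iff hpc₃).1 hz₃.at_fst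
  rw [hy₃, ← h1, ← hFm, ← hy] at h2
  obtain ⟨T, hT⟩ := exists_hasIdx hCX hc'' (p := 1) z' ((hF.corners_at_iff hpc).2 h2)
  obtain ⟨t, rfl⟩ := Finset.card_eq_one.1 hT.card
  have h3 := ((isBoundaryCornerPair_iff hX hc hF hc'' hpc hT hG hw hy).1 hz').1
  obtain rfl := F.ι.injective (Finset.singleton_inj.1 (hj.symm.trans h3))
  exact hT.ext hz

/-- The facet `s` of the face `F`, and the face `S` of the facet `G`, are one and the same face of
the chart of `X`, with the same ordering of its coordinates. Hence `Φ` is the identity in the two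
resulting charts. -/
theorem exists_boundary_corners_equiv (hX : IsManifold κ X) :
    ∃ Φ : boundary κ (corners κ X) ≃ corners κ (boundary κ X),
      IsDiffeo κ (boundary κ (corners κ X)) (corners κ (boundary κ X)) Φ ∧
      (∀ z w, Φ z = w ↔ IsBoundaryCornerPair κ X z w) ∧
      ∀ z, (Φ z).1 = (boundaryProj κ (corners κ X) z).1 := by
  have hBX : IsManifold κ (boundary κ X) := (isManifold_kCorners hX 1).1
  have hCX := isManifold_corners hX
  choose f hf hf' using fun z => existsUnique_corners_boundary hX z
  choose g hg hg' using fun w => existsUnique_boundary_corners hX w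
  let Φ : boundary κ (corners κ X) ≃ corners κ (boundary κ X) :=
    ⟨f, g, fun z => (hg' _ z (hf z)).symm, fun w => (hf' _ w (hg w)).symm⟩
  have hΦ : ∀ z w, Φ z = w ↔ IsBoundaryCornerPair κ X z w := fun z w =>
    ⟨fun h => h ▸ hf z, fun h => (hf' z w h).symm⟩
  have hz : ∀ z, ∃ (k m k₁ m₁ k₂ m₂ p : ℕ), ∃ c ∈ X.atlas k m, ∃ (F : Face k m k₁ m₁ p)
      (c' : Chart k₁ m₁ (kCorners κ X p)) (c'' : Chart k₁ m₁ (corners κ X)) (y : Fin m₁ → ℝ)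
      (s : Fin m₁) (G : Face k m k₂ m₂ 1) (d' : Chart k₂ m₂ (boundary κ X)) (y' : Fin m₂ → ℝ)
      (S : Finset (Fin m₂)), IsFace F c c' ∧ c'' ∈ (corners κ X).atlas k₁ m₁ ∧
      IsPushChart (Y := corners κ X) (Sigma.mk p) c' c'' ∧ HasIdx (p := 1) c'' y {s} z ∧
      IsFace G c d' ∧ HasIdx d' y' S (Φ z).2 ∧ G.missing = {F.ι s} ∧
      S.map G.ι.toEmbedding = F.missing := by
    intro z
    obtain ⟨k, m, c, hc, u, hu⟩ := hX.exists_at z.1.2.1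
    obtain ⟨k₁, m₁, p, F, c', c'', y, s, hF, hc'', hpc, rfl, hz⟩ :=
      exists_hasIdx_boundary_corners hX hc z hu
    have hw : At c (F.ins y) (Φ z).2.1.1 := by
      obtain ⟨q, δ, h1, h2⟩ := ((hΦ z _).1 rfl).1
      exact (h1.1.symm.trans h2.1 : z.1.2.1 = (Φ z).2.1.1) ▸ hu
    obtain ⟨k₂, m₂, G, d', y', S, hG, hy, hS⟩ := exists_hasIdx_corners_boundary hX hc (Φ z) hw
    obtain ⟨h1, h2⟩ := (isBoundaryCornerPair_iff hX hc hF hc'' hpc hz hG hS hy.symm).1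
      ((hΦ z _).1 rfl)
    exact ⟨k, m, k₁, m₁, k₂, m₂, p, c, hc, F, c', c'', y, s, G, d', y', S, hF, hc'', hpc, hz, hG,
      hS, h1, h2⟩
  refine ⟨Φ, IsLocalDiffeo.isDiffeo (X := boundary κ (corners κ X)) (isManifold_kCorners hCX 1).1
    (isManifold_corners hBX) fun z => ?_, hΦ, fun z => ?_⟩
  · obtain ⟨k, m, k₁, m₁, k₂, m₂, p, c, hc, F, c', c'', y, s, G, d', y', S, hF, hc'', hpc, hz, hG,
      hS, h1, h2⟩ := hz z
    obtain ⟨K, M, F', c₃, v, hF', hFc, -, hv⟩ := hz.exists_face hCX hc''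
    obtain ⟨K', M', G', d₃, -, hG', hGd, -, -⟩ := hS.exists_face (X := boundary κ X) hBX
      (hG.mem_atlas hX hc)
    obtain ⟨d₄, hd₄, hpd⟩ := exists_cornersChart (X := boundary κ X) hBX
      (hGd.mem_atlas (X := boundary κ X) hBX (hG.mem_atlas hX hc))
    have hcard : (Φ z).1 = p := by
      rw [← hS.card, ← Finset.card_map G.ι.toEmbedding, h2, F.card_missing]
    have e1 := F.dim_add
    have e2 := G.dim_add
    have e3 := F'.dim_add
    have e4 := G'.dim_add
    have e5 := F.bound_add
    have e6 := G.bound_add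
    have e7 := F'.bound_add
    have e8 := G'.bound_add
    obtain rfl : K' = K := by omega
    obtain rfl : M' = M := by omega
    have hins : ∀ v, F.ins (F'.ins v) = G.ins (G'.ins v) := fun v => by
      rw [← F.ins_comp c.le, ← G.ins_comp c.le]
      refine Face.ins_eq_of_missing_eq _ _ ?_ v
      rw [Face.missing_comp, Face.missing_comp, hF', hG', h1, h2, Finset.map_singleton,
        Finset.union_comm]
      rfl
    refine ⟨K', M', c₃, hFc.mem_atlas hCX hc'', mem_range_iff.2 ⟨v, hv⟩, d₄, hd₄,
      isPushChart_of_at ?_ fun v' z' hz' => ?_⟩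
    · rw [hpd.1, hGd.1, hFc.1, hpc.1, hF.1, hG.1]
      ext v
      change G.ins (G'.ins v) ∈ c.dom ↔ F.ins (F'.ins v) ∈ c.dom
      rw [hins]
    · have h3 := hFc.at_iff.1 hz'
      rw [hF'] at h3
      have hdom : v' ∈ d₄.dom := by
        rw [hpd.1, hGd.1]
        change _ ∈ d'.dom
        rw [hG.1]
        change _ ∈ c.dom
        rw [← hins]
        exact ((hF.corners_at_iff hpc).1 h3.at_fst).at_fst.1
      have h4 : At d₄ v' (d₄.toFun ⟨v', hdom⟩) := ⟨hdom, rfl⟩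
      have h5 := (hGd.corners_at_iff (X := boundary κ X) hpd).1 h4
      rw [hG'] at h5
      rwa [(hΦ z' _).2 ((isBoundaryCornerPair_iff hX hc hF hc'' hpc h3 hG h5 (hins v')).2
        ⟨h1, h2⟩)]
  · obtain ⟨k, m, k₁, m₁, k₂, m₂, p, c, hc, F, c', c'', y, s, G, d', y', S, hF, hc'', hpc, hz, hG,
      hS, h1, h2⟩ := hz z
    rw [← hS.card, ← Finset.card_map G.ι.toEmbedding, h2]
    exact ((hF.corners_at_iff hpc).1 hz.at_fst).card

end BoundaryCorners

end ACorners

namespace ACorners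

/-! ### Quotients by local diffeomorphisms -/

section Quotient

variable {κ : Kind} {Y Z : AtlasSpace.{u}}

theorem IsPushChart.comp {X Y Z : Type u} {k m : ℕ} {f : X → Y} {g : Y → Z} {c : Chart k m X}
    {d : Chart k m Y} {e : Chart k m Z} (h : IsPushChart f c d) (h' : IsPushChart g d e) :
    IsPushChart (g ∘ f) c e :=
  isPushChart_of_at (h'.1.trans h.1) fun _ _ hx => h'.at (h.at hx)

theorem IsPushChart.injective {X Y : Type u} {k m : ℕ} {f : X → Y} {c : Chart k m X}
    {d : Chart k m Y} (h : IsPushChart f c d) : Function.Injective (f ∘ c.toFun) := fun u v huv =>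
  Subtype.ext ((h.at ⟨u.2, rfl⟩).inj (by
    have := h.at (c := c) (u := v) ⟨v.2, rfl⟩
    rwa [show f (c.toFun u) = f (c.toFun v) from huv]))

/-- The quotient by the fibres of a surjective local diffeomorphism. -/
theorem IsLocalDiffeo.quotient (hY : IsManifold κ Y) (hZ : IsManifold κ Z) {q : Y → Z}
    (hq : IsLocalDiffeo Y Z q) (hs : Function.Surjective q) (r : Setoid Y)
    (hr : ∀ y y', r y y' ↔ q y = q y') :
    IsManifold κ (quotMfd κ Y r) ∧ IsLocalDiffeo Y (quotMfd κ Y r) (quotProj κ Y r) ∧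
      ∃ Φ : quotMfd κ Y r ≃ Z, IsDiffeo κ (quotMfd κ Y r) Z Φ ∧
        ∀ y, Φ (quotProj κ Y r y) = q y := by
  have := hZ.t2
  have := hZ.secondCountable
  have hqc : Continuous q := (hq.isMap False hY hZ).1
  let h₀ : Quotient r ≃ Z := Equiv.ofBijective
    (Quotient.lift q fun y y' h => (hr y y').1 h) ⟨by
      rintro ⟨y⟩ ⟨y'⟩ h
      exact Quotient.sound ((hr y y').2 h), fun z => by
      obtain ⟨y, rfl⟩ := hs z
      exact ⟨Quotient.mk r y, rfl⟩⟩
  have hh₀ : ∀ y, h₀ (Quotient.mk r y) = q y := fun y => rfl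
  -- The induced bijection is a homeomorphism because a local diffeomorphism is an open map.
  let h : Quotient r ≃ₜ Z := h₀.toHomeomorphOfContinuousOpen (hqc.quotient_lift _) (by
    intro U hU
    have : h₀ '' U = q '' (Quotient.mk r ⁻¹' U) := by
      ext z
      constructor
      · rintro ⟨⟨y⟩, hy, rfl⟩
        exact ⟨y, hy, rfl⟩
      · rintro ⟨y, hy, rfl⟩
        exact ⟨_, hy, rfl⟩
    rw [this]
    exact hq.isOpenMap hY hZ _ (hU.preimage continuous_quotient_mk'))
  -- Under `h` the charts of the quotient become images of charts of `Y` under `q`, and these belong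
  -- to the atlas of `Z`. All properties of the quotient are pulled back from `Z` in this way.
  have hB : ∀ k m (d : Chart k m (Quotient r)), (∃ c ∈ Y.atlas k m,
      IsPushChart (fun x => (Quotient.mk r x : Quotient r)) c d) →
      ∃ d' ∈ Z.atlas k m, IsPushChart h d d' := by
    rintro k m d ⟨c, hc, hcd⟩
    obtain ⟨d', hd'⟩ := exists_isPushChart d (f := h) (h.injective.comp d.injective)
    exact ⟨d', hq.mem_atlas hY hZ hc (hcd.comp hd'), hd'⟩
  have hex : ∀ y, ∃ (k m : ℕ), ∃ c ∈ Y.atlas k m, ∃ d' ∈ Z.atlas k m,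
      ∃ d : Chart k m (Quotient r), ∃ u, At c u y ∧
        IsPushChart (fun x => (Quotient.mk r x : Quotient r)) c d ∧ IsPushChart h d d' := by
    intro y
    obtain ⟨k, m, c, hc, hy, d', hd', hcd⟩ := hq y
    obtain ⟨u, hu⟩ := mem_range_iff.1 hy
    have hinj : Function.Injective ((fun x => (Quotient.mk r x : Quotient r)) ∘ c.toFun) :=
      fun u v huv => hcd.injective (congrArg h huv)
    obtain ⟨d, hd⟩ := exists_isPushChart c hinj
    exact ⟨k, m, c, hc, d', hd', d, u, hu, hd,
      isPushChart_of_at (hcd.1.trans hd.1.symm) fun v z hz => by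
        obtain ⟨y', hy', rfl⟩ := hd.exists_at hz
        exact hcd.at hy'⟩
  have main := isManifold_generate (κ := κ) (Quotient r) h.isEmbedding.t2Space
    h.secondCountableTopology
    (fun k m => {d | ∃ c ∈ Y.atlas k m, IsPushChart (fun x => (Quotient.mk r x : Quotient r)) c d})
    (fun k m d hd => by
      obtain ⟨d', hd', hp⟩ := hB k m d hd
      refine IsPushChart.isOpenEmbedding h.symm.isOpenEmbedding (hZ.isOpenEmbedding d' hd')
        (isPushChart_of_at hp.1.symm fun u z hz => ?_)
      obtain ⟨x, hx, rfl⟩ := hp.exists_at hz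
      rwa [h.symm_apply_apply])
    (fun z => by
      obtain ⟨y, rfl⟩ := Quotient.exists_rep z
      obtain ⟨k, m, c, hc, d', -, d, u, hu, hcd, -⟩ := hex y
      exact ⟨k, m, d, ⟨c, hc, hcd⟩, u, hcd.at hu⟩)
    (fun k m l n d hd e he u v z hu hv => by
      obtain ⟨d', hd', hp⟩ := hB k m d hd
      obtain ⟨e', he', hp'⟩ := hB l n e he
      obtain ⟨g, hg, hgm⟩ := hZ.exists_rep False hd' he' (hp.at hu) (hp'.at hv)
      refine ⟨g, hg.mono fun w ⟨y, h1, h2⟩ => ?_, hgm⟩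
      obtain ⟨x, hx, rfl⟩ := hp.exists_at h1
      obtain ⟨x', hx', hxx⟩ := hp'.exists_at h2
      obtain rfl := h.injective hxx
      exact ⟨_, hx, hx'⟩)
  refine ⟨main.1, fun y => ?_, h₀, IsLocalDiffeo.isDiffeo main.1 hZ fun z => ?_, hh₀⟩
  · obtain ⟨k, m, c, hc, d', -, d, u, hu, hcd, -⟩ := hex y
    exact ⟨k, m, c, hc, mem_range_iff.2 ⟨u, hu⟩, d, main.2 k m ⟨c, hc, hcd⟩, hcd⟩
  · obtain ⟨y, rfl⟩ := Quotient.exists_rep z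
    obtain ⟨k, m, c, hc, d', hd', d, u, hu, hcd, hdd⟩ := hex y
    exact ⟨k, m, d, main.2 k m ⟨c, hc, hcd⟩, mem_range_iff.2 ⟨u, hcd.at hu⟩, d', hd', hdd⟩

end Quotient

end ACorners

namespace ACorners

/-! ### Iterated boundaries -/

section Tuple

variable {κ : Kind} {X : AtlasSpace.{u}} {k K M K' M' : ℕ}

theorem BoundaryTuple.ext {t t' : BoundaryTuple X k} (h : t.pt = t'.pt) (h' : t.β = t'.β) :
    t = t' := by
  cases t; cases t'; cases h; cases h'; rfl

/-- `d` is the chart of the iterated boundary given by the chart `c`, the face `F` and an enumeration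
`i` of the coordinates vanishing on it. -/
def IsTupleChart (E : iterBoundary κ X k ≃ BoundaryTuple X k) (c : Chart K M X)
    (F : Face K M K' M' k) (i : Fin k → Fin M) (d : Chart K' M' (iterBoundary κ X k)) : Prop :=
  ∀ v y, At d v y ↔ At c (F.ins v) (E y).pt ∧ ∀ j, HasIdx (p := 1) c (F.ins v) {i j} ((E y).β j)

/-- The properties of the identification of the iterated boundary with the set of tuples that are
proved by induction. -/
structure IsTupleEquiv (E : iterBoundary κ X k ≃ BoundaryTuple X k) : Prop where
  isManifold : IsManifold κ (iterBoundary κ X k)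
  pt_eq : ∀ y, (E y).pt = iterProj κ X k y
  exists_chart : ∀ {K M K' M' : ℕ}, ∀ c ∈ X.atlas K M, ∀ (F : Face K M K' M' k) (i : Fin k → Fin M),
    (∀ t, t ∈ F.missing ↔ ∃ j, i j = t) → ∃ d ∈ (iterBoundary κ X k).atlas K' M',
      IsTupleChart E c F i d

variable {E : iterBoundary κ X k ≃ BoundaryTuple X k} {c : Chart K M X} {F : Face K M K' M' k}
  {i : Fin k → Fin M} {d : Chart K' M' (iterBoundary κ X k)} {u : Fin M → ℝ}

/-- Each `β j` has a one-element index. Distinct components have distinct indices, so these are the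
`k` missing coordinates of a face. -/
theorem BoundaryTuple.exists_idx (hX : IsManifold κ X) (hc : c ∈ X.atlas K M)
    (t : BoundaryTuple X k) (hu : At c u t.pt) :
    ∃ (K' M' : ℕ) (F : Face K M K' M' k) (i : Fin k → Fin M),
      (∀ t, t ∈ F.missing ↔ ∃ j, i j = t) ∧ F.ins (F.restr u) = u ∧
      ∀ j, HasIdx c u {i j} (t.β j) := by
  classical
  have h : ∀ j, ∃ i, HasIdx c u {i} (t.β j) := fun j => by
    obtain ⟨I, hI⟩ := exists_hasIdx hX hc (t.β j) (by rw [t.pt_eq]; exact hu)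
    obtain ⟨i, rfl⟩ := Finset.card_eq_one.1 hI.card
    exact ⟨i, hI⟩
  choose i hi using h
  have hinj : Function.Injective i := fun j j' hjj => t.injective
    ((hi j).ext (by rw [hjj]; exact hi j'))
  have hz : ∀ j, i j ∈ zeroSet K u := fun j => (hi j).subset (Finset.mem_singleton_self _)
  obtain ⟨K', M', F, hF⟩ := exists_face c.le (I := Finset.univ.image i)
    (fun t ht => by
      obtain ⟨j, -, rfl⟩ := Finset.mem_image.1 ht
      exact (mem_zeroSet.1 (hz j)).1)
    (by rw [Finset.card_image_of_injective _ hinj, Finset.card_univ, Fintype.card_fin])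
  refine ⟨K', M', F, i, fun t => by simp [hF], F.ins_restr fun t ht => ?_, hi⟩
  rw [hF] at ht
  obtain ⟨j, -, rfl⟩ := Finset.mem_image.1 ht
  exact (mem_zeroSet.1 (hz j)).2

theorem IsTupleEquiv.exists_chart_at (hE : IsTupleEquiv E) (hX : IsManifold κ X)
    (hc : c ∈ X.atlas K M) (y : iterBoundary κ X k) (hu : At c u (E y).pt) :
    ∃ (K' M' : ℕ) (F : Face K M K' M' k) (i : Fin k → Fin M),
      ∃ d ∈ (iterBoundary κ X k).atlas K' M', ∃ v, (∀ t, t ∈ F.missing ↔ ∃ j, i j = t) ∧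
      F.ins v = u ∧ IsTupleChart E c F i d ∧ At d v y := by
  obtain ⟨K', M', F, i, hi, hv, h⟩ := (E y).exists_idx hX hc hu
  obtain ⟨d, hd, hdE⟩ := hE.exists_chart c hc F i hi
  exact ⟨K', M', F, i, d, hd, F.restr u, hi, hv, hdE, (hdE _ _).2
    ⟨by rw [hv]; exact hu, fun j => by rw [hv]; exact h j⟩⟩

/-- The `k` values of `i` exhaust a set of `k` elements. -/
theorem injective_of_missing (hi : ∀ t, t ∈ F.missing ↔ ∃ j, i j = t) : Function.Injective i := by
  classical
  have h : Finset.univ.image i = F.missing := by ext t; simp [hi]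
  have h2 := Finset.card_image_iff (s := Finset.univ) (f := i)
  rw [h, F.card_missing, Finset.card_univ, Fintype.card_fin] at h2
  simpa using h2.1 rfl

theorem IsTupleChart.dom_eq (hX : IsManifold κ X) (hc : c ∈ X.atlas K M)
    (h : IsTupleChart E c F i d) (hi : ∀ t, t ∈ F.missing ↔ ∃ j, i j = t) :
    d.dom = {v | F.ins v ∈ c.dom} := by
  ext v
  constructor
  · intro hv
    exact ((h v _).1 ⟨hv, rfl⟩).1.1
  · intro hv
    have hat : At c (F.ins v) (c.toFun ⟨_, hv⟩) := ⟨hv, rfl⟩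
    have h1 : ∀ j, ∃ b : CornerPt X 1, HasIdx c (F.ins v) {i j} b := fun j =>
      exists_cornerPt hX hc hat (Finset.singleton_subset_iff.2
        (F.missing_subset_zeroSet v ((hi _).2 ⟨j, rfl⟩))) (Finset.card_singleton _)
    choose b hb using h1
    let t : BoundaryTuple X k := ⟨_, b, fun j => (hb j).at_fst.eq hat, fun j j' hjj =>
      injective_of_missing hi (Finset.singleton_inj.1
        ((hb j).unique hX hc (by rw [hjj]; exact hb j')))⟩
    have h2 := (h v (E.symm t)).2 (by rw [E.apply_symm_apply]; exact ⟨hat, hb⟩)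
    exact h2.1

theorem IsTupleChart.repAt (hE : IsTupleEquiv E) (h : IsTupleChart E c F i d) {v : Fin M' → ℝ}
    {y : iterBoundary κ X k} (hy : At d v y) : RepAt d c (iterProj κ X k) F.ins v :=
  hy.eventually_exists.mono fun w ⟨y', hy'⟩ => ⟨y', hy', hE.pt_eq y' ▸ ((h w y').1 hy').1⟩

/-- The boundary components over which a boundary component of the iterated boundary lies. -/
theorem IsTupleChart.liesOver_iff (hX : IsManifold κ X) (hE : IsTupleEquiv E)
    (hc : c ∈ X.atlas K M) (hd : d ∈ (iterBoundary κ X k).atlas K' M')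
    (hi : ∀ t, t ∈ F.missing ↔ ∃ j, i j = t) (h : IsTupleChart E c F i d) {v : Fin M' → ℝ}
    {s : Fin M'} {y : CornerPt (iterBoundary κ X k) 1} (hy : HasIdx d v {s} y) {t : Fin M}
    {b : CornerPt X 1} (hb : HasIdx c (F.ins v) {t} b) (hne : ∀ j, (E y.1).β j ≠ b) :
    LiesOver (iterProj κ X k) y b ↔ t = F.ι s := by
  have h1 := liesOver_iff_of_hasIdx hE.isManifold hX hd hc hy hb (h.repAt hE hy.at_fst)
    F.continuous_ins.continuousWithinAt (F.hasPattern_ins c.le v)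
  rw [Finset.map_singleton, Finset.singleton_subset_iff, Finset.mem_union, Finset.mem_singleton,
    hi] at h1
  rw [h1]
  -- An index `t = i j` would make `b` equal to `β j`, since a component is determined by its index.
  refine or_iff_right ?_
  rintro ⟨j, rfl⟩
  exact hne j ((((h _ _).1 hy.at_fst).2 j).ext hb)

/-- The compatibility of the identifications for `∂ᵏX` and `∂ᵏ⁺¹X`. -/
def IsTupleStep (E : iterBoundary κ X k ≃ BoundaryTuple X k)
    (E' : iterBoundary κ X (k + 1) ≃ BoundaryTuple X (k + 1)) : Prop :=
  ∀ (y : iterBoundary κ X (k + 1)) (t : BoundaryTuple X (k + 1)), E' y = t ↔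
    t.dropLast = E (boundaryProj κ (iterBoundary κ X k) y) ∧
      LiesOver (p := 1) (iterProj κ X k) y (t.β (Fin.last k))

theorem BoundaryTuple.dropLast_ne (t : BoundaryTuple X (k + 1)) (j : Fin k) :
    t.dropLast.β j ≠ t.β (Fin.last k) := fun h =>
  (Fin.castSucc_lt_last j).ne (t.injective h)

/-- In a chart, a boundary component of the iterated boundary is a coordinate `s` of the face
missing `i_1, …, i_k`. Its image in `X` has index `{i_1, …, i_k, ι s}`, so the only new boundary
component in whose closure it lies is the one with index `ι s`. Conversely the last index of a tuple
is not missing from the face of the first `k`, hence is `ι s` for exactly one `s`. -/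
theorem IsTupleEquiv.exists_step (hX : IsManifold κ X) (hE : IsTupleEquiv E) :
    ∃ E' : iterBoundary κ X (k + 1) ≃ BoundaryTuple X (k + 1), IsTupleStep E E' := by
  have h1 : ∀ y : CornerPt (iterBoundary κ X k) 1, ∃! t : BoundaryTuple X (k + 1),
      t.dropLast = E y.1 ∧ LiesOver (iterProj κ X k) y (t.β (Fin.last k)) := by
    intro y
    obtain ⟨K, M, c, hc, u, hu⟩ := hX.exists_at (E y.1).pt
    obtain ⟨K', M', F, i, d, hd, v, hi, rfl, hdE, hv⟩ := hE.exists_chart_at hX hc y.1 hu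
    obtain ⟨S, hS⟩ := exists_hasIdx hE.isManifold hd y hv
    obtain ⟨s, rfl⟩ := Finset.card_eq_one.1 hS.card
    obtain ⟨b, hb⟩ := exists_cornerPt hX hc hu (Finset.singleton_subset_iff.2
      ((F.mem_zeroSet_ins_ι c.le).2 (hS.subset (Finset.mem_singleton_self s))))
      (Finset.card_singleton _)
    have hne : ∀ j, (E y.1).β j ≠ b := fun j hj => by
      have := (((hdE _ _).1 hv).2 j).unique hX hc (hj ▸ hb)
      exact F.ι_notMem_missing s ((hi _).2 ⟨j, Finset.singleton_inj.1 this⟩)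
    refine ⟨⟨(E y.1).pt, Fin.snoc (E y.1).β b, fun j => ?_, ?_⟩, ⟨?_, ?_⟩, fun t ht => ?_⟩
    · refine Fin.lastCases ?_ (fun j => ?_) j
      · rw [Fin.snoc_last]; exact hb.at_fst.eq hu
      · rw [Fin.snoc_castSucc]; exact (E y.1).pt_eq j
    · exact Fin.snoc_injective_iff.2 ⟨(E y.1).injective, fun ⟨j, hj⟩ => hne j hj⟩
    · exact BoundaryTuple.ext rfl (funext fun j =>
        Fin.snoc_castSucc (α := fun _ => CornerPt X 1) _ _ j)
    · change LiesOver _ _ (Fin.snoc (α := fun _ => CornerPt X 1) (E y.1).β b (Fin.last k))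
      rw [Fin.snoc_last]
      exact (hdE.liesOver_iff hX hE hc hd hi hS hb hne).2 rfl
    · have hpt : t.pt = (E y.1).pt := congrArg BoundaryTuple.pt ht.1
      have hne' := t.dropLast_ne
      rw [ht.1] at hne'
      obtain ⟨T, hT⟩ := exists_hasIdx hX hc (t.β (Fin.last k)) (by rw [t.pt_eq, hpt]; exact hu)
      obtain ⟨t', rfl⟩ := Finset.card_eq_one.1 hT.card
      obtain rfl := (hdE.liesOver_iff hX hE hc hd hi hS hT hne').1 ht.2
      refine BoundaryTuple.ext hpt (funext fun j => ?_)
      refine Fin.lastCases ?_ (fun j => ?_) j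
      · change _ = Fin.snoc (α := fun _ => CornerPt X 1) (E y.1).β b (Fin.last k)
        rw [Fin.snoc_last]; exact hT.ext hb
      · change _ = Fin.snoc (α := fun _ => CornerPt X 1) (E y.1).β b j.castSucc
        rw [Fin.snoc_castSucc, ← ht.1]; rfl
  have h2 : ∀ t : BoundaryTuple X (k + 1), ∃! y : CornerPt (iterBoundary κ X k) 1,
      t.dropLast = E y.1 ∧ LiesOver (iterProj κ X k) y (t.β (Fin.last k)) := by
    intro t
    obtain ⟨y₀, hy₀⟩ := E.surjective t.dropLast
    have hpt : (E y₀).pt = t.pt := congrArg BoundaryTuple.pt hy₀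
    obtain ⟨K, M, c, hc, u, hu⟩ := hX.exists_at (E y₀).pt
    obtain ⟨K', M', F, i, d, hd, v, hi, rfl, hdE, hv⟩ := hE.exists_chart_at hX hc y₀ hu
    obtain ⟨T, hT⟩ := exists_hasIdx hX hc (t.β (Fin.last k)) (by rw [t.pt_eq, ← hpt]; exact hu)
    obtain ⟨t', rfl⟩ := Finset.card_eq_one.1 hT.card
    have hne := t.dropLast_ne
    rw [← hy₀] at hne
    have ht' : t' ∉ F.missing := fun h => by
      obtain ⟨j, rfl⟩ := (hi _).1 h
      exact hne j ((((hdE _ _).1 hv).2 j).ext hT)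
    obtain ⟨s, rfl⟩ := not_not.1 fun h => ht' (F.mem_missing.2 h)
    obtain ⟨y, hy⟩ := exists_cornerPt hE.isManifold hd hv (Finset.singleton_subset_iff.2
      ((F.mem_zeroSet_ins_ι c.le).1 (hT.subset (Finset.mem_singleton_self _))))
      (Finset.card_singleton _)
    obtain rfl : y.1 = y₀ := hy.at_fst.eq hv
    refine ⟨y, ⟨hy₀.symm, (hdE.liesOver_iff hX hE hc hd hi hy hT hne).2 rfl⟩, fun y' hy' => ?_⟩
    have hyy : y'.1 = y.1 := E.injective (hy'.1.symm.trans hy₀.symm)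
    obtain ⟨S, hS⟩ := exists_hasIdx hE.isManifold hd y' (hyy ▸ hv)
    obtain ⟨s', rfl⟩ := Finset.card_eq_one.1 hS.card
    have h3 := (hdE.liesOver_iff hX hE hc hd hi hS hT (hyy ▸ hne)).1 hy'.2
    obtain rfl := F.ι.injective h3
    exact hS.ext hy
  choose f hf hf' using h1
  choose g hg hg' using h2
  let E' : iterBoundary κ X (k + 1) ≃ BoundaryTuple X (k + 1) :=
    ⟨f, g, fun y => (hg' _ y (hf y)).symm, fun t => (hf' _ t (hg t)).symm⟩
  exact ⟨E', fun y t => ⟨fun h => h ▸ hf y, fun h => (hf' y t h).symm⟩⟩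

/-- A chart for `k + 1` enumerated coordinates is obtained from the chart for the first `k` by
passing to the facet where the last one vanishes. Comparing missing sets shows that the two-step
insertion of zeros is that of `F`. -/
theorem IsTupleEquiv.step (hX : IsManifold κ X) (hE : IsTupleEquiv E)
    {E' : iterBoundary κ X (k + 1) ≃ BoundaryTuple X (k + 1)} (hEE' : IsTupleStep E E') :
    IsTupleEquiv E' := by
  refine ⟨(isManifold_kCorners hE.isManifold 1).1, fun y => ?_, fun {K M K' M'} c hc F i hi => ?_⟩
  · have h := ((hEE' y _).1 rfl).1
    exact (congrArg BoundaryTuple.pt h).trans (hE.pt_eq _)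
  · classical
    have hinj := injective_of_missing hi
    obtain ⟨K₀, M₀, F₀, hF₀⟩ := exists_face (p := k) c.le
      (I := Finset.univ.image fun j : Fin k => i j.castSucc)
      (fun t ht => by
        obtain ⟨j, -, rfl⟩ := Finset.mem_image.1 ht
        exact F.lt_of_mem_missing ((hi _).2 ⟨_, rfl⟩))
      (by rw [Finset.card_image_of_injective (f := fun j : Fin k => i j.castSucc) _
        (hinj.comp (Fin.castSucc_injective k)), Finset.card_univ, Fintype.card_fin])
    have hi₀ : ∀ t, t ∈ F₀.missing ↔ ∃ j : Fin k, i j.castSucc = t := fun t => by simp [hF₀]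
    obtain ⟨d₀, hd₀, hdE⟩ := hE.exists_chart c hc F₀ _ hi₀
    have hlast : i (Fin.last k) ∉ F₀.missing := fun h => by
      obtain ⟨j, hj⟩ := (hi₀ _).1 h
      exact (Fin.castSucc_lt_last j).ne (hinj hj)
    obtain ⟨s, hs⟩ := not_not.1 fun h => hlast (F₀.mem_missing.2 h)
    have hsK : s.val < K₀ := by
      rw [← F₀.ι_lt_iff c.le, hs]
      exact F.lt_of_mem_missing ((hi _).2 ⟨_, rfl⟩)
    obtain ⟨K₁, M₁, G, hG⟩ := exists_face d₀.le (I := {s}) (p := 1)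
      (fun t ht => by rwa [Finset.mem_singleton.1 ht]) (Finset.card_singleton s)
    have e1 := F.dim_add
    have e2 := F₀.dim_add
    have e3 := G.dim_add
    have e4 := F.bound_add
    have e5 := F₀.bound_add
    have e6 := G.bound_add
    obtain rfl : K₁ = K' := by omega
    obtain rfl : M₁ = M' := by omega
    have hins : ∀ v, F₀.ins (G.ins v) = F.ins v := fun v => by
      rw [← F₀.ins_comp c.le]
      refine Face.ins_eq_of_missing_eq _ _ ?_ v
      rw [Face.missing_comp, hG, Finset.map_singleton]
      ext t
      rw [Finset.mem_union, hi₀, hi, Finset.mem_singleton]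
      change _ ∨ t = F₀.ι s ↔ _
      rw [hs]
      constructor
      · rintro (⟨j, rfl⟩ | rfl)
        exacts [⟨_, rfl⟩, ⟨_, rfl⟩]
      · rintro ⟨j, rfl⟩
        refine Fin.lastCases (.inr rfl) (fun j => .inl ⟨j, rfl⟩) j
    obtain ⟨d, hd⟩ := exists_isFace hE.isManifold hd₀ G
    refine ⟨d, hd.mem_atlas hE.isManifold hd₀, fun v y => ?_⟩
    obtain ⟨h1, h2⟩ := (hEE' y _).1 rfl
    have hne := (E' y).dropLast_ne
    rw [h1] at hne
    have hpt : (E' y).pt = (E (Sigma.fst y)).pt := congrArg BoundaryTuple.pt h1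
    have hβ : ∀ j : Fin k, (E' y).β j.castSucc = (E (Sigma.fst y)).β j := fun j =>
      congrFun (congrArg BoundaryTuple.β h1) j
    rw [← hins]
    constructor
    · intro hy
      have hy := hd.at_iff.1 hy
      rw [hG] at hy
      obtain ⟨h3, h4⟩ := (hdE _ _).1 hy.at_fst
      refine ⟨by rw [hpt]; exact h3, fun j => Fin.lastCases ?_ (fun j => ?_) j⟩
      · obtain ⟨T, hT⟩ := exists_hasIdx hX hc ((E' y).β (Fin.last k))
          (by rw [(E' y).pt_eq, hpt]; exact h3)
        obtain ⟨t, rfl⟩ := Finset.card_eq_one.1 hT.card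
        have := (hdE.liesOver_iff hX hE hc hd₀ hi₀ hy hT hne).1 h2
        rwa [this, hs] at hT
      · rw [hβ]; exact h4 j
    · rintro ⟨h3, h4⟩
      have h5 : At d₀ (G.ins v) (Sigma.fst y) := (hdE _ _).2
        ⟨by rw [← hpt]; exact h3, fun j => by rw [← hβ]; exact h4 _⟩
      obtain ⟨S, hS⟩ := exists_hasIdx (p := 1) hE.isManifold hd₀ y h5
      obtain ⟨s', rfl⟩ := Finset.card_eq_one.1 hS.card
      have := (hdE.liesOver_iff hX hE hc hd₀ hi₀ hS (h4 _) hne).1 h2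
      obtain rfl := F₀.ι.injective (hs.trans this)
      exact hd.at_iff.2 (hG ▸ hS)

theorem exists_isTupleEquiv_zero (hX : IsManifold κ X) :
    ∃ E : iterBoundary κ X 0 ≃ BoundaryTuple X 0, IsTupleEquiv E ∧ ∀ x, (E x).pt = x := by
  let E : iterBoundary κ X 0 ≃ BoundaryTuple X 0 :=
    { toFun := fun x => ⟨x, Fin.elim0, fun j => j.elim0, fun j => j.elim0⟩
      invFun := fun t => t.pt
      left_inv := fun _ => rfl
      right_inv := fun t => BoundaryTuple.ext rfl (Subsingleton.elim _ _) }
  refine ⟨E, ⟨hX, fun _ => rfl, fun {K M K' M'} c hc F i hi => ?_⟩, fun _ => rfl⟩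
  obtain rfl : K' = K := F.bound_add
  obtain rfl : M' = M := F.dim_add
  have hins : ∀ v, F.ins v = v := fun v => by
    funext t
    -- A face of codimension `0` misses no coordinate, so its increasing embedding is onto and must
    -- be the identity.
    have hid : F.ι = RelEmbedding.refl _ := OrderEmbedding.range_inj.1 <| by
      ext t
      refine iff_of_true ?_ ⟨t, rfl⟩
      rw [← not_not (a := t ∈ _), ← F.mem_missing, hi]
      rintro ⟨j, -⟩
      exact j.elim0
    have := F.ins_ι v t
    rw [hid] at this
    exact this
  exact ⟨c, hc, fun v y => ⟨fun h => ⟨(hins v).symm ▸ h, fun j => j.elim0⟩,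
    fun h => hins v ▸ h.1⟩⟩

theorem exists_isTupleIdentification (hX : IsManifold κ X) :
    ∃ e : ∀ k : ℕ, iterBoundary κ X k ≃ BoundaryTuple X k, IsTupleIdentification κ X e ∧
      ∀ k, IsTupleEquiv (e k) := by
  obtain ⟨E₀, h₀, h₀'⟩ := exists_isTupleEquiv_zero hX
  choose f hf using fun (k : ℕ) (E : {E : iterBoundary κ X k ≃ BoundaryTuple X k // IsTupleEquiv E}) =>
    E.2.exists_step hX
  -- The recursion carries the property `IsTupleEquiv` along with the bijection, since the next
  -- bijection can be chosen only in its presence.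
  let e : ∀ k : ℕ, {E : iterBoundary κ X k ≃ BoundaryTuple X k // IsTupleEquiv E} := fun k =>
    Nat.rec ⟨E₀, h₀⟩ (fun k E => ⟨f k E, E.2.step hX (hf k E)⟩) k
  exact ⟨fun k => (e k).1, ⟨h₀', fun k => hf k (e k)⟩, fun k => (e k).2⟩

end Tuple

end ACorners

namespace ACorners

/-! ### Corners as quotients of iterated boundaries -/

section Symmetric

variable {κ : Kind} {X : AtlasSpace.{u}} {k K M K' M' : ℕ}

/-- Permutation of a tuple of boundary components. -/
def BoundaryTuple.perm (σ : Equiv.Perm (Fin k)) (t : BoundaryTuple X k) : BoundaryTuple X k where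
  pt := t.pt
  -- The inverse makes this a left action.
  β := t.β ∘ ⇑σ⁻¹
  pt_eq _ := t.pt_eq _
  injective := t.injective.comp σ⁻¹.injective

/-- The action of the symmetric group on the iterated boundary. -/
@[reducible] def permAction (E : iterBoundary κ X k ≃ BoundaryTuple X k) :
    MulAction (Equiv.Perm (Fin k)) (iterBoundary κ X k) where
  smul σ y := E.symm ((E y).perm σ)
  one_smul y := E.symm_apply_apply y
  mul_smul σ τ y := by
    change E.symm _ = E.symm ((E (E.symm _)).perm σ)
    rw [E.apply_symm_apply]
    exact congrArg E.symm (BoundaryTuple.ext rfl (by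
      funext j
      simp [BoundaryTuple.perm, mul_inv_rev]))

variable {E : iterBoundary κ X k ≃ BoundaryTuple X k} {c : Chart K M X} {F : Face K M K' M' k}
  {i : Fin k → Fin M} {d : Chart K' M' (iterBoundary κ X k)} {u : Fin M → ℝ}

/-- Permuting the enumeration `i` of the missing coordinates gives another chart on the same face;
between these two charts the permutation is the identity. -/
theorem isLocalDiffeo_perm (hX : IsManifold κ X) (hE : IsTupleEquiv E) (σ : Equiv.Perm (Fin k)) :
    IsLocalDiffeo (iterBoundary κ X k) (iterBoundary κ X k) fun y => E.symm ((E y).perm σ) := by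
  intro y
  obtain ⟨K, M, c, hc, u, hu⟩ := hX.exists_at (E y).pt
  obtain ⟨K', M', F, i, d, hd, v, hi, rfl, hdE, hv⟩ := hE.exists_chart_at hX hc y hu
  have hi' : ∀ t, t ∈ F.missing ↔ ∃ j, (i ∘ ⇑σ⁻¹) j = t := fun t => by
    rw [hi]
    exact (σ⁻¹.surjective.exists (p := fun j => i j = t))
  obtain ⟨d', hd', hdE'⟩ := hE.exists_chart c hc F (i ∘ ⇑σ⁻¹) hi'
  refine ⟨K', M', d, hd, mem_range_iff.2 ⟨v, hv⟩, d', hd', isPushChart_of_at ?_ fun w z hz => ?_⟩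
  · rw [hdE.dom_eq hX hc hi, hdE'.dom_eq hX hc hi']
  · obtain ⟨h1, h2⟩ := (hdE _ _).1 hz
    rw [hdE' w, E.apply_symm_apply]
    exact ⟨h1, fun j => h2 _⟩

/-- `a` is the corner point whose adjacent boundary components are those in the tuple `t`. -/
def IsTupleCorner (t : BoundaryTuple X k) (a : CornerPt X k) : Prop :=
  a.1 = t.pt ∧ ∀ b : CornerPt X 1, LiesOver (id : X → X) a b ↔ ∃ j, t.β j = b

theorem liesOver_id_iff (hX : IsManifold κ X) (hc : c ∈ X.atlas K M) {a : CornerPt X k}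
    {I J : Finset (Fin M)} (ha : HasIdx c u I a) {b : CornerPt X 1} (hb : HasIdx c u J b) :
    LiesOver (id : X → X) a b ↔ J ⊆ I :=
  liesOver_iff_of_hasIdx hX hX hc hc ha hb (g := fun v => v) (φ := fun I => I)
    (ha.at_fst.eventually_exists.mono fun _ ⟨x, hx⟩ => ⟨x, hx, hx⟩) continuousWithinAt_id
    ⟨fun _ _ => rfl, .of_forall fun _ => rfl⟩

/-- The boundary components adjacent to a corner point with index `I` are those with index `{s}` for
`s ∈ I`, so the list of adjacent components determines `I`. -/
theorem isTupleCorner_iff (hX : IsManifold κ X) (hc : c ∈ X.atlas K M) {t : BoundaryTuple X k}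
    {a : CornerPt X k} (hu : At c u t.pt) (hF : ∀ t, t ∈ F.missing ↔ ∃ j, i j = t)
    (hi : ∀ j, HasIdx c u {i j} (t.β j)) : IsTupleCorner t a ↔ HasIdx c u F.missing a := by
  constructor
  · rintro ⟨h1, h2⟩
    obtain ⟨I, hI⟩ := exists_hasIdx hX hc a (h1 ▸ hu)
    convert hI
    ext s
    rw [hF]
    constructor
    · rintro ⟨j, rfl⟩
      exact Finset.singleton_subset_iff.1
        ((liesOver_id_iff hX hc hI (hi j)).1 ((h2 _).2 ⟨j, rfl⟩))
    · intro hs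
      obtain ⟨b, hb⟩ := exists_cornerPt hX hc hu (Finset.singleton_subset_iff.2 (hI.subset hs))
        (Finset.card_singleton s)
      obtain ⟨j, rfl⟩ := (h2 b).1
        ((liesOver_id_iff hX hc hI hb).2 (Finset.singleton_subset_iff.2 hs))
      exact ⟨j, Finset.singleton_inj.1 ((hi j).unique hX hc hb)⟩
  · intro ha
    have hpt : a.1 = t.pt := ha.at_fst.eq hu
    refine ⟨hpt, fun b => ⟨fun h => ?_, ?_⟩⟩
    · obtain ⟨J, hJ⟩ := exists_hasIdx hX hc b (by rw [← h.1]; exact ha.at_fst)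
      obtain ⟨s, rfl⟩ := Finset.card_eq_one.1 hJ.card
      obtain ⟨j, rfl⟩ := (hF s).1
        (Finset.singleton_subset_iff.1 ((liesOver_id_iff hX hc ha hJ).1 h))
      exact ⟨j, (hi j).ext hJ⟩
    · rintro ⟨j, rfl⟩
      exact (liesOver_id_iff hX hc ha (hi j)).2
        (Finset.singleton_subset_iff.2 ((hF _).2 ⟨j, rfl⟩))

theorem existsUnique_isTupleCorner (hX : IsManifold κ X) (t : BoundaryTuple X k) :
    ∃! a, IsTupleCorner t a := by
  obtain ⟨K, M, c, hc, u, hu⟩ := hX.exists_at t.pt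
  obtain ⟨K', M', F, i, hi, hv, h⟩ := t.exists_idx hX hc hu
  obtain ⟨a, ha⟩ := exists_cornerPt hX hc hu (hv ▸ F.missing_subset_zeroSet _) F.card_missing
  exact ⟨a, (isTupleCorner_iff hX hc hu hi h).2 ha,
    fun a' ha' => ((isTupleCorner_iff hX hc hu hi h).1 ha').ext ha⟩

/-- Any enumeration of the index of `a` gives such a tuple; the increasing one is taken. -/
theorem exists_tuple_of_corner (hX : IsManifold κ X) (a : CornerPt X k) :
    ∃ t, IsTupleCorner t a := by
  obtain ⟨K, M, c, hc, u, hu⟩ := hX.exists_at a.1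
  obtain ⟨I, hI⟩ := exists_hasIdx hX hc a hu
  obtain ⟨K', M', F, rfl⟩ := exists_face c.le (fun t ht => (mem_zeroSet.1 (hI.subset ht)).1) hI.card
  let i := F.missing.orderEmbOfFin hI.card
  have hi : ∀ t, t ∈ F.missing ↔ ∃ j, i j = t := fun t => by
    rw [← Finset.mem_coe, ← Finset.range_orderEmbOfFin F.missing hI.card]
    rfl
  have h1 : ∀ j, ∃ b : CornerPt X 1, HasIdx c u {i j} b := fun j => exists_cornerPt hX hc hu
    (Finset.singleton_subset_iff.2 (hI.subset ((hi _).2 ⟨j, rfl⟩))) (Finset.card_singleton _)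
  choose b hb using h1
  let t : BoundaryTuple X k := ⟨a.1, b, fun j => (hb j).at_fst.eq hu, fun j j' hjj =>
    i.injective (Finset.singleton_inj.1 ((hb j).unique hX hc (by rw [hjj]; exact hb j')))⟩
  exact ⟨t, (isTupleCorner_iff hX hc (t := t) hu hi hb).2 hI⟩

/-- Two tuples with the same corner point are injective families with the same range, so they differ
by a permutation. -/
theorem isTupleCorner_iff_perm {t t' : BoundaryTuple X k} {a : CornerPt X k}
    (ha : IsTupleCorner t a) :
    IsTupleCorner t' a ↔ ∃ σ : Equiv.Perm (Fin k), t.perm σ = t' := by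
  constructor
  · intro h
    have hr : range t.β = range t'.β := by
      ext b
      exact (ha.2 b).symm.trans (h.2 b)
    let σ : Equiv.Perm (Fin k) := (Equiv.ofInjective _ t.injective).trans
      ((Equiv.setCongr hr).trans (Equiv.ofInjective _ t'.injective).symm)
    have hσ : ∀ j, t'.β (σ j) = t.β j := fun j => by
      have := Equiv.apply_ofInjective_symm t'.injective
        (Equiv.setCongr hr (Equiv.ofInjective _ t.injective j))
      exact this
    refine ⟨σ, BoundaryTuple.ext (ha.1.symm.trans h.1) (funext fun j => ?_)⟩
    obtain ⟨j, rfl⟩ := σ.surjective j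
    rw [hσ]
    simp [BoundaryTuple.perm]
  · rintro ⟨σ, rfl⟩
    exact ⟨ha.1, fun b => (ha.2 b).trans (σ⁻¹.surjective.exists (p := fun j => t.β j = b))⟩

/-- Forgetting the order of the tuple is the identity between the tuple chart and the face chart on
the same face. -/
theorem isLocalDiffeo_tupleCorner (hX : IsManifold κ X) (hE : IsTupleEquiv E)
    {q : iterBoundary κ X k → kCorners κ X k} (hq : ∀ y, IsTupleCorner (E y) (q y)) :
    IsLocalDiffeo (iterBoundary κ X k) (kCorners κ X k) q := by
  intro y
  obtain ⟨K, M, c, hc, u, hu⟩ := hX.exists_at (E y).pt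
  obtain ⟨K', M', F, i, d, hd, v, hi, rfl, hdE, hv⟩ := hE.exists_chart_at hX hc y hu
  obtain ⟨c', hc'⟩ := exists_isFace hX hc F
  refine ⟨K', M', d, hd, mem_range_iff.2 ⟨v, hv⟩, c', hc'.mem_atlas hX hc,
    isPushChart_of_at (hc'.1.trans (hdE.dom_eq hX hc hi).symm) fun w z hz => ?_⟩
  obtain ⟨h1, h2⟩ := (hdE _ _).1 hz
  exact hc'.at_iff.2 ((isTupleCorner_iff hX hc h1 hi h2).1 (hq z))

/-- The fibres of the map that forgets the order are the orbits of the symmetric group, so the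
quotient is that of a surjective local diffeomorphism onto the `k`-corners. The action is free
because the members of a tuple are distinct. -/
theorem exists_quotient_iterBoundary (hX : IsManifold κ X) (hE : IsTupleEquiv E) :
    ∃ _ : MulAction (Equiv.Perm (Fin k)) (iterBoundary κ X k),
      (∀ (σ : Equiv.Perm (Fin k)) (y : iterBoundary κ X k),
        (E (σ • y)).pt = (E y).pt ∧ (E (σ • y)).β = (E y).β ∘ ⇑σ⁻¹) ∧
      (∀ (σ : Equiv.Perm (Fin k)) (y : iterBoundary κ X k), σ • y = y → σ = 1) ∧
      (∀ σ : Equiv.Perm (Fin k), IsSmooth κ (iterBoundary κ X k) (iterBoundary κ X k)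
        (fun y => σ • y)) ∧
      IsManifold κ (quotMfd κ (iterBoundary κ X k)
        (MulAction.orbitRel (Equiv.Perm (Fin k)) _)) ∧
      IsLocalDiffeo (iterBoundary κ X k)
        (quotMfd κ (iterBoundary κ X k) (MulAction.orbitRel (Equiv.Perm (Fin k)) _))
        (quotProj κ (iterBoundary κ X k) _) ∧
      ∃ Φ : quotMfd κ (iterBoundary κ X k)
          (MulAction.orbitRel (Equiv.Perm (Fin k)) _) ≃ kCorners κ X k,
        IsDiffeo κ (quotMfd κ (iterBoundary κ X k) _) (kCorners κ X k) Φ ∧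
        ∀ y : iterBoundary κ X k,
          kProj κ X k (Φ (quotProj κ _ _ y)) = (E y).pt ∧
          ∀ b : CornerPt X 1,
            LiesOver (p := k) (id : X → X) (Φ (quotProj κ _ _ y)) b ↔ ∃ j, (E y).β j = b := by
  let A := permAction E
  have hsmul : ∀ (σ : Equiv.Perm (Fin k)) (y : iterBoundary κ X k), E (σ • y) = (E y).perm σ :=
    fun σ y => E.apply_symm_apply _
  choose q hq hq' using fun y => existsUnique_isTupleCorner hX (E y)
  have hs : Function.Surjective q := fun a => by
    obtain ⟨t, ht⟩ := exists_tuple_of_corner hX a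
    exact ⟨E.symm t, (hq' _ a (by rwa [E.apply_symm_apply])).symm⟩
  have hr : ∀ y y', MulAction.orbitRel (Equiv.Perm (Fin k)) _ y y' ↔ q y = q y' := fun y y' => by
    rw [MulAction.orbitRel_apply, MulAction.mem_orbit_iff]
    have h1 := isTupleCorner_iff_perm (t' := E y) (hq y')
    have h2 : IsTupleCorner (E y) (q y') ↔ q y = q y' :=
      ⟨fun h => (hq' y _ h).symm, fun h => h ▸ hq y⟩
    rw [← h2, h1]
    refine exists_congr fun σ => ?_
    rw [← hsmul, E.apply_eq_iff_eq]
  obtain ⟨h1, h2, Φ, h3, h4⟩ := (isLocalDiffeo_tupleCorner hX hE hq).quotient hE.isManifold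
    (isManifold_kCorners hX k).1 hs _ hr
  refine ⟨A, fun σ y => ?_, fun σ y h => ?_, fun σ => ?_, h1, h2, Φ, h3, fun y => ?_⟩
  · rw [hsmul]
    exact ⟨rfl, rfl⟩
  · have h5 := hsmul σ y
    rw [h] at h5
    have h6 : ∀ j, σ⁻¹ j = j := fun j =>
      (E y).injective (congrFun (congrArg BoundaryTuple.β h5) j).symm
    exact inv_eq_one.1 (Equiv.ext h6)
  · exact (isSmooth_iff hE.isManifold hE.isManifold).2
      ((isLocalDiffeo_perm hX hE σ).isMap False hE.isManifold hE.isManifold)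
  · rw [h4]
    exact hq y

end Symmetric

end ACorners

/-! ### Assembly of the main theorem -/

theorem mainTheorem5 :
    -- boundaries and corners of manifolds with a-corners are manifolds with a-corners
    (∀ X : AtlasSpace.{u}, IsManifold .analytic X →
      (IsManifold .analytic (boundary .analytic X) ∧
        (∀ n, HasDim X (n + 1) → HasDim (boundary .analytic X) n) ∧
        (HasDim X 0 → IsEmpty (boundary .analytic X)) ∧
        IsSmooth .analytic (boundary .analytic X) X
          (boundaryProj .analytic X)) ∧
      (∀ p, IsManifold .analytic (kCorners .analytic X p) ∧
        (∀ n, HasDim X (n + p) → HasDim (kCorners .analytic X p) n) ∧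
        (∀ n, HasDim X n → n < p → IsEmpty (kCorners .analytic X p)) ∧
        IsSmooth .analytic (kCorners .analytic X p) X
          (kProj .analytic X p)) ∧
      IsManifold .analytic (corners .analytic X) ∧
      IsSmooth .analytic (corners .analytic X) X (proj .analytic X)) ∧
    -- a-smooth maps, and interior maps, contain identities and are closed under composition
    (∀ X : AtlasSpace.{u}, IsManifold .analytic X →
      IsInterior .analytic X X id) ∧
    (∀ X Y Z : AtlasSpace.{u}, IsManifold .analytic X →
      IsManifold .analytic Y → IsManifold .analytic Z →
      ∀ (f : X → Y) (g : Y → Z),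
        (IsSmooth .analytic X Y f → IsSmooth .analytic Y Z g →
          IsSmooth .analytic X Z (g ∘ f)) ∧
        (IsInterior .analytic X Y f → IsInterior .analytic Y Z g →
          IsInterior .analytic X Z (g ∘ f))) ∧
    -- the corner functor: for each a-smooth `f` and `(x, γ)` there is a unique `(f(x), f_*(γ))`, and the
    -- resulting map `C(f)` is interior
    (∀ X Y : AtlasSpace.{u}, IsManifold .analytic X →
      IsManifold .analytic Y → ∀ f : X → Y, IsSmooth .analytic X Y f →
      (∀ z : corners .analytic X, ∃! w : corners .analytic Y,
        IsPushCorner f z.2 w.2) ∧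
      ∃! F : corners .analytic X → corners .analytic Y,
        IsCornerMap .analytic X Y f F ∧
        IsInterior .analytic (corners .analytic X)
          (corners .analytic Y) F) ∧
    -- `C(id) = id` and `C(g ∘ f) = C(g) ∘ C(f)`
    (∀ X : AtlasSpace.{u}, IsManifold .analytic X →
      IsCornerMap .analytic X X id id) ∧
    (∀ X Y Z : AtlasSpace.{u}, IsManifold .analytic X →
      IsManifold .analytic Y → IsManifold .analytic Z →
      ∀ (f : X → Y) (g : Y → Z), IsSmooth .analytic X Y f →
      IsSmooth .analytic Y Z g → ∀ F G,
      IsCornerMap .analytic X Y f F → IsCornerMap .analytic Y Z g G →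
      IsCornerMap .analytic X Z (g ∘ f) (G ∘ F)) ∧
    -- `C_k(X) ≅ ∂ᵏX / S_k`
    (∀ X : AtlasSpace.{u}, IsManifold .analytic X →
      ∃ e : ∀ k : ℕ, iterBoundary .analytic X k ≃ BoundaryTuple X k,
        IsTupleIdentification .analytic X e ∧
        ∀ k : ℕ, IsManifold .analytic (iterBoundary .analytic X k) ∧
          ∃ _ : MulAction (Equiv.Perm (Fin k)) (iterBoundary .analytic X k),
          (∀ (σ : Equiv.Perm (Fin k)) (y : iterBoundary .analytic X k),
            (e k (σ • y)).pt = (e k y).pt ∧ (e k (σ • y)).β = (e k y).β ∘ ⇑σ⁻¹) ∧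
          (∀ (σ : Equiv.Perm (Fin k)) (y : iterBoundary .analytic X k),
            σ • y = y → σ = 1) ∧
          (∀ σ : Equiv.Perm (Fin k), IsSmooth .analytic
            (iterBoundary .analytic X k) (iterBoundary .analytic X k)
            (fun y => σ • y)) ∧
          IsManifold .analytic (quotMfd .analytic (iterBoundary .analytic X k)
            (MulAction.orbitRel (Equiv.Perm (Fin k)) _)) ∧
          IsLocalDiffeo (iterBoundary .analytic X k)
            (quotMfd .analytic (iterBoundary .analytic X k)
              (MulAction.orbitRel (Equiv.Perm (Fin k)) _))
            (quotProj .analytic (iterBoundary .analytic X k) _) ∧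
          ∃ Φ : quotMfd .analytic (iterBoundary .analytic X k)
              (MulAction.orbitRel (Equiv.Perm (Fin k)) _) ≃ kCorners .analytic X k,
            IsDiffeo .analytic (quotMfd .analytic (iterBoundary .analytic X k) _)
              (kCorners .analytic X k) Φ ∧
            ∀ y : iterBoundary .analytic X k,
              kProj .analytic X k (Φ (quotProj .analytic _ _ y)) = (e k y).pt ∧
              ∀ b : CornerPt X 1,
                LiesOver (p := k) (id : X → X) (Φ (quotProj .analytic _ _ y)) b ↔
                  ∃ j, (e k y).β j = b) ∧
    -- `∂C(X) ≅ C(∂X)`, with `∂C_k(X)` corresponding to `C_k(∂X)`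
    (∀ X : AtlasSpace.{u}, IsManifold .analytic X →
      ∃ Φ : boundary .analytic (corners .analytic X) ≃
          corners .analytic (boundary .analytic X),
        IsDiffeo .analytic (boundary .analytic (corners .analytic X))
          (corners .analytic (boundary .analytic X)) Φ ∧
        (∀ z w, Φ z = w ↔ IsBoundaryCornerPair .analytic X z w) ∧
        ∀ z, (Φ z).1 = (boundaryProj .analytic (corners .analytic X) z).1) ∧
    -- `C(X × Y) ≅ C(X) × C(Y)`, with `C_k(X × Y)` corresponding to the union of the
    -- `C_i(X) × C_j(Y)`, `i + j = k`
    (∀ X Y : AtlasSpace.{u}, IsManifold .analytic X →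
      IsManifold .analytic Y →
      IsManifold .analytic (prodMfd .analytic X Y) ∧
      (∀ m n, HasDim X m → HasDim Y n →
        HasDim (prodMfd .analytic X Y) (m + n)) ∧
      IsSmooth .analytic (prodMfd .analytic X Y) X Prod.fst ∧
      IsSmooth .analytic (prodMfd .analytic X Y) Y Prod.snd ∧
      ∃ Φ : corners .analytic (prodMfd .analytic X Y) ≃
          prodMfd .analytic (corners .analytic X) (corners .analytic Y),
        IsDiffeo .analytic (corners .analytic (prodMfd .analytic X Y))
          (prodMfd .analytic (corners .analytic X) (corners .analytic Y))
          Φ ∧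
        IsProdIdentification .analytic X Y Φ ∧
        ∀ z, (Φ z).1.1 + (Φ z).2.1 = z.1) ∧
    -- the last isomorphism is natural: `C(f × h) = C(f) × C(h)` and `C((g, h)) = (C(g), C(h))`
    (∀ W X Y Z : AtlasSpace.{u}, IsManifold .analytic W →
      IsManifold .analytic X → IsManifold .analytic Y →
      IsManifold .analytic Z →
      ∀ (f : W → Y) (h : X → Z), IsSmooth .analytic W Y f →
      IsSmooth .analytic X Z h →
      IsSmooth .analytic (prodMfd .analytic W X) (prodMfd .analytic Y Z)
        (Prod.map f h) ∧
      ∀ F H P Φ Ψ, IsCornerMap .analytic W Y f F → IsCornerMap .analytic X Z h H →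
        IsCornerMap .analytic (prodMfd .analytic W X) (prodMfd .analytic Y Z)
          (Prod.map f h) P →
        IsProdIdentification .analytic W X Φ →
        IsProdIdentification .analytic Y Z Ψ →
        ∀ z, Ψ (P z) = (F (Φ z).1, H (Φ z).2)) ∧
    (∀ X Y Z : AtlasSpace.{u}, IsManifold .analytic X →
      IsManifold .analytic Y → IsManifold .analytic Z →
      ∀ (g : X → Y) (h : X → Z), IsSmooth .analytic X Y g →
      IsSmooth .analytic X Z h →
      IsSmooth .analytic X (prodMfd .analytic Y Z) (fun x => (g x, h x)) ∧
      ∀ G H P Ψ, IsCornerMap .analytic X Y g G → IsCornerMap .analytic X Z h H →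
        IsCornerMap .analytic X (prodMfd .analytic Y Z) (fun x => (g x, h x)) P →
        IsProdIdentification .analytic Y Z Ψ →
        ∀ z, Ψ (P z) = (G z, H z)) ∧
    -- compatibility with the functor from manifolds with corners to manifolds with a-corners, on objects
    (∀ X : AtlasSpace.{u}, IsManifold .ordinary X →
      IsManifold .analytic (toAnalytic X) ∧
      (∀ n, HasDim X n → HasDim (toAnalytic X) n) ∧
      (∀ p, stratum (toAnalytic X) p = stratum X p) ∧
      IsManifold .ordinary (corners .ordinary X) ∧
      (∀ p, IsManifold .ordinary (kCorners .ordinary X p) ∧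
        ∃ J : kCorners .analytic (toAnalytic X) p ≃
            toAnalytic (kCorners .ordinary X p),
          IsDiffeo .analytic (kCorners .analytic (toAnalytic X) p)
            (toAnalytic (kCorners .ordinary X p)) J ∧
          ∀ z, IsSameCorner X z (J z)) ∧
      ∃ J : corners .analytic (toAnalytic X) ≃
          toAnalytic (corners .ordinary X),
        IsDiffeo .analytic (corners .analytic (toAnalytic X))
          (toAnalytic (corners .ordinary X)) J ∧
        IsCornersIdentification X J) ∧
    -- and on morphisms
    (∀ X Y : AtlasSpace.{u}, IsManifold .ordinary X →
      IsManifold .ordinary Y → ∀ f : X → Y, IsSmooth .ordinary X Y f →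
      IsSmooth .analytic (toAnalytic X) (toAnalytic Y) f ∧
      (∃! F : corners .ordinary X → corners .ordinary Y,
        IsCornerMap .ordinary X Y f F ∧
        IsInterior .ordinary (corners .ordinary X) (corners .ordinary Y) F) ∧
      ∀ F F' J J', IsCornerMap .ordinary X Y f F →
        IsCornerMap .analytic (toAnalytic X) (toAnalytic Y) f F' →
        IsCornersIdentification X J → IsCornersIdentification Y J' →
        IsInterior .analytic (toAnalytic (corners .ordinary X))
          (toAnalytic (corners .ordinary Y)) F ∧
        ∀ z, J' (F' z) = F (J z)) := by
  refine ⟨fun X hX => ?_, fun X hX => ?_, fun X Y Z hX hY hZ f g => ?_, fun X Y hX hY f hf => ?_,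
    fun X _ z => isPushCorner_id z.2, fun X Y Z hX hY hZ f g hf hg F G hF hG z => ?_,
    fun X hX => ?_, fun X hX => exists_boundary_corners_equiv hX, fun X Y hX hY => ?_,
    fun W X Y Z hW hX hY hZ f h hf hh => ?_, fun X Y Z hX hY hZ g h hg hh => ?_,
    fun X hX => ?_, fun X Y hX hY f hf => ?_⟩
  · have hk : ∀ p, IsManifold .analytic (kCorners .analytic X p) := fun p =>
      (isManifold_kCorners hX p).1
    refine ⟨⟨hk 1, fun n h => hasDim_kCorners hX h, fun h => isEmpty_kCorners hX h one_pos,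
      (isSmooth_iff (hk 1) hX).2 (isMap_kProj hX 1)⟩, fun p => ⟨hk p, fun n h => hasDim_kCorners hX h,
      fun n h hp => isEmpty_kCorners hX h hp, (isSmooth_iff (hk p) hX).2 (isMap_kProj hX p)⟩,
      isManifold_corners hX, (isSmooth_iff (isManifold_corners hX) hX).2 (isMap_proj hX)⟩
  · exact (isInterior_iff hX hX).2 (isMap_id True hX)
  · rw [isSmooth_iff hX hY, isSmooth_iff hY hZ, isSmooth_iff hX hZ, isInterior_iff hX hY,
      isInterior_iff hY hZ, isInterior_iff hX hZ]
    exact ⟨IsMap.comp hX hY hZ, IsMap.comp hX hY hZ⟩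
  · rw [isSmooth_iff hX hY] at hf
    exact ⟨fun z => existsUnique_isPushCorner hX hY hf z.2, existsUnique_isCornerMap hX hY hf⟩
  · exact IsPushCorner.comp hX hY hZ ((isSmooth_iff hX hY).1 hf) ((isSmooth_iff hY hZ).1 hg)
      (hF z) (hG (F z))
  · obtain ⟨e, he, h⟩ := exists_isTupleIdentification hX
    exact ⟨e, he, fun k => ⟨(h k).isManifold, exists_quotient_iterBoundary hX (h k)⟩⟩
  · have hP := (isManifold_prodMfd hX hY).1
    exact ⟨hP, fun m n h1 h2 => hasDim_prodMfd hX hY h1 h2,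
      (isSmooth_iff hP hX).2 (isMap_fst False hX hY), (isSmooth_iff hP hY).2 (isMap_snd False hX hY),
      exists_isProdIdentification hX hY⟩
  · rw [isSmooth_iff hW hY] at hf
    rw [isSmooth_iff hX hZ] at hh
    exact ⟨(isSmooth_iff (isManifold_prodMfd hW hX).1 (isManifold_prodMfd hY hZ).1).2
      (hf.prodMap hW hX hY hZ hh), fun F H P Φ Ψ hF hH hP hΦ hΨ =>
      eq_of_isPushCorner_prodMap hW hX hY hZ hf hh hF hH hP hΦ hΨ⟩
  · rw [isSmooth_iff hX hY] at hg
    rw [isSmooth_iff hX hZ] at hh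
    exact ⟨(isSmooth_iff hX (isManifold_prodMfd hY hZ).1).2 (hg.pair hY hZ hX hh),
      fun G H P Ψ hG hH hP hΨ => eq_of_isPushCorner_prod hX hY hZ hg hh hG hH hP hΨ⟩
  · have hX' := (isManifold_toAnalytic hX).1
    have hk := fun p => (isManifold_kCorners hX p).1
    have hC := isManifold_corners hX
    refine ⟨hX', fun n h => hasDim_toAnalytic hX h, stratum_toAnalytic hX, hC, fun p => ⟨hk p,
      cornerPtEquiv hX p, ?_, isSameCorner_cornerPtEquiv hX⟩, cornersEquiv hX, ?_,
      isCornersIdentification_cornersEquiv hX⟩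
    · exact (isLocalDiffeo_cornerPtEquiv hX p).isDiffeo (isManifold_kCorners hX' p).1
        (isManifold_toAnalytic (hk p)).1
    · exact (isLocalDiffeo_cornersEquiv hX).isDiffeo (isManifold_corners hX')
        (isManifold_toAnalytic hC).1
  · have hCX := isManifold_corners hX
    have hCY := isManifold_corners hY
    rw [isSmooth_iff hX hY] at hf
    exact ⟨(isSmooth_iff (isManifold_toAnalytic hX).1 (isManifold_toAnalytic hY).1).2
      (hf.toAnalytic hX hY), existsUnique_isCornerMap hX hY hf, fun F F' J J' hF hF' hJ hJ' =>
      ⟨(isInterior_iff (isManifold_toAnalytic hCX).1 (isManifold_toAnalytic hCY).1).2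
        ((hF.isMap hX hY hf).toAnalytic hCX hCY),
        cornersIdentification_comm hX hY hf hF hF' hJ hJ'⟩⟩
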